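/- A schema $\sigma$ is a finite set of relation symbols $R$ with arities $\mathrm{ar}(R)\ge 1$. A $\sigma$-database $D$ assigns to each $R\in\sigma$ a finite relation $R^D\subseteq \mathbb{N}_{\ge1}^{\mathrm{ar}(R)}$. Its active domain $\mathrm{adom}(D)$ is the set of constants occurring in it, and $\|D\|=|\sigma|+|\mathrm{adom}(D)|+\sum_{R\in\sigma}\mathrm{ar}(R)\cdot|R^D|$. An update inserts a tuple into, or deletes a tuple from, one relation. A conjunctive query is a formula $\varphi=\exists y_1\cdots\exists y_\ell\,(\psi_1\wedge\cdots\wedge\psi_d)$ with $\ell\ge0$, $d\ge1$, pairwise distinct variables $y_i$ and atoms $\psi_j=Ru_1\cdots u_r$ ($R\in\sigma$, $r=\mathrm{ar}(R)$, $u_i$ variables), together with a list $x_1,\dots,x_k$ without repetition of its free variables, i.e. of the variables that occur in the atoms and differ from all $y_i$. Its result $\varphi(D)$ is the set of all $(a_1,\dots,a_k)$ such that some valuation of the variables maps each $x_i$ to $a_i$ and satisfies all atoms in $D$. Its size $\|\varphi\|$ is the length of $\varphi$ as a word over relation symbols, variables, $\exists$, $\wedge$ and parentheses, and $\mathrm{poly}(\varphi)$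 means $\|\varphi\|^{O(1)}$. For a variable $x$, let $\mathrm{atoms}(x)$ be the set of atoms of $\varphi$ that contain $x$. The query $\varphi$ is q-hierarchical if for any two variables $x,y$ occurring in its atoms: (i) $\mathrm{atoms}(x)\subseteq\mathrm{atoms}(y)$ or $\mathrm{atoms}(x)\supseteq\mathrm{atoms}(y)$ or $\mathrm{atoms}(x)\cap\mathrm{atoms}(y)=\emptyset$; and (ii) if $\mathrm{atoms}(x)\subsetneq\mathrm{atoms}(y)$ and $x$ is free, then $y$ is free. The model of computation is the random access machine with uniform cost measure, with arrays of every dimension initialised to $0$. An access to a $d$-dimensional array is charged $O(d)$ steps. **Theorem.** There is one dynamic algorithm, consisting of routines preprocess, update, enumerate, count and answer, with the following properties for every schema $\sigma$, every q-hierarchical conjunctive query $\varphi$ over $\sigma$ and every $\sigma$-database $D_0$. On input $\varphi$ and $D_0$ (its facts listed in any order), preprocess builds a data structure within time $\mathrm{poly}(\varphi)\cdot O(\|D_0\|)$. Afterwards the routines update, enumerate, count and answer may be called any number of times in any order, where a call of enumerate, count or answer may also be broken off at any moment. Whenever $D$ is the current database: - update, given the insertion or deletion of a tuple, adapts the data structure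 in time $\mathrm{poly}(\varphi)$; - enumerate outputs the tuples of $\varphi(D)$ one by one, without repetition, and then halts. The time to the first output, between any two consecutive outputs, and from the last output to the halt (or from the start to the halt, if $\varphi(D)=\emptyset$) is at most $\mathrm{poly}(\varphi)$; - count outputs $|\varphi(D)|$ in time $O(1)$, with a constant that does not depend on $\varphi$; - if $\varphi$ is Boolean ($k=0$), answer decides in time $O(1)$ whether $\varphi(D)\ne\emptyset$. Throughout, the machine works with words of $\mathrm{poly}(\varphi)\cdot O(\log (N+2))$ bits, where $N$ is any common upper bound on the sizes of all databases that have occurred so far, including the one that results from an update being processed, and on all input words (codes of constants, of variables and of relation symbols, and lengths of lists in the input). -/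

import Mathlib

namespace DynCQ

/-! ### Databases -/

/-- A schema: finitely many relation symbols `R₀, …, R_{s-1}`, each with a positive arity. -/
structure Schema where
  /-- number of relation symbols -/
  card : ℕ
  /-- arity of a relation symbol -/
  ar : Fin card → ℕ
  ar_pos : ∀ R, 0 < ar R

/-- A database over the domain of positive integers: a finite relation for every symbol. -/
def Database (σ : Schema) : Type :=
  (R : Fin σ.card) → Finset (Fin (σ.ar R) → ℕ+)

/-- A fact `R(a₁,…,a_r)`. -/
def Fact (σ : Schema) : Type :=
  (R : Fin σ.card) × (Fin (σ.ar R) → ℕ+)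

/-- The active domain: the set of all constants that occur in the database. -/
def Database.adom {σ : Schema} (D : Database σ) : Finset ℕ+ :=
  Finset.univ.biUnion fun R => (D R).biUnion fun t => Finset.univ.image t

/-- The size `‖D‖ = |σ| + |adom(D)| + ∑_R ar(R)·|R^D|`. -/
def Database.size {σ : Schema} (D : Database σ) : ℕ :=
  σ.card + D.adom.card + ∑ R, σ.ar R * (D R).card

/-- `L` lists every fact of `D` exactly once (in any order). -/
def Lists {σ : Schema} (L : List (Fact σ)) (D : Database σ) : Prop :=
  L.Nodup ∧ ∀ f : Fact σ, f ∈ L ↔ f.2 ∈ D f.1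

/-- An update command: insertion or deletion of one tuple. -/
inductive Update (σ : Schema) : Type
  | insert (f : Fact σ)
  | delete (f : Fact σ)

/-- The database that results from an update command. -/
def Update.apply {σ : Schema} : Update σ → Database σ → Database σ
  | .insert f, D => Function.update D f.1 (Insert.insert f.2 (D f.1))
  | .delete f, D => Function.update D f.1 ((D f.1).erase f.2)

/-! ### Conjunctive queries -/

/-- An atom `R u₁ ⋯ u_r`; variables are natural numbers. -/
structure Atom (σ : Schema) where
  rel : Fin σ.card
  args : Fin (σ.ar rel) → ℕ

/-- The set of variables of an atom. -/
def Atom.vars {σ : Schema} (ψ : Atom σ) : Set ℕ := Set.range ψ.args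

/-- A `k`-ary conjunctive query `φ(x₁,…,x_k) = ∃ y₁ ⋯ ∃ y_ℓ (ψ₁ ∧ ⋯ ∧ ψ_d)` with `d ≥ 1`, pairwise
distinct `yᵢ`, and a repetition-free list `head = (x₁,…,x_k)` of its free variables. -/
structure Query (σ : Schema) where
  quantified : List ℕ
  atoms : List (Atom σ)
  head : List ℕ
  quantified_nodup : quantified.Nodup
  atoms_ne_nil : atoms ≠ []
  head_nodup : head.Nodup
  mem_head : ∀ x, x ∈ head ↔ (∃ ψ ∈ atoms, x ∈ ψ.vars) ∧ x ∉ quantified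

namespace Query

variable {σ : Schema}

/-- All variables that occur in the atoms. -/
def vars (φ : Query σ) : Set ℕ := {x | ∃ ψ ∈ φ.atoms, x ∈ ψ.vars}

/-- The free variables. -/
def free (φ : Query σ) : Set ℕ := {x | x ∈ φ.vars ∧ x ∉ φ.quantified}

/-- `atoms(x)`: the set of atoms of the query in which `x` occurs. -/
def atomsOf (φ : Query σ) (x : ℕ) : Set (Atom σ) := {ψ | ψ ∈ φ.atoms ∧ x ∈ ψ.vars}

/-- The query is q-hierarchical. -/
def QHierarchical (φ : Query σ) : Prop :=
  ∀ x ∈ φ.vars, ∀ y ∈ φ.vars,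
    (φ.atomsOf x ⊆ φ.atomsOf y ∨ φ.atomsOf y ⊆ φ.atomsOf x ∨ φ.atomsOf x ∩ φ.atomsOf y = ∅) ∧
    (φ.atomsOf x ⊂ φ.atomsOf y → x ∈ φ.free → y ∈ φ.free)

/-- `‖φ‖`: the length of the word `∃ y₁ ⋯ ∃ y_ℓ ( ψ₁ ∧ ⋯ ∧ ψ_d )`, every relation symbol, variable,
quantifier, conjunction sign and parenthesis counting as one letter. -/
def size (φ : Query σ) : ℕ :=
  2 * φ.quantified.length + 2 + (φ.atoms.map fun ψ => σ.ar ψ.rel + 1).sum + (φ.atoms.length - 1)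

/-- The query result `φ(D)`, a set of `k`-tuples. -/
def result (φ : Query σ) (D : Database σ) : Set (Fin φ.head.length → ℕ+) :=
  {a | ∃ ν : ℕ → ℕ+, (∀ i, ν (φ.head.get i) = a i) ∧
    ∀ ψ ∈ φ.atoms, (fun j => ν (ψ.args j)) ∈ D ψ.rel}

end Query

/-! ### Random access machines

A machine has registers, and arrays of every dimension, all initialised to `0`.  The array cells
are addressed by finite sequences of words; the address is assembled in an index register, one
word per step, so that an access to a `d`-dimensional array costs `d` steps and then one more.
Input words are read one at a time, output tuples are assembled word by word and then emitted.
Programs are finite; they are built from instructions by sequencing, branching and loops. Every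
instruction, every test and every control step costs one unit of time. -/

/-- The contents of the machine. -/
structure State where
  /-- registers -/
  reg : ℕ → ℕ
  /-- array cells -/
  mem : List ℕ → ℕ
  /-- the index register, holding an array address -/
  idx : List ℕ
  /-- the unread part of the input -/
  inp : List ℕ
  /-- the part of the next output tuple that has been written so far -/
  buf : List ℕ

/-- The blank machine. -/
def State.blank : State := ⟨fun _ => 0, fun _ => 0, [], [], []⟩

/-- An operand: a register or a constant of the program. -/
inductive Operand : Type
  | reg (r : ℕ)
  | lit (n : ℕ)

def Operand.val (s : State) : Operand → ℕ
  | .reg r => s.reg r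
  | .lit n => n

/-- Arithmetic: addition, truncated subtraction, multiplication. -/
inductive BinOp : Type
  | add
  | sub
  | mul

def BinOp.eval : BinOp → ℕ → ℕ → ℕ
  | .add, m, n => m + n
  | .sub, m, n => m - n
  | .mul, m, n => m * n

inductive Test : Type
  | eq (a b : Operand)
  | lt (a b : Operand)

def Test.holds (s : State) : Test → Bool
  | .eq a b => decide (a.val s = b.val s)
  | .lt a b => decide (a.val s < b.val s)

inductive Instr : Type
  /-- `r := a` -/
  | set (r : ℕ) (a : Operand)
  /-- `r := a ∘ b` -/
  | op (o : BinOp) (r : ℕ) (a b : Operand)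
  /-- empty the index register -/
  | clear
  /-- append a word to the index register -/
  | push (a : Operand)
  /-- `r := ` the array cell at the current address -/
  | load (r : ℕ)
  /-- the array cell at the current address `:= a` -/
  | store (a : Operand)
  /-- `r := ` the next input word (`0` when the input is exhausted) -/
  | read (r : ℕ)
  /-- append a word to the output tuple under construction -/
  | write (a : Operand)
  /-- output the tuple under construction, and start a new one -/
  | emit

def Instr.exec (s : State) : Instr → State
  | .set r a => { s with reg := Function.update s.reg r (a.val s) }
  | .op o r a b => { s with reg := Function.update s.reg r (o.eval (a.val s) (b.val s)) }
  | .clear => { s with idx := [] }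
  | .push a => { s with idx := s.idx ++ [a.val s] }
  | .load r => { s with reg := Function.update s.reg r (s.mem s.idx) }
  | .store a => { s with mem := Function.update s.mem s.idx (a.val s) }
  | .read r => { s with reg := Function.update s.reg r (s.inp.headD 0), inp := s.inp.tail }
  | .write a => { s with buf := s.buf ++ [a.val s] }
  | .emit => { s with buf := [] }

/-- Programs. -/
inductive Program : Type
  | instr (i : Instr)
  | seq (p q : Program)
  | ite (t : Test) (p q : Program)
  | while (t : Test) (p : Program)

/-- A machine in operation: the pieces of program that remain to be executed, and the contents.
The machine has halted when no program remains. -/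
structure Config where
  code : List Program
  state : State

/-- One step of the machine; a halted machine stays as it is. -/
def Config.step (c : Config) : Config :=
  match c.code with
  | [] => c
  | .instr i :: k => ⟨k, i.exec c.state⟩
  | .seq p q :: k => ⟨p :: q :: k, c.state⟩
  | .ite t p q :: k => ⟨(if t.holds c.state then p else q) :: k, c.state⟩
  | .while t p :: k => ⟨if t.holds c.state then p :: .while t p :: k else k, c.state⟩

/-- The tuple that the machine outputs in its next step, if any. -/
def Config.emitted (c : Config) : Option (List ℕ) :=
  match c.code with
  | .instr .emit :: _ => some c.state.buf
  | _ => none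

/-- The machine after `t` steps. -/
def Config.after (c : Config) (t : ℕ) : Config := Config.step^[t] c

/-- The machine has halted after `t` steps. -/
def Config.HaltedAt (c : Config) (t : ℕ) : Prop := (c.after t).code = []

/-- The sequence of tuples output during the first `t` steps. -/
def Config.outputs (c : Config) (t : ℕ) : List (List ℕ) :=
  (List.range t).filterMap fun i => (c.after i).emitted

/-- The delay is at most `d`: from any moment on (in particular from the start, and from the output
of a tuple), the next tuple is output, or the machine halts, within `d` steps. -/
def Config.DelayLE (c : Config) (d : ℕ) : Prop :=
  ∀ i, (∃ j, i ≤ j ∧ j < i + d ∧ (c.after j).emitted ≠ none) ∨ c.HaltedAt (i + d)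

/-- All words that the machine holds are at most `B`. -/
def State.WordsLE (s : State) (B : ℕ) : Prop :=
  (∀ r, s.reg r ≤ B) ∧ (∀ a, s.mem a ≤ B) ∧ (∀ w ∈ s.idx, w ≤ B) ∧ (∀ w ∈ s.inp, w ≤ B) ∧
    (∀ w ∈ s.buf, w ≤ B)

/-- Throughout the run all words are at most `B`. -/
def Config.WordsLE (c : Config) (B : ℕ) : Prop := ∀ t, (c.after t).state.WordsLE B

/-- A call of the routine `p` on the given input, with the machine's registers and arrays as left
by the previous calls. -/
def call (p : Program) (s : State) (input : List ℕ) : Config :=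
  ⟨[p], { s with idx := [], inp := input, buf := [] }⟩

/-! ### Encoding of the input as a sequence of words -/

/-- A fact is encoded by its relation symbol, followed by its constants. -/
def Fact.encode {σ : Schema} (f : Fact σ) : List ℕ :=
  (f.1 : ℕ) :: List.ofFn fun j => (f.2 j : ℕ)

/-- An update command: `1` for an insertion, `0` for a deletion, followed by the fact. -/
def Update.encode {σ : Schema} : Update σ → List ℕ
  | .insert f => 1 :: f.encode
  | .delete f => 0 :: f.encode

def Atom.encode {σ : Schema} (ψ : Atom σ) : List ℕ := (ψ.rel : ℕ) :: List.ofFn ψ.args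

def Schema.encode (σ : Schema) : List ℕ := σ.card :: List.ofFn σ.ar

/-- The quantified variables, the free variables and the atoms, each list preceded by its length. -/
def Query.encode {σ : Schema} (φ : Query σ) : List ℕ :=
  (φ.quantified.length :: φ.quantified) ++ (φ.head.length :: φ.head) ++
    (φ.atoms.length :: φ.atoms.flatMap Atom.encode)

/-- The input of the preprocessing: schema, query, number of facts, and the list of all facts. -/
def encodeInput {σ : Schema} (φ : Query σ) (L : List (Fact σ)) : List ℕ :=
  σ.encode ++ φ.encode ++ (L.length :: L.flatMap Fact.encode)

/-! ### Dynamic algorithms -/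

/-- The routines of a dynamic algorithm. -/
structure DynamicAlgorithm where
  preprocess : Program
  update : Program
  enumerate : Program
  count : Program
  answer : Program

/-- `A.Reaches φ L D₀ N s D`: the preprocessing of `φ` and the initial database `D₀`, listed by `L`,
followed by some sequence of calls of the other routines, can leave the machine with contents `s`
when the current database is `D`.  The calls come in any order, and a call of `enumerate`, `count`
or `answer` may run to its end or be broken off after any number of steps.  All databases that
occur have size at most `N`, and all input words (hence all constants) are at most `N`. -/
inductive DynamicAlgorithm.Reaches (A : DynamicAlgorithm) {σ : Schema} (φ : Query σ)
    (L : List (Fact σ)) (D₀ : Database σ) (N : ℕ) : State → Database σ → Prop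
  | preprocess (t : ℕ) (hD : D₀.size ≤ N) (hw : ∀ w ∈ encodeInput φ L, w ≤ N)
      (ht : (call A.preprocess State.blank (encodeInput φ L)).HaltedAt t) :
      A.Reaches φ L D₀ N ((call A.preprocess State.blank (encodeInput φ L)).after t).state D₀
  | update {s : State} {D : Database σ} (h : A.Reaches φ L D₀ N s D) (u : Update σ) (t : ℕ)
      (hD : (u.apply D).size ≤ N) (hw : ∀ w ∈ u.encode, w ≤ N)
      (ht : (call A.update s u.encode).HaltedAt t) :
      A.Reaches φ L D₀ N ((call A.update s u.encode).after t).state (u.apply D)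
  | enumerate {s : State} {D : Database σ} (h : A.Reaches φ L D₀ N s D) (t : ℕ) :
      A.Reaches φ L D₀ N ((call A.enumerate s []).after t).state D
  | count {s : State} {D : Database σ} (h : A.Reaches φ L D₀ N s D) (t : ℕ) :
      A.Reaches φ L D₀ N ((call A.count s []).after t).state D
  | answer {s : State} {D : Database σ} (h : A.Reaches φ L D₀ N s D) (t : ℕ) :
      A.Reaches φ L D₀ N ((call A.answer s []).after t).state D

/-- The call `c` outputs exactly the tuples in `φ(D)`, without repetition, and then halts. -/
def Config.Enumerates (c : Config) {σ : Schema} (φ : Query σ) (D : Database σ) : Prop :=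
  ∃ (t : ℕ) (E : List (Fin φ.head.length → ℕ+)), c.HaltedAt t ∧ E.Nodup ∧
    (∀ a, a ∈ E ↔ a ∈ φ.result D) ∧
    c.outputs t = E.map fun a => List.ofFn fun i => (a i : ℕ)

/-- The call `c` outputs the single word `w` and halts, within `t` steps. -/
def Config.Returns (c : Config) (w t : ℕ) : Prop := c.HaltedAt t ∧ c.outputs t = [[w]]

end DynCQ

/-! Order the variables so that free variables precede quantified ones and, within each of the two
groups, variables that occur in more atoms come first. If the query is q-hierarchical, then of two
variables with a common atom the earlier one occurs in every atom of the later one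
(`Query.QHierarchical.raw_good`). Hence the variables that precede `u` in an atom containing `u` are
the same for all such atoms. With a virtual position `0` that belongs to every atom, the positions
form a tree, each atom is a path that starts at the root, and the free positions are an initial
segment, closed under predecessors (`Raw.Good.layout_good`).

The data structure is a trie. A node of position `u` stands for a valuation of the path that ends in
`u`. It carries a bit for every atom whose path ends in `u`, telling whether the atom holds, and a
weight: the product of these bits and, over the child positions `v`, of the sum of the weights of
its children at `v`, where this sum is capped at `1` if `v` is quantified. So the weight counts the
extensions of the valuation to the free positions below that can be completed on the quantified
positions; the weight of the root is the number of results (`Dyn.length_ext_zero`, `Dyn.sound`,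
`Dyn.complete`). Counting and answering just look at it.

A fact fixes at most one valuation of the variables of an atom. An insertion or deletion therefore
flips one bit per atom with the right symbol, and only the nodes on the path of that atom get a new
weight. They are created if necessary and recomputed from bottom to top (`exec_pathProg`,
`exec_repairProg`). Preprocessing analyses the query and inserts the given facts one by one.

For the enumeration, each node has, for each child position, a list of its children with nonzero
weight (`Roster`). A node of nonzero weight has a nonempty list at every child position, so choosing
nodes for the positions `1, …, K` from these lists never runs into a dead end. Stepping through all
choices like an odometer gives a delay that depends on the query only.

Nodes are never removed. Still words stay short: a node is determined by its position and by values
at most `N`, which bounds the number of nodes by `Q.M N`, and a weight is at most `Q.M N` to the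
number of positions below.

On the machine side, `Exec` is a Hoare triple with a time bound, and `Run` demands that `Ok` holds
at every single step. The output routines run with all arrays below number `40` protected; hence
`Query.Inv` survives when they are broken off. -/

namespace DynCQ

/-! ### Executing programs -/

/-- What is guaranteed during a run: a bound on all words, and a part of the memory (the cells whose
address starts with a word below `prot`) that is not modified. -/
structure Ctx where
  B : ℕ
  prot : ℕ
  mem₀ : List ℕ → ℕ
  hB : 100 ≤ B

def Ok (Γ : Ctx) (s : State) : Prop :=
  s.WordsLE Γ.B ∧ ∀ a : List ℕ, a.headD 0 < Γ.prot → s.mem a = Γ.mem₀ a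

theorem Config.after_add (c : Config) (m n : ℕ) : c.after (m + n) = (c.after m).after n := by
  simp only [Config.after]
  rw [add_comm, Function.iterate_add_apply]

theorem Config.after_succ (c : Config) (n : ℕ) : c.after (n + 1) = c.step.after n := rfl

theorem Config.after_of_halted {c : Config} (h : c.code = []) (n : ℕ) : c.after n = c := by
  have hs : c.step = c := by
    unfold Config.step; rw [h]
  induction n with
  | zero => rfl
  | succ n ih => rw [Config.after_succ, hs, ih]

/-- `t` steps lead from `c` to `c'`, without output. -/
def Run (Γ : Ctx) (c : Config) (t : ℕ) (c' : Config) : Prop :=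
  c.after t = c' ∧ (∀ i ≤ t, Ok Γ (c.after i).state) ∧ ∀ i < t, (c.after i).emitted = none

theorem Run.refl {Γ : Ctx} {c : Config} (h : Ok Γ c.state) : Run Γ c 0 c :=
  ⟨rfl, fun i hi => by obtain rfl : i = 0 := by omega
                       exact h, fun i hi => absurd hi (by omega)⟩

theorem Run.trans {Γ : Ctx} {c c' c'' : Config} {t t' : ℕ} (h : Run Γ c t c')
    (h' : Run Γ c' t' c'') : Run Γ c (t + t') c'' := by
  obtain ⟨h1, h2, h3⟩ := h
  obtain ⟨h1', h2', h3'⟩ := h'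
  refine ⟨by rw [Config.after_add, h1, h1'], fun i hi => ?_, fun i hi => ?_⟩
  · rcases le_total i t with h | h
    · exact h2 i h
    · obtain ⟨j, rfl⟩ := Nat.exists_eq_add_of_le h
      rw [Config.after_add, h1]
      exact h2' j (by omega)
  · rcases lt_or_ge i t with h | h
    · exact h3 i h
    · obtain ⟨j, rfl⟩ := Nat.exists_eq_add_of_le h
      rw [Config.after_add, h1]
      exact h3' j (by omega)

theorem Run.one {Γ : Ctx} {c : Config} (h : Ok Γ c.state) (h' : Ok Γ c.step.state)
    (he : c.emitted = none) : Run Γ c 1 c.step := by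
  refine ⟨rfl, fun i hi => ?_, fun i hi => ?_⟩
  · rcases (show i = 0 ∨ i = 1 by omega) with rfl | rfl
    · exact h
    · exact h'
  · obtain rfl : i = 0 := by omega
    exact he

/-- Started with contents `s`, the program `p` ends after at most `T` steps, without output, with
contents that satisfy `Q`. -/
def Exec (Γ : Ctx) (p : Program) (s : State) (T : ℕ) (Q : State → Prop) : Prop :=
  s.idx = [] → Ok Γ s → ∀ k, ∃ t ≤ T, ∃ s', Run Γ ⟨p :: k, s⟩ t ⟨k, s'⟩ ∧ s'.idx = [] ∧ Q s'

/-- Gives access to the word bound on the initial contents. In this way a counter that is bounded by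
the content of a register is known to fit into a word. -/
theorem Exec.ok {Γ : Ctx} {p : Program} {s : State} {T : ℕ} {Q : State → Prop}
    (h : Ok Γ s → Exec Γ p s T Q) : Exec Γ p s T Q := fun hi ho => h ho hi ho

theorem Exec.imp {Γ : Ctx} {p : Program} {s : State} {T T' : ℕ} {Q Q' : State → Prop}
    (h : Exec Γ p s T Q) (hT : T ≤ T') (hQ : ∀ s', Ok Γ s' → Q s' → Q' s') :
    Exec Γ p s T' Q' := by
  intro hi ho k
  obtain ⟨t, ht, s', hr, hi', hq⟩ := h hi ho k
  refine ⟨t, ht.trans hT, s', hr, hi', hQ s' ?_ hq⟩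
  have := hr.2.1 t le_rfl
  rwa [hr.1] at this

theorem Exec.mono {Γ : Ctx} {p : Program} {s : State} {T T' : ℕ} {Q : State → Prop}
    (h : Exec Γ p s T Q) (hT : T ≤ T') : Exec Γ p s T' Q := h.imp hT fun _ _ h => h

theorem Exec.seq {Γ : Ctx} {p q : Program} {s : State} {T₁ T₂ : ℕ} {Q : State → Prop}
    (h : Exec Γ p s T₁ fun s' => Exec Γ q s' T₂ Q) : Exec Γ (.seq p q) s (T₁ + T₂ + 1) Q := by
  intro hi ho k
  obtain ⟨t, ht, s', hr, hi', hq⟩ := h hi ho (q :: k)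
  have ho' : Ok Γ s' := by
    have := hr.2.1 t le_rfl
    rwa [hr.1] at this
  obtain ⟨t', ht', s'', hr', hi'', hq'⟩ := hq hi' ho' k
  refine ⟨1 + (t + t'), by omega, s'', ?_, hi'', hq'⟩
  exact (Run.one (c := ⟨.seq p q :: k, s⟩) ho ho rfl).trans (hr.trans hr')

theorem Exec.ite {Γ : Ctx} {c : Test} {p q : Program} {s : State} {T : ℕ} {Q : State → Prop}
    (hp : c.holds s = true → Exec Γ p s T Q) (hq : c.holds s = false → Exec Γ q s T Q) :
    Exec Γ (.ite c p q) s (T + 1) Q := by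
  intro hi ho k
  cases hc : c.holds s with
  | true =>
    obtain ⟨t, ht, s', hr, hi', hq⟩ := hp hc hi ho k
    refine ⟨1 + t, by omega, s', ?_, hi', hq⟩
    have h1 := Run.one (Γ := Γ) (c := ⟨.ite c p q :: k, s⟩) ho ho rfl
    simp only [Config.step, hc, if_true] at h1
    exact h1.trans hr
  | false =>
    obtain ⟨t, ht, s', hr, hi', hq⟩ := hq hc hi ho k
    refine ⟨1 + t, by omega, s', ?_, hi', hq⟩
    have h1 := Run.one (Γ := Γ) (c := ⟨.ite c p q :: k, s⟩) ho ho rfl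
    simp only [Config.step, hc, Bool.false_eq_true, if_false] at h1
    exact h1.trans hr

/-- A loop with an invariant that is indexed by a budget of time. -/
theorem Exec.while_budget {Γ : Ctx} {c : Test} {p : Program} (I : ℕ → State → Prop)
    (h : ∀ n s, Ok Γ s → I n s → c.holds s = true →
      ∃ T n', T + 1 + n' ≤ n ∧ Exec Γ p s T (I n')) {n : ℕ} {s : State} (hI : I n s) :
    Exec Γ (.while c p) s (n + 1) fun s' => (∃ n', I n' s') ∧ c.holds s' = false := by
  induction n using Nat.strong_induction_on generalizing s with
  | _ n ih =>
    intro hi ho k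
    cases hc : c.holds s with
    | true =>
      obtain ⟨T, n', hn, he⟩ := h n s ho hI hc
      obtain ⟨t, ht, s', hr, hi', hq⟩ := he hi ho (.while c p :: k)
      have ho' : Ok Γ s' := by
        have := hr.2.1 t le_rfl
        rwa [hr.1] at this
      obtain ⟨t', ht', s'', hr', hi'', hq'⟩ := ih n' (by omega) hq hi' ho' k
      refine ⟨1 + (t + t'), by omega, s'', ?_, hi'', hq'⟩
      have h1 := Run.one (Γ := Γ) (c := ⟨.while c p :: k, s⟩) ho ho rfl
      simp only [Config.step, hc, if_true] at h1
      exact h1.trans (hr.trans hr')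
    | false =>
      refine ⟨1, by omega, s, ?_, hi, ⟨n, hI⟩, hc⟩
      have h1 := Run.one (Γ := Γ) (c := ⟨.while c p :: k, s⟩) ho ho rfl
      simp only [Config.step, hc, Bool.false_eq_true, if_false] at h1
      exact h1

/-- A loop that is executed `n` times; the invariant is indexed by the number of rounds so far. -/
theorem Exec.while_count {Γ : Ctx} {c : Test} {p : Program} (I : ℕ → State → Prop) (n T : ℕ)
    (ht : ∀ j s, j ≤ n → I j s → (c.holds s = true ↔ j < n))
    (h : ∀ j s, Ok Γ s → j < n → I j s → Exec Γ p s T (I (j + 1))) {s : State} (hI : I 0 s) :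
    Exec Γ (.while c p) s (n * (T + 1) + 1) (I n) := by
  refine (Exec.while_budget (fun b s => ∃ j ≤ n, I j s ∧ b = (n - j) * (T + 1)) ?_ (n := n * (T + 1))
    ⟨0, by omega, hI, by simp⟩).imp le_rfl ?_
  · rintro b s ho ⟨j, hj, hIj, rfl⟩ hc
    have hjn := (ht j s hj hIj).1 hc
    refine ⟨T, (n - (j + 1)) * (T + 1), ?_, (h j s ho hjn hIj).imp le_rfl
      fun s' _ hs' => ⟨j + 1, hjn, hs', rfl⟩⟩
    obtain ⟨a, rfl⟩ := Nat.exists_eq_add_of_lt hjn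
    rw [show j + a + 1 - j = a + 1 by omega, show j + a + 1 - (j + 1) = a by omega, add_mul]
    omega
  · rintro s' _ ⟨⟨b, j, hj, hIj, -⟩, hc⟩
    have : ¬ j < n := fun hlt => by
      rw [(ht j s' hj hIj).2 hlt] at hc
      cases hc
    obtain rfl : j = n := by omega
    exact hIj

/-! ### Straight-line code -/

def State.setReg (s : State) (r v : ℕ) : State := { s with reg := Function.update s.reg r v }
def State.setMem (s : State) (a : List ℕ) (v : ℕ) : State :=
  { s with mem := Function.update s.mem a v }
def State.setInp (s : State) (l : List ℕ) : State := { s with inp := l }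
def State.setBuf (s : State) (l : List ℕ) : State := { s with buf := l }

section
variable (s : State) (r v r' : ℕ) (a a' l : List ℕ)
@[simp] theorem State.setReg_reg : (s.setReg r v).reg r' = if r' = r then v else s.reg r' := by
  simp [State.setReg, Function.update_apply]
@[simp] theorem State.setReg_mem : (s.setReg r v).mem = s.mem := rfl
@[simp] theorem State.setReg_idx : (s.setReg r v).idx = s.idx := rfl
@[simp] theorem State.setReg_inp : (s.setReg r v).inp = s.inp := rfl
@[simp] theorem State.setReg_buf : (s.setReg r v).buf = s.buf := rfl
@[simp] theorem State.setMem_mem : (s.setMem a v).mem a' = if a' = a then v else s.mem a' := by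
  simp [State.setMem, Function.update_apply]
@[simp] theorem State.setMem_reg : (s.setMem a v).reg = s.reg := rfl
@[simp] theorem State.setMem_idx : (s.setMem a v).idx = s.idx := rfl
@[simp] theorem State.setMem_inp : (s.setMem a v).inp = s.inp := rfl
@[simp] theorem State.setMem_buf : (s.setMem a v).buf = s.buf := rfl
@[simp] theorem State.setInp_mem : (s.setInp l).mem = s.mem := rfl
@[simp] theorem State.setInp_reg : (s.setInp l).reg = s.reg := rfl
@[simp] theorem State.setInp_idx : (s.setInp l).idx = s.idx := rfl
@[simp] theorem State.setInp_inp : (s.setInp l).inp = l := rfl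
@[simp] theorem State.setInp_buf : (s.setInp l).buf = s.buf := rfl
@[simp] theorem State.setBuf_mem : (s.setBuf l).mem = s.mem := rfl
@[simp] theorem State.setBuf_reg : (s.setBuf l).reg = s.reg := rfl
@[simp] theorem State.setBuf_idx : (s.setBuf l).idx = s.idx := rfl
@[simp] theorem State.setBuf_inp : (s.setBuf l).inp = s.inp := rfl
@[simp] theorem State.setBuf_buf : (s.setBuf l).buf = l := rfl
end

/-- Commands: instructions, and whole array accesses (with a constant as first index). -/
inductive Cmd : Type
  | set (r : ℕ) (a : Operand)
  | op (o : BinOp) (r : ℕ) (a b : Operand)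
  | ld (r t : ℕ) (l : List Operand)
  | st (t : ℕ) (l : List Operand) (a : Operand)
  | read (r : ℕ)
  | write (a : Operand)

/-- An array access clears the index register before and after, so that every command restores the
empty address that `Exec` demands at both ends. -/
def Cmd.instrs : Cmd → List Instr
  | .set r a => [.set r a]
  | .op o r a b => [.op o r a b]
  | .ld r t l => .clear :: .push (.lit t) :: (l.map .push ++ [.load r, .clear])
  | .st t l a => .clear :: .push (.lit t) :: (l.map .push ++ [.store a, .clear])
  | .read r => [.read r]
  | .write a => [.write a]

@[simp] def Cmd.run (s : State) : Cmd → State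
  | .set r a => s.setReg r (a.val s)
  | .op o r a b => s.setReg r (o.eval (a.val s) (b.val s))
  | .ld r t l => s.setReg r (s.mem (t :: l.map (Operand.val s)))
  | .st t l a => s.setMem (t :: l.map (Operand.val s)) (a.val s)
  | .read r => (s.setReg r (s.inp.headD 0)).setInp s.inp.tail
  | .write a => s.setBuf (s.buf ++ [a.val s])

/-- The constants of the program are small. -/
def Operand.small : Operand → Bool
  | .reg _ => true
  | .lit n => decide (n ≤ 100)

/-- Constants and dimensions are small, and only arrays from number `p` on are modified. -/
def Cmd.wf (p : ℕ) : Cmd → Bool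
  | .set _ a => a.small
  | .op _ _ a b => a.small && b.small
  | .ld _ t l => decide (t ≤ 100) && l.all Operand.small && decide (l.length ≤ 4)
  | .st t l a => decide (t ≤ 100) && l.all Operand.small && decide (l.length ≤ 4) && a.small &&
      decide (p ≤ t)
  | .read _ => true
  | .write a => a.small

/-- The result of an arithmetic instruction fits into a word. -/
@[simp] def Cmd.fits (B : ℕ) (s : State) : Cmd → Prop
  | .op .add _ a b => a.val s + b.val s ≤ B
  | .op .mul _ a b => a.val s * b.val s ≤ B
  | _ => True

@[simp] def runs : State → List Cmd → State
  | s, [] => s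
  | s, c :: cs => runs (c.run s) cs

@[simp] def fits (B : ℕ) : State → List Cmd → Prop
  | _, [] => True
  | s, c :: cs => c.fits B s ∧ fits B (c.run s) cs

/-- There is no empty program. Clearing the index register, which is empty between commands anyway,
takes its place here and in `blk`. -/
def instrsProg : List Instr → Program
  | [] => .instr .clear
  | i :: is => .seq (.instr i) (instrsProg is)

def blk : List Cmd → Program
  | [] => .instr .clear
  | c :: cs => .seq (instrsProg c.instrs) (blk cs)

attribute [simp] Operand.val BinOp.eval

theorem Operand.val_le {B : ℕ} {s : State} (hs : s.WordsLE B) (hB : 100 ≤ B) {a : Operand}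
    (ha : a.small = true) : a.val s ≤ B := by
  cases a with
  | reg r => exact hs.1 r
  | lit n =>
    simp only [Operand.small, decide_eq_true_eq] at ha
    exact ha.trans hB

theorem Ok.setReg {Γ : Ctx} {s : State} (h : Ok Γ s) (r : ℕ) {v : ℕ} (hv : v ≤ Γ.B) :
    Ok Γ (s.setReg r v) := by
  refine ⟨⟨fun r' => ?_, h.1.2⟩, h.2⟩
  rw [State.setReg_reg]
  split_ifs
  exacts [hv, h.1.1 r']

theorem Ok.setMem {Γ : Ctx} {s : State} (h : Ok Γ s) (a : List ℕ) {v : ℕ} (hv : v ≤ Γ.B)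
    (ha : Γ.prot ≤ a.headD 0) : Ok Γ (s.setMem a v) := by
  refine ⟨⟨h.1.1, fun a' => ?_, h.1.2.2⟩, fun a' ha' => ?_⟩
  · rw [State.setMem_mem]
    split_ifs
    exacts [hv, h.1.2.1 a']
  · rw [State.setMem_mem, if_neg, h.2 a' ha']
    rintro rfl
    omega

theorem Ok.setInp {Γ : Ctx} {s : State} (h : Ok Γ s) {l : List ℕ} (hl : ∀ w ∈ l, w ≤ Γ.B) :
    Ok Γ (s.setInp l) := ⟨⟨h.1.1, h.1.2.1, h.1.2.2.1, hl, h.1.2.2.2.2⟩, h.2⟩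

theorem Ok.setBuf {Γ : Ctx} {s : State} (h : Ok Γ s) {l : List ℕ} (hl : ∀ w ∈ l, w ≤ Γ.B) :
    Ok Γ (s.setBuf l) := ⟨⟨h.1.1, h.1.2.1, h.1.2.2.1, h.1.2.2.2.1, hl⟩, h.2⟩

theorem Ok.setIdx {Γ : Ctx} {s : State} (h : Ok Γ s) {l : List ℕ} (hl : ∀ w ∈ l, w ≤ Γ.B) :
    Ok Γ { s with idx := l } := ⟨⟨h.1.1, h.1.2.1, hl, h.1.2.2.2.1, h.1.2.2.2.2⟩, h.2⟩

/-- Two steps per instruction, one of them for unfolding `seq`, and a last one for the final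
`clear`. -/
theorem run_instrsProg {Γ : Ctx} (is : List Instr) (s : State)
    (hok : ∀ n, Ok Γ ((is.take n).foldl (fun s i => i.exec s) s)) (he : Instr.emit ∉ is)
    (k : List Program) :
    Run Γ ⟨instrsProg is :: k, s⟩ (2 * is.length + 1)
      ⟨k, { is.foldl (fun s i => i.exec s) s with idx := [] }⟩ := by
  induction is generalizing s with
  | nil =>
    have h0 : Ok Γ s := hok 0
    exact Run.one (c := ⟨instrsProg [] :: k, s⟩) h0 (h0.setIdx (by simp)) rfl
  | cons i is ih =>
    have h0 : Ok Γ s := hok 0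
    have h1 : Ok Γ (i.exec s) := hok 1
    have hi : i ≠ .emit := fun h => he (by simp [h])
    have r1 := Run.one (Γ := Γ) (c := ⟨instrsProg (i :: is) :: k, s⟩) h0 h0 rfl
    have r2 := Run.one (Γ := Γ) (c := ⟨.instr i :: instrsProg is :: k, s⟩) h0 h1 (by
      cases i <;> simp_all [Config.emitted])
    have r3 := ih (i.exec s) (fun n => hok (n + 1)) (fun h => he (by simp [h]))
    have := (r1.trans r2).trans r3
    rw [List.length_cons, show 2 * (is.length + 1) + 1 = 1 + 1 + (2 * is.length + 1) by ring]
    exact this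

theorem foldl_push (s : State) (l : List Operand) :
    (l.map Instr.push).foldl (fun s i => i.exec s) s =
      { s with idx := s.idx ++ l.map (Operand.val s) } := by
  induction l generalizing s with
  | nil => simp
  | cons a l ih =>
    have hv : ∀ (i : List ℕ) (b : Operand),
        Operand.val { s with idx := i } b = Operand.val s b := fun i b => by cases b <;> rfl
    have hv' : ∀ i : List ℕ, Operand.val { s with idx := i } = Operand.val s :=
      fun i => funext (hv i)
    rw [List.map_cons, List.foldl_cons, ih]
    simp [Instr.exec, hv']

/-- The longest command is an access with four indices after the array number: eight instructions,
hence `2 * 8 + 1 = 17` steps. -/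
theorem Exec.cmd {Γ : Ctx} {p : ℕ} {c : Cmd} {s : State} (hp : Γ.prot ≤ p)
    (hwf : c.wf p = true) (hfit : c.fits Γ.B s) :
    Exec Γ (instrsProg c.instrs) s 17 (fun s' => s' = c.run s ∧ Ok Γ s') := by
  intro hi ho k
  have single : ∀ i : Instr, c.instrs = [i] → i ≠ .emit → i.exec s = c.run s → Ok Γ (c.run s) →
      (c.run s).idx = [] →
      ∃ t ≤ 17, ∃ s', Run Γ ⟨instrsProg c.instrs :: k, s⟩ t ⟨k, s'⟩ ∧ s'.idx = [] ∧
        s' = c.run s ∧ Ok Γ s' := by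
    intro i hc hne he hok hidx
    have := run_instrsProg (Γ := Γ) [i] s (fun n => by
      rcases n with _ | n
      · exact ho
      · simpa [he] using hok) (by simpa using hne.symm) k
    rw [hc]
    refine ⟨2 * [i].length + 1, by simp, c.run s, ?_, hidx, rfl, hok⟩
    convert this using 2
    simp only [List.foldl_cons, List.foldl_nil, he]
    rw [← hidx]
  have addr : ∀ (t : ℕ) (l : List Operand) (i : Instr), t ≤ 100 → l.all Operand.small = true →
      l.length ≤ 4 → c.instrs = .clear :: .push (.lit t) :: (l.map .push ++ [i, .clear]) →
      i ≠ .emit → (∀ s' : State, s' = { s with idx := t :: l.map (Operand.val s) } →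
        Ok Γ s' → Ok Γ (i.exec s') ∧ { i.exec s' with idx := [] } = c.run s) →
      ∃ t ≤ 17, ∃ s', Run Γ ⟨instrsProg c.instrs :: k, s⟩ t ⟨k, s'⟩ ∧ s'.idx = [] ∧
        s' = c.run s ∧ Ok Γ s' := by
    intro t l i ht hl hlen hc hne he
    have hsm : ∀ a ∈ l, a.val s ≤ Γ.B := fun a ha =>
      Operand.val_le ho.1 Γ.hB (by rw [List.all_eq_true] at hl; exact hl a ha)
    have htB := ht.trans Γ.hB
    have hA : Ok Γ { s with idx := t :: l.map (Operand.val s) } := ho.setIdx (by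
      intro w hw
      simp only [List.mem_cons, List.mem_map] at hw
      rcases hw with rfl | ⟨a, ha, rfl⟩
      exacts [htB, hsm a ha])
    obtain ⟨hok, hrun⟩ := he _ rfl hA
    have hv' : ∀ i : List ℕ, Operand.val { s with idx := i } = Operand.val s :=
      fun i => funext fun b => by cases b <;> rfl
    have := run_instrsProg (Γ := Γ) c.instrs s (fun n => by
      rw [hc]
      rcases n with _ | _ | n
      · exact ho
      · exact ho.setIdx (by simp)
      · simp only [List.take_succ_cons, List.foldl_cons, List.take_append, List.length_map]
        rw [List.foldl_append, ← List.map_take, foldl_push]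
        simp only [Instr.exec, List.nil_append, Operand.val]
        have hnl := Nat.le_total n l.length
        -- The prefix of the code either ends among the pushes or already contains the access
        -- itself.
        rcases Nat.lt_or_ge n (l.length + 1) with h | h
        · rw [show n - l.length = 0 by omega]
          refine ho.setIdx (fun w hw => ?_)
          simp only [List.singleton_append, List.mem_cons, List.mem_map, hv'] at hw
          rcases hw with rfl | ⟨a, ha, rfl⟩
          exacts [htB, hsm a (List.mem_of_mem_take ha)]
        · rw [List.take_of_length_le (by omega : l.length ≤ n)]
          obtain ⟨j, hj⟩ : ∃ j, n - l.length = j + 1 := ⟨n - l.length - 1, by omega⟩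
          rw [hj]
          simp only [hv', List.singleton_append, List.take_succ_cons, List.foldl_cons]
          rcases j with _ | j
          · simp only [List.take_zero, List.foldl_nil]
            exact hok
          · have := hok.setIdx (l := []) (by simp)
            simp only [List.take_succ_cons, List.take_nil, List.foldl_cons, List.foldl_nil]
            exact this) (by
        rw [hc]
        simp [hne.symm]) k
    have hfin : { c.instrs.foldl (fun s i => i.exec s) s with idx := [] } = c.run s := by
      rw [hc]
      simp only [List.foldl_cons, List.foldl_append, List.foldl_nil, foldl_push]
      rw [← hrun]
      simp [Instr.exec, hv']
    rw [hfin] at this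
    refine ⟨_, ?_, c.run s, this, ?_, rfl, ?_⟩
    · rw [hc]; simp; omega
    · rw [← hrun]
    · rw [← hrun]
      exact hok.setIdx (by simp)
  cases c with
  | set r a =>
    exact single _ rfl (by simp) rfl (ho.setReg _ (Operand.val_le ho.1 Γ.hB hwf)) hi
  | op o r a b =>
    refine single _ rfl (by simp) rfl (ho.setReg _ ?_) hi
    simp only [Cmd.wf, Bool.and_eq_true] at hwf
    cases o with
    | add => exact hfit
    | mul => exact hfit
    | sub => exact (Nat.sub_le _ _).trans (Operand.val_le ho.1 Γ.hB hwf.1)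
  | read r =>
    refine single _ rfl (by simp) rfl ((ho.setReg _ ?_).setInp ?_) hi
    · cases h : s.inp with
      | nil => simp
      | cons x l => exact ho.1.2.2.2.1 x (by simp [h])
    · exact fun w hw => ho.1.2.2.2.1 w (List.mem_of_mem_tail hw)
  | write a =>
    refine single _ rfl (by simp) rfl (ho.setBuf ?_) hi
    intro w hw
    simp only [List.mem_append, List.mem_singleton] at hw
    rcases hw with hw | rfl
    exacts [ho.1.2.2.2.2 w hw, Operand.val_le ho.1 Γ.hB hwf]
  | ld r t l =>
    simp only [Cmd.wf, Bool.and_eq_true, decide_eq_true_eq] at hwf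
    refine addr t l (.load r) hwf.1.1 hwf.1.2 hwf.2 rfl (by simp) ?_
    rintro s' rfl ho'
    refine ⟨ho'.setReg r (ho'.1.2.1 _), ?_⟩
    simp only [Instr.exec, Cmd.run, State.setReg]
    rw [hi]
  | st t l a =>
    simp only [Cmd.wf, Bool.and_eq_true, decide_eq_true_eq] at hwf
    refine addr t l (.store a) hwf.1.1.1.1 hwf.1.1.1.2 hwf.1.1.2 rfl (by simp) ?_
    rintro s' rfl ho'
    refine ⟨ho'.setMem _ (Operand.val_le ho'.1 Γ.hB hwf.1.2) ?_, ?_⟩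
    · simpa using hp.trans hwf.2
    · have hv' : ∀ i : List ℕ, Operand.val { s with idx := i } = Operand.val s :=
        fun i => funext fun b => by cases b <;> rfl
      simp only [Instr.exec, Cmd.run, State.setMem, hv']
      rw [hi]

/-- Reduces straight-line code to rewriting: `runs` computes the final contents symbolically, and
what remains to be checked is that sums and products fit into a word. -/
theorem Exec.blk {Γ : Ctx} (p : ℕ) {cs : List Cmd} {s : State} {Q : State → Prop}
    (hp : Γ.prot ≤ p) (hwf : cs.all (Cmd.wf p) = true)
    (h : Ok Γ s → fits Γ.B s cs ∧ (Ok Γ (runs s cs) → Q (runs s cs))) :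
    Exec Γ (blk cs) s (20 * cs.length + 1) Q := by
  induction cs generalizing s with
  | nil =>
    intro hi ho k
    refine ⟨1, by simp, s, ?_, hi, (h ho).2 ho⟩
    have h1 : Run Γ ⟨DynCQ.blk [] :: k, s⟩ 1 ⟨k, { s with idx := [] }⟩ :=
      Run.one (c := ⟨DynCQ.blk [] :: k, s⟩) ho (ho.setIdx (by simp)) rfl
    have hs : ({ s with idx := [] } : State) = s := by rw [← hi]
    rwa [hs] at h1
  | cons c cs ih =>
    simp only [List.all_cons, Bool.and_eq_true] at hwf
    intro hi ho
    have hf := h ho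
    have h1 : Exec Γ (instrsProg c.instrs) s 17 fun s' => Exec Γ (DynCQ.blk cs) s'
        (20 * cs.length + 1) Q :=
      (Exec.cmd hp hwf.1 hf.1.1).imp le_rfl fun s' ho' hs' => by
        rw [hs'.1]
        exact ih hwf.2 fun _ => ⟨hf.1.2, hf.2⟩
    exact (Exec.seq h1).mono (by simp; omega) hi ho

/-- Executing a block of commands, and then the rest. -/
theorem Exec.blk_seq {Γ : Ctx} (p : ℕ) {cs : List Cmd} {q : Program} {s : State} {T : ℕ}
    {Q : State → Prop} (hp : Γ.prot ≤ p) (hwf : cs.all (Cmd.wf p) = true)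
    (h : Ok Γ s → fits Γ.B s cs ∧ (Ok Γ (runs s cs) → Exec Γ q (runs s cs) T Q)) :
    Exec Γ (.seq (DynCQ.blk cs) q) s (20 * cs.length + T + 2) Q :=
  (Exec.seq (Exec.blk p hp hwf h)).mono (by omega)

/-! ### The data structure -/

/-- What the algorithm knows about the query. The variables are numbered `1, …, m`, those up to `K`
are the free ones; position `0` stands for a virtual variable that occurs in each of the `d` atoms.
`occ i u` says that `u` occurs in the `i`-th atom, `par u` is the position just before `u` in any
atom that contains `u`, and `low i` is the last position of the `i`-th atom. -/
structure Plan where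
  m : ℕ
  K : ℕ
  d : ℕ
  occ : ℕ → ℕ → Prop
  par : ℕ → ℕ
  low : ℕ → ℕ

/-- All that the later argument needs from the hierarchy. By `occ_par` and `par_max`, the positions
of an atom up to one of its positions `u` are `u`, `par u`, `par (par u)`, …, `0`, whichever atom
containing `u` is considered; so an atom is the path from `0` to `low i`. -/
structure Plan.Good (Q : Plan) : Prop where
  par_lt : ∀ u, 1 ≤ u → u ≤ Q.m → Q.par u < u
  occ_par : ∀ i < Q.d, ∀ u, Q.occ i u → Q.occ i (Q.par u)
  par_max : ∀ i < Q.d, ∀ u v, Q.occ i u → Q.par u < v → v < u → ¬ Q.occ i v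
  occ_low : ∀ i < Q.d, Q.occ i (Q.low i)
  le_low : ∀ i < Q.d, ∀ u, Q.occ i u → u ≤ Q.low i
  low_pos : ∀ i < Q.d, 1 ≤ Q.low i
  low_le : ∀ i < Q.d, Q.low i ≤ Q.m
  exists_occ : ∀ u, 1 ≤ u → u ≤ Q.m → ∃ i < Q.d, Q.occ i u
  K_le : Q.K ≤ Q.m

/-- The arrays of the data structure. A partial valuation of a path of positions is represented by
a node of a trie; `1` is the root, and `0` stands for an absent node. -/
structure DS where
  next : ℕ
  ch : ℕ → ℕ → ℕ → ℕ
  typ : ℕ → ℕ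
  up : ℕ → ℕ
  val : ℕ → ℕ
  E : ℕ → ℕ → ℕ
  W : ℕ → ℕ
  S : ℕ → ℕ → ℕ
  len : ℕ → ℕ → ℕ
  elem : ℕ → ℕ → ℕ → ℕ
  posn : ℕ → ℕ

/-- The node of position `u` that belongs to the valuation `ν`. -/
def item (par : ℕ → ℕ) (ch : ℕ → ℕ → ℕ → ℕ) (ν : ℕ → ℕ) (u : ℕ) : ℕ :=
  if _h : par u < u then ch (item par ch ν (par u)) u (ν u) else 1
termination_by u
decreasing_by exact _h

theorem item_zero (par : ℕ → ℕ) (ch : ℕ → ℕ → ℕ → ℕ) (ν : ℕ → ℕ) : item par ch ν 0 = 1 := by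
  rw [item]; simp

theorem item_of_lt {par : ℕ → ℕ} (ch : ℕ → ℕ → ℕ → ℕ) (ν : ℕ → ℕ) {u : ℕ} (h : par u < u) :
    item par ch ν u = ch (item par ch ν (par u)) u (ν u) := by
  rw [item]; simp [h]

theorem item_congr (par : ℕ → ℕ) (ch : ℕ → ℕ → ℕ → ℕ) {ν ν' : ℕ → ℕ} (u : ℕ)
    (h : ∀ v ≤ u, ν v = ν' v) : item par ch ν u = item par ch ν' u := by
  induction u using Nat.strong_induction_on with
  | _ u ih =>
    by_cases hp : par u < u
    · rw [item_of_lt _ _ hp, item_of_lt _ _ hp, ih _ hp fun v hv => h v (by omega), h u le_rfl]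
    · rw [item, dif_neg hp, item, dif_neg hp]

/-- The arrays `up`, `typ` and `val` invert `ch`, so that a node determines the values along its
path. Nodes are numbered in the order of creation; `up e < e` permits induction on the number. The
root `1` has no predecessor, which is why `node` starts at `2`. -/
structure Trie (Q : Plan) (N : ℕ) (ds : DS) : Prop where
  two_le : 2 ≤ ds.next
  typ_one : ds.typ 1 = 0
  node : ∀ e, 2 ≤ e → e < ds.next → 1 ≤ ds.typ e ∧ ds.typ e ≤ Q.m ∧ 1 ≤ ds.up e ∧ ds.up e < e ∧
    ds.typ (ds.up e) = Q.par (ds.typ e) ∧ ds.ch (ds.up e) (ds.typ e) (ds.val e) = e ∧ ds.val e ≤ N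
  ch_node : ∀ a u b, ds.ch a u b ≠ 0 → 2 ≤ ds.ch a u b ∧ ds.ch a u b < ds.next ∧
    ds.up (ds.ch a u b) = a ∧ ds.typ (ds.ch a u b) = u ∧ ds.val (ds.ch a u b) = b

/-- A bound on the number of nodes. -/
def Plan.M (Q : Plan) (N : ℕ) : ℕ := (Q.m + 1) * (N + 1) ^ (Q.m + 1) + 2

section
variable {Q : Plan} {N : ℕ} {ds : DS}

/-- The node of `u` for a valuation, in a given data structure. -/
abbrev Plan.it (Q : Plan) (ds : DS) (ν : ℕ → ℕ) (u : ℕ) : ℕ := item Q.par ds.ch ν u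

theorem Trie.it_bounds (hQ : Q.Good) (h : Trie Q N ds) {ν : ℕ → ℕ} {u : ℕ} (hu : u ≤ Q.m)
    (h0 : Q.it ds ν u ≠ 0) :
    1 ≤ Q.it ds ν u ∧ Q.it ds ν u < ds.next ∧ ds.typ (Q.it ds ν u) = u := by
  rcases Nat.eq_zero_or_pos u with rfl | hpos
  · simp only [Plan.it, item_zero]
    exact ⟨le_rfl, h.two_le, h.typ_one⟩
  · have hp := hQ.par_lt u hpos hu
    simp only [Plan.it] at h0 ⊢
    rw [item_of_lt _ _ hp] at h0 ⊢
    have := h.ch_node _ _ _ h0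
    exact ⟨by omega, this.2.1, this.2.2.2.1⟩

theorem Trie.it_up (hQ : Q.Good) (h : Trie Q N ds) {ν : ℕ → ℕ} {u : ℕ} (hu : u ≤ Q.m)
    (hpos : 1 ≤ u) (h0 : Q.it ds ν u ≠ 0) :
    2 ≤ Q.it ds ν u ∧ ds.up (Q.it ds ν u) = Q.it ds ν (Q.par u) ∧ ds.val (Q.it ds ν u) = ν u ∧
      Q.it ds ν (Q.par u) ≠ 0 := by
  have hp := hQ.par_lt u hpos hu
  simp only [Plan.it] at h0 ⊢
  rw [item_of_lt _ _ hp] at h0 ⊢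
  have := h.ch_node _ _ _ h0
  have h2 := h.node _ this.1 this.2.1
  refine ⟨this.1, this.2.2.1, this.2.2.2.2, ?_⟩
  rw [← this.2.2.1]
  omega

/-- The walk from `u` towards the root skips no position of the atom, so it passes `v`; and the
predecessor of an existing node exists. -/
theorem Trie.it_ne_zero_of_occ (hQ : Q.Good) (h : Trie Q N ds) {i : ℕ} (hi : i < Q.d) {ν : ℕ → ℕ}
    {u : ℕ} (hu : u ≤ Q.m) (ho : Q.occ i u) (h0 : Q.it ds ν u ≠ 0) {v : ℕ} (hv : Q.occ i v)
    (hvu : v ≤ u) : Q.it ds ν v ≠ 0 := by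
  induction u using Nat.strong_induction_on with
  | _ u ih =>
    rcases Nat.lt_or_ge v u with hlt | hge
    · have hp := hQ.par_lt u (by omega) hu
      have : v ≤ Q.par u := by
        by_contra hcon
        exact hQ.par_max i hi u v ho (by omega) hlt hv
      exact ih _ hp (by omega) (hQ.occ_par i hi u ho) (h.it_up hQ hu (by omega) h0).2.2.2 this
    · obtain rfl : v = u := by omega
      exact h0

/-- Nodes determine the values of the variables on their path. -/
theorem Trie.it_inj (hQ : Q.Good) (h : Trie Q N ds) {i : ℕ} (hi : i < Q.d) {ν ν' : ℕ → ℕ}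
    {u : ℕ} (hu : u ≤ Q.m) (ho : Q.occ i u) (h0 : Q.it ds ν u ≠ 0)
    (he : Q.it ds ν u = Q.it ds ν' u) {v : ℕ} (hv : Q.occ i v) (hvu : v ≤ u) (hv1 : 1 ≤ v) :
    ν v = ν' v := by
  induction u using Nat.strong_induction_on with
  | _ u ih =>
    have hp := hQ.par_lt u (by omega) hu
    have h1 := h.it_up hQ hu (by omega) h0
    have h2 := h.it_up hQ hu (by omega) (he ▸ h0)
    rcases Nat.lt_or_ge v u with hlt | hge
    · have : v ≤ Q.par u := by
        by_contra hcon
        exact hQ.par_max i hi u v ho (by omega) hlt hv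
      exact ih _ hp (by omega) (hQ.occ_par i hi u ho) h1.2.2.2 (by rw [← h1.2.1, ← h2.2.1, he]) this
    · obtain rfl : v = u := by omega
      rw [← h1.2.2.1, ← h2.2.2.1, he]

/-- Only variables of the atom lie on the path to `u`. Together with `Trie.it_inj`: two valuations
share the node at the end of an atom exactly if they agree on its variables, provided that the node
exists. -/
theorem it_congr_occ (hQ : Q.Good) {i : ℕ} (hi : i < Q.d) {ν ν' : ℕ → ℕ} {u : ℕ} (hu : u ≤ Q.m)
    (ho : Q.occ i u) (hν : ∀ v, 1 ≤ v → v ≤ u → Q.occ i v → ν v = ν' v) :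
    Q.it ds ν u = Q.it ds ν' u := by
  induction u using Nat.strong_induction_on with
  | _ u ih =>
    rcases Nat.eq_zero_or_pos u with rfl | hpos
    · simp [Plan.it, item_zero]
    · have hp := hQ.par_lt u hpos hu
      simp only [Plan.it] at ih ⊢
      rw [item_of_lt _ _ hp, item_of_lt _ _ hp, hν u hpos le_rfl ho,
        ih _ hp (by omega) (hQ.occ_par i hi u ho) fun v h1 h2 h3 => hν v h1 (by omega) h3]

/-- Following `up` from `e` collects the values on its path; each of them is at most `N`. -/
theorem Trie.exists_val (hQ : Q.Good) (h : Trie Q N ds) (e : ℕ) (h1 : 1 ≤ e) (h2 : e < ds.next) :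
    ds.typ e ≤ Q.m ∧ ∃ ν : ℕ → ℕ, (∀ v, ν v ≤ N) ∧ Q.it ds ν (ds.typ e) = e := by
  induction e using Nat.strong_induction_on with
  | _ e ih =>
    rcases Nat.lt_or_ge e 2 with hlt | hge
    · obtain rfl : e = 1 := by omega
      exact ⟨by simp [h.typ_one], fun _ => 0, by simp, by simp [h.typ_one, Plan.it, item_zero]⟩
    · obtain ⟨a1, a2, a3, a4, a5, a6, a7⟩ := h.node e hge h2
      obtain ⟨-, ν, hν, hit⟩ := ih _ a4 a3 (by omega)
      refine ⟨a2, Function.update ν (ds.typ e) (ds.val e), fun v => ?_, ?_⟩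
      · rw [Function.update_apply]; split_ifs; exacts [a7, hν v]
      · have hp := hQ.par_lt _ a1 a2
        simp only [Plan.it] at hit ⊢
        rw [item_of_lt _ _ hp, Function.update_self,
          item_congr (ν' := ν) _ _ _ fun v hv => Function.update_of_ne (by omega) _ _, ← a5, hit, a6]

/-- Makes the word length independent of the number of updates, although nodes are never freed: a
node is the value of `it` at one of `m + 1` positions and one of `(N + 1) ^ (m + 1)` valuations. -/
theorem Trie.next_le (hQ : Q.Good) (h : Trie Q N ds) : ds.next + 1 ≤ Q.M N := by
  classical
  let f : Fin (Q.m + 1) × (Fin (Q.m + 1) → Fin (N + 1)) → ℕ := fun p =>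
    Q.it ds (fun v => if hv : v < Q.m + 1 then (p.2 ⟨v, hv⟩ : ℕ) else 0) p.1
  have hsub : Finset.Ico 1 ds.next ⊆ Finset.univ.image f := by
    intro e he
    rw [Finset.mem_Ico] at he
    obtain ⟨ht, ν, hν, hit⟩ := h.exists_val hQ e he.1 he.2
    refine Finset.mem_image.2 ⟨⟨⟨ds.typ e, by omega⟩, fun v => ⟨ν v, by have := hν v; omega⟩⟩,
      Finset.mem_univ _, ?_⟩
    refine Eq.trans (item_congr _ _ _ fun v hv => ?_) hit
    simp only at hv
    rw [dif_pos (by omega)]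
  have := (Finset.card_le_card hsub).trans Finset.card_image_le
  simp only [Nat.card_Ico, Finset.card_univ, Fintype.card_prod, Fintype.card_fin,
    Fintype.card_fun] at this
  unfold Plan.M
  omega

/-! ### Bounding the weights -/

/-- The number of proper descendants of a position. -/
def Plan.ed (Q : Plan) (u : ℕ) : ℕ :=
  ∑ j ∈ (Finset.range Q.m).attach,
    if h : Q.par (j.1 + 1) = u ∧ u < j.1 + 1 then 1 + Q.ed (j.1 + 1) else 0
termination_by Q.m + 1 - u
decreasing_by
  have := Finset.mem_range.1 j.2
  omega

theorem Plan.Good.ed_eq (hQ : Q.Good) (u : ℕ) :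
    Q.ed u = ∑ j ∈ Finset.range Q.m, if Q.par (j + 1) = u then 1 + Q.ed (j + 1) else 0 := by
  rw [Plan.ed, ← Finset.sum_attach (Finset.range Q.m)]
  refine Finset.sum_congr rfl fun j _ => ?_
  have hj := Finset.mem_range.1 j.2
  have := hQ.par_lt (j.1 + 1) (by omega) (by omega)
  by_cases h : Q.par (j.1 + 1) = u
  · rw [dif_pos ⟨h, by omega⟩, if_pos h]
  · rw [dif_neg (by tauto), if_neg h]

/-- The positions beyond `i = m - n` form a forest, whose roots are those with a predecessor at most
`i`. The sum adds up the sizes of its trees, hence is at most the number `n` of these positions.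
Position `j + 1` has index `j`. -/
theorem Plan.Good.sum_ed_le (hQ : Q.Good) (n : ℕ) (hn : n ≤ Q.m) :
    (∑ j ∈ Finset.range Q.m,
      if Q.m - n ≤ j ∧ Q.par (j + 1) ≤ Q.m - n then 1 + Q.ed (j + 1) else 0) ≤ n := by
  induction n with
  | zero =>
    refine (Finset.sum_eq_zero fun j hj => ?_).le
    have := Finset.mem_range.1 hj
    rw [if_neg (by omega)]
  | succ n ih =>
    have ih := ih (by omega)
    obtain ⟨i, hi⟩ : ∃ i, Q.m - n = i + 1 := ⟨Q.m - n - 1, by omega⟩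
    have hi' : Q.m - (n + 1) = i := by omega
    rw [hi] at ih
    rw [hi']
    -- When position `i + 1` joins the forest, the trees hanging from it are merged into one tree
    -- that has one more vertex.
    have key : ∀ j ∈ Finset.range Q.m,
        (if i ≤ j ∧ Q.par (j + 1) ≤ i then 1 + Q.ed (j + 1) else 0) +
          (if Q.par (j + 1) = i + 1 then 1 + Q.ed (j + 1) else 0) =
        (if i + 1 ≤ j ∧ Q.par (j + 1) ≤ i + 1 then 1 + Q.ed (j + 1) else 0) +
          (if j = i then 1 + Q.ed (i + 1) else 0) := by
      intro j hj
      have hp := hQ.par_lt (j + 1) (by omega) (by have := Finset.mem_range.1 hj; omega)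
      by_cases h1 : j = i
      · subst h1
        rw [if_pos ⟨le_rfl, by omega⟩, if_neg (by omega), if_neg (by omega), if_pos rfl]
        omega
      · rw [if_neg h1]
        by_cases h2 : Q.par (j + 1) = i + 1
        · rw [if_neg (by omega), if_pos h2, if_pos (by omega)]
          omega
        · rw [if_neg h2]
          by_cases h3 : i ≤ j ∧ Q.par (j + 1) ≤ i
          · rw [if_pos h3, if_pos (by omega)]
          · rw [if_neg h3, if_neg (by omega)]
    have hs := Finset.sum_congr rfl key
    rw [Finset.sum_add_distrib, Finset.sum_add_distrib, ← hQ.ed_eq,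
      Finset.sum_ite_eq' (Finset.range Q.m) i, if_pos (Finset.mem_range.2 (by omega))] at hs
    omega

theorem Plan.Good.ed_le (hQ : Q.Good) {u : ℕ} (hu : u ≤ Q.m) : Q.ed u ≤ Q.m := by
  refine le_trans ?_ ((hQ.sum_ed_le (Q.m - u) (by omega)).trans (Nat.sub_le _ _))
  rw [hQ.ed_eq]
  refine Finset.sum_le_sum fun j hj => ?_
  have hp := hQ.par_lt (j + 1) (by omega) (by have := Finset.mem_range.1 hj; omega)
  by_cases h : Q.par (j + 1) = u
  · rw [if_pos h, if_pos (by omega)]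
  · rw [if_neg h]; omega

end

/-! ### The weight of a node -/

/-- The contribution of a child position: quantified variables only count as `0` or `1`. -/
def Plan.fac (Q : Plan) (v s : ℕ) : ℕ := if Q.K < v then 1 - (1 - s) else s

theorem Plan.fac_le (Q : Plan) (v s : ℕ) : Q.fac v s ≤ s := by
  unfold Plan.fac; split_ifs <;> omega

theorem Plan.fac_eq_zero (Q : Plan) (v s : ℕ) : Q.fac v s = 0 ↔ s = 0 := by
  unfold Plan.fac; split_ifs <;> omega

/-- Product over the first `n` atoms. -/
def Plan.pE (Q : Plan) (ds : DS) (u e n : ℕ) : ℕ :=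
  ∏ i ∈ Finset.range n, if Q.low i = u then ds.E e i else 1

/-- Product over the first `n` positions. -/
def Plan.pV (Q : Plan) (ds : DS) (u e n : ℕ) : ℕ :=
  ∏ j ∈ Finset.range n, if Q.par (j + 1) = u then Q.fac (j + 1) (ds.S e (j + 1)) else 1

/-- The weight that a node `e` of position `u` should have. -/
def Plan.wt (Q : Plan) (ds : DS) (u e : ℕ) : ℕ := Q.pE ds u e Q.d * Q.pV ds u e Q.m

/-! ### Lists with insertion and deletion in constant time -/

/-- The lists of children with nonzero weight. -/
structure Roster (next : ℕ) (up typ W : ℕ → ℕ) (len : ℕ → ℕ → ℕ) (elem : ℕ → ℕ → ℕ → ℕ)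
    (posn : ℕ → ℕ) : Prop where
  elem_spec : ∀ a u n, n < len a u → 2 ≤ elem a u n ∧ elem a u n < next ∧ up (elem a u n) = a ∧
    typ (elem a u n) = u ∧ W (elem a u n) ≠ 0 ∧ posn (elem a u n) = n
  posn_spec : ∀ e, 2 ≤ e → e < next → W e ≠ 0 →
    posn e < len (up e) (typ e) ∧ elem (up e) (typ e) (posn e) = e

section
variable {next : ℕ} {up typ W W' : ℕ → ℕ} {len len' : ℕ → ℕ → ℕ} {elem elem' : ℕ → ℕ → ℕ → ℕ}
  {posn posn' : ℕ → ℕ}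

theorem Roster.len_lt (h : Roster next up typ W len elem posn) (hn : 2 ≤ next) (a u : ℕ) :
    len a u < next := by
  have hinj : Set.InjOn (elem a u) (Finset.range (len a u)) := by
    intro x hx y hy hxy
    simp only [Finset.coe_range, Set.mem_Iio] at hx hy
    rw [← (h.elem_spec a u x hx).2.2.2.2.2, hxy, (h.elem_spec a u y hy).2.2.2.2.2]
  have hsub : (Finset.range (len a u)).image (elem a u) ⊆ Finset.Ico 2 next := by
    intro e he
    obtain ⟨n, hn, rfl⟩ := Finset.mem_image.1 he
    have := h.elem_spec a u n (Finset.mem_range.1 hn)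
    exact Finset.mem_Ico.2 ⟨this.1, this.2.1⟩
  have := Finset.card_le_card hsub
  rw [Finset.card_image_of_injOn hinj] at this
  simp only [Finset.card_range, Nat.card_Ico] at this
  omega

theorem Roster.same (h : Roster next up typ W len elem posn) (hW : ∀ e, W' e = 0 ↔ W e = 0) :
    Roster next up typ W' len elem posn where
  elem_spec a u n hn := by
    have := h.elem_spec a u n hn
    rw [Ne, hW]
    exact this
  posn_spec e h1 h2 h3 := h.posn_spec e h1 h2 (by rwa [Ne, ← hW])

theorem Roster.insert (h : Roster next up typ W len elem posn) {e₀ : ℕ} (h2 : 2 ≤ e₀)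
    (hn : e₀ < next) (h0 : W e₀ = 0) (h0' : W' e₀ ≠ 0) (hW : ∀ e, e ≠ e₀ → W' e = W e)
    (hlen : ∀ a u, len' a u = if a = up e₀ ∧ u = typ e₀ then len (up e₀) (typ e₀) + 1 else len a u)
    (helem : ∀ a u n, elem' a u n = if a = up e₀ ∧ u = typ e₀ ∧ n = len (up e₀) (typ e₀) then e₀
      else elem a u n)
    (hposn : ∀ e, posn' e = if e = e₀ then len (up e₀) (typ e₀) else posn e) :
    Roster next up typ W' len' elem' posn' where
  elem_spec a u n hlt := by
    rw [hlen] at hlt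
    by_cases hc : a = up e₀ ∧ u = typ e₀ ∧ n = len (up e₀) (typ e₀)
    · rw [helem, if_pos hc, hposn, if_pos rfl]
      exact ⟨h2, hn, hc.1.symm, hc.2.1.symm, h0', hc.2.2.symm⟩
    · rw [helem, if_neg hc]
      have hlt' : n < len a u := by
        split_ifs at hlt with h1
        · obtain ⟨rfl, rfl⟩ := h1
          simp only [true_and] at hc
          omega
        · exact hlt
      have := h.elem_spec a u n hlt'
      have hne : elem a u n ≠ e₀ := fun heq => this.2.2.2.2.1 (by rw [heq, h0])
      rw [hposn, if_neg hne, hW _ hne]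
      exact this
  posn_spec e h1 h1' h3 := by
    rw [hposn, hlen]
    by_cases he : e = e₀
    · subst he
      rw [if_pos rfl, if_pos ⟨rfl, rfl⟩, helem, if_pos ⟨rfl, rfl, rfl⟩]
      exact ⟨by omega, rfl⟩
    · rw [if_neg he]
      rw [hW e he] at h3
      have := h.posn_spec e h1 h1' h3
      have hcn : ¬ (up e = up e₀ ∧ typ e = typ e₀ ∧ posn e = len (up e₀) (typ e₀)) := by
        rintro ⟨hc1, hc2, hc3⟩
        rw [hc1, hc2] at this
        omega
      rw [helem, if_neg hcn]
      refine ⟨?_, this.2⟩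
      split_ifs with hc
      · rw [hc.1, hc.2] at this
        omega
      · exact this.1

/-- The last entry `e₁` moves into the gap left by `e₀`, so nothing else is shifted. If `e₁ = e₀`,
the entry written lies beyond the new length and does no harm. -/
theorem Roster.erase (h : Roster next up typ W len elem posn) {e₀ : ℕ} (h2 : 2 ≤ e₀)
    (hn : e₀ < next) (h0 : W e₀ ≠ 0) (h0' : W' e₀ = 0) (hW : ∀ e, e ≠ e₀ → W' e = W e)
    {e₁ : ℕ} (he₁ : e₁ = elem (up e₀) (typ e₀) (len (up e₀) (typ e₀) - 1))
    (hlen : ∀ a u, len' a u = if a = up e₀ ∧ u = typ e₀ then len (up e₀) (typ e₀) - 1 else len a u)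
    (helem : ∀ a u n, elem' a u n = if a = up e₀ ∧ u = typ e₀ ∧ n = posn e₀ then e₁
      else elem a u n)
    (hposn : ∀ e, posn' e = if e = e₁ then posn e₀ else posn e) :
    Roster next up typ W' len' elem' posn' := by
  have hp₀ := h.posn_spec e₀ h2 hn h0
  have hs₁ := h.elem_spec (up e₀) (typ e₀) (len (up e₀) (typ e₀) - 1) (by omega)
  rw [← he₁] at hs₁
  refine ⟨fun a u n hlt => ?_, fun e h1 h1' h3 => ?_⟩
  · rw [hlen] at hlt
    by_cases hc : a = up e₀ ∧ u = typ e₀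
    · obtain ⟨rfl, rfl⟩ := hc
      rw [if_pos ⟨rfl, rfl⟩] at hlt
      rw [helem]
      by_cases hnp : n = posn e₀
      · rw [if_pos ⟨rfl, rfl, hnp⟩, hposn, if_pos rfl]
        have hne : e₁ ≠ e₀ := by
          rintro rfl
          omega
        rw [hW _ hne]
        exact ⟨hs₁.1, hs₁.2.1, hs₁.2.2.1, hs₁.2.2.2.1, hs₁.2.2.2.2.1, hnp.symm⟩
      · rw [if_neg (by tauto)]
        have := h.elem_spec (up e₀) (typ e₀) n (by omega)
        have hne : elem (up e₀) (typ e₀) n ≠ e₀ := fun heq => hnp (by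
          rw [← this.2.2.2.2.2, heq])
        have hne₁ : elem (up e₀) (typ e₀) n ≠ e₁ := fun heq => by
          have h5 := this.2.2.2.2.2
          rw [heq, hs₁.2.2.2.2.2] at h5
          omega
        rw [hposn, if_neg hne₁, hW _ hne]
        exact this
    · rw [if_neg hc] at hlt
      rw [helem, if_neg (by tauto)]
      have := h.elem_spec a u n hlt
      have hne : elem a u n ≠ e₀ := fun heq => hc (by
        rw [← heq]; exact ⟨this.2.2.1.symm, this.2.2.2.1.symm⟩)
      have hne₁ : elem a u n ≠ e₁ := fun heq => hc (by
        rw [heq] at this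
        exact ⟨this.2.2.1.symm.trans hs₁.2.2.1, this.2.2.2.1.symm.trans hs₁.2.2.2.1⟩)
      rw [hposn, if_neg hne₁, hW _ hne]
      exact this
  · have hne : e ≠ e₀ := fun heq => h3 (by rw [heq, h0'])
    rw [hW e hne] at h3
    have := h.posn_spec e h1 h1' h3
    rw [hposn, hlen, helem]
    by_cases he : e = e₁
    · rw [if_pos he, he, hs₁.2.2.1, hs₁.2.2.2.1, if_pos ⟨rfl, rfl⟩, if_pos ⟨rfl, rfl, rfl⟩]
      refine ⟨?_, rfl⟩
      have hq : posn e₀ ≠ len (up e₀) (typ e₀) - 1 := fun hq => hne (by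
        rw [he, he₁, ← hq, hp₀.2])
      omega
    · have hcn : ¬ (up e = up e₀ ∧ typ e = typ e₀ ∧ posn e = posn e₀) := by
        rintro ⟨hc1, hc2, hc3⟩
        rw [hc1, hc2, hc3, hp₀.2] at this
        exact hne this.2.symm
      rw [if_neg he, if_neg hcn]
      refine ⟨?_, this.2⟩
      split_ifs with hc
      · rw [hc.1, hc.2] at this
        have hq : posn e ≠ len (up e₀) (typ e₀) - 1 := fun hq => he (by
          rw [he₁, ← hq, this.2])
        omega
      · exact this.1

end

/-! ### The invariant and how it survives elementary changes -/

open Classical in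
/-- The invariant of the data structure. `F i ν` says that the valuation `ν` satisfies the `i`-th
atom; the weights of the nodes in `ex` need not be up to date. -/
structure Dyn (Q : Plan) (N : ℕ) (F : ℕ → (ℕ → ℕ) → Prop) (ex : ℕ → Prop) (ds : DS) : Prop
    extends Trie Q N ds where
  fresh_W : ∀ e, ds.next ≤ e → ds.W e = 0
  fresh_E : ∀ e i, ds.next ≤ e → ds.E e i = 0
  zero_E : ∀ i, ds.E 0 i = 0
  E_le : ∀ e i, ds.E e i ≤ 1
  E_eq : ∀ i < Q.d, ∀ ν, ds.E (Q.it ds ν (Q.low i)) i = if F i ν then 1 else 0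
  S_eq : ∀ a u, ds.S a u = ∑ e ∈ (Finset.Ico 2 ds.next).filter fun e => ds.up e = a ∧ ds.typ e = u,
    ds.W e
  roster : Roster ds.next ds.up ds.typ ds.W ds.len ds.elem ds.posn
  W_eq : ∀ e, 1 ≤ e → e < ds.next → ¬ ex e → ds.W e = Q.wt ds (ds.typ e) e
  W_le : ∀ e, ds.W e ≤ Q.M N ^ Q.ed (ds.typ e)

section
variable {Q : Plan} {N : ℕ} {F : ℕ → (ℕ → ℕ) → Prop} {ex ex' : ℕ → Prop} {ds ds' : DS}

theorem Dyn.ex_imp (h : Dyn Q N F ex ds) (he : ∀ e, ex e → ex' e) : Dyn Q N F ex' ds :=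
  { h with W_eq := fun e h1 h2 h3 => h.W_eq e h1 h2 fun h4 => h3 (he e h4) }

theorem Plan.M_pos (Q : Plan) (N : ℕ) : 0 < Q.M N := by unfold Plan.M; omega

/-- Fewer than `M` nodes contribute, and each has weight at most `M ^ ed u`. -/
theorem Dyn.S_le (hQ : Q.Good) (h : Dyn Q N F ex ds) (a u : ℕ) :
    ds.S a u ≤ Q.M N ^ (1 + Q.ed u) := by
  rw [h.S_eq]
  calc _ ≤ ∑ _e ∈ (Finset.Ico 2 ds.next).filter fun e => ds.up e = a ∧ ds.typ e = u,
        Q.M N ^ Q.ed u := Finset.sum_le_sum fun e he => by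
          rw [Finset.mem_filter] at he
          rw [← he.2.2]
          exact h.W_le e
    _ = ((Finset.Ico 2 ds.next).filter fun e => ds.up e = a ∧ ds.typ e = u).card *
        Q.M N ^ Q.ed u := by simp
    _ ≤ Q.M N * Q.M N ^ Q.ed u := by
        refine Nat.mul_le_mul_right _ ((Finset.card_filter_le _ _).trans ?_)
        have := h.toTrie.next_le hQ
        rw [Nat.card_Ico]
        omega
    _ = _ := by rw [pow_add, pow_one]

theorem Plan.pE_le (h : ∀ e i, ds.E e i ≤ 1) (u e n : ℕ) : Q.pE ds u e n ≤ 1 := by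
  refine Finset.prod_le_one' fun i _ => ?_
  split_ifs
  exacts [h e i, le_rfl]

/-- The bounds for the child positions multiply, and by `ed_eq` their exponents add up to `ed u`. -/
theorem Dyn.pV_le (hQ : Q.Good) (h : Dyn Q N F ex ds) (u e n : ℕ) (hn : n ≤ Q.m) :
    Q.pV ds u e n ≤ Q.M N ^ Q.ed u := by
  have h1 : Q.pV ds u e n ≤ ∏ j ∈ Finset.range n,
      Q.M N ^ (if Q.par (j + 1) = u then 1 + Q.ed (j + 1) else 0) := by
    refine Finset.prod_le_prod' fun j _ => ?_
    split_ifs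
    · exact (Q.fac_le _ _).trans (h.S_le hQ _ _)
    · simp
  refine h1.trans ?_
  rw [Finset.prod_pow_eq_pow_sum, hQ.ed_eq]
  refine Nat.pow_le_pow_right (Q.M_pos N) (Finset.sum_le_sum_of_subset ?_)
  exact Finset.range_subset_range.2 hn

theorem Dyn.partial_wt_le (hQ : Q.Good) (h : Dyn Q N F ex ds) (u e i n : ℕ) (hn : n ≤ Q.m) :
    Q.pE ds u e i * Q.pV ds u e n ≤ Q.M N ^ Q.ed u :=
  (Nat.mul_le_mul (Plan.pE_le h.E_le u e i) (h.pV_le hQ u e n hn)).trans (by simp)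

theorem Dyn.wt_le (hQ : Q.Good) (h : Dyn Q N F ex ds) (u e : ℕ) :
    Q.wt ds u e ≤ Q.M N ^ Q.ed u := h.partial_wt_le hQ u e _ _ le_rfl

/-- The weight is local: it depends on the bits of `e` and on the sums over its children only. So a
new weight at a node can make only the weight of its predecessor outdated. -/
theorem Plan.wt_congr {u e : ℕ} (hE : ∀ i, ds'.E e i = ds.E e i)
    (hS : ∀ v, Q.par v = u → ds'.S e v = ds.S e v) : Q.wt ds' u e = Q.wt ds u e := by
  unfold Plan.wt Plan.pE Plan.pV
  congr 1
  · simp only [hE]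
  · refine Finset.prod_congr rfl fun j _ => ?_
    split_ifs with h
    · rw [hS _ h]
    · rfl

/-- A new node. -/
@[simps] def DS.addNode (ds : DS) (a u b : ℕ) : DS :=
  { ds with
    next := ds.next + 1
    ch := fun a' u' b' => if a' = a ∧ u' = u ∧ b' = b then ds.next else ds.ch a' u' b'
    typ := fun e => if e = ds.next then u else ds.typ e
    up := fun e => if e = ds.next then a else ds.up e
    val := fun e => if e = ds.next then b else ds.val e }

/-- A fresh node has weight `0` and bits `0` by `fresh_W` and `fresh_E`. Sums, lists and truth
values thus need no change; only the weight of the new node is suspect, and it is put among the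
exceptions. -/
theorem Dyn.addNode (hQ : Q.Good) (h : Dyn Q N F ex ds) {ν : ℕ → ℕ} {u : ℕ} (hu1 : 1 ≤ u)
    (hu : u ≤ Q.m) (hν : ν u ≤ N) (hp : Q.it ds ν (Q.par u) ≠ 0) (h0 : Q.it ds ν u = 0)
    (hex : ∀ e, ex e → ex' e) (hex' : ex' ds.next)
    (hds : ds' = ds.addNode (Q.it ds ν (Q.par u)) u (ν u)) :
    Dyn Q N F ex' ds' ∧ (∀ ν' v, v ≤ Q.m → Q.it ds ν' v ≠ 0 → Q.it ds' ν' v = Q.it ds ν' v) ∧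
      Q.it ds' ν u = ds.next := by
  have hpu := hQ.par_lt u hu1 hu
  have ha := h.toTrie.it_bounds hQ (by omega : Q.par u ≤ Q.m) hp
  rw [Plan.it, item_of_lt _ _ hpu] at h0
  set a := Q.it ds ν (Q.par u) with ha_def
  change ds.ch a u (ν u) = 0 at h0
  have hT : Trie Q N ds' := by
    subst hds
    refine ⟨by simp; have := h.two_le; omega, ?_, ?_, ?_⟩
    · have := h.two_le
      simp only [DS.addNode_typ]
      rw [if_neg (by omega), h.typ_one]
    · intro e h1 h2
      simp only [DS.addNode_next] at h2
      by_cases he : e = ds.next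
      · subst he
        simp only [DS.addNode_typ, DS.addNode_up, DS.addNode_ch, DS.addNode_val, eq_self, if_true,
          and_self]
        rw [if_neg (by omega)]
        exact ⟨hu1, hu, ha.1, ha.2.1, ha.2.2, trivial, hν⟩
      · have hn := h.node e h1 (by omega)
        simp only [DS.addNode_typ, DS.addNode_up, DS.addNode_ch, DS.addNode_val, if_neg he]
        rw [if_neg (show ds.up e ≠ ds.next by omega), if_neg]
        · exact hn
        · rintro ⟨h3, h4, h5⟩
          rw [h3, h4, h5, h0] at hn
          omega
    · intro a' u' b' hne
      simp only [DS.addNode_typ, DS.addNode_up, DS.addNode_ch, DS.addNode_val,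
        DS.addNode_next] at hne ⊢
      by_cases hc : a' = a ∧ u' = u ∧ b' = ν u
      · simp only [if_pos hc, if_pos]
        exact ⟨h.two_le, by omega, hc.1.symm, hc.2.1.symm, hc.2.2.symm⟩
      · simp only [if_neg hc] at hne ⊢
        have := h.ch_node a' u' b' hne
        rw [if_neg (by omega), if_neg (by omega), if_neg (by omega)]
        exact ⟨this.1, by omega, this.2.2⟩
  -- The node of a valuation either stays the same, or it was absent and is now the new node.
  have hit : ∀ ν' v, v ≤ Q.m → Q.it ds' ν' v = Q.it ds ν' v ∨
      Q.it ds ν' v = 0 ∧ Q.it ds' ν' v = ds.next := by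
    intro ν' v
    induction v using Nat.strong_induction_on with
    | _ v ih =>
      intro hv
      rcases Nat.eq_zero_or_pos v with rfl | hpos
      · left; simp [Plan.it, item_zero]
      · have hpv := hQ.par_lt v hpos hv
        have e1 : Q.it ds' ν' v = ds'.ch (Q.it ds' ν' (Q.par v)) v (ν' v) := item_of_lt _ _ hpv
        have e2 : Q.it ds ν' v = ds.ch (Q.it ds ν' (Q.par v)) v (ν' v) := item_of_lt _ _ hpv
        rw [e1, e2]
        rcases ih _ hpv (by omega) with h1 | ⟨h1, h2⟩
        · rw [h1, hds, DS.addNode_ch]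
          split_ifs with hc
          · right; rw [hc.1, hc.2.2, hc.2.1]; exact ⟨h0, rfl⟩
          · left; rfl
        · left
          rw [h1, h2, hds, DS.addNode_ch, if_neg (by omega)]
          -- The new node has no children yet, and the absent node `0` never has any: a predecessor
          -- lies between `1` and the number of its child, excluding the latter.
          have z1 : ds.ch ds.next v (ν' v) = 0 := by
            by_contra hne
            have := h.ch_node _ _ _ hne
            have h4 := h.node _ this.1 this.2.1
            omega
          have z2 : ds.ch 0 v (ν' v) = 0 := by
            by_contra hne
            have := h.ch_node _ _ _ hne
            have h4 := h.node _ this.1 this.2.1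
            omega
          rw [z1, z2]
  have hold : ∀ ν' v, v ≤ Q.m → Q.it ds ν' v ≠ 0 → Q.it ds' ν' v = Q.it ds ν' v := by
    intro ν' v hv hne
    rcases hit ν' v hv with h1 | h1
    exacts [h1, absurd h1.1 hne]
  have hsum : ∀ a' u', (Finset.Ico 2 (ds.next + 1)).filter
      (fun e => ds'.up e = a' ∧ ds'.typ e = u') ⊆ insert ds.next
      ((Finset.Ico 2 ds.next).filter fun e => ds.up e = a' ∧ ds.typ e = u') := by
    intro a' u' e he
    simp only [hds, DS.addNode_up, DS.addNode_typ, Finset.mem_filter, Finset.mem_Ico,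
      Finset.mem_insert] at he ⊢
    by_cases hc : e = ds.next
    · exact Or.inl hc
    · rw [if_neg hc, if_neg hc] at he
      exact Or.inr ⟨⟨he.1.1, by omega⟩, he.2⟩
  refine ⟨{ hT with
    fresh_W := fun e he => ?_
    fresh_E := fun e i he => ?_
    zero_E := fun i => ?_
    E_le := fun e i => ?_
    E_eq := fun i hi ν' => ?_
    S_eq := fun a' u' => ?_
    roster := ⟨fun a' u' n hn => ?_, fun e h1 h2 h3 => ?_⟩
    W_eq := fun e h1 h2 h3 => ?_
    W_le := fun e => ?_ }, hold, ?_⟩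
  · subst hds; exact h.fresh_W e (by simp at he; omega)
  · subst hds; exact h.fresh_E e i (by simp at he; omega)
  · subst hds; exact h.zero_E i
  · subst hds; exact h.E_le e i
  · rw [← h.E_eq i hi ν']
    have hE : ds'.E = ds.E := by subst hds; rfl
    rw [hE]
    rcases hit ν' (Q.low i) (hQ.low_le i hi) with h1 | ⟨h1, h2⟩
    · rw [h1]
    -- Going from the absent node `0` to the fresh one does not alter the bit: it is `0` at both.
    · rw [h1, h2, h.zero_E, h.fresh_E _ _ le_rfl]
  · have hS : ds'.S = ds.S := by subst hds; rfl
    have hW : ds'.W = ds.W := by subst hds; rfl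
    have hn : ds'.next = ds.next + 1 := by subst hds; rfl
    rw [hS, hW, hn, h.S_eq]
    rw [Finset.sum_subset (hsum a' u') ?_]
    · refine Finset.sum_subset (Finset.subset_insert _ _) ?_
      · intro e he hne
        rw [Finset.mem_insert] at he
        rcases he with rfl | he
        exacts [h.fresh_W _ le_rfl, absurd he hne]
    · intro e he hne
      rw [Finset.mem_insert] at he
      rcases he with rfl | he
      · exact h.fresh_W _ le_rfl
      · exfalso
        apply hne
        simp only [hds, DS.addNode_up, DS.addNode_typ, Finset.mem_filter, Finset.mem_Ico] at he ⊢
        rw [if_neg (by omega), if_neg (by omega)]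
        exact ⟨⟨he.1.1, by omega⟩, he.2⟩
  · subst hds
    have := h.roster.elem_spec a' u' n hn
    simp only [DS.addNode_up, DS.addNode_typ, DS.addNode_next, DS.addNode_elem, DS.addNode_W,
      DS.addNode_posn]
    rw [if_neg (by omega), if_neg (by omega)]
    exact ⟨this.1, by omega, this.2.2⟩
  · subst hds
    simp only [DS.addNode_up, DS.addNode_typ, DS.addNode_next, DS.addNode_elem, DS.addNode_W,
      DS.addNode_posn, DS.addNode_len] at h2 h3 ⊢
    have hne : e ≠ ds.next := fun he => h3 (h.fresh_W e he.ge)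
    rw [if_neg hne, if_neg hne]
    exact h.roster.posn_spec e h1 (by omega) h3
  · subst hds
    simp only [DS.addNode_typ, DS.addNode_next, DS.addNode_W] at h2 ⊢
    have hne : e ≠ ds.next := fun he => h3 (he ▸ hex')
    rw [if_neg hne, h.W_eq e h1 (by omega) fun h4 => h3 (hex e h4)]
    rfl
  · subst hds
    simp only [DS.addNode_typ, DS.addNode_W]
    by_cases he : e = ds.next
    · rw [h.fresh_W e he.ge]; exact Nat.zero_le _
    · rw [if_neg he]; exact h.W_le e
  · have e1 : Q.it ds' ν u = ds'.ch (Q.it ds' ν (Q.par u)) u (ν u) := item_of_lt _ _ hpu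
    rw [e1, hold ν _ (by omega) hp, hds, DS.addNode_ch, if_pos ⟨rfl, rfl, rfl⟩]

/-- Recording whether a valuation satisfies the `i`-th atom. -/
theorem Dyn.setE (hQ : Q.Good) (h : Dyn Q N F ex ds) {ν : ℕ → ℕ} {i o : ℕ} (hi : i < Q.d)
    (ho : o ≤ 1) (h0 : Q.it ds ν (Q.low i) ≠ 0) (hex : ex (Q.it ds ν (Q.low i)))
    {F' : ℕ → (ℕ → ℕ) → Prop}
    (hF : ∀ ν', (∀ v, 1 ≤ v → Q.occ i v → ν' v = ν v) → (F' i ν' ↔ o = 1))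
    (hF₂ : ∀ ν', ¬ (∀ v, 1 ≤ v → Q.occ i v → ν' v = ν v) → (F' i ν' ↔ F i ν'))
    (hF₃ : ∀ j < Q.d, j ≠ i → ∀ ν', (F' j ν' ↔ F j ν'))
    (hds : ds' = { ds with E := fun e j => if e = Q.it ds ν (Q.low i) ∧ j = i then o else ds.E e j }) :
    Dyn Q N F' ex ds' := by
  classical
  have hb := h.toTrie.it_bounds hQ (hQ.low_le i hi) h0
  refine { (⟨?_, ?_, ?_, ?_⟩ : Trie Q N ds') with
    fresh_W := ?_, fresh_E := fun e j he => ?_, zero_E := fun j => ?_, E_le := fun e j => ?_,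
    E_eq := fun j hj ν' => ?_, S_eq := ?_, roster := ?_, W_eq := fun e h1 h2 h3 => ?_, W_le := ?_ }
  · subst hds; exact h.two_le
  · subst hds; exact h.typ_one
  · subst hds; exact h.node
  · subst hds; exact h.ch_node
  · subst hds; exact h.fresh_W
  · subst hds
    simp only at he ⊢
    rw [if_neg (by omega), h.fresh_E e j he]
  · subst hds
    simp only
    rw [if_neg (by omega), h.zero_E]
  · subst hds
    simp only
    split_ifs
    exacts [ho, h.E_le e j]
  · have hit : ∀ v, Q.it ds' ν' v = Q.it ds ν' v := by subst hds; intro v; rfl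
    rw [hit]
    subst hds
    simp only
    by_cases hj' : j = i
    · subst hj'
      by_cases hag : ∀ v, 1 ≤ v → Q.occ j v → ν' v = ν v
      · have : Q.it ds ν' (Q.low j) = Q.it ds ν (Q.low j) :=
          it_congr_occ hQ hj (hQ.low_le j hj) (hQ.occ_low j hj) fun v h1 _ h3 => hag v h1 h3
        rw [if_pos ⟨this, rfl⟩]
        simp only [hF ν' hag]
        split_ifs <;> omega
      -- A valuation that differs from `ν` on the atom has another node, by `Trie.it_inj`, so its
      -- bit is untouched.
      · rw [if_neg]
        · rw [h.E_eq j hj]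
          exact if_congr (hF₂ ν' hag).symm rfl rfl
        · rintro ⟨heq, -⟩
          exact hag fun v h1 h3 => (h.toTrie.it_inj hQ hj (hQ.low_le j hj) (hQ.occ_low j hj)
            h0 heq.symm h3 (hQ.le_low j hj v h3) h1).symm
    · rw [if_neg (by tauto), h.E_eq j hj]
      exact if_congr (hF₃ j hj hj' ν').symm rfl rfl
  · subst hds; exact h.S_eq
  · subst hds; exact h.roster
  · have hne : e ≠ Q.it ds ν (Q.low i) := fun he => h3 (he ▸ hex)
    have : Q.wt ds' (ds.typ e) e = Q.wt ds (ds.typ e) e := by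
      subst hds
      refine Plan.wt_congr (fun j => ?_) fun v _ => rfl
      simp only
      rw [if_neg (by tauto)]
    subst hds
    rw [this]
    exact h.W_eq e h1 h2 h3
  · subst hds; exact h.W_le

/-- Recomputing the weight of a node other than the root. -/
theorem Dyn.repair (hQ : Q.Good) (hN : Dyn Q N F ex ds) {id pid u : ℕ} (h2 : 2 ≤ id)
    (hlt : id < ds.next) (hup : ds.up id = pid) (htyp : ds.typ id = u)
    (hex : ∀ e, ex e → e = id ∨ ex' e) (hpid : ex' pid)
    {len' : ℕ → ℕ → ℕ} {elem' : ℕ → ℕ → ℕ → ℕ} {posn' : ℕ → ℕ}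
    (hR : Roster ds.next ds.up ds.typ (fun e => if e = id then Q.wt ds u id else ds.W e)
      len' elem' posn')
    (hds : ds' = { ds with
      W := fun e => if e = id then Q.wt ds u id else ds.W e
      S := fun a v => if a = pid ∧ v = u then ds.S pid u - ds.W id + Q.wt ds u id else ds.S a v
      len := len', elem := elem', posn := posn' }) : Dyn Q N F ex' ds' := by
  have hnode := hN.node id h2 hlt
  refine { (⟨?_, ?_, ?_, ?_⟩ : Trie Q N ds') with
    fresh_W := fun e he => ?_, fresh_E := ?_, zero_E := ?_, E_le := ?_,
    E_eq := ?_, S_eq := fun a v => ?_, roster := ?_, W_eq := fun e h1 h3 h4 => ?_,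
    W_le := fun e => ?_ }
  · subst hds; exact hN.two_le
  · subst hds; exact hN.typ_one
  · subst hds; exact hN.node
  · subst hds; exact hN.ch_node
  · subst hds
    simp only at he ⊢
    rw [if_neg (by omega), hN.fresh_W e he]
  · subst hds; exact hN.fresh_E
  · subst hds; exact hN.zero_E
  · subst hds; exact hN.E_le
  · subst hds; exact hN.E_eq
  · have hmem : id ∈ (Finset.Ico 2 ds.next).filter fun e => ds.up e = pid ∧ ds.typ e = u := by
      rw [Finset.mem_filter, Finset.mem_Ico]
      exact ⟨⟨h2, hlt⟩, hup, htyp⟩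
    subst hds
    simp only
    by_cases hc : a = pid ∧ v = u
    · obtain ⟨rfl, rfl⟩ := hc
      rw [if_pos ⟨rfl, rfl⟩, hN.S_eq, ← Finset.add_sum_erase _ _ hmem,
        ← Finset.add_sum_erase _ _ hmem, if_pos rfl]
      have : ∑ e ∈ ((Finset.Ico 2 ds.next).filter fun e => ds.up e = a ∧ ds.typ e = v).erase id,
          (if e = id then Q.wt ds v id else ds.W e) =
          ∑ e ∈ ((Finset.Ico 2 ds.next).filter fun e => ds.up e = a ∧ ds.typ e = v).erase id,
            ds.W e :=
        Finset.sum_congr rfl fun e he => if_neg (Finset.ne_of_mem_erase he)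
      rw [this]
      omega
    · rw [if_neg hc, hN.S_eq]
      refine Finset.sum_congr rfl fun e he => ?_
      rw [Finset.mem_filter] at he
      rw [if_neg]
      rintro rfl
      exact hc ⟨he.2.1.symm.trans hup, he.2.2.symm.trans htyp⟩
  · subst hds; exact hR
  · have hwt : e ≠ pid → Q.wt ds' (ds.typ e) e = Q.wt ds (ds.typ e) e := by
      intro hne
      subst hds
      refine Plan.wt_congr (fun j => rfl) fun v hv => ?_
      simp only
      rw [if_neg (by tauto)]
    have h3' : e < ds.next := by subst hds; exact h3
    have htyp' : ds'.typ e = ds.typ e := by subst hds; rfl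
    have hne : e ≠ pid := fun he => h4 (he ▸ hpid)
    rw [htyp', hwt hne]
    subst hds
    simp only
    split_ifs with he
    · rw [he, htyp]
    · exact hN.W_eq e h1 h3' fun h5 => (hex e h5).elim he h4
  · subst hds
    simp only
    split_ifs with he
    · rw [he, htyp]; exact hN.wt_le hQ _ _
    · exact hN.W_le e

/-- Recomputing the weight of the root. -/
theorem Dyn.repair_root (hQ : Q.Good) (h : Dyn Q N F ex ds) (hex : ∀ e, ex e → e = 1 ∨ ex' e)
    (hds : ds' = { ds with W := fun e => if e = 1 then Q.wt ds 0 1 else ds.W e }) :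
    Dyn Q N F ex' ds' := by
  have hn := h.two_le
  refine { (⟨?_, ?_, ?_, ?_⟩ : Trie Q N ds') with
    fresh_W := fun e he => ?_, fresh_E := ?_, zero_E := ?_, E_le := ?_,
    E_eq := ?_, S_eq := fun a v => ?_, roster := ⟨fun a v n hlt => ?_, fun e h1 h2 h3 => ?_⟩,
    W_eq := fun e h1 h3 h4 => ?_, W_le := fun e => ?_ }
  · subst hds; exact h.two_le
  · subst hds; exact h.typ_one
  · subst hds; exact h.node
  · subst hds; exact h.ch_node
  · subst hds
    simp only at he ⊢
    rw [if_neg (by omega), h.fresh_W e he]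
  · subst hds; exact h.fresh_E
  · subst hds; exact h.zero_E
  · subst hds; exact h.E_le
  · subst hds; exact h.E_eq
  · subst hds
    simp only
    rw [h.S_eq]
    refine Finset.sum_congr rfl fun e he => ?_
    rw [Finset.mem_filter, Finset.mem_Ico] at he
    rw [if_neg (by omega)]
  · subst hds
    have := h.roster.elem_spec a v n hlt
    simp only
    rw [if_neg (by omega)]
    exact this
  · subst hds
    simp only at h3 ⊢
    rw [if_neg (by omega)] at h3
    exact h.roster.posn_spec e h1 h2 h3
  · have htyp' : ds'.typ e = ds.typ e := by subst hds; rfl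
    have hwt : Q.wt ds' (ds.typ e) e = Q.wt ds (ds.typ e) e := by
      subst hds; exact Plan.wt_congr (fun j => rfl) fun v hv => rfl
    rw [htyp', hwt]
    subst hds
    simp only
    split_ifs with he
    · rw [he, h.typ_one]
    · exact h.W_eq e h1 h3 fun h5 => (hex e h5).elim he h4
  · subst hds
    simp only
    split_ifs with he
    · rw [he, h.typ_one]; exact h.wt_le hQ _ _
    · exact h.W_le e

end

/-! ### Enumeration and counting -/

/-- The children of `a` at position `u` with nonzero weight. -/
def DS.lst (ds : DS) (a u : ℕ) : List ℕ := (List.range (ds.len a u)).map (ds.elem a u)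

/-- All ways to choose nodes for the `n` positions after `i`. -/
def Plan.ext (Q : Plan) (ds : DS) : ℕ → ℕ → (ℕ → ℕ) → List (ℕ → ℕ)
  | 0, _, p => [p]
  | n + 1, i, p => (ds.lst (p (Q.par (i + 1))) (i + 1)).flatMap fun e =>
      Q.ext ds n (i + 1) (Function.update p (i + 1) e)

section
variable {Q : Plan} {N : ℕ} {F : ℕ → (ℕ → ℕ) → Prop} {ds : DS}

/-- All weights are up to date. -/
abbrev Dyn.Clean (Q : Plan) (N : ℕ) (F : ℕ → (ℕ → ℕ) → Prop) (ds : DS) : Prop :=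
  Dyn Q N F (fun _ => False) ds

theorem Dyn.mem_lst {ex : ℕ → Prop} (h : Dyn Q N F ex ds) {a u e : ℕ} :
    e ∈ ds.lst a u ↔ 2 ≤ e ∧ e < ds.next ∧ ds.up e = a ∧ ds.typ e = u ∧ ds.W e ≠ 0 := by
  simp only [DS.lst, List.mem_map, List.mem_range]
  constructor
  · rintro ⟨n, hn, rfl⟩
    have := h.roster.elem_spec a u n hn
    exact ⟨this.1, this.2.1, this.2.2.1, this.2.2.2.1, this.2.2.2.2.1⟩
  · rintro ⟨h1, h2, rfl, rfl, h3⟩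
    have := h.roster.posn_spec e h1 h2 h3
    exact ⟨_, this.1, this.2⟩

theorem Dyn.nodup_lst {ex : ℕ → Prop} (h : Dyn Q N F ex ds) (a u : ℕ) : (ds.lst a u).Nodup := by
  refine List.Nodup.map_on ?_ List.nodup_range
  intro x hx y hy hxy
  rw [List.mem_range] at hx hy
  rw [← (h.roster.elem_spec a u x hx).2.2.2.2.2, hxy, (h.roster.elem_spec a u y hy).2.2.2.2.2]

theorem Dyn.sum_lst {ex : ℕ → Prop} (h : Dyn Q N F ex ds) (a u : ℕ) :
    ((ds.lst a u).map ds.W).sum = ds.S a u := by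
  classical
  rw [h.S_eq, ← List.sum_toFinset _ (h.nodup_lst a u)]
  refine Finset.sum_subset (fun e he => ?_) (fun e he hne => ?_)
  · rw [List.mem_toFinset, h.mem_lst] at he
    rw [Finset.mem_filter, Finset.mem_Ico]
    exact ⟨⟨he.1, he.2.1⟩, he.2.2.1, he.2.2.2.1⟩
  · rw [Finset.mem_filter, Finset.mem_Ico] at he
    rw [List.mem_toFinset, h.mem_lst] at hne
    by_contra h0
    exact hne ⟨he.1.1, he.1.2, he.2.1, he.2.2, h0⟩

theorem Plan.mem_ext (hQ : Q.Good) (n i : ℕ) (hn : i + n ≤ Q.m) (p q : ℕ → ℕ) :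
    q ∈ Q.ext ds n i p ↔ (∀ v, v ≤ i ∨ i + n < v → q v = p v) ∧
      ∀ v, i < v → v ≤ i + n → q v ∈ ds.lst (q (Q.par v)) v := by
  induction n generalizing i p with
  | zero =>
    simp only [Plan.ext, List.mem_singleton, add_zero]
    constructor
    · rintro rfl
      exact ⟨fun _ _ => rfl, fun v h1 h2 => by omega⟩
    · rintro ⟨h1, -⟩
      exact funext fun v => h1 v (by omega)
  | succ n ih =>
    simp only [Plan.ext, List.mem_flatMap]
    have hp := hQ.par_lt (i + 1) (by omega) (by omega)
    constructor
    · rintro ⟨e, he, hq⟩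
      rw [ih (i + 1) (by omega)] at hq
      have hqe : q (i + 1) = e := by rw [hq.1 (i + 1) (by omega), Function.update_self]
      have hle : ∀ v, v ≤ i ∨ i + (n + 1) < v → q v = p v := fun v hv => by
        rw [hq.1 v (by omega), Function.update_of_ne (by omega)]
      refine ⟨hle, fun v h1 h2 => ?_⟩
      rcases Nat.lt_or_ge (i + 1) v with h3 | h3
      · exact hq.2 v h3 (by omega)
      · obtain rfl : v = i + 1 := by omega
        rw [hqe, hle _ (by omega)]
        exact he
    · rintro ⟨h1, h2⟩
      refine ⟨q (i + 1), ?_, ?_⟩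
      · have := h2 (i + 1) (by omega) (by omega)
        rwa [h1 (Q.par (i + 1)) (by omega)] at this
      · rw [ih (i + 1) (by omega)]
        refine ⟨fun v hv => ?_, fun v h3 h4 => h2 v (by omega) (by omega)⟩
        rw [Function.update_apply]
        split_ifs with hc
        · rw [hc]
        · exact h1 v (by omega)

theorem Dyn.nodup_ext {ex : ℕ → Prop} (hQ : Q.Good) (h : Dyn Q N F ex ds) (n i : ℕ)
    (hn : i + n ≤ Q.m) (p : ℕ → ℕ) : (Q.ext ds n i p).Nodup := by
  induction n generalizing i p with
  | zero => simp [Plan.ext]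
  | succ n ih =>
    rw [Plan.ext, List.nodup_flatMap]
    refine ⟨fun e _ => ih _ (by omega) _, (h.nodup_lst _ _).imp ?_⟩
    intro e e' hne q hq hq'
    rw [Plan.mem_ext hQ _ _ (by omega)] at hq hq'
    apply hne
    have h1 := hq.1 (i + 1) (by omega)
    have h2 := hq'.1 (i + 1) (by omega)
    rw [Function.update_self] at h1 h2
    rw [← h1, h2]

/-- All bits and all capped factors are at most `1`; if the product is nonzero they equal `1`, and
the factors of the free child positions remain. -/
theorem Dyn.wt_eq_of_ne_zero {ex : ℕ → Prop} (hQ : Q.Good) (h : Dyn Q N F ex ds) {u e : ℕ}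
    (h0 : Q.wt ds u e ≠ 0) : Q.wt ds u e =
      ∏ j ∈ Finset.range Q.K, if Q.par (j + 1) = u then ds.S e (j + 1) else 1 := by
  unfold Plan.wt at h0 ⊢
  have h1 : Q.pE ds u e Q.d = 1 := by
    have := Plan.pE_le (Q := Q) h.E_le u e Q.d
    have := left_ne_zero_of_mul h0
    omega
  have h2 := right_ne_zero_of_mul h0
  rw [h1, one_mul]
  unfold Plan.pV at h2 ⊢
  rw [← Finset.prod_range_mul_prod_Ico _ hQ.K_le] at h2 ⊢
  rw [Finset.prod_eq_one (s := Finset.Ico Q.K Q.m), mul_one]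
  · refine Finset.prod_congr rfl fun j hj => ?_
    rw [Finset.mem_range] at hj
    rw [Plan.fac, if_neg (show ¬ Q.K < j + 1 by omega)]
  · intro j hj
    have h3 := Finset.prod_ne_zero_iff.1 (right_ne_zero_of_mul h2) j hj
    rw [Finset.mem_Ico] at hj
    split_ifs at h3 ⊢ with hc
    · have : Q.fac (j + 1) (ds.S e (j + 1)) ≤ 1 := by
        rw [Plan.fac, if_pos (by omega)]; omega
      omega
    · rfl

/-- The product runs over the free positions beyond `i` that hang from a position already chosen.
Positions deeper down do not appear since they are accounted for by the weights summed up in `S`.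
Choosing a node for position `i + 1` replaces the factor of this position by the weight of the node,
which is the product over its own free children; summing over the list restores the factor. -/
theorem Dyn.length_ext (hQ : Q.Good) (h : Dyn.Clean Q N F ds) (n i : ℕ) (hn : i + n = Q.K)
    (p : ℕ → ℕ) : (Q.ext ds n i p).length = ∏ j ∈ Finset.range Q.K,
      if i ≤ j ∧ Q.par (j + 1) ≤ i then ds.S (p (Q.par (j + 1))) (j + 1) else 1 := by
  have hK := hQ.K_le
  induction n generalizing i p with
  | zero =>
    rw [Plan.ext, List.length_singleton, Finset.prod_eq_one]
    intro j hj
    rw [Finset.mem_range] at hj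
    rw [if_neg (by omega)]
  | succ n ih =>
    have hpi := hQ.par_lt (i + 1) (by omega) (by omega)
    rw [Plan.ext, List.length_flatMap]
    set R := ∏ j ∈ Finset.range Q.K,
      if i + 1 ≤ j ∧ Q.par (j + 1) ≤ i then ds.S (p (Q.par (j + 1))) (j + 1) else 1 with hR
    -- `R` collects the pending positions that hang from nodes chosen before `e`; those hanging from
    -- `e` contribute its weight.
    have h1 : ∀ e ∈ ds.lst (p (Q.par (i + 1))) (i + 1),
        (Q.ext ds n (i + 1) (Function.update p (i + 1) e)).length = R * ds.W e := by
      intro e he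
      rw [h.mem_lst] at he
      have hW := h.W_eq e (by omega) he.2.1 (by simp)
      have h0 := he.2.2.2.2
      rw [hW] at h0
      rw [ih (i + 1) (by omega), hW, h.wt_eq_of_ne_zero hQ h0, hR, ← Finset.prod_mul_distrib,
        he.2.2.2.1]
      refine Finset.prod_congr rfl fun j hj => ?_
      rw [Finset.mem_range] at hj
      have hpj := hQ.par_lt (j + 1) (by omega) (by omega)
      by_cases hc : Q.par (j + 1) = i + 1
      · rw [if_pos (by omega), if_neg (by omega), if_pos hc, hc, Function.update_self, one_mul]
      · rw [if_neg hc, mul_one, Function.update_of_ne hc]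
        by_cases hc' : i + 1 ≤ j ∧ Q.par (j + 1) ≤ i
        · rw [if_pos hc', if_pos (by omega)]
        · rw [if_neg hc', if_neg (by omega)]
    rw [List.map_congr_left h1, List.sum_map_mul_left, h.sum_lst]
    -- The factor of position `i + 1` itself is split off. Its predecessor is at most `i`, so it is
    -- pending.
    have h2 : ∀ j ∈ Finset.range Q.K,
        (if i ≤ j ∧ Q.par (j + 1) ≤ i then ds.S (p (Q.par (j + 1))) (j + 1) else 1) =
        (if i + 1 ≤ j ∧ Q.par (j + 1) ≤ i then ds.S (p (Q.par (j + 1))) (j + 1) else 1) *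
          (if j = i then ds.S (p (Q.par (i + 1))) (i + 1) else 1) := by
      intro j _
      by_cases hc : j = i
      · subst hc
        rw [if_pos (by omega), if_neg (by omega), if_pos rfl, one_mul]
      · rw [if_neg hc, mul_one]
        by_cases hc' : i + 1 ≤ j ∧ Q.par (j + 1) ≤ i
        · rw [if_pos hc', if_pos (by omega)]
        · rw [if_neg hc', if_neg (by omega)]
    rw [Finset.prod_congr rfl h2, Finset.prod_mul_distrib, Finset.prod_ite_eq',
      if_pos (Finset.mem_range.2 (by omega))]

theorem Dyn.length_ext_zero (hQ : Q.Good) (h : Dyn.Clean Q N F ds) (h0 : ds.W 1 ≠ 0)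
    {p : ℕ → ℕ} (hp : p 0 = 1) : (Q.ext ds Q.K 0 p).length = ds.W 1 := by
  have h2 := h.two_le
  have hW := h.W_eq 1 le_rfl (by omega) (by simp)
  rw [hW] at h0
  rw [h.length_ext hQ _ _ (by simp), hW, h.wt_eq_of_ne_zero hQ h0, h.typ_one]
  refine Finset.prod_congr rfl fun j _ => ?_
  by_cases hc : Q.par (j + 1) = 0
  · rw [if_pos (by omega), if_pos hc, hc, hp]
  · rw [if_neg (by omega), if_neg hc]

/-- The nodes `q 0, …, q i` form a partial valuation all of whose nodes have nonzero weight. -/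
def Plan.Chosen (Q : Plan) (ds : DS) (i : ℕ) (q : ℕ → ℕ) : Prop :=
  q 0 = 1 ∧ ∀ v, 1 ≤ v → v ≤ i → q v ∈ ds.lst (q (Q.par v)) v

theorem Dyn.chosen_spec {ex : ℕ → Prop} (h : Dyn Q N F ex ds) (h0 : ds.W 1 ≠ 0)
    {i : ℕ} {q : ℕ → ℕ} (hq : Q.Chosen ds i q) {v : ℕ} (hv : v ≤ i) :
    1 ≤ q v ∧ q v < ds.next ∧ ds.typ (q v) = v ∧ ds.W (q v) ≠ 0 := by
  rcases Nat.eq_zero_or_pos v with rfl | hpos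
  · rw [hq.1]
    exact ⟨le_rfl, h.two_le, h.typ_one, h0⟩
  · have := h.mem_lst.1 (hq.2 v hpos hv)
    exact ⟨by omega, this.2.1, this.2.2.2.1, this.2.2.2.2⟩

/-- The reason why the enumeration meets no dead ends: a nonzero product has nonzero factors, and a
nonzero sum of weights has a nonzero summand. -/
theorem Dyn.exists_lst (h : Dyn.Clean Q N F ds) {a u : ℕ} (h1 : 1 ≤ a) (h2 : a < ds.next)
    (hW : ds.W a ≠ 0) (hu : 1 ≤ u) (hm : u ≤ Q.m) (hp : Q.par u = ds.typ a) :
    ds.lst a u ≠ [] := by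
  rw [h.W_eq a h1 h2 (by simp)] at hW
  have h3 := Finset.prod_ne_zero_iff.1 (right_ne_zero_of_mul hW) (u - 1)
    (Finset.mem_range.2 (by omega))
  rw [Nat.sub_add_cancel hu, if_pos hp, Ne, Plan.fac_eq_zero] at h3
  intro hnil
  rw [← h.sum_lst, hnil] at h3
  exact h3 rfl

theorem Dyn.exists_chosen (hQ : Q.Good) (h : Dyn.Clean Q N F ds) (h0 : ds.W 1 ≠ 0) (n i : ℕ)
    (hn : i + n ≤ Q.m) {q : ℕ → ℕ} (hq : Q.Chosen ds i q) :
    ∃ q', Q.Chosen ds (i + n) q' ∧ ∀ v ≤ i, q' v = q v := by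
  induction n with
  | zero => exact ⟨q, hq, fun _ _ => rfl⟩
  | succ n ih =>
    obtain ⟨q', hq', hag⟩ := ih (by omega)
    have hp := hQ.par_lt (i + n + 1) (by omega) (by omega)
    have hs := h.chosen_spec h0 hq' (by omega : Q.par (i + n + 1) ≤ i + n)
    obtain ⟨e, he⟩ := List.exists_mem_of_ne_nil _ (h.exists_lst hs.1 hs.2.1 hs.2.2.2
      (u := i + n + 1) (by omega) (by omega) hs.2.2.1.symm)
    refine ⟨Function.update q' (i + n + 1) e, ⟨?_, fun v h1 h2 => ?_⟩, fun v hv => ?_⟩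
    · rw [Function.update_of_ne (by omega), hq'.1]
    · have hpv := hQ.par_lt v h1 (by omega)
      rw [Function.update_of_ne (a := Q.par v) (by omega)]
      by_cases hc : v = i + n + 1
      · subst hc; rwa [Function.update_self]
      · rw [Function.update_of_ne hc]
        exact hq'.2 v h1 (by omega)
    · rw [Function.update_of_ne (by omega), hag v hv]

/-- By induction along the path: the choice at `v` is a child of the choice at `par v`, and `ch`
recovers a node from its predecessor, position and value. -/
theorem Dyn.chosen_it (hQ : Q.Good) (h : Dyn.Clean Q N F ds) {q ν : ℕ → ℕ} {i : ℕ} (hi : i ≤ Q.m)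
    (hq : Q.Chosen ds i q) (hν : ∀ v, 1 ≤ v → v ≤ i → ν v = ds.val (q v)) {v : ℕ} (hv : v ≤ i) :
    Q.it ds ν v = q v := by
  induction v using Nat.strong_induction_on with
  | _ v ih =>
    rcases Nat.eq_zero_or_pos v with rfl | hpos
    · rw [Plan.it, item_zero, hq.1]
    · have hp := hQ.par_lt v hpos (by omega)
      have hm := h.mem_lst.1 (hq.2 v hpos hv)
      have hn := h.node _ hm.1 hm.2.1
      have e1 : Q.it ds ν v = ds.ch (Q.it ds ν (Q.par v)) v (ν v) := item_of_lt _ _ hp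
      rw [e1, ih _ hp (by omega), hν v hpos hv, ← hm.2.2.1]
      nth_rewrite 2 [← hm.2.2.2.1]
      exact hn.2.2.2.2.2.1

/-- Nodes with nonzero weight on all positions yield a valuation that satisfies all atoms. -/
theorem Dyn.sound (hQ : Q.Good) (h : Dyn.Clean Q N F ds) (h0 : ds.W 1 ≠ 0) {q : ℕ → ℕ}
    (hq : Q.Chosen ds Q.m q) : ∀ i < Q.d, F i fun v => ds.val (q v) := by
  intro i hi
  have hl := hQ.low_le i hi
  have hs := h.chosen_spec h0 hq hl
  have hit := h.chosen_it hQ le_rfl hq (ν := fun v => ds.val (q v)) (fun _ _ _ => rfl) hl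
  have hE := h.E_eq i hi fun v => ds.val (q v)
  have hW := hs.2.2.2
  rw [h.W_eq _ hs.1 hs.2.1 (by simp)] at hW
  have h3 := Finset.prod_ne_zero_iff.1 (left_ne_zero_of_mul hW) i (Finset.mem_range.2 hi)
  rw [if_pos hs.2.2.1.symm] at h3
  rw [hit] at hE
  by_contra hF
  rw [if_neg hF] at hE
  exact h3 hE

/-- The bit of a satisfied atom is `1`, while the absent node has bits `0`. So the node at the end
of the atom exists, and with it all nodes above. -/
theorem Dyn.it_ne_zero (hQ : Q.Good) (h : Dyn.Clean Q N F ds) {ν : ℕ → ℕ}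
    (hF : ∀ i < Q.d, F i ν) {v : ℕ} (hv : v ≤ Q.m) : Q.it ds ν v ≠ 0 := by
  rcases Nat.eq_zero_or_pos v with rfl | hpos
  · simp [Plan.it, item_zero]
  · obtain ⟨i, hi, ho⟩ := hQ.exists_occ v hpos hv
    refine h.toTrie.it_ne_zero_of_occ hQ hi (hQ.low_le i hi) (hQ.occ_low i hi) (fun h1 => ?_) ho
      (hQ.le_low i hi v ho)
    have := h.E_eq i hi ν
    rw [if_pos (hF i hi), h1, h.zero_E] at this
    cases this

/-- Induction from the last position upwards, with `n = m - v`: the bits are `1`, and every child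
position has a child of nonzero weight, namely the node of `ν` itself. -/
theorem Dyn.W_it_ne_zero (hQ : Q.Good) (h : Dyn.Clean Q N F ds) {ν : ℕ → ℕ}
    (hF : ∀ i < Q.d, F i ν) (n : ℕ) {v : ℕ} (hv : v + n = Q.m) : ds.W (Q.it ds ν v) ≠ 0 := by
  induction n using Nat.strong_induction_on generalizing v with
  | _ n ih =>
    have hb := h.toTrie.it_bounds hQ (by omega) (h.it_ne_zero hQ hF (by omega : v ≤ Q.m))
    rw [h.W_eq _ hb.1 hb.2.1 (by simp), hb.2.2]
    refine mul_ne_zero (Finset.prod_ne_zero_iff.2 fun i hi => ?_)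
      (Finset.prod_ne_zero_iff.2 fun j hj => ?_)
    · rw [Finset.mem_range] at hi
      split_ifs with hc
      · rw [← hc, h.E_eq i hi, if_pos (hF i hi)]
        exact one_ne_zero
      · exact one_ne_zero
    · rw [Finset.mem_range] at hj
      split_ifs with hc
      · have hp := hQ.par_lt (j + 1) (by omega) (by omega)
        have hne := h.it_ne_zero hQ hF (by omega : j + 1 ≤ Q.m)
        have hb' := h.toTrie.it_bounds hQ (by omega) hne
        have hup := h.toTrie.it_up hQ (by omega) (by omega) hne
        rw [Ne, Plan.fac_eq_zero, h.S_eq, Finset.sum_eq_zero_iff]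
        intro hall
        refine ih (Q.m - (j + 1)) (by omega) (v := j + 1) (by omega) (hall _ ?_)
        rw [Finset.mem_filter, Finset.mem_Ico, hup.2.1, hc]
        exact ⟨⟨hup.1, hb'.2.1⟩, rfl, hb'.2.2⟩
      · exact one_ne_zero

theorem Dyn.complete (hQ : Q.Good) (h : Dyn.Clean Q N F ds) {ν : ℕ → ℕ}
    (hF : ∀ i < Q.d, F i ν) : ds.W 1 ≠ 0 ∧ Q.Chosen ds Q.m (Q.it ds ν) ∧
      ∀ v, 1 ≤ v → v ≤ Q.m → ds.val (Q.it ds ν v) = ν v := by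
  refine ⟨?_, ⟨by simp [Plan.it, item_zero], fun v h1 h2 => ?_⟩, fun v h1 h2 => ?_⟩
  · have := h.W_it_ne_zero hQ hF Q.m (v := 0) (by omega)
    rwa [Plan.it, item_zero] at this
  · have hne := h.it_ne_zero hQ hF h2
    have hb := h.toTrie.it_bounds hQ h2 hne
    have hup := h.toTrie.it_up hQ h2 h1 hne
    rw [h.mem_lst]
    exact ⟨hup.1, hb.2.1, hup.2.1, hb.2.2, h.W_it_ne_zero hQ hF (Q.m - v) (by omega)⟩
  · exact (h.toTrie.it_up hQ h2 h1 (h.it_ne_zero hQ hF h2)).2.2.1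

theorem Plan.chosen_of_mem_ext (hQ : Q.Good) {p q : ℕ → ℕ} (hp : p 0 = 1)
    (hq : q ∈ Q.ext ds Q.K 0 p) : Q.Chosen ds Q.K q := by
  rw [Plan.mem_ext hQ _ _ (by have := hQ.K_le; omega)] at hq
  exact ⟨by rw [hq.1 0 (by omega), hp], fun v h1 h2 => hq.2 v (by omega) (by omega)⟩

/-- A choice for the free positions extends to the quantified ones by `exists_chosen`; the values of
all the nodes then satisfy every atom. -/
theorem Dyn.ext_sound (hQ : Q.Good) (h : Dyn.Clean Q N F ds) (h0 : ds.W 1 ≠ 0) {p q : ℕ → ℕ}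
    (hp : p 0 = 1) (hq : q ∈ Q.ext ds Q.K 0 p) :
    ∃ ν : ℕ → ℕ, (∀ i < Q.d, F i ν) ∧ ∀ v ≤ Q.K, ν v = ds.val (q v) := by
  have hK := hQ.K_le
  obtain ⟨q', hq', hag⟩ := h.exists_chosen hQ h0 (Q.m - Q.K) Q.K (by omega)
    (Plan.chosen_of_mem_ext hQ hp hq)
  rw [Nat.add_sub_cancel' hK] at hq'
  exact ⟨_, h.sound hQ h0 hq', fun v hv => by simp only [hag v hv]⟩

theorem Dyn.ext_complete (hQ : Q.Good) (h : Dyn.Clean Q N F ds) {p ν : ℕ → ℕ} (hp : p 0 = 1)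
    (hF : ∀ i < Q.d, F i ν) :
    ds.W 1 ≠ 0 ∧ ∃ q ∈ Q.ext ds Q.K 0 p, ∀ v, 1 ≤ v → v ≤ Q.K → ds.val (q v) = ν v := by
  have hK := hQ.K_le
  obtain ⟨h0, hc, hv⟩ := h.complete hQ hF
  refine ⟨h0, fun v => if v ≤ Q.K then Q.it ds ν v else p v, ?_, fun v h1 h2 => ?_⟩
  · rw [Plan.mem_ext hQ _ _ (by omega)]
    refine ⟨fun v hv => ?_, fun v h1 h2 => ?_⟩
    · split_ifs with hle
      · obtain rfl : v = 0 := by omega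
        rw [hc.1, hp]
      · rfl
    · have := hQ.par_lt v (by omega) (by omega)
      rw [if_pos (by omega), if_pos (by omega)]
      exact hc.2 v (by omega) (by omega)
  · simp only [if_pos h2]
    exact hv v h1 (by omega)

/-- Chosen nodes are recovered from their values along the paths (`chosen_it`), so different choices
give different results. -/
theorem Dyn.ext_inj (hQ : Q.Good) (h : Dyn.Clean Q N F ds) {p q q' : ℕ → ℕ} (hp : p 0 = 1)
    (hq : q ∈ Q.ext ds Q.K 0 p) (hq' : q' ∈ Q.ext ds Q.K 0 p)
    (hv : ∀ v, 1 ≤ v → v ≤ Q.K → ds.val (q v) = ds.val (q' v)) : q = q' := by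
  have hK := hQ.K_le
  have hc := Plan.chosen_of_mem_ext hQ hp hq
  have hc' := Plan.chosen_of_mem_ext hQ hp hq'
  rw [Plan.mem_ext hQ _ _ (by omega)] at hq hq'
  funext v
  by_cases hvK : v ≤ Q.K
  · rw [← h.chosen_it hQ hK hc (ν := fun v => ds.val (q v)) (fun _ _ _ => rfl) hvK,
      ← h.chosen_it hQ hK hc' (ν := fun v => ds.val (q v)) (fun v h1 h2 => hv v h1 h2) hvK]
  · rw [hq.1 v (by omega), hq'.1 v (by omega)]

end

/-! ### Memory layout -/

/-- The arrays of the data structure in memory. -/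
@[simps] def view (mem : List ℕ → ℕ) : DS where
  next := mem [13]
  ch a u b := mem [20, a, u, b]
  typ e := mem [21, e]
  up e := mem [22, e]
  val e := mem [23, e]
  E e i := mem [24, e, i]
  W e := mem [25, e]
  S a u := mem [26, a, u]
  len a u := mem [27, a, u]
  elem a u n := mem [28, a, u, n]
  posn e := mem [29, e]

/-- A plan together with the atoms and the head of the query, as lists of positions. -/
structure Layout extends Plan where
  rel : ℕ → ℕ
  ar : ℕ → ℕ
  arg : ℕ → ℕ → ℕ
  hd : List ℕ
  /-- a bound on the numbers of variables and atoms, and on the arities -/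
  n : ℕ

structure Layout.Good (P : Layout) : Prop extends P.toPlan.Good where
  arg_occ : ∀ i < P.d, ∀ u, 1 ≤ u → (P.occ i u ↔ ∃ j < P.ar i, P.arg i j = u)
  arg_pos : ∀ i < P.d, ∀ j < P.ar i, 1 ≤ P.arg i j ∧ P.arg i j ≤ P.m
  m_le : P.m ≤ P.n
  d_le : P.d ≤ P.n
  ar_le : ∀ i < P.d, P.ar i ≤ P.n
  hd_le : P.hd.length ≤ P.n
  mem_hd : ∀ u, u ∈ P.hd ↔ 1 ≤ u ∧ u ≤ P.K

/-- The memory contains the description of the query. -/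
structure Static (P : Layout) (mem : List ℕ → ℕ) : Prop where
  d_eq : mem [12, 0] = P.d
  m_eq : mem [12, 1] = P.m
  K_eq : mem [12, 2] = P.K
  hd_length : mem [12, 3] = P.hd.length
  rel_eq : ∀ i < P.d, mem [6, i] = P.rel i
  low_eq : ∀ i < P.d, mem [11, i] = P.low i
  par_eq : ∀ u, 1 ≤ u → u ≤ P.m → mem [10, u] = P.par u
  arg_eq : ∀ i < P.d, ∀ j < P.ar i, mem [5, mem [4, i, j]] = P.arg i j
  len_eq : ∀ i < P.d, mem [1, P.rel i] = P.ar i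
  len_zero : ∀ R, (∀ i < P.d, P.rel i ≠ R) → mem [1, R] = 0
  occ_eq : ∀ i < P.d, ∀ u, 1 ≤ u → u ≤ P.m → (0 < mem [7, i, mem [8, u]] ↔ P.occ i u)
  hd_eq : ∀ h < P.hd.length, mem [5, mem [3, h]] = P.hd.getD h 0

/-- Arrays `0` to `12` describe the query and are written by the preprocessing only. Array `13` and
arrays `20` to `29` hold the data structure, `30` to `32` the tuple, valuation and path under
treatment in an update, and `40` and `41` the state of an enumeration. -/
theorem Static.congr {P : Layout} {mem mem' : List ℕ → ℕ} (h : Static P mem)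
    (he : ∀ a : List ℕ, a.headD 0 < 13 → mem' a = mem a) : Static P mem' := by
  constructor
  · rw [he _ (by simp), h.d_eq]
  · rw [he _ (by simp), h.m_eq]
  · rw [he _ (by simp), h.K_eq]
  · rw [he _ (by simp), h.hd_length]
  · intro i hi; rw [he _ (by simp), h.rel_eq i hi]
  · intro i hi; rw [he _ (by simp), h.low_eq i hi]
  · intro u h1 h2; rw [he _ (by simp), h.par_eq u h1 h2]
  · intro i hi j hj; rw [he _ (by simp), he _ (by simp), h.arg_eq i hi j hj]
  · intro i hi; rw [he _ (by simp), h.len_eq i hi]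
  · intro R hR; rw [he _ (by simp), h.len_zero R hR]
  · intro i hi u h1 h2; rw [he _ (by simp), he _ (by simp), h.occ_eq i hi u h1 h2]
  · intro i hi; rw [he _ (by simp), he _ (by simp), h.hd_eq i hi]

/-! ### Frame conditions for programs -/

/-- `s'` differs from `s` at most in the memory and in the registers `lo, …, hi`. -/
def Frame (lo hi : ℕ) (s s' : State) : Prop :=
  s'.inp = s.inp ∧ s'.buf = s.buf ∧ ∀ r, r < lo ∨ hi < r → s'.reg r = s.reg r

theorem Frame.refl (lo hi : ℕ) (s : State) : Frame lo hi s s := ⟨rfl, rfl, fun _ _ => rfl⟩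

theorem Frame.trans {lo hi : ℕ} {s s' s'' : State} (h : Frame lo hi s s')
    (h' : Frame lo hi s' s'') : Frame lo hi s s'' :=
  ⟨h'.1.trans h.1, h'.2.1.trans h.2.1, fun r hr => (h'.2.2 r hr).trans (h.2.2 r hr)⟩

theorem Frame.weaken {lo hi lo' hi' : ℕ} {s s' : State} (h : Frame lo hi s s') (h1 : lo' ≤ lo)
    (h2 : hi ≤ hi') : Frame lo' hi' s s' :=
  ⟨h.1, h.2.1, fun r hr => h.2.2 r (by omega)⟩

@[simp] theorem frame_setReg {lo hi : ℕ} {s s' : State} {r v : ℕ} (h1 : lo ≤ r) (h2 : r ≤ hi) :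
    Frame lo hi s (s'.setReg r v) ↔ Frame lo hi s s' := by
  have : ∀ r', r' < lo ∨ hi < r' → (s'.setReg r v).reg r' = s'.reg r' := fun r' hr => by
    rw [State.setReg_reg, if_neg (by omega)]
  constructor
  · exact fun h => ⟨h.1, h.2.1, fun r' hr => by rw [← this r' hr, h.2.2 r' hr]⟩
  · exact fun h => ⟨h.1, h.2.1, fun r' hr => by rw [this r' hr, h.2.2 r' hr]⟩

@[simp] theorem frame_setMem {lo hi : ℕ} {s s' : State} {a : List ℕ} {v : ℕ} :
    Frame lo hi s (s'.setMem a v) ↔ Frame lo hi s s' := Iff.rfl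

@[simp] theorem frame_self (lo hi : ℕ) (s : State) : Frame lo hi s s := Frame.refl lo hi s

theorem Exec.skip {Γ : Ctx} {s : State} {Q : State → Prop} (h : Q s) :
    Exec Γ (DynCQ.blk []) s 1 Q :=
  fun hi ho => Exec.blk (cs := []) Γ.prot le_rfl rfl (fun _ => ⟨trivial, fun _ => h⟩) hi ho

theorem Exec.seq' {Γ : Ctx} {p q : Program} {s : State} {T₁ T₂ : ℕ} {R Q : State → Prop}
    (h : Exec Γ p s T₁ R) (h' : ∀ s', Ok Γ s' → R s' → Exec Γ q s' T₂ Q) :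
    Exec Γ (.seq p q) s (T₁ + T₂ + 1) Q := Exec.seq (h.imp le_rfl h')

/-! ### Recomputing a weight -/

/-- Register 12 becomes the weight of the node in register 11 of position in register 10. -/
def weightProg : Program :=
  .seq (blk [.set 12 (.lit 1), .set 13 (.lit 0)]) <|
  .seq (.while (.lt (.reg 13) (.reg 1)) <|
    .seq (blk [.ld 14 11 [.reg 13]]) <|
    .seq (.ite (.eq (.reg 14) (.reg 10))
      (blk [.ld 15 24 [.reg 11, .reg 13], .op .mul 12 (.reg 12) (.reg 15)])
      (blk [])) <|
    blk [.op .add 13 (.reg 13) (.lit 1)]) <|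
  .seq (blk [.set 13 (.lit 0)]) <|
  .while (.lt (.reg 13) (.reg 2)) <|
    .seq (blk [.op .add 13 (.reg 13) (.lit 1), .ld 14 10 [.reg 13]]) <|
    .ite (.eq (.reg 14) (.reg 10))
      (.seq (blk [.ld 15 26 [.reg 11, .reg 13]]) <|
       .seq (.ite (.lt (.reg 3) (.reg 13))
          (blk [.op .sub 16 (.lit 1) (.reg 15), .op .sub 15 (.lit 1) (.reg 16)]) (blk [])) <|
       blk [.op .mul 12 (.reg 12) (.reg 15)])
      (blk [])

/-- The bound is required for all partial products, not just for the weight: if a later factor is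
`0`, an intermediate product exceeds the final one. -/
theorem exec_weightProg {Γ : Ctx} {P : Layout} {s : State} (hp : Γ.prot ≤ 0) (hS : Static P s.mem)
    (h1 : s.reg 1 = P.d) (h2 : s.reg 2 = P.m) (h3 : s.reg 3 = P.K) (hd : P.d ≤ Γ.B)
    (hm : P.m ≤ Γ.B)
    (hB : ∀ i ≤ P.d, ∀ j ≤ P.m, P.pE (view s.mem) (s.reg 10) (s.reg 11) i *
      P.pV (view s.mem) (s.reg 10) (s.reg 11) j ≤ Γ.B) :
    Exec Γ weightProg s (300 * (P.d + P.m + 1)) fun s' => Frame 12 16 s s' ∧ s'.mem = s.mem ∧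
      s'.reg 12 = P.wt (view s.mem) (s.reg 10) (s.reg 11) := by
  let u := s.reg 10
  let e := s.reg 11
  refine Exec.mono (Exec.blk_seq 0 hp (by decide) (T := P.d * 200 + 1 + (21 + (P.m * 200 + 1) + 2) + 1)
    fun _ => ⟨by simp, fun _ => ?_⟩) (by simp; omega)
  refine Exec.seq' (Exec.while_count (fun j s' => Frame 12 16 s s' ∧ s'.mem = s.mem ∧
    s'.reg 13 = j ∧ s'.reg 12 = P.pE (view s.mem) u e j) P.d 199 ?_ ?_ ?_) ?_
  · rintro j s' - ⟨hf, -, hj, -⟩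
    simp [Test.holds, hj, hf.2.2 1 (by omega), h1]
  · rintro j s' ho hj ⟨hf, hmem, hjr, hw⟩
    have r10 := hf.2.2 10 (by omega)
    have r11 := hf.2.2 11 (by omega)
    have hmul : P.pE (view s.mem) u e (j + 1) =
        P.pE (view s.mem) u e j * if P.low j = u then s.mem [24, e, j] else 1 := by
      unfold Plan.pE
      rw [Finset.prod_range_succ]
      rfl
    have hle : P.pE (view s.mem) u e (j + 1) ≤ Γ.B := by
      have := hB (j + 1) hj 0 (Nat.zero_le _)
      simpa [Plan.pV] using this
    refine Exec.mono (Exec.blk_seq 0 hp (by decide) (T := 150)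
      fun _ => ⟨by simp, fun _ => ?_⟩) (by simp)
    simp only [runs, Cmd.run, Operand.val, List.map_cons, List.map_nil, hmem, hjr,
      hS.low_eq j hj]
    refine Exec.mono (Exec.seq' (T₁ := 100) (T₂ := 21) (R := fun s' => Frame 12 16 s s' ∧
      s'.mem = s.mem ∧ s'.reg 13 = j ∧ s'.reg 12 = P.pE (view s.mem) u e (j + 1))
      (Exec.mono (Exec.ite (T := 41) (fun hc => ?_) (fun hc => ?_)) (by simp)) ?_) (by simp)
    · simp [Test.holds, r10] at hc
      rw [if_pos hc] at hmul
      refine Exec.blk 0 hp (by decide) fun _ => ?_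
      simp [r11, hmem, hjr, hw, hf]
      rw [← hmul]
      exact ⟨hle, fun _ => rfl⟩
    · simp [Test.holds, r10] at hc
      rw [if_neg hc, mul_one] at hmul
      refine (Exec.skip ?_).mono (by simp)
      simp [hmem, hjr, hw, hf, hmul]
    · rintro s'' ho ⟨hf, hmem, hjr, hw⟩
      refine Exec.blk 0 hp (by decide) fun _ => ?_
      simp [hmem, hjr, hw, hf]
      omega
  · simp [Plan.pE]
  · rintro s₁ - ⟨hf₁, hm₁, -, hw₁⟩
    refine Exec.mono (Exec.blk_seq 0 hp (by decide) (T := P.m * 200 + 1)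
      fun _ => ⟨by simp, fun _ => ?_⟩) (by simp)
    refine (Exec.while_count (fun j s' => Frame 12 16 s s' ∧ s'.mem = s.mem ∧
      s'.reg 13 = j ∧ s'.reg 12 = P.pE (view s.mem) u e P.d * P.pV (view s.mem) u e j)
      P.m 199 ?_ ?_ ?_).imp le_rfl ?_
    · rintro j s' - ⟨hf, -, hj, -⟩
      simp [Test.holds, hj, hf.2.2 2 (by omega), h2]
    · rintro j s' ho hj ⟨hf, hmem, hjr, hw⟩
      have r10 := hf.2.2 10 (by omega)
      have r11 := hf.2.2 11 (by omega)
      have r3 := (hf.2.2 3 (by omega)).trans h3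
      have hmul : P.pV (view s.mem) u e (j + 1) = P.pV (view s.mem) u e j *
          if P.par (j + 1) = u then P.fac (j + 1) (s.mem [26, e, j + 1]) else 1 := by
        unfold Plan.pV
        rw [Finset.prod_range_succ]
        rfl
      have hle := hB P.d le_rfl (j + 1) hj
      refine Exec.mono (Exec.blk_seq 0 hp (by decide) (T := 150)
        fun _ => ⟨by simp [hjr]; omega, fun _ => ?_⟩) (by simp)
      simp only [runs, Cmd.run, Operand.val, List.map_cons, List.map_nil, hmem, hjr, BinOp.eval,
        State.setReg_reg, if_true, State.setReg_mem, hS.par_eq (j + 1) (by omega) hj]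
      refine Exec.mono (Exec.ite (T := 145) (fun hc => ?_) (fun hc => ?_)) (by simp)
      · simp [Test.holds, r10] at hc
        rw [if_pos hc] at hmul
        refine Exec.mono (Exec.blk_seq 0 hp (by decide) (T := 100)
          fun _ => ⟨by simp, fun _ => ?_⟩) (by simp)
        simp only [runs, Cmd.run, Operand.val, List.map_cons, List.map_nil, hmem,
          State.setReg_reg, if_true, State.setReg_mem]
        refine Exec.mono (Exec.seq' (T₁ := 60) (T₂ := 21) (R := fun s' => Frame 12 16 s s' ∧
          s'.mem = s.mem ∧ s'.reg 13 = j + 1 ∧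
          s'.reg 12 = P.pE (view s.mem) u e P.d * P.pV (view s.mem) u e j ∧
          s'.reg 15 = P.fac (j + 1) (s.mem [26, e, j + 1]))
          (Exec.mono (Exec.ite (T := 41) (fun hc => ?_) (fun hc => ?_)) (by simp)) ?_) (by simp)
        · simp [Test.holds, r3] at hc
          refine Exec.blk 0 hp (by decide) fun _ => ?_
          simp [r11, hmem, hw, hf, Plan.fac, hc, e]
        · simp [Test.holds, r3] at hc
          refine (Exec.skip ?_).mono (by simp)
          simp [r11, hmem, hw, hf, Plan.fac, hc, e]
        · rintro s'' ho ⟨hf, hmem, hjr, hw, h15⟩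
          refine Exec.blk 0 hp (by decide) fun _ => ?_
          simp only [u, e] at *
          rw [hmul, ← mul_assoc] at hle
          simp [hmem, hjr, hw, hf, h15, hmul, mul_assoc] at hle ⊢
          exact hle
      · simp [Test.holds, r10] at hc
        rw [if_neg hc, mul_one] at hmul
        refine (Exec.skip ?_).mono (by simp)
        simp [hmem, hw, hf, hmul]
    · simp [hf₁, hm₁, hw₁, Plan.pV]
    · rintro s' - ⟨hf, hmem, -, hw⟩
      exact ⟨hf, hmem, hw⟩

theorem view_congr {mem mem' : List ℕ → ℕ}
    (h : ∀ a : List ℕ, 13 ≤ a.headD 0 → a.headD 0 < 30 → mem' a = mem a) :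
    view mem' = view mem := by
  unfold view
  congr 1 <;> (try funext) <;> exact h _ (by simp) (by simp)

theorem State.setMem_mem_ne (s : State) {a : List ℕ} {t : ℕ} (l : List ℕ) (v : ℕ)
    (h : a.headD 0 ≠ t) : (s.setMem (t :: l) v).mem a = s.mem a := by
  rw [State.setMem_mem, if_neg]
  rintro rfl
  exact h rfl

/-- What is known about the machine's word length. -/
structure Layout.Fits (P : Layout) (N B : ℕ) : Prop where
  pow_le : P.M N ^ (P.m + 2) ≤ B
  n_le : 2 * P.n + 10 ≤ B

theorem Layout.Fits.M_pow_le {P : Layout} {N B : ℕ} (h : P.Fits N B) {k : ℕ} (hk : k ≤ P.m + 2) :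
    P.M N ^ k ≤ B := (Nat.pow_le_pow_right (P.M_pos N) hk).trans h.pow_le

theorem Layout.Fits.M_le {P : Layout} {N B : ℕ} (h : P.Fits N B) : P.M N ≤ B := by
  simpa using h.M_pow_le (k := 1) (by omega)

/-- The nodes for the variables of the `i`-th atom up to `j`. -/
def Layout.path (P : Layout) (ds : DS) (ν : ℕ → ℕ) (i j : ℕ) (e : ℕ) : Prop :=
  ∃ v ≤ j, P.occ i v ∧ e = P.it ds ν v

theorem Layout.path_succ_of_not_occ {P : Layout} {ds : DS} {ν : ℕ → ℕ} {i j e : ℕ}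
    (h : ¬ P.occ i (j + 1)) : P.path ds ν i (j + 1) e ↔ P.path ds ν i j e := by
  constructor
  · rintro ⟨v, hv, ho, he⟩
    refine ⟨v, ?_, ho, he⟩
    rcases Nat.lt_or_ge v (j + 1) with h1 | h1
    · omega
    · obtain rfl : v = j + 1 := by omega
      exact absurd ho h
  · rintro ⟨v, hv, ho, he⟩
    exact ⟨v, by omega, ho, he⟩

/-! ### Providing the nodes of a path -/

/-- For every position of the atom in register 7, the node of the valuation stored in array 31 is
stored in array 32. -/
def pathProg : Program :=
  .seq (blk [.st 32 [.lit 0] (.lit 1), .set 10 (.lit 0)]) <|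
  .while (.lt (.reg 10) (.reg 2)) <|
    .seq (blk [.op .add 10 (.reg 10) (.lit 1), .ld 13 8 [.reg 10], .ld 13 7 [.reg 7, .reg 13]]) <|
    .ite (.lt (.lit 0) (.reg 13))
      (.seq (blk [.ld 11 10 [.reg 10], .ld 11 32 [.reg 11], .ld 12 31 [.reg 10],
          .ld 13 20 [.reg 11, .reg 10, .reg 12]]) <|
       .seq (.ite (.eq (.reg 13) (.lit 0))
          (blk [.ld 13 13 [], .st 20 [.reg 11, .reg 10, .reg 12] (.reg 13),
            .st 21 [.reg 13] (.reg 10), .st 22 [.reg 13] (.reg 11), .st 23 [.reg 13] (.reg 12),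
            .op .add 14 (.reg 13) (.lit 1), .st 13 [] (.reg 14)])
          (blk [])) <|
       blk [.st 32 [.reg 10] (.reg 13)])
      (blk [])

/-- The state after the positions up to `j` of the `i`-th atom. -/
structure PathInv (P : Layout) (N : ℕ) (F : ℕ → (ℕ → ℕ) → Prop) (i : ℕ) (ν : ℕ → ℕ) (s : State)
    (j : ℕ) (s' : State) : Prop where
  frame : Frame 10 14 s s'
  mem_eq : ∀ a : List ℕ, a.headD 0 < 13 ∨ a.headD 0 = 30 ∨ a.headD 0 = 31 → s'.mem a = s.mem a
  dyn : Dyn P.toPlan N F (P.path (view s'.mem) ν i j) (view s'.mem)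
  it_ne : ∀ v ≤ j, P.occ i v → P.it (view s'.mem) ν v ≠ 0

/-- The positions of the atom are visited in increasing order, so the node of the predecessor is
already in array 32. All nodes of the path visited so far count as exceptions, whether new or old,
since their weights will be recomputed anyway. -/
theorem exec_pathProg {Γ : Ctx} {P : Layout} {N : ℕ} {F : ℕ → (ℕ → ℕ) → Prop} {s : State} {i : ℕ}
    {ν : ℕ → ℕ} (hP : P.Good) (hB : P.Fits N Γ.B) (hp : Γ.prot ≤ 0) (hS : Static P s.mem)
    (hD : Dyn.Clean P.toPlan N F (view s.mem)) (h2 : s.reg 2 = P.m) (h7 : s.reg 7 = i)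
    (hi : i < P.d) (hν : ∀ v, 1 ≤ v → P.occ i v → s.mem [31, v] = ν v ∧ ν v ≤ N) :
    Exec Γ pathProg s (500 * (P.m + 1)) fun s' => PathInv P N F i ν s P.m s' ∧
      ∀ v ≤ P.m, P.occ i v → s'.mem [32, v] = P.it (view s'.mem) ν v := by
  have hQ := hP.toGood
  have hmn := hP.m_le
  have hnB := hB.n_le
  have hMB := hB.M_le
  refine Exec.mono (Exec.blk_seq 0 hp (by decide) (T := P.m * 401 + 1)
    fun _ => ⟨by simp, fun _ => ?_⟩) (by simp; omega)
  refine (Exec.while_count (fun j s' => PathInv P N F i ν s j s' ∧ s'.reg 10 = j ∧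
    ∀ v ≤ j, P.occ i v → s'.mem [32, v] = P.it (view s'.mem) ν v) P.m 400 ?_ ?_ ?_).imp le_rfl ?_
  · rintro j s' - ⟨hI, hj, -⟩
    simp [Test.holds, hj, hI.frame.2.2 2 (by omega), h2]
  · rintro j s' ho hj ⟨hI, hjr, hit⟩
    have r7 := (hI.frame.2.2 7 (by omega)).trans h7
    have hS' : Static P s'.mem := hS.congr fun a ha => hI.mem_eq a (Or.inl ha)
    have hocc := hS'.occ_eq i hi (j + 1) (by omega) hj
    refine Exec.mono (Exec.blk_seq 0 hp (by decide) (T := 330)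
      fun _ => ⟨by simp [hjr]; omega, fun _ => ?_⟩) (by simp)
    simp only [runs, Cmd.run, Operand.val, List.map_cons, List.map_nil, hjr, BinOp.eval,
      State.setReg_reg, if_true, State.setReg_mem]
    refine Exec.mono (Exec.ite (T := 329) (fun hc => ?_) (fun hc => ?_)) (by simp)
    · simp [Test.holds, r7] at hc
      have hoc := hocc.1 hc
      have hpar := hQ.par_lt (j + 1) (by omega) (by omega)
      have hop := hQ.occ_par i hi _ hoc
      have hitp := hit _ (by omega) hop
      have hν1 := hν (j + 1) (by omega) hoc
      have e1 : P.it (view s'.mem) ν (j + 1) =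
        s'.mem [20, P.it (view s'.mem) ν (P.par (j + 1)), j + 1, ν (j + 1)] := item_of_lt _ _ hpar
      refine Exec.mono (Exec.blk_seq 0 hp (by decide) (T := 240)
        fun _ => ⟨by simp, fun _ => ?_⟩) (by simp)
      simp [hS'.par_eq (j + 1) (by omega) (by omega), hitp,
        hI.mem_eq [31, j + 1] (by simp), hν1.1]
      rw [← e1]
      refine Exec.mono (Exec.seq' (T₁ := 200) (T₂ := 21) (R := fun s' =>
        PathInv P N F i ν s (j + 1) s' ∧ s'.reg 10 = j + 1 ∧
        s'.reg 13 = P.it (view s'.mem) ν (j + 1) ∧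
        ∀ v ≤ j, P.occ i v → s'.mem [32, v] = P.it (view s'.mem) ν v)
        (Exec.mono (Exec.ite (T := 141) (fun hc => ?_) (fun hc => ?_)) (by simp)) ?_) (by simp)
      · simp [Test.holds] at hc
        have hnext := hI.dyn.toTrie.next_le hQ
        refine Exec.blk 0 hp (by decide) fun _ => ?_
        simp only [view_next] at hnext
        refine ⟨by simp; omega, fun _ => ?_⟩
        generalize hs₂ : runs _ _ = s₂
        simp at hs₂
        have hm : ∀ a : List ℕ, (a.headD 0 < 13 ∨ 30 ≤ a.headD 0) → s₂.mem a = s'.mem a := by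
          intro a ha
          subst hs₂
          rw [State.setMem_mem_ne, State.setReg_mem, State.setMem_mem_ne, State.setMem_mem_ne,
            State.setMem_mem_ne, State.setMem_mem_ne] <;> first | rfl | omega
        have hview : view s₂.mem = (view s'.mem).addNode (P.it (view s'.mem) ν (P.par (j + 1)))
            (j + 1) (ν (j + 1)) := by
          subst hs₂
          simp [view, DS.addNode]
          refine ⟨?_, ?_, ?_, ?_⟩ <;> congr!
        obtain ⟨hD', hold, hnew⟩ := hI.dyn.addNode
          (ex' := fun e => P.path (view s'.mem) ν i j e ∨ e = (view s'.mem).next) hQ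
          (by omega) (by omega) hν1.2 (hI.it_ne _ (by omega) hop) hc (fun e he => Or.inl he)
          (Or.inr rfl) hview
        -- The path is now read off the enlarged trie; its older nodes have kept their numbers.
        have hD'' : Dyn P.toPlan N F (P.path (view s₂.mem) ν i (j + 1)) (view s₂.mem) := by
          refine hD'.ex_imp fun e he => ?_
          rcases he with ⟨v, hv, hov, he⟩ | he
          · exact ⟨v, by omega, hov, by rw [he, hold _ _ (by omega) (hI.it_ne v hv hov)]⟩
          · exact ⟨j + 1, le_rfl, hoc, by rw [he, hnew]⟩
        refine ⟨⟨?_, fun a ha => ?_, hD'', fun v hv hov => ?_⟩, ?_, ?_, fun v hv hov => ?_⟩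
        · subst hs₂; simp [hI.frame]
        · rw [hm a (by omega), hI.mem_eq a ha]
        · rcases Nat.lt_or_ge v (j + 1) with h1 | h1
          · rw [hold _ _ (by omega) (hI.it_ne v (by omega) hov)]
            exact hI.it_ne v (by omega) hov
          · obtain rfl : v = j + 1 := by omega
            rw [hnew]
            have := hI.dyn.two_le
            omega
        · subst hs₂; simp
        · rw [hnew]; subst hs₂; simp
        · rw [hm _ (by simp), hold _ _ (by omega) (hI.it_ne v (by omega) hov), hit v hv hov]
      · simp [Test.holds] at hc
        refine (Exec.skip ?_).mono (by simp)
        refine ⟨⟨by simp [hI.frame], hI.mem_eq, ?_, fun v hv hov => ?_⟩, by simp, by simp, ?_⟩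
        · refine hI.dyn.ex_imp fun e he => ?_
          obtain ⟨v, hv, hov, he⟩ := he
          exact ⟨v, by omega, hov, he⟩
        · rcases Nat.lt_or_ge v (j + 1) with h1 | h1
          · exact hI.it_ne v (by omega) hov
          · obtain rfl : v = j + 1 := by omega
            exact hc
        · exact hit
      · rintro s₃ - ⟨hI₃, h10, h13, hit₃⟩
        refine Exec.blk 0 hp (by decide) fun _ => ⟨by simp, fun _ => ?_⟩
        generalize hs₂ : runs _ _ = s₂
        simp [h10, h13] at hs₂
        have hm : ∀ a : List ℕ, a.headD 0 ≠ 32 → s₂.mem a = s₃.mem a := by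
          intro a ha
          subst hs₂
          rw [State.setMem_mem_ne] <;> omega
        have hview : view s₂.mem = view s₃.mem := view_congr fun a _ _ => hm a (by omega)
        refine ⟨⟨?_, fun a ha => ?_, ?_, ?_⟩, ?_, fun v hv hov => ?_⟩
        · subst hs₂; simp [hI₃.frame]
        · rw [hm a (by omega), hI₃.mem_eq a ha]
        · rw [hview]; exact hI₃.dyn
        · rw [hview]; exact hI₃.it_ne
        · subst hs₂; simp [h10]
        · rw [hview]
          subst hs₂
          simp only [State.setMem_mem, List.cons.injEq, true_and, and_true]
          split_ifs with h
          · rw [h]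
          · exact hit₃ v (by omega) hov
    · simp [Test.holds, r7] at hc
      have hoc : ¬ P.occ i (j + 1) := fun h => by have := hocc.2 h; omega
      refine (Exec.skip ?_).mono (by simp)
      refine ⟨⟨by simp [hI.frame], hI.mem_eq, ?_, fun v hv hov => ?_⟩, by simp, fun v hv hov => ?_⟩
      · refine hI.dyn.ex_imp fun e he => ?_
        exact (P.path_succ_of_not_occ hoc).2 he
      · have : v ≠ j + 1 := fun h => hoc (h ▸ hov)
        exact hI.it_ne v (by omega) hov
      · have : v ≠ j + 1 := fun h => hoc (h ▸ hov)
        exact hit v (by omega) hov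
  · have hview : view (runs s [.st 32 [.lit 0] (.lit 1), .set 10 (.lit 0)]).mem = view s.mem :=
      view_congr fun a _ _ => by
        simp only [runs, Cmd.run, State.setReg_mem, Operand.val, List.map_cons, List.map_nil]
        rw [State.setMem_mem_ne] <;> omega
    refine ⟨⟨by simp, fun a ha => ?_, ?_, fun v hv hov => ?_⟩, by simp, fun v hv hov => ?_⟩
    · simp only [runs, Cmd.run, State.setReg_mem, Operand.val, List.map_cons, List.map_nil]
      rw [State.setMem_mem_ne] <;> omega
    · rw [hview]
      exact hD.ex_imp fun e he => he.elim
    · obtain rfl : v = 0 := by omega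
      simp [Plan.it, item_zero]
    · obtain rfl : v = 0 := by omega
      simp [Plan.it, item_zero]
  · rintro s' - ⟨hI, -, hit⟩
    exact ⟨hI, hit⟩

/-! ### Repairing the weights along a path -/

/-- Node 11 of position 10 has weight 12: this is recorded, and the list of children of its parent
is adapted. -/
def relinkProg : Program :=
  .seq (blk [.ld 17 10 [.reg 10], .ld 17 32 [.reg 17], .ld 18 25 [.reg 11],
    .st 25 [.reg 11] (.reg 12), .ld 19 26 [.reg 17, .reg 10], .op .sub 19 (.reg 19) (.reg 18),
    .op .add 19 (.reg 19) (.reg 12), .st 26 [.reg 17, .reg 10] (.reg 19),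
    .ld 20 27 [.reg 17, .reg 10]]) <|
  .ite (.lt (.lit 0) (.reg 18))
    (.ite (.lt (.lit 0) (.reg 12)) (blk [])
      (blk [.op .sub 20 (.reg 20) (.lit 1), .ld 21 29 [.reg 11], .ld 22 28 [.reg 17, .reg 10, .reg 20],
        .st 28 [.reg 17, .reg 10, .reg 21] (.reg 22), .st 29 [.reg 22] (.reg 21),
        .st 27 [.reg 17, .reg 10] (.reg 20)]))
    (.ite (.lt (.lit 0) (.reg 12))
      (blk [.st 28 [.reg 17, .reg 10, .reg 20] (.reg 11), .st 29 [.reg 11] (.reg 20),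
        .op .add 20 (.reg 20) (.lit 1), .st 27 [.reg 17, .reg 10] (.reg 20)])
      (blk []))

/-- The list of children changes only if exactly one of the old and the new weight is `0`: the node
then enters the list at its end, or leaves it by an exchange with the last entry. -/
theorem exec_relinkProg {Γ : Ctx} {P : Layout} {N : ℕ} {F : ℕ → (ℕ → ℕ) → Prop} {ex ex' : ℕ → Prop}
    {s : State} {id pid u : ℕ} (hP : P.Good) (hB : P.Fits N Γ.B) (hp : Γ.prot ≤ 0)
    (hD : Dyn P.toPlan N F ex (view s.mem)) (h10 : s.reg 10 = u) (h11 : s.reg 11 = id)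
    (h12 : s.reg 12 = P.wt (view s.mem) u id) (hpar : s.mem [32, s.mem [10, u]] = pid)
    (h2 : 2 ≤ id) (hlt : id < (view s.mem).next) (hup : (view s.mem).up id = pid)
    (htyp : (view s.mem).typ id = u) (hex : ∀ e, ex e → e = id ∨ ex' e) (hpid : ex' pid) :
    Exec Γ relinkProg s 400 fun s' => Frame 10 22 s s' ∧ s'.reg 10 = u ∧
      (∀ a : List ℕ, a.headD 0 < 25 ∨ 29 < a.headD 0 → s'.mem a = s.mem a) ∧
      Dyn P.toPlan N F ex' (view s'.mem) := by
  have hQ := hP.toGood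
  have hnode := hD.toTrie.node id h2 hlt
  rw [htyp] at hnode
  have hed := hQ.ed_le hnode.2.1
  have hS := hD.S_le hQ pid u
  have hw := hD.wt_le hQ u id
  have hlen := hD.roster.len_lt hD.two_le pid u
  have hnext := hD.toTrie.next_le hQ
  have hMB := hB.M_le
  -- The corrected sum is at most `2 * M ^ (1 + ed u)`, hence at most `M ^ (2 + ed u)`. This is
  -- where the exponent `m + 2` of `Layout.Fits` is needed.
  have hfit : (view s.mem).S pid u + P.wt (view s.mem) u id ≤ Γ.B := by
    have h1 : P.M N ^ P.ed u ≤ P.M N ^ (1 + P.ed u) :=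
      Nat.pow_le_pow_right (P.M_pos N) (by omega)
    have h3 : 2 * P.M N ^ (1 + P.ed u) ≤ P.M N ^ (2 + P.ed u) := by
      rw [show 2 + P.ed u = 1 + P.ed u + 1 by omega, pow_succ, mul_comm]
      exact Nat.mul_le_mul_left _ (by unfold Plan.M; omega)
    have h4 := hB.M_pow_le (k := 2 + P.ed u) (by omega)
    omega
  set w := P.wt (view s.mem) u id with hw_def
  simp only [view_S, view_len, view_next] at hfit hlen hnext
  refine Exec.mono (Exec.blk_seq 0 hp (by decide) (T := 200)
    fun _ => ⟨by simp [h10, h11, h12, hpar]; omega, fun _ => ?_⟩) (by simp)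
  generalize hs₁ : runs _ _ = s₁
  simp [h10, h11, h12, hpar] at hs₁
  have hfr : Frame 10 22 s s₁ := by subst hs₁; simp
  have r10 : s₁.reg 10 = u := by subst hs₁; simp [h10]
  have r11 : s₁.reg 11 = id := by subst hs₁; simp [h11]
  have r12 : s₁.reg 12 = w := by subst hs₁; simp [h12]
  have r17 : s₁.reg 17 = pid := by subst hs₁; simp
  have r18 : s₁.reg 18 = s.mem [25, id] := by subst hs₁; simp
  have r20 : s₁.reg 20 = s.mem [27, pid, u] := by subst hs₁; simp
  have hm₁ : ∀ a, s₁.mem a = if a = [26, pid, u] then s.mem [26, pid, u] - s.mem [25, id] + w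
      else if a = [25, id] then w else s.mem a := by
    intro a; subst hs₁; simp
  -- Weight and sum are already updated in `s₁`; the four cases differ in the list only.
  have fin : ∀ (s' : State) (len' : ℕ → ℕ → ℕ) (elem' : ℕ → ℕ → ℕ → ℕ) (posn' : ℕ → ℕ),
      (∀ a : List ℕ, a.headD 0 < 27 ∨ 29 < a.headD 0 → s'.mem a = s₁.mem a) →
      (∀ a v, s'.mem [27, a, v] = len' a v) → (∀ a v n, s'.mem [28, a, v, n] = elem' a v n) →
      (∀ e, s'.mem [29, e] = posn' e) →
      Roster (view s.mem).next (view s.mem).up (view s.mem).typ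
        (fun e => if e = id then w else (view s.mem).W e) len' elem' posn' →
      (∀ a : List ℕ, a.headD 0 < 25 ∨ 29 < a.headD 0 → s'.mem a = s.mem a) ∧
      Dyn P.toPlan N F ex' (view s'.mem) := by
    intro s' len' elem' posn' hm hl he hps hR
    refine ⟨fun a ha => ?_, hD.repair hQ h2 hlt hup htyp hex hpid hR ?_⟩
    · rw [hm a (by omega), hm₁, if_neg, if_neg]
      · rintro rfl; simp at ha
      · rintro rfl; simp at ha
    · have hm' : ∀ t l, t < 27 ∨ 29 < t → s'.mem (t :: l) = s₁.mem (t :: l) :=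
        fun t l ht => hm _ ht
      unfold view
      simp [hm', hm₁, hl, he, hps]
      refine ⟨?_, ?_⟩ <;> congr!
  have hsame : ∀ s' : State, s'.mem = s₁.mem → (s.mem [25, id] = 0 ↔ w = 0) →
      (∀ a : List ℕ, a.headD 0 < 25 ∨ 29 < a.headD 0 → s'.mem a = s.mem a) ∧
      Dyn P.toPlan N F ex' (view s'.mem) := by
    intro s' hm hiff
    refine fin s' (view s.mem).len (view s.mem).elem (view s.mem).posn (fun a _ => by rw [hm])
      (fun a v => ?_) (fun a v n => ?_) (fun e => ?_) (hD.roster.same fun e => ?_)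
    · rw [hm, hm₁]; simp
    · rw [hm, hm₁]; simp
    · rw [hm, hm₁]; simp
    · split_ifs with h
      · rw [h, view_W]; exact hiff.symm
      · rfl
  refine Exec.mono (Exec.ite (T := 180) (fun hc => ?_) (fun hc => ?_)) (by simp)
  · simp [Test.holds, r18] at hc
    refine Exec.mono (Exec.ite (T := 125) (fun hc' => ?_) (fun hc' => ?_)) (by simp)
    · simp [Test.holds, r12] at hc'
      refine (Exec.skip ?_).mono (by simp)
      exact ⟨hfr, r10, hsame _ rfl (by omega)⟩
    · simp [Test.holds, r12] at hc'
      refine (Exec.blk 0 hp (by decide) fun _ => ?_).mono (by simp)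
      refine ⟨by simp, fun _ => ?_⟩
      generalize hs₂ : runs _ _ = s₂
      simp [r10, r11, r17, r20, hm₁] at hs₂
      refine ⟨by subst hs₂; simp [hfr], by subst hs₂; simp [r10], fin s₂ _ _ _ (fun a ha => ?_)
        (fun a v => ?_) (fun a v n => ?_) (fun e => ?_)
        (hD.roster.erase h2 hlt (by simp; omega) (by simp [hc']) (fun e he => by simp [he]) rfl
          (fun _ _ => rfl) (fun _ _ _ => rfl) (fun _ => rfl))⟩
      · subst hs₂
        rw [State.setMem_mem_ne, State.setMem_mem_ne, State.setMem_mem_ne] <;> first | rfl | omega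
      · subst hs₂
        simp only [view_up, view_typ] at hup htyp
        simp [hm₁, hup, htyp]
      · subst hs₂
        simp only [view_up, view_typ] at hup htyp
        simp [hm₁, hup, htyp]
      · subst hs₂
        simp only [view_up, view_typ] at hup htyp
        simp [hm₁, hup, htyp]
  · simp [Test.holds, r18] at hc
    refine Exec.mono (Exec.ite (T := 125) (fun hc' => ?_) (fun hc' => ?_)) (by simp)
    · simp [Test.holds, r12] at hc'
      refine (Exec.blk 0 hp (by decide) fun _ => ?_).mono (by simp)
      refine ⟨by simp [r20]; omega, fun _ => ?_⟩
      generalize hs₂ : runs _ _ = s₂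
      simp [r10, r11, r17, r20] at hs₂
      refine ⟨by subst hs₂; simp [hfr], by subst hs₂; simp [r10], fin s₂ _ _ _ (fun a ha => ?_)
        (fun a v => ?_) (fun a v n => ?_) (fun e => ?_)
        (hD.roster.insert h2 hlt (by simp; omega) (by simp; omega) (fun e he => by simp [he])
          (fun _ _ => rfl) (fun _ _ _ => rfl) (fun _ => rfl))⟩
      · subst hs₂
        rw [State.setMem_mem_ne, State.setReg_mem, State.setMem_mem_ne, State.setMem_mem_ne] <;>
          first | rfl | omega
      · subst hs₂
        simp only [view_up, view_typ] at hup htyp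
        simp [hm₁, hup, htyp]
      · subst hs₂
        simp only [view_up, view_typ] at hup htyp
        simp [hm₁, hup, htyp]
      · subst hs₂
        simp only [view_up, view_typ] at hup htyp
        simp [hm₁, hup, htyp]
    · simp [Test.holds, r12] at hc'
      refine (Exec.skip ?_).mono (by simp)
      exact ⟨hfr, r10, hsame _ rfl (by omega)⟩

theorem Layout.Fits.weight {P : Layout} {N B : ℕ} {F : ℕ → (ℕ → ℕ) → Prop} {ex : ℕ → Prop} {ds : DS}
    (hP : P.Good) (hB : P.Fits N B) (hD : Dyn P.toPlan N F ex ds) {u : ℕ} (hu : u ≤ P.m) (e : ℕ) :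
    ∀ i ≤ P.d, ∀ j ≤ P.m, P.pE ds u e i * P.pV ds u e j ≤ B := fun i _ j hj =>
  (hD.partial_wt_le hP.toGood u e i j hj).trans
    (hB.M_pow_le (by have := hP.toGood.ed_le hu; omega))

/-- The weights of all nodes in array 32 are recomputed, from the bottom to the top. -/
def repairProg : Program :=
  .seq (blk [.set 10 (.reg 2)]) <|
  .while (.lt (.lit 0) (.reg 10)) <|
    .seq (blk [.ld 13 8 [.reg 10], .ld 13 7 [.reg 7, .reg 13]]) <|
    .seq (.ite (.lt (.lit 0) (.reg 13))
      (.seq (blk [.ld 11 32 [.reg 10]]) (.seq weightProg relinkProg)) (blk [])) <|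
    blk [.op .sub 10 (.reg 10) (.lit 1)]

/-- Repairing a node makes its predecessor outdated, but the predecessor lies on the same path at a
smaller position and comes later. So the exceptions shrink to the path up to position `m - j`, and
finally to the root, which has no predecessor and is treated separately. -/
theorem exec_repairProg {Γ : Ctx} {P : Layout} {N : ℕ} {F : ℕ → (ℕ → ℕ) → Prop} {s : State} {i : ℕ}
    {ν : ℕ → ℕ} (hP : P.Good) (hB : P.Fits N Γ.B) (hp : Γ.prot ≤ 0) (hS : Static P s.mem)
    (h1 : s.reg 1 = P.d) (h2 : s.reg 2 = P.m) (h3 : s.reg 3 = P.K) (h7 : s.reg 7 = i) (hi : i < P.d)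
    (hD : Dyn P.toPlan N F (P.path (view s.mem) ν i P.m) (view s.mem))
    (hne : ∀ v ≤ P.m, P.occ i v → P.it (view s.mem) ν v ≠ 0)
    (hit : ∀ v ≤ P.m, P.occ i v → s.mem [32, v] = P.it (view s.mem) ν v) :
    Exec Γ repairProg s (P.m * (300 * (P.d + P.m + 1) + 600) + 30) fun s' => Frame 10 22 s s' ∧
      (∀ a : List ℕ, a.headD 0 < 25 ∨ 29 < a.headD 0 → s'.mem a = s.mem a) ∧
      Dyn P.toPlan N F (fun e => e = 1) (view s'.mem) := by
  have hQ := hP.toGood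
  have hmn := hP.m_le
  have hdn := hP.d_le
  have hnB := hB.n_le
  refine Exec.mono (Exec.blk_seq 0 hp (by decide)
    (T := P.m * (300 * (P.d + P.m + 1) + 600) + 1) fun _ => ⟨by simp, fun _ => ?_⟩) (by simp; omega)
  refine (Exec.while_count (fun j s' => Frame 10 22 s s' ∧ s'.reg 10 = P.m - j ∧
    (∀ a : List ℕ, a.headD 0 < 25 ∨ 29 < a.headD 0 → s'.mem a = s.mem a) ∧
    Dyn P.toPlan N F (P.path (view s.mem) ν i (P.m - j)) (view s'.mem)) P.m
    (300 * (P.d + P.m + 1) + 599) ?_ ?_ ?_).imp (by simp) ?_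
  · rintro j s' hj ⟨-, h10, -⟩
    simp [Test.holds, h10]
  · rintro j s' ho hj ⟨hf, h10, hm, hD'⟩
    obtain ⟨u, hu⟩ : ∃ u, P.m - j = u + 1 := ⟨P.m - j - 1, by omega⟩
    have hu' : P.m - (j + 1) = u := by omega
    rw [hu] at h10 hD'
    rw [hu']
    have r1 := (hf.2.2 1 (by omega)).trans h1
    have r2 := (hf.2.2 2 (by omega)).trans h2
    have r3 := (hf.2.2 3 (by omega)).trans h3
    have r7 := (hf.2.2 7 (by omega)).trans h7
    have hS' : Static P s'.mem := hS.congr fun a ha => hm a (by omega)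
    have hocc := hS'.occ_eq i hi (u + 1) (by omega) (by omega)
    refine Exec.mono (Exec.blk_seq 0 hp (by decide) (T := 300 * (P.d + P.m + 1) + 500)
      fun _ => ⟨by simp, fun _ => ?_⟩) (by simp; omega)
    refine Exec.mono (Exec.seq' (T₁ := 300 * (P.d + P.m + 1) + 450) (T₂ := 21)
      (R := fun s' => Frame 10 22 s s' ∧ s'.reg 10 = u + 1 ∧
        (∀ a : List ℕ, a.headD 0 < 25 ∨ 29 < a.headD 0 → s'.mem a = s.mem a) ∧
        Dyn P.toPlan N F (P.path (view s.mem) ν i u) (view s'.mem))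
      (Exec.mono (Exec.ite (T := 300 * (P.d + P.m + 1) + 440) (fun hc => ?_) (fun hc => ?_))
      (by simp)) ?_) (by simp)
    · simp [Test.holds, r7, h10] at hc
      have hoc := hocc.1 hc
      have hne1 := hne (u + 1) (by omega) hoc
      -- Repairs do not touch `ch`, so the path may be described by the trie before the loop.
      have hch : (view s'.mem).ch = (view s.mem).ch := by
        funext a b c
        exact hm _ (by simp)
      have hiteq : ∀ v, P.it (view s'.mem) ν v = P.it (view s.mem) ν v := fun v => by
        simp only [Plan.it, hch]
      rw [← hiteq] at hne1
      have hb := hD'.toTrie.it_bounds hQ (by omega) hne1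
      have hup := hD'.toTrie.it_up hQ (by omega) (by omega) hne1
      have hpar := hQ.par_lt (u + 1) (by omega) (by omega)
      have hop := hQ.occ_par i hi _ hoc
      refine Exec.mono (Exec.blk_seq 0 hp (by decide) (T := 300 * (P.d + P.m + 1) + 401)
        fun _ => ⟨by simp, fun _ => ?_⟩) (by simp; omega)
      generalize hs₁ : runs _ _ = s₁
      simp [h10, hm [32, u + 1] (by simp), hit (u + 1) (by omega) hoc] at hs₁
      have hm₁ : s₁.mem = s'.mem := by subst hs₁; rfl
      have q10 : s₁.reg 10 = u + 1 := by subst hs₁; simp [h10]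
      have q11 : s₁.reg 11 = P.it (view s'.mem) ν (u + 1) := by subst hs₁; simp [hiteq]
      refine Exec.seq' (exec_weightProg hp (by rw [hm₁]; exact hS') ?_ ?_ ?_ (by omega) (by omega)
        ?_) ?_
      · subst hs₁; simp [r1]
      · subst hs₁; simp [r2]
      · subst hs₁; simp [r3]
      · rw [hm₁, q10]
        exact hB.weight hP hD' (by omega) _
      · rintro s₂ - ⟨hf₂, hm₂, hw₂⟩
        have hm₂' : s₂.mem = s'.mem := hm₂.trans hm₁
        refine (exec_relinkProg hP hB hp (s := s₂) (u := u + 1)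
          (ex' := P.path (view s.mem) ν i u) (by rw [hm₂']; exact hD')
          ((hf₂.2.2 10 (by omega)).trans q10) ((hf₂.2.2 11 (by omega)).trans q11)
          (by rw [hw₂, hm₂', hm₁, q10, q11]) rfl hup.1 (by rw [hm₂']; exact hb.2.1) ?_
          (by rw [hm₂']; exact hb.2.2) ?_ ?_).imp le_rfl ?_
        · rw [hm₂', hup.2.1, hS'.par_eq _ (by omega) (by omega), hm _ (by simp),
            hit _ (by omega) hop, hiteq]
        · rintro e ⟨v, hv, hov, he⟩
          rcases Nat.lt_or_ge v (u + 1) with h | h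
          · exact Or.inr ⟨v, by omega, hov, he⟩
          · obtain rfl : v = u + 1 := by omega
            exact Or.inl (by rw [he, hiteq])
        · refine ⟨P.par (u + 1), by omega, hop, ?_⟩
          rw [hm₂', hS'.par_eq _ (by omega) (by omega), hm _ (by simp), hit _ (by omega) hop]
        · rintro s₃ - ⟨hf₃, h10₃, hm₃, hD₃⟩
          refine ⟨(hf.trans ?_).trans hf₃, h10₃, fun a ha => ?_, hD₃⟩
          · refine Frame.trans (s' := s₁) ?_ (hf₂.weaken (by omega) (by omega))
            subst hs₁; simp
          · rw [hm₃ a ha, hm₂', hm a ha]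
    · simp [Test.holds, r7, h10] at hc
      have hoc : ¬ P.occ i (u + 1) := fun h => by have := hocc.2 h; omega
      refine (Exec.skip ?_).mono (by omega)
      refine ⟨by simp [hf], by simp [h10], hm, hD'.ex_imp fun e he => ?_⟩
      exact (P.path_succ_of_not_occ hoc).1 he
    · rintro s₂ - ⟨hf₂, h10₂, hm₂, hD₂⟩
      refine Exec.blk 0 hp (by decide) fun _ => ⟨by simp, fun _ => ?_⟩
      exact ⟨by simp [hf₂], by simp [h10₂], hm₂, hD₂⟩
  · exact ⟨by simp, by simp [h2], fun _ _ => rfl, hD⟩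
  · rintro s' - ⟨hf, -, hm, hD'⟩
    refine ⟨hf, hm, hD'.ex_imp fun e he => ?_⟩
    obtain ⟨v, hv, -, he⟩ := he
    obtain rfl : v = 0 := by omega
    rw [he, Plan.it, item_zero]

/-! ### Processing an atom -/

/-- The atom in register 7 holds (or fails, according to register 4) for the valuation stored in
array 31. -/
def atomProg : Program :=
  .seq pathProg <|
  .seq (blk [.ld 10 11 [.reg 7], .ld 10 32 [.reg 10], .st 24 [.reg 10, .reg 7] (.reg 4)]) <|
  .seq repairProg <|
  .seq (blk [.set 10 (.lit 0), .set 11 (.lit 1)]) <|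
  .seq weightProg <|
  blk [.st 25 [.lit 1] (.reg 12)]

def Layout.atomTime (P : Layout) : ℕ := (P.m + 1) * (300 * (P.d + P.m + 1) + 1500)

/-- `hF`, `hF₂` and `hF₃` say that truth changes for atom `i` only, and only for valuations that
agree with `ν` on its variables, in other words at a single node. -/
theorem exec_atomProg {Γ : Ctx} {P : Layout} {N : ℕ} {F F' : ℕ → (ℕ → ℕ) → Prop} {s : State}
    {i : ℕ} {ν : ℕ → ℕ} (hP : P.Good) (hB : P.Fits N Γ.B) (hp : Γ.prot ≤ 0) (hS : Static P s.mem)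
    (hD : Dyn.Clean P.toPlan N F (view s.mem))
    (h1 : s.reg 1 = P.d) (h2 : s.reg 2 = P.m) (h3 : s.reg 3 = P.K) (h4 : s.reg 4 ≤ 1)
    (h7 : s.reg 7 = i) (hi : i < P.d)
    (hν : ∀ v, 1 ≤ v → P.occ i v → s.mem [31, v] = ν v ∧ ν v ≤ N)
    (hF : ∀ ν', (∀ v, 1 ≤ v → P.occ i v → ν' v = ν v) → (F' i ν' ↔ s.reg 4 = 1))
    (hF₂ : ∀ ν', ¬ (∀ v, 1 ≤ v → P.occ i v → ν' v = ν v) → (F' i ν' ↔ F i ν'))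
    (hF₃ : ∀ j < P.d, j ≠ i → ∀ ν', (F' j ν' ↔ F j ν')) :
    Exec Γ atomProg s P.atomTime fun s' => Frame 10 22 s s' ∧
      (∀ a : List ℕ, a.headD 0 < 13 ∨ a.headD 0 = 30 → s'.mem a = s.mem a) ∧
      Dyn.Clean P.toPlan N F' (view s'.mem) := by
  have hQ := hP.toGood
  have hmn := hP.m_le
  have hdn := hP.d_le
  have hnB := hB.n_le
  have hll := hQ.low_le i hi
  have hlo := hQ.occ_low i hi
  refine Exec.mono (Exec.seq' (exec_pathProg hP hB hp hS hD h2 h7 hi hν)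
    (T₂ := 61 + (P.m * (300 * (P.d + P.m + 1) + 600) + 30 + (41 + (300 * (P.d + P.m + 1) + 21 + 1) + 2)
      + 1) + 2) ?_) ?_
  swap
  · unfold Layout.atomTime
    ring_nf
    omega
  rintro s₁ - ⟨hI, hit⟩
  have r1 := (hI.frame.2.2 1 (by omega)).trans h1
  have r2 := (hI.frame.2.2 2 (by omega)).trans h2
  have r3 := (hI.frame.2.2 3 (by omega)).trans h3
  have r4 := hI.frame.2.2 4 (by omega)
  have r7 := (hI.frame.2.2 7 (by omega)).trans h7
  have hS₁ : Static P s₁.mem := hS.congr fun a ha => hI.mem_eq a (by omega)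
  refine Exec.mono (Exec.blk_seq 0 hp (by decide)
    (T := P.m * (300 * (P.d + P.m + 1) + 600) + 30 + (41 + (300 * (P.d + P.m + 1) + 21 + 1) + 2)
      + 1) fun _ => ⟨by simp, fun _ => ?_⟩) (by simp)
  generalize hs₂ : runs _ _ = s₂
  simp [r7, r4, hS₁.low_eq i hi, hit _ hll hlo] at hs₂
  have hf₂ : Frame 10 22 s s₂ := by
    subst hs₂; simp [hI.frame.weaken (lo' := 10) (hi' := 22) (by omega) (by omega)]
  have hm₂ : ∀ a : List ℕ, a.headD 0 ≠ 24 → s₂.mem a = s₁.mem a := by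
    intro a ha
    subst hs₂
    rw [State.setMem_mem_ne] <;> first | rfl | omega
  have hview : view s₂.mem = { view s₁.mem with
      E := fun e j => if e = P.it (view s₁.mem) ν (P.low i) ∧ j = i then s.reg 4
        else (view s₁.mem).E e j } := by
    subst hs₂
    unfold view
    simp
  have hch : (view s₂.mem).ch = (view s₁.mem).ch := by rw [hview]
  have hiteq : ∀ v, P.it (view s₂.mem) ν v = P.it (view s₁.mem) ν v := fun v => by
    simp only [Plan.it, hch]
  have hD₂ : Dyn P.toPlan N F' (P.path (view s₂.mem) ν i P.m) (view s₂.mem) := by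
    have := hI.dyn.setE hQ hi h4 (hI.it_ne _ hll hlo) ⟨_, hll, hlo, rfl⟩ hF hF₂ hF₃ hview
    refine this.ex_imp fun e he => ?_
    obtain ⟨v, hv, hov, he⟩ := he
    exact ⟨v, hv, hov, by rw [he, hiteq]⟩
  have hS₂ : Static P s₂.mem := hS₁.congr fun a ha => hm₂ a (by omega)
  refine Exec.seq' (exec_repairProg hP hB hp hS₂ ((hf₂.2.2 1 (by omega)).trans h1)
    ((hf₂.2.2 2 (by omega)).trans h2) ((hf₂.2.2 3 (by omega)).trans h3)
    ((hf₂.2.2 7 (by omega)).trans h7) hi hD₂ (fun v hv hov => ?_) (fun v hv hov => ?_)) ?_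
  · rw [hiteq]; exact hI.it_ne v hv hov
  · rw [hiteq, hm₂ _ (by simp), hit v hv hov]
  · rintro s₃ - ⟨hf₃, hm₃, hD₃⟩
    have hf₃' := hf₂.trans hf₃
    have hS₃ : Static P s₃.mem := hS₂.congr fun a ha => hm₃ a (by omega)
    refine Exec.mono (Exec.blk_seq 0 hp (by decide) (T := 300 * (P.d + P.m + 1) + 21 + 1)
      fun _ => ⟨by simp, fun _ => ?_⟩) (by simp)
    generalize hs₄ : runs _ _ = s₄
    simp at hs₄
    have hf₄ : Frame 10 22 s s₄ := by subst hs₄; simp [hf₃']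
    have hm₄ : s₄.mem = s₃.mem := by subst hs₄; rfl
    have q10 : s₄.reg 10 = 0 := by subst hs₄; simp
    have q11 : s₄.reg 11 = 1 := by subst hs₄; simp
    refine Exec.seq' (exec_weightProg hp (by rw [hm₄]; exact hS₃) ((hf₄.2.2 1 (by omega)).trans h1)
      ((hf₄.2.2 2 (by omega)).trans h2) ((hf₄.2.2 3 (by omega)).trans h3) (by omega) (by omega)
        (by rw [hm₄, q10]; exact hB.weight hP hD₃ (by omega) _)) ?_
    rintro s₅ - ⟨hf₅, hm₅, hw₅⟩
    refine Exec.blk 0 hp (by decide) fun _ => ⟨by simp, fun _ => ?_⟩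
    rw [q10, q11, hm₄] at hw₅
    rw [hm₄] at hm₅
    generalize hs₆ : runs _ _ = s₆
    simp [hw₅] at hs₆
    refine ⟨?_, fun a ha => ?_, ?_⟩
    · subst hs₆
      simp [hf₄.trans (hf₅.weaken (by omega) (by omega))]
    · subst hs₆
      rw [State.setMem_mem_ne _ (t := 25) _ _ (by omega), hm₅, hm₃ a (by omega),
        hm₂ a (by omega), hI.mem_eq a (by omega)]
    · refine hD₃.repair_root hQ (fun e he => Or.inl he) ?_
      subst hs₆
      unfold view
      simp [hm₅]

open Classical in
theorem Dyn.congr_F {Q : Plan} {N : ℕ} {F F' : ℕ → (ℕ → ℕ) → Prop} {ex : ℕ → Prop} {ds : DS}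
    (h : Dyn Q N F ex ds) (hF : ∀ i < Q.d, ∀ ν, F i ν ↔ F' i ν) : Dyn Q N F' ex ds :=
  { h with E_eq := fun i hi ν => (h.E_eq i hi ν).trans (if_congr (hF i hi ν) rfl rfl) }

/-! ### Reading an array -/

/-- Reads as many words as register 6 says into the array `t`. -/
def readProg (t : ℕ) : Program :=
  .seq (blk [.set 8 (.lit 0)]) <|
  .while (.lt (.reg 8) (.reg 6)) <|
    blk [.read 9, .st t [.reg 8] (.reg 9), .op .add 8 (.reg 8) (.lit 1)]

theorem exec_readProg {Γ : Ctx} {s : State} {t n : ℕ} (hp : Γ.prot ≤ 0) (ht : t ≤ 100)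
    (h6 : s.reg 6 = n) :
    Exec Γ (readProg t) s (62 * n + 30) fun s' => Frame 8 9 (s.setInp (s.inp.drop n)) s' ∧
      (∀ a, (∀ j < n, a ≠ [t, j]) → s'.mem a = s.mem a) ∧
      ∀ j < n, s'.mem [t, j] = s.inp.getD j 0 := by
  refine Exec.ok fun ho₀ => ?_
  have hn := ho₀.1.1 6
  rw [h6] at hn
  refine Exec.mono (Exec.blk_seq 0 hp (by decide) (T := n * 62 + 1)
    fun _ => ⟨by simp, fun _ => ?_⟩) (by simp; omega)
  refine (Exec.while_count (fun j s' => Frame 8 9 (s.setInp (s.inp.drop j)) s' ∧ s'.reg 8 = j ∧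
      (∀ a, (∀ k < j, a ≠ [t, k]) → s'.mem a = s.mem a) ∧
      ∀ k < j, s'.mem [t, k] = s.inp.getD k 0) n 61 ?_ ?_ ?_).imp le_rfl ?_
  · rintro j s' - ⟨hf, hj, -⟩
    simp [Test.holds, hj, hf.2.2 6 (by omega), h6]
  · rintro j s' ho hj ⟨hf, h8, hm, hv⟩
    have hi : s'.inp = s.inp.drop j := hf.1
    refine Exec.blk 0 hp (by simp [Cmd.wf, Operand.small, ht]) fun _ => ⟨?_, fun _ => ?_⟩
    · simp [h8]; omega
    · have hhd : (s.inp.drop j).headD 0 = s.inp.getD j 0 := by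
        rw [List.headD_eq_head?_getD, List.head?_drop, List.getD_eq_getElem?_getD]
      refine ⟨⟨?_, ?_, fun r hr => ?_⟩, ?_, fun a ha => ?_, fun k hk => ?_⟩
      · simp [hi]
      · simpa using hf.2.1
      · have := hf.2.2 r hr
        simp at this ⊢
        rw [if_neg (by omega), if_neg (by omega), this]
      · simp [h8]
      · have h1 := ha j (by omega)
        simp [h8, h1]
        exact hm a fun k hk => ha k (by omega)
      · simp [h8]
        split_ifs with hkj
        · subst hkj
          simp [hi]
        · rw [hv k (by omega), List.getD_eq_getElem?_getD]
  · refine ⟨?_, by simp, by simp, by simp⟩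
    rw [List.drop_zero]
    simp [Frame]
    intro r hr h8
    omega
  · rintro s' - ⟨hf, -, hm, hv⟩
    exact ⟨hf, hm, hv⟩

/-! ### Processing a fact -/

/-- The `i`-th atom holds for the valuation `ν`; the facts are given as a set of words. -/
def Layout.Sat (P : Layout) (X : Set (List ℕ)) (i : ℕ) (ν : ℕ → ℕ) : Prop :=
  (P.rel i :: (List.range (P.ar i)).map fun p => ν (P.arg i p)) ∈ X

/-- The valuation that is forced by the tuple in array 30 is stored in array 31. -/
def fillProg : Program :=
  .seq (blk [.set 8 (.lit 0)]) <|
  .while (.lt (.reg 8) (.reg 6)) <|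
    blk [.ld 9 4 [.reg 7, .reg 8], .ld 9 5 [.reg 9], .ld 10 30 [.reg 8], .st 31 [.reg 9] (.reg 10),
      .op .add 8 (.reg 8) (.lit 1)]

/-- If a variable is repeated in the atom, a later value overwrites an earlier one. So the stored
value is known to come from some place `q` with the same variable; whether all such places agree is
left to `checkProg`. -/
theorem exec_fillProg {Γ : Ctx} {P : Layout} {s : State} {i : ℕ} (hp : Γ.prot ≤ 0)
    (hS : Static P s.mem) (h6 : s.reg 6 = P.ar i) (h7 : s.reg 7 = i) (hi : i < P.d) :
    Exec Γ fillProg s (102 * P.ar i + 30) fun s' => Frame 8 11 s s' ∧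
      (∀ a : List ℕ, a.headD 0 ≠ 31 → s'.mem a = s.mem a) ∧
      ∀ p < P.ar i, ∃ q < P.ar i, P.arg i q = P.arg i p ∧ s'.mem [31, P.arg i p] = s.mem [30, q] := by
  refine Exec.ok fun ho₀ => ?_
  have hn := ho₀.1.1 6
  rw [h6] at hn
  refine Exec.mono (Exec.blk_seq 0 hp (by decide) (T := P.ar i * 102 + 1)
    fun _ => ⟨by simp, fun _ => ?_⟩) (by simp; omega)
  refine (Exec.while_count (fun j s' => Frame 8 11 s s' ∧ s'.reg 8 = j ∧
      (∀ a : List ℕ, a.headD 0 ≠ 31 → s'.mem a = s.mem a) ∧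
      ∀ p < j, ∃ q < j, P.arg i q = P.arg i p ∧ s'.mem [31, P.arg i p] = s.mem [30, q])
      (P.ar i) 101 ?_ ?_ ?_).imp le_rfl ?_
  · rintro j s' - ⟨hf, hj, -⟩
    simp [Test.holds, hj, hf.2.2 6 (by omega), h6]
  · rintro j s' ho hj ⟨hf, h8, hm, hv⟩
    have r7 := (hf.2.2 7 (by omega)).trans h7
    refine Exec.blk 0 hp (by decide) fun _ => ?_
    have harg : s'.mem [5, s'.mem [4, i, j]] = P.arg i j := by
      rw [hm _ (by simp), hm _ (by simp), hS.arg_eq i hi j hj]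
    simp [h8, r7, harg, hf, hm [30, j] (by simp)]
    refine ⟨by omega, fun _ => ⟨fun a ha => ?_, fun p hpj => ?_⟩⟩
    · rw [if_neg, hm a (by simpa using ha)]
      rintro rfl
      simp at ha
    · by_cases h : P.arg i p = P.arg i j
      · exact ⟨j, by omega, h.symm, by rw [if_pos h]⟩
      · rw [if_neg h]
        obtain ⟨q, hq, hqp, hval⟩ := hv p (by
          rcases Nat.lt_or_ge p j with h1 | h1
          · exact h1
          · obtain rfl : p = j := by omega
            exact absurd rfl h)
        exact ⟨q, by omega, hqp, hval⟩
  · exact ⟨by simp, by simp, by simp, by simp⟩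
  · rintro s' - ⟨hf, -, hm, hv⟩
    exact ⟨hf, hm, hv⟩

/-- Register 11 tells whether the valuation in array 31 is consistent with the tuple in
array 30. -/
def checkProg : Program :=
  .seq (blk [.set 8 (.lit 0), .set 11 (.lit 1)]) <|
  .while (.lt (.reg 8) (.reg 6)) <|
    .seq (blk [.ld 9 4 [.reg 7, .reg 8], .ld 9 5 [.reg 9], .ld 9 31 [.reg 9], .ld 10 30 [.reg 8],
      .op .add 8 (.reg 8) (.lit 1)]) <|
    .ite (.eq (.reg 9) (.reg 10)) (blk []) (blk [.set 11 (.lit 0)])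

theorem exec_checkProg {Γ : Ctx} {P : Layout} {s : State} {i : ℕ} (hp : Γ.prot ≤ 0)
    (hS : Static P s.mem) (h6 : s.reg 6 = P.ar i) (h7 : s.reg 7 = i) (hi : i < P.d) :
    Exec Γ checkProg s (130 * P.ar i + 50) fun s' => Frame 8 11 s s' ∧ s'.mem = s.mem ∧
      (0 < s'.reg 11 ↔ ∀ p < P.ar i, s.mem [31, P.arg i p] = s.mem [30, p]) := by
  refine Exec.ok fun ho₀ => ?_
  have hn := ho₀.1.1 6
  rw [h6] at hn
  refine Exec.mono (Exec.blk_seq 0 hp (by decide) (T := P.ar i * 130 + 1)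
    fun _ => ⟨by simp, fun _ => ?_⟩) (by simp; omega)
  refine (Exec.while_count (fun j s' => Frame 8 11 s s' ∧ s'.reg 8 = j ∧ s'.mem = s.mem ∧
      (0 < s'.reg 11 ↔ ∀ p < j, s.mem [31, P.arg i p] = s.mem [30, p]))
      (P.ar i) 129 ?_ ?_ ?_).imp le_rfl ?_
  · rintro j s' - ⟨hf, hj, -⟩
    simp [Test.holds, hj, hf.2.2 6 (by omega), h6]
  · rintro j s' ho hj ⟨hf, h8, hm, hv⟩
    have r7 := (hf.2.2 7 (by omega)).trans h7
    have hsplit : (∀ p < j + 1, s.mem [31, P.arg i p] = s.mem [30, p]) ↔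
        (∀ p < j, s.mem [31, P.arg i p] = s.mem [30, p]) ∧
          s.mem [31, P.arg i j] = s.mem [30, j] :=
      ⟨fun h => ⟨fun p hp => h p (by omega), h j (by omega)⟩, fun h p hp => by
        rcases Nat.lt_or_ge p j with h1 | h1
        · exact h.1 p h1
        · obtain rfl : p = j := by omega
          exact h.2⟩
    refine Exec.mono (Exec.blk_seq 0 hp (by decide) (T := 22)
      fun _ => ⟨by simp [h8]; omega, fun _ => ?_⟩) (by simp)
    simp [h8, r7, hm, hS.arg_eq i hi j hj]
    refine Exec.ite (T := 21) (fun hc => ?_) (fun hc => ?_)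
    · simp [Test.holds] at hc
      refine (Exec.skip ?_).mono (by simp)
      refine ⟨by simp [hf], by simp, by simp [hm], ?_⟩
      refine Iff.trans ?_ (hv.trans ⟨fun h p hp => (hsplit.2 ⟨h, hc⟩) p (by omega), fun h p hp => h p (by omega)⟩)
      simp

    · simp [Test.holds] at hc
      refine Exec.blk 0 hp (by decide) fun _ => ?_
      simp [hf, hm]
      exact fun _ => ⟨j, by omega, hc⟩
  · exact ⟨by simp, by simp, by simp, by simp⟩
  · rintro s' - ⟨hf, -, hm, hv⟩
    exact ⟨hf, hm, hv⟩

/-- The fact that consists of the symbol in register 5 and the tuple in array 30 is inserted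
(register 4 is `1`) or deleted (it is `0`). -/
def factProg : Program :=
  .seq (blk [.set 7 (.lit 0)]) <|
  .while (.lt (.reg 7) (.reg 1)) <|
    .seq (blk [.ld 9 6 [.reg 7]]) <|
    .seq (.ite (.eq (.reg 9) (.reg 5))
      (.seq fillProg <| .seq checkProg <| .ite (.lt (.lit 0) (.reg 11)) atomProg (blk []))
      (blk [])) <|
    blk [.op .add 7 (.reg 7) (.lit 1)]

def Layout.factTime (P : Layout) : ℕ := P.d * (240 * P.n + P.atomTime + 200) + 30

/-- A relation symbol may occur in several atoms, which are served one after the other. `hX`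
describes insertion and deletion at once: the fact ends up in `X'` if and only if register 4 is `1`,
and all other facts stay as they are. -/
theorem exec_factProg {Γ : Ctx} {P : Layout} {N : ℕ} {X X' : Set (List ℕ)} {s : State} {R : ℕ}
    {t : List ℕ} (hP : P.Good) (hB : P.Fits N Γ.B) (hp : Γ.prot ≤ 0) (hS : Static P s.mem)
    (hD : Dyn.Clean P.toPlan N (P.Sat X) (view s.mem))
    (h1 : s.reg 1 = P.d) (h2 : s.reg 2 = P.m) (h3 : s.reg 3 = P.K) (h4 : s.reg 4 ≤ 1)
    (h5 : s.reg 5 = R) (h6 : ∀ i < P.d, P.rel i = R → s.reg 6 = P.ar i ∧ t.length = P.ar i)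
    (ht : ∀ p < s.reg 6, s.mem [30, p] = t.getD p 0) (htN : ∀ w ∈ t, w ≤ N)
    (hX : ∀ g, g ∈ X' ↔ (g = R :: t ∧ s.reg 4 = 1) ∨ (g ≠ R :: t ∧ g ∈ X)) :
    Exec Γ factProg s P.factTime fun s' => Frame 7 22 s s' ∧
      (∀ a : List ℕ, a.headD 0 < 13 ∨ a.headD 0 = 30 → s'.mem a = s.mem a) ∧
      Dyn.Clean P.toPlan N (P.Sat X') (view s'.mem) := by
  have hQ := hP.toGood
  have hdn := hP.d_le
  have hnB := hB.n_le
  -- In between, the atoms below `j` refer to the new database and the others still to the old one.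
  let G : ℕ → ℕ → (ℕ → ℕ) → Prop := fun j i ν => if i < j then P.Sat X' i ν else P.Sat X i ν
  have hGsame : ∀ j, (∀ ν, P.Sat X' j ν ↔ P.Sat X j ν) → G (j + 1) = G j := by
    intro j h
    funext i ν
    simp only [G, eq_iff_iff]
    rcases lt_trichotomy i j with hij | rfl | hij
    · rw [if_pos (by omega), if_pos hij]
    · rw [if_pos (by omega), if_neg (by omega), h]
    · rw [if_neg (by omega), if_neg (by omega)]
  have hne : ∀ i ν, P.rel i :: (List.range (P.ar i)).map (fun p => ν (P.arg i p)) ≠ R :: t →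
      (P.Sat X' i ν ↔ P.Sat X i ν) := fun i ν h => by
    unfold Layout.Sat
    rw [hX]
    simp [h]
  refine Exec.mono (Exec.blk_seq 0 hp (by decide) (T := P.d * (240 * P.n + P.atomTime + 200) + 1)
    fun _ => ⟨by simp, fun _ => ?_⟩) (by simp [Layout.factTime]; omega)
  refine (Exec.while_count (fun j s' => Frame 7 22 s s' ∧ s'.reg 7 = j ∧
      (∀ a : List ℕ, a.headD 0 < 13 ∨ a.headD 0 = 30 → s'.mem a = s.mem a) ∧
      Dyn.Clean P.toPlan N (G j) (view s'.mem)) P.d (240 * P.n + P.atomTime + 199)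
      ?_ ?_ ?_).imp le_rfl ?_
  · rintro j s' - ⟨hf, hj, -⟩
    simp [Test.holds, hj, hf.2.2 1 (by omega), h1]
  · rintro i s' ho hi ⟨hf, h7', hm, hD'⟩
    have r1 := (hf.2.2 1 (by omega)).trans h1
    have r2 := (hf.2.2 2 (by omega)).trans h2
    have r3 := (hf.2.2 3 (by omega)).trans h3
    have r4 := hf.2.2 4 (by omega)
    have r5 := (hf.2.2 5 (by omega)).trans h5
    have r6 := hf.2.2 6 (by omega)
    have hS' : Static P s'.mem := hS.congr fun a ha => hm a (by omega)
    have harn := hP.ar_le i hi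
    refine Exec.mono (Exec.blk_seq 0 hp (by decide) (T := 240 * P.n + P.atomTime + 165)
      fun _ => ⟨by simp, fun _ => ?_⟩) (by simp; omega)
    simp [h7', hS'.rel_eq i hi]
    refine Exec.mono (Exec.seq' (T₁ := 240 * P.n + P.atomTime + 100) (T₂ := 21)
      (R := fun s' => Frame 7 22 s s' ∧ s'.reg 7 = i ∧
      (∀ a : List ℕ, a.headD 0 < 13 ∨ a.headD 0 = 30 → s'.mem a = s.mem a) ∧
      Dyn.Clean P.toPlan N (G (i + 1)) (view s'.mem))
      (Exec.mono (Exec.ite (T := 240 * P.n + P.atomTime + 99) (fun hc => ?_) (fun hc => ?_))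
      (by simp)) ?_) (by omega)
    · simp [Test.holds, r5] at hc
      obtain ⟨h6i, htl⟩ := h6 i hi hc
      rw [h6i] at r6 ht
      generalize hs₁ : s'.setReg 9 (P.rel i) = s₁
      have hm₁ : s₁.mem = s'.mem := by subst hs₁; rfl
      have hf₁ : Frame 7 22 s s₁ := by subst hs₁; simp [hf]
      have q7 : s₁.reg 7 = i := by subst hs₁; simp [h7']
      refine Exec.mono (Exec.seq' (exec_fillProg hp (by rw [hm₁]; exact hS')
        ((hf₁.2.2 6 (by omega)).trans h6i) q7 hi) (T₂ := 130 * P.n + P.atomTime + 60) ?_)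
        (by omega)
      rintro s₂ - ⟨hf₂, hm₂, hv₂⟩
      have hS₂ : Static P s₂.mem := hS'.congr fun a ha => by rw [hm₂ a (by omega), hm₁]
      have hf₂' := hf₁.trans (hf₂.weaken (lo' := 7) (hi' := 22) (by omega) (by omega))
      have h30 : ∀ p < P.ar i, s₂.mem [30, p] = t.getD p 0 := fun p hp => by
        rw [hm₂ _ (by simp), hm₁, hm _ (by simp), ht p hp]
      refine Exec.mono (Exec.seq' (exec_checkProg hp hS₂ ((hf₂'.2.2 6 (by omega)).trans h6i)
        ((hf₂.2.2 7 (by omega)).trans q7) hi) (T₂ := P.atomTime + 5) ?_) (by omega)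
      rintro s₃ - ⟨hf₃, hm₃, hv₃⟩
      have hf₃' := hf₂'.trans (hf₃.weaken (lo' := 7) (hi' := 22) (by omega) (by omega))
      have q7₃ := (hf₃.2.2 7 (by omega)).trans ((hf₂.2.2 7 (by omega)).trans q7)
      have hview : view s₃.mem = view s'.mem := view_congr fun a h1 h2 => by
        rw [hm₃, hm₂ a (by omega), hm₁]
      have h31 : ∀ p < P.ar i, ∃ q < P.ar i, P.arg i q = P.arg i p ∧
          s₂.mem [31, P.arg i p] = t.getD q 0 := fun p hp => by
        obtain ⟨q, hq, hqp, he⟩ := hv₂ p hp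
        refine ⟨q, hq, hqp, ?_⟩
        rw [he, hm₁, hm _ (by simp), ht q hq]
      have heq : ∀ ν : ℕ → ℕ, P.rel i :: (List.range (P.ar i)).map (fun p => ν (P.arg i p)) =
          R :: t ↔ ∀ p < P.ar i, ν (P.arg i p) = t.getD p 0 := fun ν => by
        rw [hc]
        constructor
        · intro h p hp
          rw [List.cons.injEq] at h
          rw [← h.2]
          simp [hp]
        · intro h
          congr 1
          refine List.ext_getElem (by simp [htl]) fun p hp1 hp2 => ?_
          simp at hp1 ⊢
          rw [h p hp1, List.getD_eq_getElem _ _ hp2]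
      refine Exec.mono (Exec.ite (T := P.atomTime + 4) (fun hc => ?_) (fun hc => ?_)) le_rfl
      · have hck := hv₃.1 (of_decide_eq_true hc)
        let ν : ℕ → ℕ := fun v => s₂.mem [31, v]
        -- If the check succeeds, a valuation agrees with `ν` on the atom exactly if it maps the
        -- atom to the given fact.
        have hag : ∀ ν' : ℕ → ℕ, (∀ v, 1 ≤ v → P.occ i v → ν' v = ν v) ↔
            P.rel i :: (List.range (P.ar i)).map (fun p => ν' (P.arg i p)) = R :: t := fun ν' => by
          rw [heq]
          constructor
          · intro h p hp
            have hpos := hP.arg_pos i hi p hp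
            rw [h _ hpos.1 ((hP.arg_occ i hi _ hpos.1).2 ⟨p, hp, rfl⟩), ← h30 p hp]
            exact hck p hp
          · intro h v hv ho
            obtain ⟨p, hp, rfl⟩ := (hP.arg_occ i hi v hv).1 ho
            rw [h p hp, ← h30 p hp]
            exact (hck p hp).symm
        refine (exec_atomProg (i := i) (ν := ν) (F := G i) (F' := G (i + 1)) hP hB hp ?_ ?_
          ((hf₃'.2.2 1 (by omega)).trans h1) ((hf₃'.2.2 2 (by omega)).trans h2)
          ((hf₃'.2.2 3 (by omega)).trans h3) (by rw [hf₃'.2.2 4 (by omega)]; exact h4) q7₃ hi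
          ?_ ?_ ?_ ?_).imp (by omega) ?_
        · rw [hm₃]; exact hS₂
        · rw [hview]; exact hD'
        · intro v hv ho
          rw [hm₃]
          refine ⟨rfl, ?_⟩
          obtain ⟨p, hp, rfl⟩ := (hP.arg_occ i hi v hv).1 ho
          obtain ⟨q, hq, -, he⟩ := h31 p hp
          simp only [ν]
          rw [he, List.getD_eq_getElem _ _ (by omega)]
          exact htN _ (List.getElem_mem _)
        · intro ν' hν'
          simp only [G]
          rw [if_pos (by omega), hf₃'.2.2 4 (by omega), Layout.Sat, hX]
          simp [(hag ν').1 hν']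
        · intro ν' hν'
          simp only [G]
          rw [if_pos (by omega), if_neg (by omega)]
          exact hne i ν' fun h => hν' ((hag ν').2 h)
        · intro j hj hji ν'
          simp only [G]
          rcases Nat.lt_or_ge j i with h | h
          · rw [if_pos (by omega), if_pos h]
          · rw [if_neg (by omega), if_neg (by omega)]
        · rintro s₄ - ⟨hf₄, hm₄, hD₄⟩
          refine ⟨hf₃'.trans (hf₄.weaken (by omega) (by omega)),
            (hf₄.2.2 7 (by omega)).trans q7₃, fun a ha => ?_, hD₄⟩
          rw [hm₄ a ha, hm₃, hm₂ a (by omega), hm₁, hm a ha]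
      · have hc := of_decide_eq_false hc
        refine (Exec.skip ?_).mono (by omega)
        refine ⟨hf₃', q7₃, fun a ha => by rw [hm₃, hm₂ a (by omega), hm₁, hm a ha], ?_⟩
        rw [hview, hGsame i fun ν => hne i ν fun h => ?_]
        · exact hD'
        -- If some valuation mapped the atom to the fact, equal variables would carry equal entries,
        -- and the check would have succeeded.
        · rw [heq] at h
          refine hc (hv₃.2 fun p hp => by
            obtain ⟨q, hq, hqp, he⟩ := h31 p hp
            rw [he, h30 p hp, ← h p hp, ← h q hq, hqp])
    · simp [Test.holds, r5] at hc
      refine (Exec.skip ?_).mono (by omega)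
      refine ⟨by simp [hf], by simp [h7'], by simpa using hm, ?_⟩
      rw [hGsame i fun ν => hne i ν fun h => hc (by injection h)]
      exact hD'
    · rintro s₂ - ⟨hf₂, h7₂, hm₂, hD₂⟩
      refine Exec.blk 0 hp (by decide) fun _ => ⟨by simp [h7₂]; omega, fun _ => ?_⟩
      exact ⟨by simp [hf₂], by simp [h7₂], fun a ha => hm₂ a (by simpa using ha), hD₂⟩
  · refine ⟨by simp, by simp, fun _ _ => rfl, ?_⟩
    have : G 0 = P.Sat X := by funext i ν; simp [G]
    rw [this]
    exact hD
  · rintro s' - ⟨hf, -, hm, hD'⟩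
    refine ⟨hf, hm, ?_⟩
    exact hD'.congr_F fun i hi ν => by simp only [G]; rw [if_pos hi]

/-! ### The update routine -/

def updateProg : Program :=
  .seq (blk [.read 4, .read 5, .ld 1 12 [.lit 0], .ld 2 12 [.lit 1], .ld 3 12 [.lit 2],
    .ld 6 1 [.reg 5]]) <|
  .seq (readProg 30) factProg

def Layout.updateTime (P : Layout) : ℕ := P.factTime + 62 * P.n + 200

theorem exec_updateProg {Γ : Ctx} {P : Layout} {N : ℕ} {X X' : Set (List ℕ)} {s : State} {o R : ℕ}
    {t : List ℕ} (hP : P.Good) (hB : P.Fits N Γ.B) (hp : Γ.prot ≤ 0) (hS : Static P s.mem)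
    (hD : Dyn.Clean P.toPlan N (P.Sat X) (view s.mem)) (hi : s.inp = o :: R :: t) (ho : o ≤ 1)
    (hR : ∀ i < P.d, P.rel i = R → t.length = P.ar i) (htN : ∀ w ∈ t, w ≤ N)
    (hX : ∀ g, g ∈ X' ↔ (g = R :: t ∧ o = 1) ∨ (g ≠ R :: t ∧ g ∈ X)) :
    Exec Γ updateProg s P.updateTime fun s' => Static P s'.mem ∧
      Dyn.Clean P.toPlan N (P.Sat X') (view s'.mem) := by
  -- For a symbol that does not occur in the query the entry is `0`: nothing of the tuple is read
  -- and no atom matches, so that the arities of foreign symbols do not affect the time.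
  have hle : s.mem [1, R] ≤ P.n := by
    by_cases h : ∃ i < P.d, P.rel i = R
    · obtain ⟨i, hid, rfl⟩ := h
      rw [hS.len_eq i hid]
      exact hP.ar_le i hid
    · rw [hS.len_zero R fun i hi he => h ⟨i, hi, he⟩]
      exact Nat.zero_le _
  refine Exec.mono (Exec.blk_seq 0 hp (by decide) (T := 62 * P.n + 30 + P.factTime + 1)
    fun _ => ⟨by simp, fun _ => ?_⟩) (by simp [Layout.updateTime]; omega)
  generalize hs₁ : runs _ _ = s₁
  simp [hi, hS.d_eq, hS.m_eq, hS.K_eq] at hs₁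
  have hm₁ : s₁.mem = s.mem := by subst hs₁; rfl
  have hi₁ : s₁.inp = t := by subst hs₁; simp
  have q : s₁.reg 1 = P.d ∧ s₁.reg 2 = P.m ∧ s₁.reg 3 = P.K ∧ s₁.reg 4 = o ∧ s₁.reg 5 = R ∧
      s₁.reg 6 = s.mem [1, R] := by subst hs₁; simp
  obtain ⟨q1, q2, q3, q4, q5, q6⟩ := q
  refine Exec.mono (Exec.seq' (exec_readProg hp (by decide) q6) (T₂ := P.factTime) ?_) (by omega)
  rintro s₂ - ⟨hf₂, hm₂, hv₂⟩
  have r : ∀ k < 8, s₂.reg k = s₁.reg k := fun k hk => hf₂.2.2 k (by omega)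
  have hm : ∀ a : List ℕ, a.headD 0 < 30 → s₂.mem a = s.mem a := fun a ha => by
    rw [hm₂ a, hm₁]
    rintro j - rfl
    simp at ha
  have hS₂ : Static P s₂.mem := hS.congr fun a ha => hm a (by omega)
  refine (exec_factProg (t := t) (R := R) hP hB hp hS₂ (X := X) (X' := X')
    ?_ ((r 1 (by omega)).trans q1) ((r 2 (by omega)).trans q2) ((r 3 (by omega)).trans q3)
    (by rw [r 4 (by omega), q4]; exact ho) ((r 5 (by omega)).trans q5) ?_ ?_ htN ?_).imp le_rfl ?_
  · rw [view_congr fun a _ h => hm a h]; exact hD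
  · intro i hi he
    rw [r 6 (by omega), q6, ← he, hS.len_eq i hi]
    exact ⟨rfl, hR i hi he⟩
  · intro p hp
    rw [r 6 (by omega), q6] at hp
    rw [hv₂ p hp, hi₁]
  · rw [r 4 (by omega), q4]; exact hX
  · rintro s₃ - ⟨-, hm₃, hD₃⟩
    exact ⟨hS₂.congr fun a ha => hm₃ a (Or.inl ha), hD₃⟩

/-! ### Ordering the variables of a query -/

/-- A conjunctive query in terms of lists of numbers. -/
structure Raw where
  d : ℕ
  rel : ℕ → ℕ
  args : ℕ → List ℕ
  quant : List ℕ
  head : List ℕ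

namespace Raw

def isq (r : Raw) (x : ℕ) : ℕ := if x ∈ r.quant then 1 else 0

def inAtom (r : Raw) (i x : ℕ) : ℕ := if x ∈ r.args i then 1 else 0

/-- Free variables come first; variables that occur in more atoms come earlier. -/
def rk (r : Raw) (x : ℕ) : ℕ := r.isq x * (r.d + 1) + r.d - ∑ i ∈ Finset.range r.d, r.inAtom i x

def names (r : Raw) : List ℕ := (List.range r.d).flatMap r.args

/-- The field `hier` is the hierarchy in terms of ranks: of two variables with a common atom, the
one of smaller or equal rank occurs wherever the other does. -/
structure Good (r : Raw) : Prop where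
  d_pos : 0 < r.d
  args_ne : ∀ i < r.d, r.args i ≠ []
  hier : ∀ x y, r.rk x ≤ r.rk y → ∀ i < r.d, x ∈ r.args i → y ∈ r.args i →
    ∀ j < r.d, y ∈ r.args j → x ∈ r.args j
  mem_head : ∀ x, x ∈ r.head ↔ (∃ i < r.d, x ∈ r.args i) ∧ x ∉ r.quant

/-- `L` lists all variables in the order of their ranks. -/
structure Order (r : Raw) (L : List ℕ) : Prop where
  nodup : L.Nodup
  mem_iff : ∀ x, x ∈ L ↔ ∃ i < r.d, x ∈ r.args i
  sorted : L.Pairwise fun x y => r.rk x ≤ r.rk y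

/-- The variable at a position. -/
def var (L : List ℕ) (u : ℕ) : ℕ := L.getD (u - 1) 0

def pos (L : List ℕ) (x : ℕ) : ℕ := L.idxOf x + 1

def occ (r : Raw) (L : List ℕ) (i u : ℕ) : Prop :=
  u = 0 ∨ (1 ≤ u ∧ u ≤ L.length ∧ var L u ∈ r.args i)

open Classical in
/-- The last position of the `i`-th atom that is at most `j`. -/
noncomputable def last (r : Raw) (L : List ℕ) (i j : ℕ) : ℕ := Nat.findGreatest (r.occ L i) j

-- The maximum is over all atoms that contain `u`; by `Good.last_eq_par` each single one of them
-- gives the same value.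
open Classical in
noncomputable def par (r : Raw) (L : List ℕ) (u : ℕ) : ℕ :=
  Nat.findGreatest (fun v => ∃ i < r.d, r.occ L i u ∧ r.occ L i v) (u - 1)

noncomputable def layout (r : Raw) (L : List ℕ) (n : ℕ) : Layout where
  m := L.length
  K := (L.filter fun x => x ∉ r.quant).length
  d := r.d
  occ := r.occ L
  par := r.par L
  low i := r.last L i L.length
  rel := r.rel
  ar i := (r.args i).length
  arg i j := pos L ((r.args i).getD j 0)
  hd := r.head.map (pos L)
  n := n

variable {r : Raw} {L : List ℕ}

theorem var_pos {x : ℕ} (h : x ∈ L) : var L (pos L x) = x := by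
  unfold var pos
  rw [Nat.add_sub_cancel, List.getD_eq_getElem _ _ (List.idxOf_lt_length_of_mem h)]
  exact List.getElem_idxOf _

theorem pos_le {x : ℕ} (h : x ∈ L) : 1 ≤ pos L x ∧ pos L x ≤ L.length :=
  ⟨by unfold pos; omega, List.idxOf_lt_length_of_mem h⟩

theorem var_mem {u : ℕ} (h1 : 1 ≤ u) (h2 : u ≤ L.length) : var L u ∈ L := by
  unfold var
  rw [List.getD_eq_getElem _ _ (by omega)]
  exact List.getElem_mem _

theorem pos_var (h : L.Nodup) {u : ℕ} (h1 : 1 ≤ u) (h2 : u ≤ L.length) : pos L (var L u) = u := by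
  unfold var pos
  rw [List.getD_eq_getElem _ _ (by omega), h.idxOf_getElem]
  omega

theorem Order.rk_le (h : r.Order L) {u v : ℕ} (h1 : 1 ≤ u) (huv : u < v) (h2 : v ≤ L.length) :
    r.rk (var L u) ≤ r.rk (var L v) := by
  unfold var
  rw [List.getD_eq_getElem _ _ (by omega), List.getD_eq_getElem _ _ (by omega)]
  exact List.pairwise_iff_getElem.1 h.sorted _ _ _ _ (by omega)

theorem occ_zero (i : ℕ) : r.occ L i 0 := Or.inl rfl

/-- The crucial consequence of the hierarchy: what precedes `u` in one atom precedes it in every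
atom that contains `u`, because earlier positions have smaller or equal rank. -/
theorem Good.occ_of_occ (hr : r.Good) (h : r.Order L) {u v i j : ℕ} (hi : i < r.d) (hj : j < r.d)
    (huv : v < u) (hu : r.occ L i u) (hv : r.occ L i v) (hju : r.occ L j u) : r.occ L j v := by
  rcases hv with rfl | ⟨hv1, hv2, hv3⟩
  · exact occ_zero j
  rcases hu with rfl | ⟨hu1, hu2, hu3⟩
  · omega
  rcases hju with rfl | ⟨-, -, hju⟩
  · omega
  exact Or.inr ⟨hv1, hv2, hr.hier _ _ (h.rk_le hv1 huv hu2) i hi hv3 hu3 j hj hju⟩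

theorem last_occ (i j : ℕ) : r.occ L i (r.last L i j) := by
  classical
  exact Nat.findGreatest_spec (P := r.occ L i) (Nat.zero_le j) (occ_zero i)

theorem last_le (i j : ℕ) : r.last L i j ≤ j := by
  classical
  exact Nat.findGreatest_le j

theorem le_last {i j u : ℕ} (h : r.occ L i u) (hu : u ≤ j) : u ≤ r.last L i j := by
  classical
  exact Nat.le_findGreatest hu h

theorem last_succ_of_occ {i j : ℕ} (h : r.occ L i (j + 1)) : r.last L i (j + 1) = j + 1 :=
  le_antisymm (last_le i _) (le_last h le_rfl)

theorem last_succ_of_not_occ {i j : ℕ} (h : ¬ r.occ L i (j + 1)) :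
    r.last L i (j + 1) = r.last L i j := by
  classical
  exact Nat.findGreatest_of_not h

/-- An atom that realises the maximum in `par` hands its position over to atom `i` by `occ_of_occ`.
Hence the predecessor can be computed from any atom containing `u`. -/
theorem Good.last_eq_par (hr : r.Good) (h : r.Order L) {i u : ℕ} (hi : i < r.d) (hu1 : 1 ≤ u)
    (hu : r.occ L i u) : r.last L i (u - 1) = r.par L u := by
  classical
  refine le_antisymm (Nat.le_findGreatest (last_le i _) ⟨i, hi, hu, last_occ i _⟩) ?_
  obtain ⟨j, hj, hju, hjp⟩ := Nat.findGreatest_spec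
    (P := fun v => ∃ i < r.d, r.occ L i u ∧ r.occ L i v) (Nat.zero_le (u - 1)) ⟨i, hi, hu, occ_zero i⟩
  have hle : r.par L u ≤ u - 1 := Nat.findGreatest_le _
  have hjp' : r.occ L j (r.par L u) := hjp
  exact le_last (hr.occ_of_occ h hj hi (by omega) hju hjp' hu) hle

theorem Order.exists_occ (h : r.Order L) {u : ℕ} (h1 : 1 ≤ u) (h2 : u ≤ L.length) :
    ∃ i < r.d, r.occ L i u := by
  obtain ⟨i, hi, hx⟩ := (h.mem_iff _).1 (var_mem h1 h2)
  exact ⟨i, hi, Or.inr ⟨h1, h2, hx⟩⟩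

theorem Order.occ_pos (h : r.Order L) {i x : ℕ} (hi : i < r.d) (hx : x ∈ r.args i) :
    r.occ L i (pos L x) := by
  have := (h.mem_iff x).2 ⟨i, hi, hx⟩
  exact Or.inr ⟨(pos_le this).1, (pos_le this).2, by rwa [var_pos this]⟩

/-- Free variables have rank at most `d`, and quantified ones more than `d`, by the summand `d + 1`.
So the free variables are a prefix of the order. -/
theorem rk_le_of_free {x : ℕ} (h : x ∉ r.quant) : r.rk x ≤ r.d := by
  unfold rk isq
  rw [if_neg h]
  omega

theorem lt_rk_of_quant {x : ℕ} (h : x ∈ r.quant) : r.d < r.rk x := by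
  have : ∑ i ∈ Finset.range r.d, r.inAtom i x ≤ r.d := by
    refine (Finset.sum_le_card_nsmul _ _ 1 fun i _ => ?_).trans (by simp)
    unfold inAtom
    split_ifs <;> omega
  unfold rk isq
  rw [if_pos h]
  omega

/-- In a list whose members that satisfy `p` come first, these are given by their number. -/
theorem getElem_filter_prefix {p : ℕ → Bool} {l : List ℕ}
    (h : l.Pairwise fun x y => p y = true → p x = true) (k : ℕ) (hk : k < l.length) :
    p l[k] = true ↔ k < (l.filter p).length := by
  induction l generalizing k with
  | nil => simp at hk
  | cons x l ih =>
    rw [List.pairwise_cons] at h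
    cases hx : p x with
    | true =>
      rw [List.filter_cons_of_pos hx]
      cases k with
      | zero => simp [hx]
      | succ k => simpa using ih h.2 k (by simpa using hk)
    | false =>
      have hl : l.filter p = [] := List.filter_eq_nil_iff.2 fun y hy hpy => by
        rw [h.1 y hy hpy] at hx
        cases hx
      rw [List.filter_cons_of_neg (by simp [hx]), hl]
      have hn : ∀ y ∈ x :: l, p y = false := by
        intro y hy
        rcases List.mem_cons.1 hy with rfl | hy
        · exact hx
        · simpa using List.filter_eq_nil_iff.1 hl y hy
      simp [hn _ (List.getElem_mem hk)]

theorem Order.free_iff (h : r.Order L) {u : ℕ} (h1 : 1 ≤ u) (h2 : u ≤ L.length) :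
    var L u ∉ r.quant ↔ u ≤ (L.filter fun x => x ∉ r.quant).length := by
  have hp : L.Pairwise fun x y => decide (y ∉ r.quant) = true → decide (x ∉ r.quant) = true := by
    refine h.sorted.imp fun {x y} hxy hy => ?_
    rw [decide_eq_true_eq] at hy ⊢
    intro hx
    have := rk_le_of_free hy
    have := lt_rk_of_quant hx
    omega
  have := getElem_filter_prefix hp (u - 1) (by omega)
  rw [decide_eq_true_eq] at this
  unfold var
  rw [List.getD_eq_getElem _ _ (by omega), this]
  omega

/-- The conditions on `par` reduce to `last_eq_par`, those on `low` to `last`, and those on free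
positions to the prefix property `Order.free_iff`. Positivity of `low` uses that every atom has an
argument. -/
theorem Good.layout_good (hr : r.Good) (h : r.Order L) {n : ℕ} (hn : r.names.length ≤ n)
    (hd : r.d ≤ n) (hh : r.head.length ≤ n) : (r.layout L n).Good := by
  have hm : L.length ≤ n := by
    refine le_trans (List.Subperm.length_le (List.subperm_of_subset h.nodup fun x hx => ?_)) hn
    obtain ⟨i, hi, hx⟩ := (h.mem_iff x).1 hx
    exact List.mem_flatMap.2 ⟨i, List.mem_range.2 hi, hx⟩
  have hpar : ∀ u, r.par L u ≤ u - 1 := fun u => by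
    classical
    exact Nat.findGreatest_le _
  have hfirst : ∀ i < r.d, ∃ x, x ∈ r.args i := fun i hi => List.exists_mem_of_ne_nil _ (hr.args_ne i hi)
  refine
    { par_lt := fun u h1 _ => by have := hpar u; simp only [layout]; omega
      occ_par := fun i hi u hu => ?_
      par_max := fun i hi u v hu h1 h2 hv => ?_
      occ_low := fun i _ => last_occ i _
      le_low := fun i hi u hu => ?_
      low_pos := fun i hi => ?_
      low_le := fun i _ => last_le i _
      exists_occ := fun u h1 h2 => h.exists_occ h1 h2
      K_le := List.length_filter_le _ _
      arg_occ := fun i hi u h1 => ?_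
      arg_pos := fun i hi j hj => ?_
      m_le := hm
      d_le := hd
      ar_le := fun i hi => ?_
      hd_le := by simpa [layout] using hh
      mem_hd := fun u => ?_ }
  · change r.occ L i (r.par L u)
    rcases Nat.eq_zero_or_pos u with rfl | hu1
    · have := hpar 0
      rw [show r.par L 0 = 0 by omega]
      exact occ_zero i
    · rw [← hr.last_eq_par h hi hu1 hu]
      exact last_occ i _
  · change r.par L u < v at h1
    have := hr.last_eq_par h hi (by omega) hu
    have := le_last (j := u - 1) hv (by omega)
    omega
  · refine le_last hu ?_
    rcases hu with rfl | ⟨-, h2, -⟩ <;> omega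
  · obtain ⟨x, hx⟩ := hfirst i hi
    have hx' := (h.mem_iff x).2 ⟨i, hi, hx⟩
    exact (pos_le hx').1.trans (le_last (h.occ_pos hi hx) (pos_le hx').2)
  · change r.occ L i u ↔ ∃ j < (r.args i).length, pos L ((r.args i).getD j 0) = u
    constructor
    · rintro (rfl | ⟨-, h2, hx⟩)
      · omega
      · obtain ⟨j, hj, hjx⟩ := List.getElem_of_mem hx
        exact ⟨j, hj, by rw [List.getD_eq_getElem _ _ hj, hjx, pos_var h.nodup h1 h2]⟩
    · rintro ⟨j, hj, rfl⟩
      rw [List.getD_eq_getElem _ _ hj]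
      exact h.occ_pos hi (List.getElem_mem hj)
  · change j < (r.args i).length at hj
    change 1 ≤ pos L ((r.args i).getD j 0) ∧ pos L ((r.args i).getD j 0) ≤ L.length
    rw [List.getD_eq_getElem _ _ hj]
    exact pos_le ((h.mem_iff _).2 ⟨i, hi, List.getElem_mem hj⟩)
  · refine le_trans ?_ hn
    unfold names
    rw [List.length_flatMap]
    exact List.single_le_sum (by simp) _ (List.mem_map.2 ⟨i, List.mem_range.2 hi, rfl⟩)
  · change u ∈ r.head.map (pos L) ↔ 1 ≤ u ∧ u ≤ (L.filter fun x => x ∉ r.quant).length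
    rw [List.mem_map]
    constructor
    · rintro ⟨x, hx, rfl⟩
      rw [hr.mem_head, ← h.mem_iff] at hx
      have := pos_le hx.1
      refine ⟨this.1, (h.free_iff this.1 this.2).1 ?_⟩
      rw [var_pos hx.1]
      exact hx.2
    · rintro ⟨h1, h2⟩
      have h3 : u ≤ L.length := h2.trans (List.length_filter_le _ _)
      refine ⟨var L u, ?_, pos_var h.nodup h1 h3⟩
      rw [hr.mem_head, ← h.mem_iff]
      exact ⟨var_mem h1 h3, (h.free_iff h1 h3).2 h2⟩

end Raw

/-! ### Frame conditions for programs that consume input -/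

/-- `s'` differs from `s` at most in the memory, the input and the registers `lo, …, hi`. -/
def RFrame (lo hi : ℕ) (s s' : State) : Prop :=
  s'.buf = s.buf ∧ ∀ r, r < lo ∨ hi < r → s'.reg r = s.reg r

theorem Frame.rframe {lo hi : ℕ} {s s' : State} (h : Frame lo hi s s') : RFrame lo hi s s' := h.2

theorem RFrame.trans {lo hi : ℕ} {s s' s'' : State} (h : RFrame lo hi s s')
    (h' : RFrame lo hi s' s'') : RFrame lo hi s s'' :=
  ⟨h'.1.trans h.1, fun r hr => (h'.2 r hr).trans (h.2 r hr)⟩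

theorem RFrame.weaken {lo hi lo' hi' : ℕ} {s s' : State} (h : RFrame lo hi s s') (h1 : lo' ≤ lo)
    (h2 : hi ≤ hi') : RFrame lo' hi' s s' := ⟨h.1, fun r hr => h.2 r (by omega)⟩

@[simp] theorem rframe_setReg {lo hi : ℕ} {s s' : State} {r v : ℕ} (h1 : lo ≤ r) (h2 : r ≤ hi) :
    RFrame lo hi s (s'.setReg r v) ↔ RFrame lo hi s s' := by
  have : ∀ r', r' < lo ∨ hi < r' → (s'.setReg r v).reg r' = s'.reg r' := fun r' hr => by
    rw [State.setReg_reg, if_neg (by omega)]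
  constructor
  · exact fun h => ⟨h.1, fun r' hr => by rw [← this r' hr, h.2 r' hr]⟩
  · exact fun h => ⟨h.1, fun r' hr => by rw [this r' hr, h.2 r' hr]⟩

@[simp] theorem rframe_setMem {lo hi : ℕ} {s s' : State} {a : List ℕ} {v : ℕ} :
    RFrame lo hi s (s'.setMem a v) ↔ RFrame lo hi s s' := Iff.rfl

@[simp] theorem rframe_setInp {lo hi : ℕ} {s s' : State} {l : List ℕ} :
    RFrame lo hi s (s'.setInp l) ↔ RFrame lo hi s s' := Iff.rfl

@[simp] theorem rframe_self (lo hi : ℕ) (s : State) : RFrame lo hi s s := ⟨rfl, fun _ _ => rfl⟩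

theorem exec_readProg_append {Γ : Ctx} {s : State} {t : ℕ} {l rest : List ℕ} (hp : Γ.prot ≤ 0)
    (ht : t ≤ 100) (h6 : s.reg 6 = l.length) (hi : s.inp = l ++ rest) :
    Exec Γ (readProg t) s (62 * l.length + 30) fun s' => RFrame 8 9 s s' ∧ s'.inp = rest ∧
      (∀ a : List ℕ, a.headD 0 ≠ t → s'.mem a = s.mem a) ∧
      ∀ j < l.length, s'.mem [t, j] = l.getD j 0 := by
  refine (exec_readProg hp ht h6).imp le_rfl ?_
  rintro s' - ⟨hf, hm, hv⟩
  refine ⟨hf.rframe, by simpa [hi] using hf.1, fun a ha => hm a ?_, fun j hj => ?_⟩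
  · rintro j - rfl
    simp at ha
  · rw [hv j hj, hi, List.getD_append _ _ _ _ hj]

/-! ### Reading the query -/

/-- The words that describe the query, and the arities of the relation symbols. -/
def Raw.code (r : Raw) (ars : List ℕ) : List ℕ :=
  (ars.length :: ars) ++ ((r.quant.length :: r.quant) ++ (r.head.length :: r.head) ++
    (r.d :: (List.range r.d).flatMap fun i => r.rel i :: r.args i))

/-- The query is stored in memory. -/
structure Raw.Loaded (r : Raw) (ars : List ℕ) (mem : List ℕ → ℕ) : Prop where
  ar_eq : ∀ R < ars.length, mem [0, R] = ars.getD R 0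
  len_eq : ∀ i < r.d, mem [1, r.rel i] = (r.args i).length
  len_zero : ∀ R, (∀ i < r.d, r.rel i ≠ R) → mem [1, R] = 0
  isq_eq : ∀ x, mem [2, x] = r.isq x
  head_eq : ∀ h < r.head.length, mem [3, h] = r.head.getD h 0
  arg_eq : ∀ i < r.d, ∀ j < (r.args i).length, mem [4, i, j] = (r.args i).getD j 0
  rel_eq : ∀ i < r.d, mem [6, i] = r.rel i
  occ_eq : ∀ i < r.d, ∀ x, mem [7, i, x] = r.inAtom i x
  d_eq : mem [12, 0] = r.d
  nh_eq : mem [12, 3] = r.head.length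

theorem Raw.Loaded.congr {r : Raw} {ars : List ℕ} {mem mem' : List ℕ → ℕ} (h : r.Loaded ars mem)
    (he : ∀ a : List ℕ, a.headD 0 < 8 → a.headD 0 ≠ 5 → mem' a = mem a)
    (h0 : mem' [12, 0] = mem [12, 0]) (h3 : mem' [12, 3] = mem [12, 3]) : r.Loaded ars mem' := by
  constructor
  · intro R hR; rw [he _ (by simp) (by simp), h.ar_eq R hR]
  · intro i hi; rw [he _ (by simp) (by simp), h.len_eq i hi]
  · intro R hR; rw [he _ (by simp) (by simp), h.len_zero R hR]
  · intro x; rw [he _ (by simp) (by simp), h.isq_eq x]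
  · intro i hi; rw [he _ (by simp) (by simp), h.head_eq i hi]
  · intro i hi j hj; rw [he _ (by simp) (by simp), h.arg_eq i hi j hj]
  · intro i hi; rw [he _ (by simp) (by simp), h.rel_eq i hi]
  · intro i hi x; rw [he _ (by simp) (by simp), h.occ_eq i hi x]
  · rw [h0, h.d_eq]
  · rw [h3, h.nh_eq]

def loadQuantProg : Program :=
  .while (.lt (.reg 8) (.reg 6)) <|
    blk [.read 9, .st 2 [.reg 9] (.lit 1), .op .add 8 (.reg 8) (.lit 1)]

theorem exec_loadQuantProg {Γ : Ctx} {s : State} {l rest : List ℕ} (hp : Γ.prot ≤ 0)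
    (h6 : s.reg 6 = l.length) (h8 : s.reg 8 = 0) (hi : s.inp = l ++ rest) :
    Exec Γ loadQuantProg s (62 * l.length + 1) fun s' => RFrame 8 9 s s' ∧ s'.inp = rest ∧
      (∀ a : List ℕ, a.headD 0 ≠ 2 → s'.mem a = s.mem a) ∧
      ∀ x, s'.mem [2, x] = if x ∈ l then 1 else s.mem [2, x] := by
  refine Exec.ok fun ho₀ => ?_
  have hn := ho₀.1.1 6
  rw [h6] at hn
  refine (Exec.while_count (fun j s' => RFrame 8 9 s s' ∧ s'.inp = l.drop j ++ rest ∧ s'.reg 8 = j ∧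
      (∀ a : List ℕ, a.headD 0 ≠ 2 → s'.mem a = s.mem a) ∧
      ∀ x, s'.mem [2, x] = if x ∈ l.take j then 1 else s.mem [2, x]) l.length 61 ?_ ?_ ?_).imp
      (by omega) ?_
  · rintro j s' - ⟨hf, -, hj, -⟩
    simp [Test.holds, hj, hf.2 6 (by omega), h6]
  · rintro j s' ho hj ⟨hf, hin, h8', hm, hv⟩
    rw [List.drop_eq_getElem_cons hj, List.cons_append] at hin
    have htk : ∀ x, x ∈ l.take (j + 1) ↔ x ∈ l.take j ∨ x = l[j] := fun x => by
      rw [List.take_succ_eq_append_getElem hj, List.mem_append, List.mem_singleton]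
    generalize hy : l[j] = y at hin htk
    refine Exec.blk 0 hp (by decide) fun _ => ⟨by simp [h8']; omega, fun _ => ?_⟩
    generalize hs₂ : runs _ _ = s₂
    simp [hin, h8'] at hs₂
    subst hs₂
    refine ⟨by simp [hf], by simp, by simp, fun a ha => ?_, fun x => ?_⟩
    · simp only [State.setReg_mem]
      rw [State.setMem_mem_ne _ (t := 2) _ _ ha]
      exact hm a ha
    · by_cases h : x = y <;> simp [h, htk, hv]
  · exact ⟨by simp, by simp [hi], h8, fun _ _ => rfl, by simp⟩
  · rintro s' - ⟨hf, hin, -, hm, hv⟩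
    exact ⟨hf, by simpa using hin, hm, by simpa using hv⟩

def loadArgsProg : Program :=
  .while (.lt (.reg 8) (.reg 6)) <|
    blk [.read 9, .st 4 [.reg 7, .reg 8] (.reg 9), .st 7 [.reg 7, .reg 9] (.lit 1),
      .op .add 8 (.reg 8) (.lit 1)]

theorem exec_loadArgsProg {Γ : Ctx} {s : State} {i : ℕ} {l rest : List ℕ} (hp : Γ.prot ≤ 0)
    (h6 : s.reg 6 = l.length) (h7 : s.reg 7 = i) (h8 : s.reg 8 = 0) (hi : s.inp = l ++ rest) :
    Exec Γ loadArgsProg s (82 * l.length + 1) fun s' => RFrame 8 9 s s' ∧ s'.inp = rest ∧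
      (∀ a, (∀ j, a ≠ [4, i, j]) → (∀ x, a ≠ [7, i, x]) → s'.mem a = s.mem a) ∧
      (∀ j < l.length, s'.mem [4, i, j] = l.getD j 0) ∧
      ∀ x, s'.mem [7, i, x] = if x ∈ l then 1 else s.mem [7, i, x] := by
  refine Exec.ok fun ho₀ => ?_
  have hn := ho₀.1.1 6
  rw [h6] at hn
  refine (Exec.while_count (fun j s' => RFrame 8 9 s s' ∧ s'.inp = l.drop j ++ rest ∧ s'.reg 8 = j ∧
      (∀ a, (∀ j, a ≠ [4, i, j]) → (∀ x, a ≠ [7, i, x]) → s'.mem a = s.mem a) ∧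
      (∀ k < j, s'.mem [4, i, k] = l.getD k 0) ∧
      ∀ x, s'.mem [7, i, x] = if x ∈ l.take j then 1 else s.mem [7, i, x]) l.length 81 ?_ ?_ ?_).imp
      (by omega) ?_
  · rintro j s' - ⟨hf, -, hj, -⟩
    simp [Test.holds, hj, hf.2 6 (by omega), h6]
  · rintro j s' ho hj ⟨hf, hin, h8', hm, hv, hv'⟩
    have r7 := (hf.2 7 (by omega)).trans h7
    rw [List.drop_eq_getElem_cons hj, List.cons_append] at hin
    have htk : ∀ x, x ∈ l.take (j + 1) ↔ x ∈ l.take j ∨ x = l[j] := fun x => by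
      rw [List.take_succ_eq_append_getElem hj, List.mem_append, List.mem_singleton]
    generalize hy : l[j] = y at hin htk
    refine Exec.blk 0 hp (by decide) fun _ => ⟨by simp [h8']; omega, fun _ => ?_⟩
    generalize hs₂ : runs _ _ = s₂
    simp [hin, h8', r7] at hs₂
    subst hs₂
    refine ⟨by simp [hf], by simp, by simp, fun a h4 h7 => ?_, fun k hk => ?_, fun x => ?_⟩
    · simp [h4, h7]
      exact hm a h4 h7
    · simp
      split_ifs with h
      · subst h; simp [hj, hy]
      · rw [hv k (by omega), List.getD_eq_getElem?_getD]
    · by_cases h : x = y <;> simp [h, htk, hv']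
  · exact ⟨by simp, by simp [hi], h8, fun _ _ _ => rfl, by simp, by simp⟩
  · rintro s' - ⟨hf, hin, -, hm, hv, hv'⟩
    exact ⟨hf, by simpa using hin, hm, hv, by simpa using hv'⟩

def loadAtomsProg : Program :=
  .while (.lt (.reg 7) (.reg 1)) <|
    .seq (blk [.read 5, .st 6 [.reg 7] (.reg 5), .ld 6 0 [.reg 5], .st 1 [.reg 5] (.reg 6),
      .set 8 (.lit 0)]) <|
    .seq loadArgsProg <|
    blk [.op .add 7 (.reg 7) (.lit 1)]

theorem exec_loadAtomsProg {Γ : Ctx} {s : State} {r : Raw} {n : ℕ} {rest : List ℕ}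
    (hp : Γ.prot ≤ 0) (h1 : s.reg 1 = r.d) (h7 : s.reg 7 = 0)
    (hi : s.inp = ((List.range r.d).flatMap fun i => r.rel i :: r.args i) ++ rest)
    (har : ∀ i < r.d, s.mem [0, r.rel i] = (r.args i).length)
    (hn : ∀ i < r.d, (r.args i).length ≤ n) (hz : ∀ R, s.mem [1, R] = 0)
    (hz' : ∀ i x, s.mem [7, i, x] = 0) :
    Exec Γ loadAtomsProg s (r.d * (82 * n + 150) + 1) fun s' => RFrame 5 9 s s' ∧ s'.inp = rest ∧
      (∀ a : List ℕ, a.headD 0 ≠ 1 → a.headD 0 ≠ 4 → a.headD 0 ≠ 6 → a.headD 0 ≠ 7 →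
        s'.mem a = s.mem a) ∧
      (∀ i < r.d, s'.mem [6, i] = r.rel i ∧ s'.mem [1, r.rel i] = (r.args i).length ∧
        (∀ j < (r.args i).length, s'.mem [4, i, j] = (r.args i).getD j 0) ∧
        ∀ x, s'.mem [7, i, x] = r.inAtom i x) ∧
      ∀ R, (∀ i < r.d, r.rel i ≠ R) → s'.mem [1, R] = 0 := by
  refine Exec.ok fun ho₀ => ?_
  have hdB := ho₀.1.1 1
  rw [h1] at hdB
  refine (Exec.while_count (fun k s' => RFrame 5 9 s s' ∧ s'.reg 7 = k ∧
      s'.inp = (((List.range r.d).drop k).flatMap fun i => r.rel i :: r.args i) ++ rest ∧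
      (∀ a : List ℕ, a.headD 0 ≠ 1 → a.headD 0 ≠ 4 → a.headD 0 ≠ 6 → a.headD 0 ≠ 7 →
        s'.mem a = s.mem a) ∧
      (∀ i < k, s'.mem [6, i] = r.rel i ∧ s'.mem [1, r.rel i] = (r.args i).length ∧
        (∀ j < (r.args i).length, s'.mem [4, i, j] = (r.args i).getD j 0) ∧
        ∀ x, s'.mem [7, i, x] = r.inAtom i x) ∧
      (∀ R, (∀ i < k, r.rel i ≠ R) → s'.mem [1, R] = 0) ∧
      ∀ i ≥ k, ∀ x, s'.mem [7, i, x] = 0) r.d (82 * n + 149) ?_ ?_ ?_).imp le_rfl ?_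
  · rintro j s' - ⟨hf, hj, -⟩
    simp [Test.holds, hj, hf.2 1 (by omega), h1]
  · rintro k s' ho hk ⟨hf, h7', hin, hm, hv, hR, hz⟩
    rw [List.drop_eq_getElem_cons (by simpa using hk), List.getElem_range, List.flatMap_cons,
      List.append_assoc] at hin
    have hln := hn k hk
    refine Exec.mono (Exec.blk_seq 0 hp (by decide) (T := 82 * n + 30)
      fun _ => ⟨by simp, fun _ => ?_⟩) (by simp; omega)
    generalize hs₂ : runs _ _ = s₂
    simp [hin, h7', hm [0, r.rel k] (by simp) (by simp) (by simp) (by simp), har k hk] at hs₂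
    have q6 : s₂.reg 6 = (r.args k).length := by subst hs₂; simp
    have q7 : s₂.reg 7 = k := by subst hs₂; simp [h7']
    have q8 : s₂.reg 8 = 0 := by subst hs₂; simp
    have qf : RFrame 5 9 s s₂ := by subst hs₂; simp [hf]
    have qi : s₂.inp = r.args k ++ ((((List.range r.d).drop (k + 1)).flatMap
      fun i => r.rel i :: r.args i) ++ rest) := by subst hs₂; simp
    have qm : ∀ a : List ℕ, a.headD 0 ≠ 1 → a.headD 0 ≠ 6 → s₂.mem a = s'.mem a := fun a h1 h6 => by
      subst hs₂
      simp only [State.setReg_mem]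
      rw [State.setMem_mem_ne _ (t := 1) _ _ h1]
      simp only [State.setReg_mem]
      rw [State.setMem_mem_ne _ (t := 6) _ _ h6]
      rfl
    have qm1 : ∀ R, s₂.mem [1, R] = if R = r.rel k then (r.args k).length else s'.mem [1, R] := by
      intro R; subst hs₂; simp
    have qm6 : ∀ i, s₂.mem [6, i] = if i = k then r.rel k else s'.mem [6, i] := by
      intro i; subst hs₂; simp
    refine Exec.mono (Exec.seq' (exec_loadArgsProg hp q6 q7 q8 qi) (T₂ := 21) ?_) (by omega)
    rintro s₃ - ⟨hf₃, hi₃, hm₃, hv₃, hx₃⟩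
    have r7 := (hf₃.2 7 (by omega)).trans q7
    refine Exec.blk 0 hp (by decide) fun _ => ⟨by simp [r7]; omega, fun _ => ?_⟩
    generalize hs₄ : runs _ _ = s₄
    simp [r7] at hs₄
    have hm₄ : s₄.mem = s₃.mem := by subst hs₄; rfl
    refine ⟨?_, by subst hs₄; simp, by subst hs₄; simpa using hi₃, fun a h1 h4 h6 h7 => ?_,
      fun i hik => ?_, fun R hRk => ?_, fun i hik x => ?_⟩
    · subst hs₄
      simp [qf.trans (hf₃.weaken (by omega) (by omega))]
    · rw [hm₄, hm₃ a (by rintro j rfl; simp at h4) (by rintro j rfl; simp at h7), qm a h1 h6,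
        hm a h1 h4 h6 h7]
    · rw [hm₄, hm₃ [6, i] (by simp) (by simp), hm₃ [1, _] (by simp) (by simp), qm1, qm6]
      by_cases hki : i = k
      · subst hki
        refine ⟨by simp, by simp, hv₃, fun x => ?_⟩
        rw [hx₃, qm _ (by simp) (by simp), hz i le_rfl]
        rfl
      · have h1 := hv i (by omega)
        refine ⟨by rw [if_neg hki, h1.1], ?_, fun j hj => ?_, fun x => ?_⟩
        -- An earlier atom with the same symbol has its entry overwritten, but by the same arity, as
        -- both come from array 0.
        · split_ifs with hc
          · rw [← har k hk, ← hc, har i (by omega)]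
          · exact h1.2.1
        · rw [hm₃ _ (by simp; omega) (by simp), qm _ (by simp) (by simp), h1.2.2.1 j hj]
        · rw [hm₃ _ (by simp) (by simp; omega), qm _ (by simp) (by simp), h1.2.2.2 x]
    · rw [hm₄, hm₃ _ (by simp) (by simp), qm1, if_neg (fun h => hRk k (by omega) h.symm)]
      exact hR R fun i hi => hRk i (by omega)
    · rw [hm₄, hm₃ _ (by simp) (by simp; omega), qm _ (by simp) (by simp), hz i (by omega)]
  · exact ⟨by simp, h7, by simp [hi], fun _ _ _ _ _ => rfl, by simp, fun R _ => hz R,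
      fun i _ x => hz' i x⟩
  · rintro s' - ⟨hf, -, hin, hm, hv, hR, -⟩
    rw [List.drop_of_length_le (by simp)] at hin
    exact ⟨hf, by simpa using hin, hm, hv, hR⟩

/-- Reading the schema and the query. -/
def loadProg : Program :=
  .seq (blk [.read 6]) <| .seq (readProg 0) <|
  .seq (blk [.read 6, .set 8 (.lit 0)]) <| .seq loadQuantProg <|
  .seq (blk [.read 6, .st 12 [.lit 3] (.reg 6)]) <| .seq (readProg 3) <|
  .seq (blk [.read 1, .st 12 [.lit 0] (.reg 1), .set 7 (.lit 0)]) loadAtomsProg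

/-- Only positive information is written. That the entries of unused symbols, free variables and
missing occurrences are `0` comes from the initial state of the arrays. -/
theorem exec_loadProg {Γ : Ctx} {s : State} {r : Raw} {n : ℕ} {ars rest : List ℕ}
    (hp : Γ.prot ≤ 0) (hs : ∀ a, s.mem a = 0) (hi : s.inp = r.code ars ++ rest)
    (har : ∀ i < r.d, r.rel i < ars.length ∧ ars.getD (r.rel i) 0 = (r.args i).length)
    (hn : ∀ i < r.d, (r.args i).length ≤ n) :
    Exec Γ loadProg s (62 * ars.length + 62 * r.quant.length + 62 * r.head.length +
        r.d * (82 * n + 150) + 400) fun s' => s'.inp = rest ∧ s'.reg 1 = r.d ∧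
      r.Loaded ars s'.mem ∧
      ∀ a : List ℕ, a.headD 0 = 5 ∨ 8 ≤ a.headD 0 ∧ a.headD 0 ≠ 12 → s'.mem a = 0 := by
  unfold Raw.code at hi
  simp only [List.cons_append, List.append_assoc] at hi
  refine Exec.mono (Exec.blk_seq 0 hp (by decide) (T := 62 * ars.length + 62 * r.quant.length +
    62 * r.head.length + r.d * (82 * n + 150) + 360) fun _ => ⟨by simp, fun _ => ?_⟩) (by simp; omega)
  generalize hs₁ : runs _ _ = s₁
  simp [hi] at hs₁
  have m₁ : s₁.mem = s.mem := by subst hs₁; rfl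
  refine Exec.mono (Exec.seq' (exec_readProg_append (t := 0) hp (by decide) (l := ars) (by subst hs₁; simp)
    (by subst hs₁; simp; rfl)) (T₂ := 62 * r.quant.length + 62 * r.head.length +
      r.d * (82 * n + 150) + 300) ?_) (by omega)
  rintro s₂ - ⟨-, i₂, m₂, v₂⟩
  refine Exec.mono (Exec.blk_seq 0 hp (by decide) (T := 62 * r.quant.length +
    62 * r.head.length + r.d * (82 * n + 150) + 250) fun _ => ⟨by simp, fun _ => ?_⟩) (by simp; omega)
  generalize hs₃ : runs _ _ = s₃
  simp [i₂] at hs₃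
  have m₃ : s₃.mem = s₂.mem := by subst hs₃; rfl
  refine Exec.mono (Exec.seq' (exec_loadQuantProg hp (l := r.quant) (by subst hs₃; simp)
    (by subst hs₃; simp) (by subst hs₃; simp; rfl)) (T₂ := 62 * r.head.length +
      r.d * (82 * n + 150) + 240) ?_) (by omega)
  rintro s₄ - ⟨-, i₄, m₄, v₄⟩
  refine Exec.mono (Exec.blk_seq 0 hp (by decide) (T := 62 * r.head.length +
    r.d * (82 * n + 150) + 180) fun _ => ⟨by simp, fun _ => ?_⟩) (by simp; omega)
  generalize hs₅ : runs _ _ = s₅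
  simp [i₄] at hs₅
  have m₅ : ∀ a : List ℕ, a.headD 0 ≠ 12 → s₅.mem a = s₄.mem a := fun a ha => by
    subst hs₅; rw [State.setMem_mem_ne _ (t := 12) _ _ ha]; rfl
  have v₅ : s₅.mem [12, 3] = r.head.length := by subst hs₅; simp
  refine Exec.mono (Exec.seq' (exec_readProg_append (t := 3) hp (by decide) (l := r.head)
    (by subst hs₅; simp) (by subst hs₅; simp; rfl)) (T₂ := r.d * (82 * n + 150) + 100) ?_)
    (by omega)
  rintro s₆ - ⟨-, i₆, m₆, v₆⟩
  refine Exec.mono (Exec.blk_seq 0 hp (by decide) (T := r.d * (82 * n + 150) + 1)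
    fun _ => ⟨by simp, fun _ => ?_⟩) (by simp; omega)
  generalize hs₇ : runs _ _ = s₇
  simp [i₆] at hs₇
  have m₇ : ∀ a : List ℕ, a ≠ [12, 0] → s₇.mem a = s₆.mem a := fun a ha => by
    subst hs₇; simp [ha]
  have v₇ : s₇.mem [12, 0] = r.d := by subst hs₇; simp
  have q1 : s₇.reg 1 = r.d := by subst hs₇; simp
  have M : ∀ a : List ℕ, a.headD 0 ≠ 0 → a.headD 0 ≠ 2 → a.headD 0 ≠ 3 → a.headD 0 ≠ 12 →
      s₇.mem a = 0 := fun a h0 h2 h3 h12 => by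
    rw [m₇ a (by rintro rfl; simp at h12), m₆ a h3, m₅ a h12, m₄ a h2, m₃, m₂ a h0, m₁, hs]
  have A : ∀ R < ars.length, s₇.mem [0, R] = ars.getD R 0 := fun R hR => by
    rw [m₇ _ (by simp), m₆ _ (by simp), m₅ _ (by simp), m₄ _ (by simp), m₃, v₂ R hR]
  refine (exec_loadAtomsProg (r := r) (n := n) (rest := rest) hp q1 (by subst hs₇; simp)
    (by subst hs₇; simp) (fun i hi => ?_) hn (fun R => M _ (by simp) (by simp) (by simp) (by simp))
    fun i x => M _ (by simp) (by simp) (by simp) (by simp)).imp le_rfl ?_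
  · rw [A _ (har i hi).1, (har i hi).2]
  rintro s₈ - ⟨f₈, i₈, m₈, v₈, z₈⟩
  refine ⟨i₈, (f₈.2 1 (by omega)).trans q1, ⟨fun R hR => ?_, fun i hi => (v₈ i hi).2.1, z₈,
    fun x => ?_, fun h hh => ?_, fun i hi => (v₈ i hi).2.2.1, fun i hi => (v₈ i hi).1,
    fun i hi => (v₈ i hi).2.2.2, ?_, ?_⟩, fun a ha => ?_⟩
  · rw [m₈ _ (by simp) (by simp) (by simp) (by simp), A R hR]
  · rw [m₈ _ (by simp) (by simp) (by simp) (by simp), m₇ _ (by simp), m₆ _ (by simp),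
      m₅ _ (by simp), v₄, m₃, m₂ _ (by simp), m₁, hs]
    rfl
  · rw [m₈ _ (by simp) (by simp) (by simp) (by simp), m₇ _ (by simp), v₆ h hh]
  · rw [m₈ _ (by simp) (by simp) (by simp) (by simp), v₇]
  · rw [m₈ _ (by simp) (by simp) (by simp) (by simp), m₇ _ (by simp), m₆ _ (by simp), v₅]
  · rw [m₈ _ (by omega) (by omega) (by omega) (by omega),
      M a (by omega) (by omega) (by omega) (by omega)]

/-! ### Sorting the variables -/

namespace Raw

variable {r : Raw} {L : List ℕ}

/-- Append `x` if its rank is `ρ`. -/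
def place (r : Raw) (ρ : ℕ) (L : List ℕ) (x : ℕ) : List ℕ :=
  if x ∈ L ∨ r.rk x ≠ ρ then L else L ++ [x]

/-- The variables of rank less than `k`. -/
def order (r : Raw) (k : ℕ) : List ℕ :=
  (List.range k).foldl (fun L ρ => r.names.foldl (r.place ρ) L) []

theorem mem_foldl_place (ρ : ℕ) (l : List ℕ) (L : List ℕ) (x : ℕ) :
    x ∈ l.foldl (r.place ρ) L ↔ x ∈ L ∨ x ∈ l ∧ r.rk x = ρ := by
  induction l generalizing L with
  | nil => simp
  | cons y l ih =>
    rw [List.foldl_cons, ih]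
    unfold place
    split_ifs with h
    · rw [List.mem_cons]
      constructor
      · rintro (h1 | h1)
        exacts [Or.inl h1, Or.inr ⟨Or.inr h1.1, h1.2⟩]
      · rintro (h1 | ⟨rfl | h1, h2⟩)
        · exact Or.inl h1
        · rcases h with h | h
          exacts [Or.inl h, absurd h2 h]
        · exact Or.inr ⟨h1, h2⟩
    · push Not at h
      rw [List.mem_append, List.mem_singleton, List.mem_cons]
      constructor
      · rintro ((h1 | rfl) | h1)
        exacts [Or.inl h1, Or.inr ⟨Or.inl rfl, h.2⟩, Or.inr ⟨Or.inr h1.1, h1.2⟩]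
      · rintro (h1 | ⟨rfl | h1, h2⟩)
        exacts [Or.inl (Or.inl h1), Or.inl (Or.inr rfl), Or.inr ⟨h1, h2⟩]

theorem nodup_place {ρ x : ℕ} (h : L.Nodup) : (r.place ρ L x).Nodup := by
  unfold place
  split_ifs with hc
  · exact h
  · push Not at hc
    exact List.nodup_append.2 ⟨h, by simp, fun a ha b hb hab => hc.1 (by
      rw [List.mem_singleton] at hb
      rw [← hb, ← hab]
      exact ha)⟩

theorem nodup_foldl_place (ρ : ℕ) (l : List ℕ) (h : L.Nodup) : (l.foldl (r.place ρ) L).Nodup := by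
  induction l generalizing L with
  | nil => exact h
  | cons y l ih => exact ih (nodup_place h)

theorem sorted_foldl_place (ρ : ℕ) (l : List ℕ) (h : L.Pairwise fun x y => r.rk x ≤ r.rk y)
    (hρ : ∀ x ∈ L, r.rk x ≤ ρ) :
    (l.foldl (r.place ρ) L).Pairwise fun x y => r.rk x ≤ r.rk y := by
  induction l generalizing L with
  | nil => exact h
  | cons y l ih =>
    rw [List.foldl_cons]
    unfold place
    split_ifs with hc
    · exact ih h hρ
    · push Not at hc
      refine ih (List.pairwise_append.2 ⟨h, by simp, fun a ha b hb => ?_⟩) fun x hx => ?_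
      · rw [List.mem_singleton] at hb
        rw [hb, hc.2]
        exact hρ a ha
      · rw [List.mem_append, List.mem_singleton] at hx
        rcases hx with hx | rfl
        exacts [hρ x hx, hc.2.le]

theorem order_succ (k : ℕ) : r.order (k + 1) = r.names.foldl (r.place k) (r.order k) := by
  unfold order
  rw [List.range_succ, List.foldl_append, List.foldl_cons, List.foldl_nil]

/-- Sorting by one pass over all occurrences for each possible rank: a pass appends the new
variables of its rank, so the list stays sorted and free of repetitions. -/
theorem order_spec (k : ℕ) : (r.order k).Nodup ∧ (∀ x, x ∈ r.order k ↔ x ∈ r.names ∧ r.rk x < k) ∧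
    (r.order k).Pairwise fun x y => r.rk x ≤ r.rk y := by
  induction k with
  | zero => simp [order]
  | succ k ih =>
    obtain ⟨h1, h2, h3⟩ := ih
    rw [order_succ]
    refine ⟨nodup_foldl_place _ _ h1, fun x => ?_,
      sorted_foldl_place _ _ h3 fun x hx => ((h2 x).1 hx).2.le⟩
    rw [mem_foldl_place, h2]
    constructor
    · rintro (h | h)
      · exact ⟨h.1, by omega⟩
      · exact ⟨h.1, by omega⟩
    · rintro ⟨h, hk⟩
      rcases Nat.lt_or_ge (r.rk x) k with h' | h'
      exacts [Or.inl ⟨h, h'⟩, Or.inr ⟨h, by omega⟩]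

theorem mem_names {x : ℕ} : x ∈ r.names ↔ ∃ i < r.d, x ∈ r.args i := by
  simp [names]

/-- All variables, in the order of their ranks. -/
def vars (r : Raw) : List ℕ := r.order (2 * r.d + 2)

theorem order_vars : r.Order r.vars where
  nodup := (order_spec _).1
  mem_iff x := by
    -- Since `isq` is at most `1`, every rank is at most `2 * d + 1`, and `2 * d + 2` passes
    -- suffice.
    have : r.isq x * (r.d + 1) ≤ 1 * (r.d + 1) := Nat.mul_le_mul_right _ (by
      unfold isq; split_ifs <;> omega)
    have : r.rk x < 2 * r.d + 2 := by unfold rk; omega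
    rw [vars, (order_spec _).2.1, mem_names]
    simp [this]
  sorted := (order_spec _).2.2

end Raw

/-- Register 12 becomes the rank of the variable in register 9. -/
def rankProg : Program :=
  .seq (blk [.ld 13 2 [.reg 9], .op .add 12 (.reg 1) (.lit 1), .op .mul 12 (.reg 13) (.reg 12),
    .op .add 12 (.reg 12) (.reg 1), .set 13 (.lit 0)]) <|
  .while (.lt (.reg 13) (.reg 1)) <|
    blk [.ld 14 7 [.reg 13, .reg 9], .op .sub 12 (.reg 12) (.reg 14), .op .add 13 (.reg 13) (.lit 1)]

theorem exec_rankProg {Γ : Ctx} {s : State} {r : Raw} {ars : List ℕ} (hp : Γ.prot ≤ 0)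
    (hM : r.Loaded ars s.mem) (h1 : s.reg 1 = r.d) (hB : 2 * r.d + 2 ≤ Γ.B) :
    Exec Γ rankProg s (62 * r.d + 110) fun s' => Frame 12 14 s s' ∧ s'.mem = s.mem ∧
      s'.reg 12 = r.rk (s.reg 9) := by
  have hq : r.isq (s.reg 9) * (r.d + 1) ≤ 1 * (r.d + 1) := Nat.mul_le_mul_right _ (by
    unfold Raw.isq; split_ifs <;> omega)
  refine Exec.mono (Exec.blk_seq 0 hp (by decide) (T := r.d * 62 + 1)
    fun _ => ⟨?_, fun _ => ?_⟩) (by simp; omega)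
  · simp [h1, hM.isq_eq]; omega
  refine (Exec.while_count (fun j s' => Frame 12 14 s s' ∧ s'.mem = s.mem ∧ s'.reg 13 = j ∧
    s'.reg 12 = r.isq (s.reg 9) * (r.d + 1) + r.d - ∑ i ∈ Finset.range j, r.inAtom i (s.reg 9))
    r.d 61 ?_ ?_ ?_).imp le_rfl ?_
  · rintro j s' - ⟨hf, -, hj, -⟩
    simp [Test.holds, hj, hf.2.2 1 (by omega), h1]
  · rintro j s' ho hj ⟨hf, hm, h13, h12⟩
    refine Exec.blk 0 hp (by decide) fun _ => ⟨by simp [h13]; omega, fun _ => ?_⟩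
    simp [hf, hm, h13, h12, hf.2.2 9 (by omega), hM.occ_eq j hj, Finset.sum_range_succ,
      Nat.sub_sub]
  · simp [h1, hM.isq_eq]
  · rintro s' - ⟨hf, hm, -, h12⟩
    exact ⟨hf, hm, h12⟩

/-- The variable in register 9 is given the next position if its rank is in register 10. -/
def placeProg : Program :=
  .seq (blk [.ld 11 5 [.reg 9]]) <|
  .ite (.eq (.reg 11) (.lit 0))
    (.seq rankProg <|
     .ite (.eq (.reg 12) (.reg 10))
      (.seq (blk [.op .add 2 (.reg 2) (.lit 1), .st 8 [.reg 2] (.reg 9), .st 5 [.reg 9] (.reg 2),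
          .ld 11 2 [.reg 9]]) <|
       .ite (.eq (.reg 11) (.lit 0)) (blk [.op .add 3 (.reg 3) (.lit 1)]) (blk []))
      (blk []))
    (blk [])

/-- The state when the variables in the list `L` have been placed. -/
structure SortInv (r : Raw) (s : State) (L : List ℕ) (s' : State) : Prop where
  inp : s'.inp = s.inp
  reg1 : s'.reg 1 = s.reg 1
  nodup : L.Nodup
  sub : ∀ x ∈ L, x ∈ r.names
  m_eq : s'.reg 2 = L.length
  K_eq : s'.reg 3 = (L.filter fun x => x ∉ r.quant).length
  var_eq : ∀ u, 1 ≤ u → u ≤ L.length → s'.mem [8, u] = Raw.var L u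
  pos_eq : ∀ x, s'.mem [5, x] = if x ∈ L then Raw.pos L x else 0
  mem_eq : ∀ a : List ℕ, a.headD 0 ≠ 5 → a.headD 0 ≠ 8 → s'.mem a = s.mem a

theorem SortInv.congr {r : Raw} {s s' s'' : State} {L : List ℕ} (h : SortInv r s L s')
    (hi : s''.inp = s'.inp) (h1 : s''.reg 1 = s'.reg 1) (h2 : s''.reg 2 = s'.reg 2)
    (h3 : s''.reg 3 = s'.reg 3) (hm : s''.mem = s'.mem) : SortInv r s L s'' where
  inp := hi.trans h.inp
  reg1 := h1.trans h.reg1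
  nodup := h.nodup
  sub := h.sub
  m_eq := h2.trans h.m_eq
  K_eq := h3.trans h.K_eq
  var_eq := by rw [hm]; exact h.var_eq
  pos_eq := by rw [hm]; exact h.pos_eq
  mem_eq := by rw [hm]; exact h.mem_eq

/-- Positions start at `1`, so the entry `0` in array 5 means that the variable has not been placed
yet. -/
theorem exec_placeProg {Γ : Ctx} {s s' : State} {r : Raw} {ars L : List ℕ} {x ρ : ℕ}
    (hp : Γ.prot ≤ 0) (hM : r.Loaded ars s.mem) (h1 : s.reg 1 = r.d) (hB : 2 * r.d + 2 ≤ Γ.B)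
    (hB' : r.names.length ≤ Γ.B) (hx : x ∈ r.names) (h9 : s'.reg 9 = x) (h10 : s'.reg 10 = ρ)
    (hI : SortInv r s L s') :
    Exec Γ placeProg s' (62 * r.d + 300) fun s'' => SortInv r s (r.place ρ L x) s'' ∧
      ∀ k, 4 ≤ k → k ≤ 10 ∨ 15 ≤ k → s''.reg k = s'.reg k := by
  have hM' : r.Loaded ars s'.mem := hM.congr (fun a h8 h5 => hI.mem_eq a h5 (by omega))
    (hI.mem_eq _ (by simp) (by simp)) (hI.mem_eq _ (by simp) (by simp))
  refine Exec.mono (Exec.blk_seq 0 hp (by decide) (T := 62 * r.d + 250)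
    fun _ => ⟨by simp, fun _ => ?_⟩) (by simp; omega)
  generalize hs₁ : runs _ _ = s₁
  simp [h9, hI.pos_eq] at hs₁
  have hI₁ : SortInv r s L s₁ := by
    subst hs₁; exact hI.congr rfl (by simp) (by simp) (by simp) rfl
  have f₁ : ∀ k, 4 ≤ k → k ≤ 10 ∨ 15 ≤ k → s₁.reg k = s'.reg k := fun k h1 h2 => by
    subst hs₁; simp; omega
  have q11 : s₁.reg 11 = if x ∈ L then Raw.pos L x else 0 := by subst hs₁; simp
  have hm₁ : s₁.mem = s'.mem := by subst hs₁; rfl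
  clear hs₁
  refine Exec.mono (Exec.ite (T := 62 * r.d + 249) (fun hc => ?_) (fun hc => ?_)) le_rfl
  · have hxL : x ∉ L := fun h => by
      simp [Test.holds, q11, h, Raw.pos] at hc
    refine Exec.mono (Exec.seq' (exec_rankProg hp (by rw [hm₁]; exact hM') (hI₁.reg1.trans h1) hB)
      (T₂ := 110) ?_) (by omega)
    rintro s₂ - ⟨f₂, hm₂, q12⟩
    rw [f₁ 9 (by omega) (by omega), h9] at q12
    have hI₂ : SortInv r s L s₂ := hI₁.congr f₂.1 (f₂.2.2 1 (by omega)) (f₂.2.2 2 (by omega))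
      (f₂.2.2 3 (by omega)) hm₂
    have f₂' : ∀ k, 4 ≤ k → k ≤ 10 ∨ 15 ≤ k → s₂.reg k = s'.reg k := fun k h1 h2 =>
      (f₂.2.2 k (by omega)).trans (f₁ k h1 h2)
    have q9 := (f₂' 9 (by omega) (by omega)).trans h9
    refine Exec.mono (Exec.ite (T := 109) (fun hc => ?_) (fun hc => ?_)) le_rfl
    · simp [Test.holds, q12, f₂' 10, h10] at hc
      have hpl : r.place ρ L x = L ++ [x] := by simp [Raw.place, hxL, hc]
      -- The list with `x` added is free of repetitions and consists of names; this bounds the next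
      -- position by `B`.
      have hlen : L.length + 1 ≤ r.names.length := by
        have := List.Subperm.length_le (List.subperm_of_subset (l₁ := L ++ [x]) (l₂ := r.names)
          (hpl ▸ Raw.nodup_place hI.nodup) fun y hy => by
            rw [List.mem_append, List.mem_singleton] at hy
            rcases hy with hy | rfl
            exacts [hI.sub y hy, hx])
        simpa using this
      refine Exec.mono (Exec.blk_seq 0 hp (by decide) (T := 22)
        fun _ => ⟨by simp [hI₂.m_eq]; omega, fun _ => ?_⟩) (by simp)
      generalize hs₃ : runs _ _ = s₃
      have hq₂ : s₂.mem [2, x] = r.isq x := by rw [hm₂, hm₁]; exact hM'.isq_eq x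
      simp [q9, hI₂.m_eq, hq₂] at hs₃
      have q3 : s₃.reg 3 = (L.filter fun x => x ∉ r.quant).length := by
        rw [← hI₂.K_eq]; subst hs₃; simp
      have q11 : s₃.reg 11 = r.isq x := by subst hs₃; simp
      have f₃ : ∀ k, 4 ≤ k → k ≤ 10 ∨ 15 ≤ k → s₃.reg k = s'.reg k := fun k h1 h2 => by
        rw [← f₂' k h1 h2]
        subst hs₃; simp; split_ifs <;> omega
      have hI₃ : ∀ s₄ : State, s₄.inp = s₃.inp → s₄.reg 1 = s₃.reg 1 → s₄.reg 2 = s₃.reg 2 →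
          s₄.mem = s₃.mem → s₄.reg 3 = ((L ++ [x]).filter fun x => x ∉ r.quant).length →
          SortInv r s (L ++ [x]) s₄ := by
        intro s₄ hi₄ h1₄ h2₄ hm₄ h3₄
        refine ⟨?_, ?_, hpl ▸ Raw.nodup_place hI.nodup, fun y hy => ?_, ?_, h3₄, fun u hu1 hu2 => ?_,
          fun y => ?_, fun a h5 h8 => ?_⟩
        · rw [hi₄, ← hI₂.inp]; subst hs₃; rfl
        · rw [h1₄, ← hI₂.reg1]; subst hs₃; simp
        · rw [List.mem_append, List.mem_singleton] at hy
          rcases hy with hy | rfl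
          exacts [hI.sub y hy, hx]
        · rw [h2₄]; subst hs₃; simp
        · rw [hm₄]
          subst hs₃
          simp at hu2
          simp
          unfold Raw.var
          rcases Nat.lt_or_ge L.length u with h | h
          · obtain rfl : u = L.length + 1 := by omega
            simp
          · rw [if_neg (by omega), List.getD_append _ _ _ _ (by omega)]
            exact hI₂.var_eq u hu1 h
        · rw [hm₄]
          subst hs₃
          simp [hI₂.pos_eq]
          unfold Raw.pos
          by_cases h : y = x
          · subst h
            simp [List.idxOf_append, hxL]
          · simp [h]
            by_cases h' : y ∈ L
            · simp [h', List.idxOf_append]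
            · simp [h']
        · rw [hm₄, ← hI₂.mem_eq a h5 h8]
          subst hs₃
          simp only [State.setReg_mem]
          rw [State.setMem_mem_ne _ (t := 5) _ _ h5, State.setMem_mem_ne _ (t := 8) _ _ h8]
          rfl
      rw [hpl]
      refine Exec.mono (Exec.ite (T := 21) (fun hc => ?_) (fun hc => ?_)) le_rfl
      · simp [Test.holds, q11, Raw.isq] at hc
        refine Exec.blk 0 hp (by decide) fun _ => ⟨?_, fun _ => ⟨hI₃ _ rfl (by simp) (by simp) rfl ?_,
          fun k h1 h2 => ?_⟩⟩
        · have := List.length_filter_le (fun x => decide (x ∉ r.quant)) L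
          simp only [fits, Cmd.fits, Operand.val, q3]
          exact ⟨by omega, trivial⟩
        · simp [q3, hc]
        · rw [← f₃ k h1 h2]; simp; omega
      · simp [Test.holds, q11, Raw.isq] at hc
        refine (Exec.skip ?_).mono (by omega)
        exact ⟨hI₃ _ rfl rfl rfl rfl (by simp [q3, hc]), f₃⟩
    · simp [Test.holds, q12, f₂' 10, h10] at hc
      refine (Exec.skip ?_).mono (by omega)
      have : r.place ρ L x = L := by simp [Raw.place, hc]
      rw [this]
      exact ⟨hI₂, f₂'⟩
  · have hxL : x ∈ L := by
      by_contra h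
      simp [Test.holds, q11, h] at hc
    refine (Exec.skip ?_).mono (by omega)
    have : r.place ρ L x = L := by simp [Raw.place, hxL]
    rw [this]
    exact ⟨hI₁, f₁⟩

/-- All variables are placed in the order of their ranks. -/
def sortProg : Program :=
  .seq (blk [.set 2 (.lit 0), .set 3 (.lit 0), .set 10 (.lit 0), .op .add 15 (.reg 1) (.lit 1),
    .op .add 15 (.reg 15) (.reg 15)]) <|
  .while (.lt (.reg 10) (.reg 15)) <|
    .seq (blk [.set 7 (.lit 0)]) <|
    .seq (.while (.lt (.reg 7) (.reg 1)) <|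
      .seq (blk [.ld 6 6 [.reg 7], .ld 6 1 [.reg 6], .set 8 (.lit 0)]) <|
      .seq (.while (.lt (.reg 8) (.reg 6)) <|
        .seq (blk [.ld 9 4 [.reg 7, .reg 8]]) <| .seq placeProg <|
        blk [.op .add 8 (.reg 8) (.lit 1)]) <|
      blk [.op .add 7 (.reg 7) (.lit 1)]) <|
    blk [.op .add 10 (.reg 10) (.lit 1)]

set_option maxRecDepth 10000 in
theorem exec_sortProg {Γ : Ctx} {s : State} {r : Raw} {ars : List ℕ} {n : ℕ} (hp : Γ.prot ≤ 0)
    (hM : r.Loaded ars s.mem) (h1 : s.reg 1 = r.d) (hB : 2 * r.d + 2 ≤ Γ.B)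
    (hB' : r.names.length ≤ Γ.B) (hn : ∀ i < r.d, (r.args i).length ≤ n)
    (hz : ∀ x, s.mem [5, x] = 0) :
    Exec Γ sortProg s ((2 * r.d + 2) * (r.d * (n * (62 * r.d + 400) + 150) + 60) + 110)
      fun s' => SortInv r s r.vars s' := by
  refine Exec.mono (Exec.blk_seq 0 hp (by decide)
    (T := (2 * r.d + 2) * (r.d * (n * (62 * r.d + 400) + 150) + 60) + 1)
    fun _ => ⟨by simp [h1]; omega, fun _ => ?_⟩) (by simp; omega)
  refine (Exec.while_count (fun ρ s' => SortInv r s (r.order ρ) s' ∧ s'.reg 10 = ρ ∧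
    s'.reg 15 = 2 * r.d + 2) (2 * r.d + 2) (r.d * (n * (62 * r.d + 400) + 150) + 59)
    ?_ ?_ ?_).imp le_rfl ?_
  · rintro j s' - ⟨-, h10, h15⟩
    simp [Test.holds, h10, h15]
  · rintro ρ s' ho hρ ⟨hI, h10, h15⟩
    refine Exec.mono (Exec.blk_seq 0 hp (by decide)
      (T := r.d * (n * (62 * r.d + 400) + 150) + 35)
      fun _ => ⟨by simp, fun _ => ?_⟩) (by simp; omega)
    refine Exec.mono (Exec.seq' (T₁ := r.d * (n * (62 * r.d + 400) + 150) + 1) (T₂ := 21)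
      (Exec.while_count (fun i s' => SortInv r s
        (((List.range i).flatMap r.args).foldl (r.place ρ) (r.order ρ)) s' ∧ s'.reg 10 = ρ ∧
        s'.reg 15 = 2 * r.d + 2 ∧ s'.reg 7 = i) r.d (n * (62 * r.d + 400) + 149) ?_ ?_ ?_) ?_)
      (by omega)
    · rintro i s₁ - ⟨hI₁, -, -, h7⟩
      simp [Test.holds, h7, hI₁.reg1, h1]
    · rintro i s₁ - hi ⟨hI₁, h10₁, h15₁, h7₁⟩
      have hni := hn i hi
      have hlen : s₁.mem [1, s₁.mem [6, i]] = (r.args i).length := by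
        rw [hI₁.mem_eq _ (by simp) (by simp), hI₁.mem_eq _ (by simp) (by simp), hM.rel_eq i hi,
          hM.len_eq i hi]
      refine Exec.mono (Exec.blk_seq 0 hp (by decide) (T := n * (62 * r.d + 400) + 60)
        fun _ => ⟨by simp, fun _ => ?_⟩) (by simp; omega)
      have hmul : (r.args i).length * (62 * r.d + 400) ≤ n * (62 * r.d + 400) :=
        Nat.mul_le_mul_right _ hni
      refine Exec.mono (Exec.seq' (T₁ := (r.args i).length * (62 * r.d + 400) + 1) (T₂ := 21)
        (Exec.while_count (fun j s' => SortInv r s (((r.args i).take j).foldl (r.place ρ)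
          (((List.range i).flatMap r.args).foldl (r.place ρ) (r.order ρ))) s' ∧ s'.reg 10 = ρ ∧
          s'.reg 15 = 2 * r.d + 2 ∧ s'.reg 7 = i ∧ s'.reg 6 = (r.args i).length ∧ s'.reg 8 = j)
          (r.args i).length (62 * r.d + 399) ?_ ?_ ?_) ?_) (by
          generalize (r.args i).length * (62 * r.d + 400) = a at hmul ⊢
          generalize n * (62 * r.d + 400) = b at hmul ⊢
          omega)
      · rintro j s₂ - ⟨-, -, -, -, h6, h8⟩
        simp [Test.holds, h6, h8]
      · rintro j s₂ - hj ⟨hI₂, h10₂, h15₂, h7₂, h6₂, h8₂⟩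
        have hx : s₂.mem [4, i, j] = (r.args i)[j] := by
          rw [hI₂.mem_eq _ (by simp) (by simp), hM.arg_eq i hi j hj, List.getD_eq_getElem _ _ hj]
        refine Exec.mono (Exec.blk_seq 0 hp (by decide) (T := 62 * r.d + 350)
          fun _ => ⟨by simp, fun _ => ?_⟩) (by simp; omega)
        refine Exec.mono (Exec.seq' (exec_placeProg (x := (r.args i)[j]) (ρ := ρ)
          (L := ((r.args i).take j).foldl (r.place ρ)
          (((List.range i).flatMap r.args).foldl (r.place ρ) (r.order ρ))) (s := s) hp hM h1 hB hB'
          (Raw.mem_names.2 ⟨i, hi, List.getElem_mem hj⟩) (by simp [h7₂, h8₂, hx]) (by simp [h10₂])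
          (hI₂.congr rfl (by simp) (by simp) (by simp) rfl)) (T₂ := 21) ?_) (by omega)
        rintro s₃ - ⟨hI₃, f₃⟩
        simp at f₃
        have q6 := f₃ 6 (by omega) (by omega)
        have q7 := f₃ 7 (by omega) (by omega)
        have q8 := f₃ 8 (by omega) (by omega)
        have q10 := f₃ 10 (by omega) (by omega)
        have q15 := f₃ 15 (by omega) (by omega)
        simp at q6 q7 q8 q10 q15
        have hlB := ho.1.1
        refine Exec.ok fun ho₃ => ?_
        have hb := ho₃.1.1 6
        rw [q6, h6₂] at hb
        refine Exec.blk 0 hp (by decide) fun _ => ⟨by simp [q8, h8₂]; omega, fun _ => ?_⟩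
        refine ⟨?_, by simp [q10, h10₂], by simp [q15, h15₂], by simp [q7, h7₂],
          by simp [q6, h6₂], by simp [q8, h8₂]⟩
        rw [List.take_succ_eq_append_getElem hj, List.foldl_append, List.foldl_cons,
          List.foldl_nil]
        exact hI₃.congr rfl (by simp) (by simp) (by simp) rfl
      · refine ⟨?_, by simp [h10₁], by simp [h15₁], by simp [h7₁], by simp [h7₁, hlen], by simp⟩
        simp only [List.take_zero, List.foldl_nil]
        exact hI₁.congr rfl (by simp) (by simp) (by simp) rfl
      · rintro s₂ - ⟨hI₂, h10₂, h15₂, h7₂, -, -⟩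
        refine Exec.blk 0 hp (by decide) fun _ => ⟨by simp [h7₂]; omega, fun _ => ?_⟩
        refine ⟨?_, by simp [h10₂], by simp [h15₂], by simp [h7₂]⟩
        rw [List.range_succ, List.flatMap_append, List.foldl_append, List.flatMap_singleton]
        rw [List.take_length] at hI₂
        exact hI₂.congr rfl (by simp) (by simp) (by simp) rfl
    · refine ⟨?_, by simp [h10], by simp [h15], by simp⟩
      exact hI.congr rfl (by simp) (by simp) (by simp) rfl
    · rintro s₁ - ⟨hI₁, h10₁, h15₁, -⟩
      refine Exec.blk 0 hp (by decide) fun _ => ⟨by simp [h10₁]; omega, fun _ => ?_⟩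
      refine ⟨?_, by simp [h10₁], by simp [h15₁]⟩
      rw [Raw.order_succ]
      exact hI₁.congr rfl (by simp) (by simp) (by simp) rfl
  · refine ⟨⟨rfl, by simp, by simp [Raw.order], by simp [Raw.order], by simp [Raw.order],
      by simp [Raw.order], by simp [Raw.order]; omega, by simp [Raw.order, hz], fun _ _ _ => rfl⟩,
      by simp, by simp [h1]; omega⟩
  · rintro s' - ⟨hI, -, -⟩
    exact hI

/-! ### The forest of positions -/

/-- The predecessors of the positions, and the last positions of the atoms. -/
def parProg : Program :=
  .seq (blk [.set 7 (.lit 0)]) <|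
  .while (.lt (.reg 7) (.reg 1)) <|
    .seq (blk [.set 10 (.lit 0), .set 8 (.lit 0)]) <|
    .seq (.while (.lt (.reg 8) (.reg 2)) <|
      .seq (blk [.op .add 8 (.reg 8) (.lit 1), .ld 9 8 [.reg 8], .ld 9 7 [.reg 7, .reg 9]]) <|
      .ite (.lt (.lit 0) (.reg 9)) (blk [.st 10 [.reg 8] (.reg 10), .set 10 (.reg 8)]) (blk [])) <|
    blk [.st 11 [.reg 7] (.reg 10), .op .add 7 (.reg 7) (.lit 1)]

/-- While the positions are scanned for atom `i`, register 10 holds the last one that occurs in it.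
At an occurring position this is the predecessor, and at the end it is `low i`. An entry of array 10
may be written for several atoms, with the same value each time by `Good.last_eq_par`. -/
theorem exec_parProg {Γ : Ctx} {s : State} {r : Raw} {ars L : List ℕ} (hp : Γ.prot ≤ 0)
    (hr : r.Good) (hL : r.Order L) (hM : r.Loaded ars s.mem) (h1 : s.reg 1 = r.d)
    (h2 : s.reg 2 = L.length) (hv : ∀ u, 1 ≤ u → u ≤ L.length → s.mem [8, u] = Raw.var L u) :
    Exec Γ parProg s (r.d * (L.length * 130 + 120) + 30) fun s' => Frame 7 10 s s' ∧
      (∀ a : List ℕ, a.headD 0 ≠ 10 → a.headD 0 ≠ 11 → s'.mem a = s.mem a) ∧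
      (∀ i < r.d, s'.mem [11, i] = r.last L i L.length) ∧
      ∀ u, 1 ≤ u → u ≤ L.length → s'.mem [10, u] = r.par L u := by
  refine Exec.ok fun ho₀ => ?_
  have hdB := ho₀.1.1 1
  have hmB := ho₀.1.1 2
  rw [h1] at hdB
  rw [h2] at hmB
  refine Exec.mono (Exec.blk_seq 0 hp (by decide) (T := r.d * (L.length * 130 + 120) + 1)
    fun _ => ⟨by simp, fun _ => ?_⟩) (by simp; omega)
  refine (Exec.while_count (fun i s' => Frame 7 10 s s' ∧ s'.reg 7 = i ∧
      (∀ a : List ℕ, a.headD 0 ≠ 10 → a.headD 0 ≠ 11 → s'.mem a = s.mem a) ∧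
      (∀ i' < i, s'.mem [11, i'] = r.last L i' L.length) ∧
      ∀ u, 1 ≤ u → u ≤ L.length → (∃ i' < i, r.occ L i' u) → s'.mem [10, u] = r.par L u)
      r.d (L.length * 130 + 119) ?_ ?_ ?_).imp le_rfl ?_
  · rintro j s' - ⟨hf, hj, -⟩
    simp [Test.holds, hj, hf.2.2 1 (by omega), h1]
  · rintro i s' ho hi ⟨hf, h7, hm, h11, h10⟩
    refine Exec.mono (Exec.blk_seq 0 hp (by decide) (T := L.length * 130 + 64)
      fun _ => ⟨by simp, fun _ => ?_⟩) (by simp; omega)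
    generalize hs₁ : runs _ _ = s₁
    simp at hs₁
    refine Exec.mono (Exec.seq' (T₁ := L.length * 130 + 1) (T₂ := 41)
      (Exec.while_count (fun j s' => Frame 7 10 s s' ∧ s'.reg 7 = i ∧ s'.reg 8 = j ∧
      s'.reg 10 = r.last L i j ∧
      (∀ a : List ℕ, a.headD 0 ≠ 10 → a.headD 0 ≠ 11 → s'.mem a = s.mem a) ∧
      (∀ i' < i, s'.mem [11, i'] = r.last L i' L.length) ∧
      ∀ u, 1 ≤ u → u ≤ L.length → ((∃ i' < i, r.occ L i' u) ∨ u ≤ j ∧ r.occ L i u) →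
        s'.mem [10, u] = r.par L u) L.length 129 ?_ ?_ ?_) ?_) (by omega)
    · rintro j s₂ - ⟨hf, -, hj, -⟩
      simp [Test.holds, hj, hf.2.2 2 (by omega), h2]
    · rintro j s₂ - hj ⟨hf₂, h7₂, h8₂, h10₂, hm₂, h11₂, hu₂⟩
      have hvar : s₂.mem [8, j + 1] = Raw.var L (j + 1) := by
        rw [hm₂ _ (by simp) (by simp), hv _ (by omega) (by omega)]
      have hocc : s₂.mem [7, i, Raw.var L (j + 1)] = r.inAtom i (Raw.var L (j + 1)) := by
        rw [hm₂ _ (by simp) (by simp), hM.occ_eq i hi]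
      have hiff : 0 < r.inAtom i (Raw.var L (j + 1)) ↔ r.occ L i (j + 1) := by
        have : r.occ L i (j + 1) ↔ Raw.var L (j + 1) ∈ r.args i :=
          ⟨fun h => h.elim (by omega) fun h => h.2.2, fun h => Or.inr ⟨by omega, hj, h⟩⟩
        rw [this]
        unfold Raw.inAtom
        split_ifs with h <;> simp [h]
      refine Exec.mono (Exec.blk_seq 0 hp (by decide) (T := 42)
        fun _ => ⟨by simp [h8₂]; omega, fun _ => ?_⟩) (by simp)
      simp [h8₂, h7₂, hvar, hocc]
      refine Exec.mono (Exec.ite (T := 41) (fun hc => ?_) (fun hc => ?_)) le_rfl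
      · simp [Test.holds] at hc
        have ho := hiff.1 hc
        have hlast : r.last L i j = r.par L (j + 1) := hr.last_eq_par hL hi (by omega) ho
        refine Exec.blk 0 hp (by decide) fun _ => ⟨by simp, fun _ => ?_⟩
        generalize hs₃ : runs _ _ = s₃
        simp [h10₂] at hs₃
        subst hs₃
        refine ⟨by simp [hf₂], by simp [h7₂], by simp, by simp [Raw.last_succ_of_occ ho],
          fun a ha10 ha11 => ?_, fun i' hi' => ?_, fun u hu1 hu2 hu => ?_⟩
        · simp only [State.setReg_mem]
          rw [State.setMem_mem_ne _ (t := 10) _ _ (by simpa using ha10)]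
          exact hm₂ a (by simpa using ha10) (by simpa using ha11)
        · simp [h11₂ i' hi']
        · simp
          split_ifs with h
          · rw [h, hlast]
          · refine hu₂ u hu1 hu2 (hu.imp_right fun h' => ⟨by omega, h'.2⟩)
      · simp [Test.holds] at hc
        have ho : ¬ r.occ L i (j + 1) := fun h => by have := hiff.2 h; omega
        refine (Exec.skip ?_).mono (by omega)
        refine ⟨by simp [hf₂], by simp [h7₂], by simp, by simp [Raw.last_succ_of_not_occ ho, h10₂],
          fun a h h' => hm₂ a (by simpa using h) (by simpa using h'), h11₂,
          fun u hu1 hu2 hu => hu₂ u hu1 hu2 (hu.imp_right fun h' => ⟨?_, h'.2⟩)⟩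
        rcases Nat.lt_or_ge j u with h | h
        · obtain rfl : u = j + 1 := by omega
          exact absurd h'.2 ho
        · exact h
    · subst hs₁
      refine ⟨by simp [hf], by simp [h7], by simp, ?_, hm, h11, fun u hu1 hu2 hu => ?_⟩
      · have := Raw.last_le (r := r) (L := L) i 0
        simp; omega
      · exact h10 u hu1 hu2 (hu.elim id fun h => by omega)
    · rintro s₂ - ⟨hf₂, h7₂, -, h10₂, hm₂, h11₂, hu₂⟩
      refine Exec.blk 0 hp (by decide) fun _ => ⟨by simp [h7₂]; omega, fun _ => ?_⟩
      generalize hs₃ : runs _ _ = s₃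
      simp [h10₂, h7₂] at hs₃
      subst hs₃
      refine ⟨by simp [hf₂], by simp, fun a ha10 ha11 => ?_, fun i' hi' => ?_,
        fun u hu1 hu2 hu => ?_⟩
      · simp only [State.setReg_mem]
        rw [State.setMem_mem_ne _ (t := 11) _ _ ha11]
        exact hm₂ a ha10 ha11
      · simp
        split_ifs with h
        · rw [h]
        · exact h11₂ i' (by omega)
      · obtain ⟨i', hi', ho⟩ := hu
        simp
        refine hu₂ u hu1 hu2 ?_
        rcases Nat.lt_or_ge i' i with h | h
        · exact Or.inl ⟨i', h, ho⟩
        · obtain rfl : i' = i := by omega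
          exact Or.inr ⟨hu2, ho⟩
  · exact ⟨by simp, by simp, fun _ _ _ => rfl, by simp, fun u _ _ h => by obtain ⟨i, hi, -⟩ := h; omega⟩
  · rintro s' - ⟨hf, -, hm, h11, h10⟩
    exact ⟨hf, hm, h11, fun u hu1 hu2 => h10 u hu1 hu2 (hL.exists_occ hu1 hu2)⟩

/-! ### The empty data structure -/

theorem Dyn.empty {Q : Plan} {N : ℕ} {F : ℕ → (ℕ → ℕ) → Prop} {ds : DS} (hQ : Q.Good)
    (hd : 0 < Q.d) (hF : ∀ i < Q.d, ∀ ν, ¬ F i ν) (hn : ds.next = 2) (hch : ∀ a u b, ds.ch a u b = 0)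
    (ht : ∀ e, ds.typ e = 0) (hE : ∀ e i, ds.E e i = 0) (hW : ∀ e, ds.W e = 0)
    (hS : ∀ a u, ds.S a u = 0) (hl : ∀ a u, ds.len a u = 0) : Dyn.Clean Q N F ds where
  two_le := hn.ge
  typ_one := ht 1
  node e h1 h2 := by omega
  ch_node a u b h := absurd (hch a u b) h
  fresh_W e _ := hW e
  fresh_E e i _ := hE e i
  zero_E i := hE 0 i
  E_le e i := by rw [hE]; omega
  E_eq i hi ν := by rw [hE, if_neg (hF i hi ν)]
  S_eq a u := by rw [hS, hn]; simp
  roster := ⟨fun a u n h => by rw [hl] at h; omega, fun e h1 h2 => by omega⟩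
  W_eq e h1 h2 _ := by
    obtain rfl : e = 1 := by omega
    -- There is an atom and it has a variable, so position `1` exists, with predecessor `0`. Its
    -- empty sum makes the weight of the root `0`, in agreement with the blank memory.
    have hm : 1 ≤ Q.m := (hQ.low_pos 0 hd).trans (hQ.low_le 0 hd)
    have h0 : Q.par 1 = 0 := by have := hQ.par_lt 1 le_rfl hm; omega
    rw [hW, ht, Plan.wt, Plan.pV, Finset.prod_eq_zero (i := 0) (Finset.mem_range.2 hm), mul_zero]
    rw [zero_add, if_pos h0, hS]
    exact (Q.fac_eq_zero _ _).2 rfl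
  W_le e := by rw [hW]; exact Nat.zero_le _

/-! ### Preprocessing -/

def factsProg : Program :=
  .seq (blk [.read 31, .set 30 (.lit 0), .set 4 (.lit 1)]) <|
  .while (.lt (.reg 30) (.reg 31)) <|
    .seq (blk [.read 5, .ld 6 0 [.reg 5]]) <| .seq (readProg 30) <| .seq factProg <|
    blk [.op .add 30 (.reg 30) (.lit 1)]

/-- The time for reading and processing a fact. -/
def Layout.readTime (P : Layout) (f : ℕ × List ℕ) : ℕ := 62 * f.2.length + P.factTime + 150

/-- After `k` rounds the structure represents the first `k` facts. The facts differ in length, so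
the budget of the loop is the total time for those that remain; this keeps preprocessing linear in
the database. -/
theorem exec_factsProg {Γ : Ctx} {P : Layout} {N : ℕ} {s : State} {fs : List (ℕ × List ℕ)}
    (hP : P.Good) (hB : P.Fits N Γ.B) (hp : Γ.prot ≤ 0) (hS : Static P s.mem)
    (hD : Dyn.Clean P.toPlan N (P.Sat ∅) (view s.mem)) (h1 : s.reg 1 = P.d) (h2 : s.reg 2 = P.m)
    (h3 : s.reg 3 = P.K) (hi : s.inp = fs.length :: fs.flatMap fun f => f.1 :: f.2)
    (har : ∀ f ∈ fs, s.mem [0, f.1] = f.2.length)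
    (hR : ∀ f ∈ fs, ∀ i < P.d, P.rel i = f.1 → P.ar i = f.2.length)
    (hN : ∀ f ∈ fs, ∀ w ∈ f.2, w ≤ N) :
    Exec Γ factsProg s ((fs.map P.readTime).sum + 70) fun s' => Static P s'.mem ∧
      Dyn.Clean P.toPlan N (P.Sat {g | ∃ f ∈ fs, g = f.1 :: f.2}) (view s'.mem) := by
  refine Exec.mono (Exec.blk_seq 0 hp (by decide) (T := (fs.map P.readTime).sum + 1)
    fun _ => ⟨by simp, fun _ => ?_⟩) (by simp; omega)
  generalize hs₁ : runs _ _ = s₁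
  simp [hi] at hs₁
  refine (Exec.while_budget (fun b s' => ∃ k ≤ fs.length, b = ((fs.drop k).map P.readTime).sum ∧
      s'.inp = (fs.drop k).flatMap (fun f => f.1 :: f.2) ∧ s'.reg 30 = k ∧
      s'.reg 31 = fs.length ∧ s'.reg 1 = P.d ∧ s'.reg 2 = P.m ∧ s'.reg 3 = P.K ∧ s'.reg 4 = 1 ∧
      (∀ a : List ℕ, a.headD 0 < 13 → s'.mem a = s.mem a) ∧
      Dyn.Clean P.toPlan N (P.Sat {g | ∃ f ∈ fs.take k, g = f.1 :: f.2}) (view s'.mem))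
      ?_ ?_).imp le_rfl ?_
  · rintro b s' ho ⟨k, -, rfl, hin, h30, h31, q1, q2, q3, q4, hm, hD'⟩ hc
    simp [Test.holds, h30, h31] at hc
    have hmem := List.getElem_mem hc
    have htk : ∀ f, f ∈ fs.take (k + 1) ↔ f ∈ fs.take k ∨ f = fs[k] := fun f => by
      rw [List.take_succ_eq_append_getElem hc, List.mem_append, List.mem_singleton]
    rw [List.drop_eq_getElem_cons hc] at hin ⊢
    generalize fs[k] = f at hin hmem htk ⊢
    simp only [List.flatMap_cons, List.cons_append, List.map_cons, List.sum_cons] at hin ⊢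
    -- One step of the time of the fact is reserved for the loop test.
    refine ⟨P.readTime f - 1, _, Nat.add_le_add_right (show P.readTime f - 1 + 1 ≤ _ by
      unfold Layout.readTime; omega) _, ?_⟩
    have hlB : k + 1 ≤ Γ.B := by have := ho.1.1 31; rw [h31] at this; omega
    refine Exec.mono (Exec.blk_seq 0 hp (by decide) (T := 62 * f.2.length + P.factTime + 60)
      fun _ => ⟨by simp, fun _ => ?_⟩) (by simp [Layout.readTime]; omega)
    generalize hs₂ : runs _ _ = s₂
    simp [hin, hm, har f hmem] at hs₂
    have hm₂ : s₂.mem = s'.mem := by subst hs₂; rfl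
    have hr₂ : ∀ k, k ≠ 5 → k ≠ 6 → s₂.reg k = s'.reg k := fun k h5 h6 => by
      subst hs₂; simp [h5, h6]
    refine Exec.mono (Exec.seq' (exec_readProg_append (l := f.2) hp (by decide)
      (by subst hs₂; simp) (by subst hs₂; simp; rfl)) (T₂ := P.factTime + 25) ?_) (by omega)
    rintro s₃ - ⟨hf₃, hi₃, hm₃, hv₃⟩
    have hr₃ : ∀ k, k < 5 ∨ 9 < k → s₃.reg k = s'.reg k := fun k hk =>
      (hf₃.2 k (by omega)).trans (hr₂ k (by omega) (by omega))
    have hmm : ∀ a : List ℕ, a.headD 0 < 30 → s₃.mem a = s'.mem a := fun a ha => by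
      rw [hm₃ a (by omega), hm₂]
    refine Exec.mono (Exec.seq' (exec_factProg (t := f.2) (R := f.1) hP hB hp
      (X := {g | ∃ f ∈ fs.take k, g = f.1 :: f.2}) (X' := {g | ∃ f ∈ fs.take (k + 1), g = f.1 :: f.2})
      (hS.congr fun a ha => ?_) ?_ ((hr₃ 1 (by omega)).trans q1) ((hr₃ 2 (by omega)).trans q2)
      ((hr₃ 3 (by omega)).trans q3) (by rw [hr₃ 4 (by omega), q4]) ?_ ?_ ?_ (hN f hmem) ?_)
      (T₂ := 21) ?_) (by omega)
    · rw [hmm a (by omega), hm a ha]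
    · rw [view_congr fun a _ h => hmm a h]; exact hD'
    · rw [hf₃.2 5 (by omega)]; subst hs₂; simp
    · intro i hi he
      rw [hR f hmem i hi he, hf₃.2 6 (by omega)]
      subst hs₂; simp
    · intro p hp
      refine hv₃ p ?_
      rw [hf₃.2 6 (by omega)] at hp
      subst hs₂; simpa using hp
    · intro g
      rw [hr₃ 4 (by omega), q4]
      simp only [Set.mem_ofPred_eq, htk]
      constructor
      · rintro ⟨f', h | rfl, rfl⟩
        · by_cases he : f'.1 :: f'.2 = f.1 :: f.2
          · exact Or.inl ⟨he, trivial⟩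
          · exact Or.inr ⟨he, f', h, rfl⟩
        · exact Or.inl ⟨rfl, trivial⟩
      · rintro (⟨rfl, -⟩ | ⟨-, f', h, rfl⟩)
        · exact ⟨f, Or.inr rfl, rfl⟩
        · exact ⟨f', Or.inl h, rfl⟩
    · rintro s₄ - ⟨hf₄, hm₄, hD₄⟩
      have hr₄ : ∀ k, k < 5 ∨ 22 < k → s₄.reg k = s'.reg k := fun k hk =>
        (hf₄.2.2 k (by omega)).trans (hr₃ k (by omega))
      refine Exec.blk 0 hp (by decide) fun _ => ⟨?_, fun _ => ⟨k + 1, hc, rfl, ?_, ?_, ?_, ?_, ?_,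
        ?_, ?_, fun a ha => ?_, hD₄⟩⟩
      · simp [hr₄ 30 (by omega), h30]; omega
      · simp [hf₄.1, hi₃]
      · simp [hr₄ 30 (by omega), h30]
      · simp [hr₄ 31 (by omega), h31]
      · simp [hr₄ 1 (by omega), q1]
      · simp [hr₄ 2 (by omega), q2]
      · simp [hr₄ 3 (by omega), q3]
      · simp [hr₄ 4 (by omega), q4]
      · have := hm₄ a (Or.inl ha)
        simp only [runs, Cmd.run, State.setReg_mem]
        rw [this, hmm a (by omega), hm a ha]
  · subst hs₁
    refine ⟨0, by simp, by simp, by simp, by simp, by simp, by simp [h1], by simp [h2], by simp [h3],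
      by simp, fun _ _ => rfl, ?_⟩
    have : ({g | ∃ f ∈ fs.take 0, g = f.1 :: f.2} : Set (List ℕ)) = ∅ := by simp
    rw [this]
    exact hD
  · rintro s' - ⟨⟨b, k, hk, -, hin, h30, h31, -, -, -, -, hm, hD'⟩, hc⟩
    simp [Test.holds, h30, h31] at hc
    rw [List.take_of_length_le hc] at hD'
    exact ⟨hS.congr hm, hD'⟩

def preProg : Program :=
  .seq loadProg <| .seq sortProg <|
  .seq (blk [.st 12 [.lit 1] (.reg 2), .st 12 [.lit 2] (.reg 3), .st 13 [] (.lit 2)]) <|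
  .seq parProg factsProg

/-- The time for reading and analysing the query. -/
def loadTime (c n : ℕ) : ℕ :=
  (62 * c + 62 * n + 62 * n + n * (82 * n + 150) + 400) +
    ((2 * n + 2) * (n * (n * (62 * n + 400) + 150) + 60) + 110) + (n * (n * 130 + 120) + 30) + 300

set_option maxRecDepth 10000 in
theorem exec_preProg {Γ : Ctx} {N n : ℕ} {s : State} {r : Raw} {ars : List ℕ}
    {fs : List (ℕ × List ℕ)} (hp : Γ.prot ≤ 0) (hr : r.Good)
    (hB : (r.layout r.vars n).Fits N Γ.B) (hs : ∀ a, s.mem a = 0)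
    (hi : s.inp = r.code ars ++ (fs.length :: fs.flatMap fun f => f.1 :: f.2))
    (har : ∀ i < r.d, r.rel i < ars.length ∧ ars.getD (r.rel i) 0 = (r.args i).length)
    (hfs : ∀ f ∈ fs, f.1 < ars.length ∧ ars.getD f.1 0 = f.2.length)
    (hn : r.names.length ≤ n) (hd : r.d ≤ n) (hh : r.head.length ≤ n) (hq : r.quant.length ≤ n)
    (hN : ∀ f ∈ fs, ∀ w ∈ f.2, w ≤ N) :
    Exec Γ preProg s (loadTime ars.length n + (fs.map (r.layout r.vars n).readTime).sum) fun s' =>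
      Static (r.layout r.vars n) s'.mem ∧ Dyn.Clean (r.layout r.vars n).toPlan N
        ((r.layout r.vars n).Sat {g | ∃ f ∈ fs, g = f.1 :: f.2}) (view s'.mem) := by
  have hL := r.order_vars
  have hP := hr.layout_good hL hn hd hh
  have hargs : ∀ i < r.d, (r.args i).length ≤ n := hP.ar_le
  have hmn : r.vars.length ≤ n := hP.m_le
  have hnB : 2 * n + 10 ≤ Γ.B := hB.n_le
  have t1 : 62 * ars.length + 62 * r.quant.length + 62 * r.head.length + r.d * (82 * n + 150) + 400 ≤
      62 * ars.length + 62 * n + 62 * n + n * (82 * n + 150) + 400 := by gcongr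
  have t2 : (2 * r.d + 2) * (r.d * (n * (62 * r.d + 400) + 150) + 60) + 110 ≤
      (2 * n + 2) * (n * (n * (62 * n + 400) + 150) + 60) + 110 := by gcongr
  have t3 : r.d * (r.vars.length * 130 + 120) + 30 ≤ n * (n * 130 + 120) + 30 := by gcongr
  unfold loadTime
  generalize 62 * ars.length + 62 * n + 62 * n + n * (82 * n + 150) + 400 = a1 at t1 ⊢
  generalize (2 * n + 2) * (n * (n * (62 * n + 400) + 150) + 60) + 110 = a2 at t2 ⊢
  generalize n * (n * 130 + 120) + 30 = a3 at t3 ⊢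
  generalize hFT : (fs.map (r.layout r.vars n).readTime).sum = a4
  refine Exec.mono (Exec.seq' ((exec_loadProg (n := n) hp hs hi har hargs).mono t1)
    (T₂ := a2 + a3 + a4 + 290) ?_) (by omega)
  rintro s₁ - ⟨hi₁, q1, hM₁, hz₁⟩
  refine Exec.mono (Exec.seq' ((exec_sortProg (n := n) hp hM₁ q1 (by omega) (by omega) hargs
    fun x => hz₁ _ (by simp)).mono t2) (T₂ := a3 + a4 + 200) ?_) (by omega)
  rintro s₂ - hI₂
  refine Exec.mono (Exec.blk_seq 0 hp (by decide) (T := a3 + a4 + 120)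
    fun _ => ⟨by simp, fun _ => ?_⟩) (by simp; omega)
  generalize hs₃ : runs _ _ = s₃
  simp [hI₂.m_eq, hI₂.K_eq] at hs₃
  have hm₃ : ∀ a : List ℕ, a ≠ [12, 1] → a ≠ [12, 2] → a ≠ [13] → s₃.mem a = s₂.mem a := by
    intro a h1 h2 h3
    subst hs₃
    simp [h1, h2, h3]
  have v1 : s₃.mem [12, 1] = r.vars.length := by subst hs₃; simp
  have v2 : s₃.mem [12, 2] = (r.vars.filter fun x => x ∉ r.quant).length := by subst hs₃; simp
  have v3 : s₃.mem [13] = 2 := by subst hs₃; simp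
  have hM₃ : r.Loaded ars s₃.mem := hM₁.congr (fun a h8 h5 => by
    rw [hm₃ a (by rintro rfl; simp at h8) (by rintro rfl; simp at h8) (by rintro rfl; simp at h8),
      hI₂.mem_eq a h5 (by omega)])
    (by rw [hm₃ _ (by simp) (by simp) (by simp), hI₂.mem_eq _ (by simp) (by simp)])
    (by rw [hm₃ _ (by simp) (by simp) (by simp), hI₂.mem_eq _ (by simp) (by simp)])
  have r₃ : ∀ k, s₃.reg k = s₂.reg k := fun k => by subst hs₃; simp
  have i₃ : s₃.inp = s₂.inp := by subst hs₃; simp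
  have hv₃ : ∀ u, 1 ≤ u → u ≤ r.vars.length → s₃.mem [8, u] = Raw.var r.vars u := fun u h1 h2 => by
    rw [hm₃ _ (by simp) (by simp) (by simp), hI₂.var_eq u h1 h2]
  refine Exec.mono (Exec.seq' ((exec_parProg hp hr hL hM₃ ((r₃ 1).trans (hI₂.reg1.trans q1))
    ((r₃ 2).trans hI₂.m_eq) hv₃).mono t3) (T₂ := a4 + 70) ?_) (by omega)
  rintro s₄ - ⟨hf₄, hm₄, hlow, hpar⟩
  have hM₄ : r.Loaded ars s₄.mem := hM₃.congr (fun a h8 h5 => hm₄ a (by omega) (by omega))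
    (hm₄ _ (by simp) (by simp)) (hm₄ _ (by simp) (by simp))
  have hpos₄ : ∀ x ∈ r.vars, s₄.mem [5, x] = Raw.pos r.vars x := fun x hx => by
    rw [hm₄ _ (by simp) (by simp), hm₃ _ (by simp) (by simp) (by simp), hI₂.pos_eq, if_pos hx]
  have hS₄ : Static (r.layout r.vars n) s₄.mem := by
    refine
      { d_eq := hM₄.d_eq
        m_eq := by rw [hm₄ _ (by simp) (by simp), v1]; rfl
        K_eq := by rw [hm₄ _ (by simp) (by simp), v2]; rfl
        hd_length := by rw [hM₄.nh_eq]; simp [Raw.layout]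
        rel_eq := hM₄.rel_eq
        low_eq := hlow
        par_eq := hpar
        arg_eq := fun i hi j hj => ?_
        len_eq := hM₄.len_eq
        len_zero := hM₄.len_zero
        occ_eq := fun i hi u h1 h2 => ?_
        hd_eq := fun h hh => ?_ }
    · change j < (r.args i).length at hj
      rw [hM₄.arg_eq i hi j hj, hpos₄]
      · rfl
      · rw [List.getD_eq_getElem _ _ hj]
        exact (hL.mem_iff _).2 ⟨i, hi, List.getElem_mem hj⟩
    · change u ≤ r.vars.length at h2
      rw [hm₄ [8, u] (by simp) (by simp), hv₃ u h1 h2, hM₄.occ_eq i hi]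
      change _ ↔ r.occ r.vars i u
      unfold Raw.inAtom Raw.occ
      split_ifs with h
      · simp [h, h1, h2]
      · simp [h]; omega
    · have hh' : h < r.head.length := by simpa [Raw.layout] using hh
      rw [hM₄.head_eq h hh', List.getD_eq_getElem _ _ hh', hpos₄]
      · rw [List.getD_eq_getElem _ _ hh]
        simp [Raw.layout]
      · exact (hL.mem_iff _).2 ((hr.mem_head _).1 (List.getElem_mem hh')).1
  -- Reading, sorting and `parProg` use no array beyond number `13`, so the arrays of the structure
  -- are still blank.
  have hz : ∀ (t : ℕ) (l : List ℕ), 14 ≤ t → s₄.mem (t :: l) = 0 := fun t l ht => by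
    rw [hm₄ _ (by simp; omega) (by simp; omega), hm₃ _ (by simp; omega) (by simp; omega) (by simp; omega),
      hI₂.mem_eq _ (by simp; omega) (by simp; omega), hz₁ _ (by simp; omega)]
  have hD₄ : Dyn.Clean (r.layout r.vars n).toPlan N ((r.layout r.vars n).Sat ∅) (view s₄.mem) := by
    refine Dyn.empty hP.toGood hr.d_pos (fun i _ ν h => h) ?_ ?_ ?_ ?_ ?_ ?_ ?_
    · rw [view_next, hm₄ _ (by simp) (by simp), v3]
    all_goals intros; exact hz _ _ (by omega)
  refine (exec_factsProg hP hB hp hS₄ hD₄ ?_ ?_ ?_ ?_ (fun f hf => ?_) (fun f hf i hi he => ?_)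
    hN).imp (by rw [hFT]) fun _ _ h => h
  · rw [hf₄.2.2 1 (by omega), r₃, hI₂.reg1, q1]; rfl
  · rw [hf₄.2.2 2 (by omega), r₃, hI₂.m_eq]; rfl
  · rw [hf₄.2.2 3 (by omega), r₃, hI₂.K_eq]; rfl
  · rw [hf₄.1, i₃, hI₂.inp, hi₁]
  · rw [hM₄.ar_eq _ (hfs f hf).1, (hfs f hf).2]
  · change r.rel i = f.1 at he
    change (r.args i).length = f.2.length
    rw [← (har i hi).2, he, (hfs f hf).2]

/-! ### Programs with output -/

/-- From `c` on the machine outputs the given tuples and halts; the first output (or the halt) is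
within `b` steps, and every further one within `d` steps from the preceding one. -/
inductive Emits (Γ : Ctx) (d : ℕ) : ℕ → Config → List (List ℕ) → Prop
  | halt {b t : ℕ} {c c' : Config} (hr : Run Γ c t c') (ht : t ≤ b) (hc : c'.code = []) :
      Emits Γ d b c []
  | emit {b t : ℕ} {c c' : Config} {o : List ℕ} {os : List (List ℕ)} (hr : Run Γ c t c')
      (ht : t < b) (he : c'.emitted = some o) (hok : Ok Γ c'.step.state)
      (h : Emits Γ d d c'.step os) : Emits Γ d b c (o :: os)

theorem Emits.run {Γ : Ctx} {d b b' t : ℕ} {c c' : Config} {os : List (List ℕ)}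
    (h : Emits Γ d b c' os) (hr : Run Γ c t c') (hb : t + b ≤ b') : Emits Γ d b' c os := by
  cases h with
  | halt hr' ht hc => exact .halt (hr.trans hr') (by omega) hc
  | emit hr' ht he hok h => exact .emit (hr.trans hr') (by omega) he hok h

theorem Config.outputs_add (c : Config) (m n : ℕ) :
    c.outputs (m + n) = c.outputs m ++ (c.after m).outputs n := by
  simp only [Config.outputs, List.range_add, List.filterMap_append, List.filterMap_map]
  congr 2
  funext i
  simp [Config.after_add]

theorem Run.outputs {Γ : Ctx} {t : ℕ} {c c' : Config} (hr : Run Γ c t c') : c.outputs t = [] := by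
  rw [Config.outputs, List.filterMap_eq_nil_iff]
  intro i hi
  exact hr.2.2 i (List.mem_range.1 hi)

/-- What `Emits` means for the behaviour of the machine. -/
theorem Emits.spec {Γ : Ctx} {d b : ℕ} {c : Config} {os : List (List ℕ)} (h : Emits Γ d b c os) :
    (∃ T ≤ max b d * (os.length + 1), c.HaltedAt T ∧ c.outputs T = os) ∧ (∀ t, Ok Γ (c.after t).state) ∧
      ∀ i, (∃ j, i ≤ j ∧ j < i + max b d ∧ (c.after j).emitted ≠ none) ∨
        c.HaltedAt (i + max b d) := by
  induction h with
  | @halt b t c c' hr ht hc =>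
    have hh : ∀ n, c.after (t + n) = c' := fun n => by
      rw [Config.after_add, hr.1, Config.after_of_halted hc]
    refine ⟨⟨t, by simp [ht], ?_, hr.outputs⟩, fun i => ?_, fun i => Or.inr ?_⟩
    · have := hh 0
      rw [add_zero] at this
      rw [Config.HaltedAt, this, hc]
    · rcases le_total i t with h | h
      · exact hr.2.1 i h
      · obtain ⟨n, rfl⟩ := Nat.exists_eq_add_of_le h
        have := hr.2.1 t le_rfl
        rw [hh, ← hr.1]
        exact this
    · obtain ⟨n, hn⟩ := Nat.exists_eq_add_of_le (show t ≤ i + max b d by omega)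
      rw [Config.HaltedAt, hn, hh, hc]
  | @emit b t c c' o os hr ht he hok h ih =>
    obtain ⟨⟨T, hTd, hT, ho⟩, hok', hd⟩ := ih
    have hh : ∀ n, c.after (t + 1 + n) = c'.step.after n := fun n => by
      rw [add_assoc, Config.after_add, hr.1, add_comm 1 n, Config.after_succ]
    rw [max_self] at hd hTd
    refine ⟨⟨t + 1 + T, ?_, ?_, ?_⟩, fun i => ?_, fun i => ?_⟩
    · have := Nat.mul_le_mul_right (os.length + 1) (le_max_right b d)
      have := le_max_left b d
      rw [List.length_cons, mul_add, mul_one]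
      omega
    · rw [Config.HaltedAt, hh]
      exact hT
    · rw [Config.outputs_add, Config.outputs_add, hr.outputs, hr.1]
      have h0 := hh 0
      rw [add_zero] at h0
      rw [h0]
      change [] ++ c'.outputs 1 ++ c'.step.outputs T = _
      rw [ho]
      simp [Config.outputs, Config.after, he]
    · rcases le_total i t with h | h
      · exact hr.2.1 i h
      · rcases Nat.lt_or_ge t i with h' | h'
        · obtain ⟨n, rfl⟩ := Nat.exists_eq_add_of_le (show t + 1 ≤ i by omega)
          rw [hh]
          exact hok' n
        · exact hr.2.1 i h'
    · rcases le_or_gt i t with h | h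
      · refine Or.inl ⟨t, h, by omega, ?_⟩
        rw [hr.1, he]
        simp
      · obtain ⟨n, rfl⟩ := Nat.exists_eq_add_of_le (show t + 1 ≤ i by omega)
        rcases hd n with ⟨j, h1, h2, h3⟩ | h3
        · exact Or.inl ⟨t + 1 + j, by omega, by omega, by rwa [hh]⟩
        · right
          obtain ⟨k, hk⟩ := Nat.exists_eq_add_of_le (show n + d ≤ n + max b d by omega)
          rw [add_assoc, hk, Config.HaltedAt, hh, Config.after_add,
            Config.after_of_halted h3]
          exact h3

/-! ### Stepping through the choices -/

section
variable {Q : Plan} {ds : DS}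

/-- The choices that come after a given one, when only the first `i` positions may change. -/
def Plan.rest (Q : Plan) (ds : DS) (ix : ℕ → ℕ) : ℕ → (ℕ → ℕ) → List (ℕ → ℕ)
  | 0, _ => []
  | i + 1, q => ((ds.lst (q (Q.par (i + 1))) (i + 1)).drop (ix (i + 1) + 1)).flatMap (fun e =>
      Q.ext ds (Q.K - (i + 1)) (i + 1) (Function.update q (i + 1) e)) ++ Q.rest ds ix i q

theorem Plan.ext_congr (hQ : Q.Good) (n i : ℕ) (hn : i + n ≤ Q.m) {q q' : ℕ → ℕ}
    (h : ∀ v, v ≤ i ∨ i + n < v → q v = q' v) : Q.ext ds n i q = Q.ext ds n i q' := by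
  induction n generalizing i q q' with
  | zero =>
    rw [Plan.ext, Plan.ext]
    congr 1
    exact funext fun v => h v (by omega)
  | succ n ih =>
    rw [Plan.ext, Plan.ext]
    have hp := hQ.par_lt (i + 1) (by omega) (by omega)
    rw [h (Q.par (i + 1)) (by omega)]
    congr 1
    funext e
    refine ih (i + 1) (by omega) fun v hv => ?_
    rw [Function.update_apply, Function.update_apply]
    split_ifs
    · rfl
    · exact h v (by omega)

theorem Plan.rest_congr (hQ : Q.Good) (i : ℕ) (hi : i ≤ Q.K) {q q' ix ix' : ℕ → ℕ}
    (h : ∀ v, v ≤ i ∨ Q.K < v → q v = q' v) (hx : ∀ v, 1 ≤ v → v ≤ i → ix v = ix' v) :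
    Q.rest ds ix i q = Q.rest ds ix' i q' := by
  have hK := hQ.K_le
  induction i with
  | zero => rfl
  | succ i ih =>
    rw [Plan.rest, Plan.rest]
    have hp := hQ.par_lt (i + 1) (by omega) (by omega)
    rw [h (Q.par (i + 1)) (by omega), hx (i + 1) (by omega) le_rfl,
      ih (by omega) (fun v hv => h v (by omega)) fun v h1 h2 => hx v h1 (by omega)]
    congr 2
    funext e
    refine Plan.ext_congr hQ _ _ (by omega) fun v hv => ?_
    rw [Function.update_apply, Function.update_apply]
    split_ifs
    · rfl
    · exact h v (by omega)

theorem DS.lst_drop (ds : DS) {a u k : ℕ} (h : k < ds.len a u) :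
    (ds.lst a u).drop k = ds.elem a u k :: (ds.lst a u).drop (k + 1) := by
  rw [List.drop_eq_getElem_cons (by simpa [DS.lst] using h)]
  simp [DS.lst]

/-- The choices from the `k`-th child on are those that extend the `k`-th child, followed by what
`rest` lists one level deeper. With `k = 0` this is a step of `resetProg`, with the next index the
success of `advanceProg`. -/
theorem Plan.flatMap_drop (hQ : Q.Good) {i k : ℕ} (hi : i + 1 ≤ Q.K) {q q' ix ix' : ℕ → ℕ}
    (hk : k < ds.len (q (Q.par (i + 1))) (i + 1))
    (h1 : q' (i + 1) = ds.elem (q (Q.par (i + 1))) (i + 1) k) (h2 : ix' (i + 1) = k)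
    (hq : ∀ v, v ≠ i + 1 → q' v = q v) (hx : ∀ v, v ≠ i + 1 → ix' v = ix v) :
    ((ds.lst (q (Q.par (i + 1))) (i + 1)).drop k).flatMap (fun e =>
      Q.ext ds (Q.K - (i + 1)) (i + 1) (Function.update q (i + 1) e)) ++ Q.rest ds ix i q =
    Q.ext ds (Q.K - (i + 1)) (i + 1) q' ++ Q.rest ds ix' (i + 1) q' := by
  have hK := hQ.K_le
  have hp := hQ.par_lt (i + 1) (by omega) (by omega)
  have hu : Function.update q (i + 1) (ds.elem (q (Q.par (i + 1))) (i + 1) k) = q' := by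
    funext v
    rw [Function.update_apply]
    split_ifs with h
    · rw [h, h1]
    · rw [hq v h]
  have hu' : ∀ e, Function.update q' (i + 1) e = Function.update q (i + 1) e := fun e => by
    rw [← hu, Function.update_idem]
  rw [ds.lst_drop hk, List.flatMap_cons, hu, List.append_assoc, Plan.rest, h2,
    hq (Q.par (i + 1)) (by omega)]
  simp only [hu']
  rw [Plan.rest_congr hQ i (by omega) (q := q) (q' := q') (ix := ix) (ix' := ix')
    (fun v hv => (hq v (by omega)).symm) fun v _ h => (hx v (by omega)).symm]

theorem Plan.rest_of_len_le {i : ℕ} {q ix : ℕ → ℕ}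
    (h : ds.len (q (Q.par (i + 1))) (i + 1) ≤ ix (i + 1) + 1) :
    Q.rest ds ix (i + 1) q = Q.rest ds ix i q := by
  rw [Plan.rest, List.drop_of_length_le (by simpa [DS.lst] using h)]
  rfl

end

/-! ### Enumeration -/

/-- Memory arrays 40 and 41 contain nodes with nonzero weight for the positions up to `i`, and
their places in the lists of children. -/
structure Selected (P : Layout) (ds : DS) (i : ℕ) (mem : List ℕ → ℕ) : Prop where
  chosen : P.Chosen ds i fun v => mem [40, v]
  ix_lt : ∀ v, 1 ≤ v → v ≤ i → mem [41, v] < ds.len (mem [40, P.par v]) v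

/-- The choices that remain, beginning with the first one that extends the choice for the positions
up to `i`. -/
def Layout.todo (P : Layout) (ds : DS) (i : ℕ) (mem : List ℕ → ℕ) : List (ℕ → ℕ) :=
  P.ext ds (P.K - i) i (fun v => mem [40, v]) ++
    P.rest ds (fun v => mem [41, v]) i (fun v => mem [40, v])

/-- Choose the first possible nodes for all positions after the one in register 3. -/
def resetProg : Program :=
  .while (.lt (.reg 3) (.reg 2)) <|
    blk [.op .add 3 (.reg 3) (.lit 1), .ld 4 10 [.reg 3], .ld 4 40 [.reg 4], .st 41 [.reg 3] (.lit 0),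
      .ld 6 28 [.reg 4, .reg 3, .lit 0], .st 40 [.reg 3] (.reg 6)]

theorem Selected.step {P : Layout} {i k : ℕ} {mem mem' : List ℕ → ℕ} {ds : DS} (hQ : P.toPlan.Good) (hi : i + 1 ≤ P.K)
    (hS : Selected P ds i mem) (hk : k < ds.len (mem [40, P.par (i + 1)]) (i + 1))
    (h40 : ∀ v, mem' [40, v] = if v = i + 1 then ds.elem (mem [40, P.par (i + 1)]) (i + 1) k
      else mem [40, v])
    (h41 : ∀ v, mem' [41, v] = if v = i + 1 then k else mem [41, v]) :
    Selected P ds (i + 1) mem' := by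
  have hK := hQ.K_le
  have hpar : ∀ v, 1 ≤ v → v ≤ i + 1 → mem' [40, P.par v] = mem [40, P.par v] := fun v h1 h2 => by
    have := hQ.par_lt v h1 (by omega)
    rw [h40, if_neg (by omega)]
  refine ⟨⟨?_, fun v h1 h2 => ?_⟩, fun v h1 h2 => ?_⟩
  · change mem' [40, 0] = 1
    rw [h40, if_neg (by omega)]
    exact hS.chosen.1
  · change mem' [40, v] ∈ ds.lst (mem' [40, P.par v]) v
    rw [hpar v h1 h2, h40]
    split_ifs with h
    · subst h
      exact List.mem_map.2 ⟨k, List.mem_range.2 hk, rfl⟩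
    · exact hS.chosen.2 v h1 (by omega)
  · rw [hpar v h1 h2, h41]
    split_ifs with h
    · subst h
      exact hk
    · exact hS.ix_lt v h1 (by omega)

/-- Every chosen node has nonzero weight, so the list at the next position is nonempty and its entry
`0` exists. Descending to first entries does not alter the list of outstanding choices. -/
theorem exec_resetProg {Γ : Ctx} {P : Layout} {N i : ℕ} {F : ℕ → (ℕ → ℕ) → Prop} {s : State}
    (hQ : P.toPlan.Good) (hp : Γ.prot = 40) (hS : Static P Γ.mem₀)
    (hD : Dyn.Clean P.toPlan N F (view Γ.mem₀)) (h0 : (view Γ.mem₀).W 1 ≠ 0)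
    (h2 : s.reg 2 = P.K) (h3 : s.reg 3 = i) (hi : i ≤ P.K) (hsel : Selected P (view Γ.mem₀) i s.mem) :
    Exec Γ resetProg s (P.K * 122 + 1) fun s' => Frame 3 6 s s' ∧ s'.reg 3 = P.K ∧
      Selected P (view Γ.mem₀) P.K s'.mem ∧
      P.todo (view Γ.mem₀) P.K s'.mem = P.todo (view Γ.mem₀) i s.mem := by
  have hK := hQ.K_le
  refine Exec.ok fun ho₀ => ?_
  have hKB := ho₀.1.1 2
  rw [h2] at hKB
  refine (Exec.while_count (fun j s' => Frame 3 6 s s' ∧ s'.reg 3 = i + j ∧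
    Selected P (view Γ.mem₀) (i + j) s'.mem ∧
      P.todo (view Γ.mem₀) (i + j) s'.mem = P.todo (view Γ.mem₀) i s.mem) (P.K - i) 121
      ?_ ?_ ?_).imp ?_ ?_
  · rintro j s' hj ⟨hf, h3', -⟩
    simp [Test.holds, h3', hf.2.2 2 (by omega), h2]
    omega
  · rintro j s' ho hj ⟨hf, h3', hsel', htodo⟩
    rw [show i + (j + 1) = i + j + 1 by omega]
    obtain ⟨u, hu⟩ : ∃ u, u = i + j := ⟨_, rfl⟩
    rw [← hu] at h3' hsel' htodo ⊢
    have hK' : u + 1 ≤ P.K := by omega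
    have hpar := hQ.par_lt (u + 1) (by omega) (by omega)
    have hm : ∀ (t : ℕ) (l : List ℕ), t < 40 → s'.mem (t :: l) = Γ.mem₀ (t :: l) := fun t l ht =>
      ho.2 _ (by rw [hp]; exact ht)
    have hspec := hD.chosen_spec h0 hsel'.chosen (v := P.par (u + 1)) (by omega)
    have hlen : 0 < (view Γ.mem₀).len (s'.mem [40, P.par (u + 1)]) (u + 1) := by
      have := hD.exists_lst hspec.1 hspec.2.1 hspec.2.2.2 (u := u + 1) (by omega) (by omega)
        hspec.2.2.1.symm
      rw [Nat.pos_iff_ne_zero]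
      intro h
      exact this (by simp only [DS.lst, h]; rfl)
    refine Exec.blk 40 (by rw [hp]) (by decide) fun _ => ⟨by simp [h3']; omega, fun _ => ?_⟩
    generalize hs₂ : runs _ _ = s₂
    simp [h3', hm, hS.par_eq (u + 1) (by omega) (by omega)] at hs₂
    have e40 : ∀ v, s₂.mem [40, v] = if v = u + 1 then
        (view Γ.mem₀).elem (s'.mem [40, P.par (u + 1)]) (u + 1) 0 else s'.mem [40, v] := fun v => by
      subst hs₂; simp
    have e41 : ∀ v, s₂.mem [41, v] = if v = u + 1 then 0 else s'.mem [41, v] := fun v => by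
      subst hs₂; simp
    refine ⟨by subst hs₂; simp [hf], by subst hs₂; simp, hsel'.step hQ hK' hlen e40 e41, ?_⟩
    rw [← htodo]
    unfold Layout.todo
    rw [← Plan.flatMap_drop hQ (ix := fun v => s'.mem [41, v]) (q := fun v => s'.mem [40, v]) hK'
      hlen (by simp only [e40, if_true]) (by simp only [e41, if_true])
      (fun v hv => by simp only [e40, if_neg hv]) (fun v hv => by simp only [e41, if_neg hv])]
    obtain ⟨n, hn⟩ : ∃ n, P.K - u = n + 1 := ⟨P.K - (u + 1), by omega⟩
    rw [hn, Plan.ext, List.drop_zero, show P.K - (u + 1) = n by omega]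
  · exact ⟨by simp, h3, hsel, rfl⟩
  · have := Nat.mul_le_mul_right 122 (Nat.sub_le P.K i)
    omega
  · rintro s' - ⟨hf, h3', hsel', htodo⟩
    rw [Nat.add_sub_cancel' hi] at h3' hsel' htodo
    exact ⟨hf, h3', hsel', htodo⟩

/-- The output tuple for the current choice. -/
def writeProg : Program :=
  .seq (blk [.set 4 (.lit 0)]) <|
  .while (.lt (.reg 4) (.reg 1)) <|
    blk [.ld 6 3 [.reg 4], .ld 6 5 [.reg 6], .ld 6 40 [.reg 6], .ld 6 23 [.reg 6], .write (.reg 6),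
      .op .add 4 (.reg 4) (.lit 1)]

/-- The tuple that belongs to a choice of nodes. -/
def Layout.out (P : Layout) (ds : DS) (q : ℕ → ℕ) : List ℕ := P.hd.map fun u => ds.val (q u)

theorem exec_writeProg {Γ : Ctx} {P : Layout} {s : State}
    (hp : Γ.prot = 40) (hS : Static P Γ.mem₀) (h1 : s.reg 1 = P.hd.length) (hb : s.buf = []) :
    Exec Γ writeProg s (P.hd.length * 122 + 30) fun s' => s'.mem = s.mem ∧
      (∀ k, k ≠ 4 → k ≠ 6 → s'.reg k = s.reg k) ∧
      s'.buf = P.out (view Γ.mem₀) fun v => s.mem [40, v] := by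
  refine Exec.ok fun ho₀ => ?_
  have hB := ho₀.1.1 1
  rw [h1] at hB
  refine Exec.mono (Exec.blk_seq 40 (by rw [hp]) (by decide) (T := P.hd.length * 122 + 1)
    fun _ => ⟨by simp, fun _ => ?_⟩) (by simp; omega)
  refine (Exec.while_count (fun j s' => s'.mem = s.mem ∧ s'.reg 4 = j ∧
      (∀ k, k ≠ 4 → k ≠ 6 → s'.reg k = s.reg k) ∧
      s'.buf = ((P.hd.take j).map fun u => (view Γ.mem₀).val (s.mem [40, u]))) P.hd.length 121
      ?_ ?_ ?_).imp le_rfl ?_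
  · rintro j s' hj ⟨-, h4, hr, -⟩
    simp [Test.holds, h4, hr 1 (by omega) (by omega), h1]
  · rintro j s' ho hj ⟨hm, h4, hr, hbuf⟩
    have hm' : ∀ (t : ℕ) (l : List ℕ), t < 40 → s.mem (t :: l) = Γ.mem₀ (t :: l) := fun t l ht =>
      ho₀.2 _ (by rw [hp]; exact ht)
    refine Exec.blk 40 (by rw [hp]) (by decide) fun _ => ⟨by simp [h4]; omega, fun _ => ?_⟩
    have hhd := hS.hd_eq j hj
    rw [List.getD_eq_getElem _ _ hj] at hhd
    generalize hs₂ : runs _ _ = s₂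
    simp only [runs, Cmd.run, Operand.val, List.map_cons, List.map_nil, h4, State.setReg_reg,
      if_true, State.setReg_mem, hm, hm', hhd, Nat.reduceLT] at hs₂
    subst hs₂
    refine ⟨hm, by simp [h4], fun k h h' => by simp [h, h', hr], ?_⟩
    rw [List.take_succ_eq_append_getElem hj, List.map_append]
    simp [hbuf]
  · simp [hb]
    intro k h h'
    simp [h]
  · rintro s' - ⟨hm, -, hr, hbuf⟩
    rw [List.take_length] at hbuf
    exact ⟨hm, hr, hbuf⟩

/-- Find the last position for which there is another node. -/
def advanceProg : Program :=
  .seq (blk [.set 5 (.lit 0)]) <|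
  .seq (.while (.lt (.lit 0) (.reg 3)) <|
    .seq (blk [.ld 4 10 [.reg 3], .ld 4 40 [.reg 4], .ld 6 41 [.reg 3], .op .add 6 (.reg 6) (.lit 1),
      .ld 7 27 [.reg 4, .reg 3]]) <|
    .ite (.lt (.reg 6) (.reg 7))
      (blk [.st 41 [.reg 3] (.reg 6), .ld 6 28 [.reg 4, .reg 3, .reg 6], .st 40 [.reg 3] (.reg 6),
        .set 5 (.lit 1), .set 8 (.reg 3), .set 3 (.lit 0)])
      (blk [.op .sub 3 (.reg 3) (.lit 1)])) <|
  blk [.set 3 (.reg 8)]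

/-- The carry of an odometer: positions with exhausted lists are given up from the last one
backwards. On success register 8 keeps the position found, register 5 is set, and setting register 3
to `0` ends the loop. -/
theorem exec_advanceProg {Γ : Ctx} {P : Layout} {s : State}
    (hQ : P.toPlan.Good) (hp : Γ.prot = 40) (hS : Static P Γ.mem₀)
    (h3 : s.reg 3 = P.K)
    (hsel : Selected P (view Γ.mem₀) P.K s.mem) :
    Exec Γ advanceProg s (P.K * 260 + 90) fun s' => Frame 3 8 s s' ∧
      (s'.reg 5 = 0 ∧ P.rest (view Γ.mem₀) (fun v => s.mem [41, v]) P.K (fun v => s.mem [40, v]) = [] ∨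
      s'.reg 5 = 1 ∧ s'.reg 3 ≤ P.K ∧ Selected P (view Γ.mem₀) (s'.reg 3) s'.mem ∧
        P.todo (view Γ.mem₀) (s'.reg 3) s'.mem =
          P.rest (view Γ.mem₀) (fun v => s.mem [41, v]) P.K (fun v => s.mem [40, v])) := by
  have hK := hQ.K_le
  refine Exec.mono (Exec.blk_seq 40 (by rw [hp]) (by decide) (T := P.K * 260 + 60)
    fun _ => ⟨by simp, fun _ => ?_⟩) (by simp; omega)
  refine Exec.mono (Exec.seq' (T₁ := P.K * 260 + 1) (T₂ := 21)
    (Exec.while_budget (fun b s' => Frame 3 8 s s' ∧ b = s'.reg 3 * 260 ∧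
      (s'.reg 5 = 0 ∧ s'.reg 3 ≤ P.K ∧ Selected P (view Γ.mem₀) (s'.reg 3) s'.mem ∧
        P.rest (view Γ.mem₀) (fun v => s'.mem [41, v]) (s'.reg 3) (fun v => s'.mem [40, v]) =
          P.rest (view Γ.mem₀) (fun v => s.mem [41, v]) P.K (fun v => s.mem [40, v]) ∨
      s'.reg 5 = 1 ∧ s'.reg 3 = 0 ∧ s'.reg 8 ≤ P.K ∧ Selected P (view Γ.mem₀) (s'.reg 8) s'.mem ∧
        P.todo (view Γ.mem₀) (s'.reg 8) s'.mem =
          P.rest (view Γ.mem₀) (fun v => s.mem [41, v]) P.K (fun v => s.mem [40, v]))) ?_ ?_) ?_)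
    (by omega)
  · rintro b s' ho ⟨hf, rfl, hc⟩ ht
    simp [Test.holds] at ht
    obtain ⟨h5, hle, hsel', hrest⟩ := hc.resolve_right fun h => by
      have := of_decide_eq_true ht
      omega
    replace ht := of_decide_eq_true ht
    obtain ⟨u, hu⟩ : ∃ u, s'.reg 3 = u + 1 := ⟨s'.reg 3 - 1, by omega⟩
    rw [hu] at hle hsel' hrest ⊢
    have hm : ∀ (t : ℕ) (l : List ℕ), t < 40 → s'.mem (t :: l) = Γ.mem₀ (t :: l) := fun t l ht =>
      ho.2 _ (by rw [hp]; exact ht)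
    have hlt := hsel'.ix_lt (u + 1) (by omega) le_rfl
    have hlB : (view Γ.mem₀).len (s'.mem [40, P.par (u + 1)]) (u + 1) ≤ Γ.B := by
      rw [view_len, ← hm _ _ (by omega)]
      exact ho.1.2.1 _
    have hpre : ∀ mem' : List ℕ → ℕ, (∀ v ≤ u, mem' [40, v] = s'.mem [40, v]) →
        (∀ v ≤ u, mem' [41, v] = s'.mem [41, v]) → Selected P (view Γ.mem₀) u mem' := by
      intro mem' h40 h41
      refine ⟨⟨(h40 0 (by omega)).trans hsel'.chosen.1, fun v h1 h2 => ?_⟩, fun v h1 h2 => ?_⟩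
      · have := hQ.par_lt v h1 (by omega)
        change mem' [40, v] ∈ DS.lst _ (mem' [40, P.par v]) v
        rw [h40 v h2, h40 _ (by omega)]
        exact hsel'.chosen.2 v h1 (by omega)
      · have := hQ.par_lt v h1 (by omega)
        rw [h41 v h2, h40 _ (by omega)]
        exact hsel'.ix_lt v h1 (by omega)
    -- Either the search is over, with register 3 equal to `0`, or it goes on at position `u`; `260`
    -- steps are granted per position.
    let b' : ℕ := if s'.mem [41, u + 1] + 1 < (view Γ.mem₀).len (s'.mem [40, P.par (u + 1)]) (u + 1)
      then 0 else u * 260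
    refine ⟨259, b', ?_, ?_⟩
    · have : b' ≤ u * 260 := by simp only [b']; split_ifs <;> omega
      omega
    refine Exec.mono (Exec.blk_seq 40 (by rw [hp]) (by decide) (T := 122)
      fun _ => ⟨by simp [hu]; omega, fun _ => ?_⟩) (by simp)
    generalize hs₁ : runs _ _ = s₁
    simp [hu, hm, hS.par_eq (u + 1) (by omega) (by omega)] at hs₁
    have q3 : s₁.reg 3 = u + 1 := by subst hs₁; simp [hu]
    have q4 : s₁.reg 4 = s'.mem [40, P.par (u + 1)] := by subst hs₁; simp
    have q5 : s₁.reg 5 = 0 := by subst hs₁; simp [h5]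
    have q6 : s₁.reg 6 = s'.mem [41, u + 1] + 1 := by subst hs₁; simp
    have q7 : s₁.reg 7 = (view Γ.mem₀).len (s'.mem [40, P.par (u + 1)]) (u + 1) := by
      subst hs₁; simp
    have qm : s₁.mem = s'.mem := by subst hs₁; rfl
    have qf : Frame 3 8 s s₁ := by subst hs₁; simp [hf]
    refine Exec.mono (Exec.ite (T := 121) (fun hc => ?_) (fun hc => ?_)) le_rfl
    · simp [Test.holds, q6, q7] at hc
      have hb' : b' = 0 := if_pos hc
      rw [hb']
      refine Exec.blk 40 (by rw [hp]) (by decide) fun _ => ⟨by simp, fun _ => ?_⟩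
      generalize hs₂ : runs _ _ = s₂
      simp [q3, q4, q6, qm, hm] at hs₂
      have e40 : ∀ v, s₂.mem [40, v] = if v = u + 1 then
          (view Γ.mem₀).elem (s'.mem [40, P.par (u + 1)]) (u + 1) (s'.mem [41, u + 1] + 1)
          else s'.mem [40, v] := fun v => by subst hs₂; simp [qm]
      have e41 : ∀ v, s₂.mem [41, v] = if v = u + 1 then s'.mem [41, u + 1] + 1
          else s'.mem [41, v] := fun v => by subst hs₂; simp [qm]
      have e8 : s₂.reg 8 = u + 1 := by subst hs₂; simp
      refine ⟨by subst hs₂; simp [qf], by subst hs₂; simp, Or.inr ⟨by subst hs₂; simp,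
        by subst hs₂; simp, by rw [e8]; exact hle, ?_, ?_⟩⟩
      · rw [e8]
        exact (hpre s'.mem (fun _ _ => rfl) fun _ _ => rfl).step hQ hle hc e40 e41
      · rw [e8, ← hrest]
        unfold Layout.todo
        rw [← Plan.flatMap_drop hQ (ix := fun v => s'.mem [41, v]) (q := fun v => s'.mem [40, v]) hle
          hc (by simp only [e40, if_true]) (by simp only [e41, if_true])
          (fun v hv => by simp only [e40, if_neg hv]) (fun v hv => by simp only [e41, if_neg hv])]
        rfl
    · simp [Test.holds, q6, q7] at hc
      have hb' : b' = u * 260 := if_neg (by rw [view_len]; omega)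
      rw [hb']
      refine Exec.mono (Exec.blk 40 (by rw [hp]) (by decide) fun _ => ⟨by simp, fun _ => ?_⟩) (by simp)
      generalize hs₂ : runs _ _ = s₂
      simp [q3] at hs₂
      have e3 : s₂.reg 3 = u := by subst hs₂; simp
      have em : s₂.mem = s'.mem := by subst hs₂; exact qm
      refine ⟨by subst hs₂; simp [qf], by rw [e3], Or.inl ⟨by subst hs₂; simp [q5], by omega, ?_, ?_⟩⟩
      · rw [e3, em]
        exact hpre _ (fun _ _ => rfl) fun _ _ => rfl
      · rw [e3, em, ← hrest, Plan.rest_of_len_le]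
        exact hc
  · exact ⟨by simp, by simp [h3], Or.inl ⟨by simp, by simp [h3], by simpa [h3] using hsel,
      by simp [h3]⟩⟩
  · rintro s₁ - ⟨⟨b, hf, -, hc⟩, ht⟩
    simp [Test.holds] at ht
    refine Exec.blk 40 (by rw [hp]) (by decide) fun _ => ⟨by simp, fun _ => ⟨by simp [hf], ?_⟩⟩
    rcases hc with ⟨h5, -, -, hrest⟩ | ⟨h5, -, h8, hsel', htodo⟩
    · left
      rw [show s₁.reg 3 = 0 by have := of_decide_eq_false ht; omega] at hrest
      exact ⟨by simp [h5], hrest.symm⟩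
    · right
      simp only [runs, Cmd.run, Operand.val, State.setReg_reg, if_true, State.setReg_mem]
      exact ⟨by simp [h5], h8, hsel', htodo⟩

/-! ### The routines with output -/

/-- Output the remaining choices. -/
def emitLoop : Program :=
  .while (.lt (.lit 0) (.reg 5)) <| .seq resetProg <| .seq writeProg <| .seq (.instr .emit)
    advanceProg

def enumProg : Program :=
  .seq (blk [.ld 1 12 [.lit 3], .ld 2 12 [.lit 2], .set 3 (.lit 0), .st 40 [.lit 0] (.lit 1),
    .ld 5 25 [.lit 1]]) emitLoop

def Layout.enumDelay (P : Layout) : ℕ := (P.K + P.hd.length) * 400 + 400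

theorem Ok.of_run {Γ : Ctx} {c c' : Config} {t : ℕ} (h : Run Γ c t c') : Ok Γ c'.state := by
  have := h.2.1 t le_rfl
  rwa [h.1] at this

theorem Run.seq {Γ : Ctx} {c : Config} {t : ℕ} {p q : Program} {k : List Program} {s : State}
    (h : Run Γ c t ⟨.seq p q :: k, s⟩) : Run Γ c (t + 1) ⟨p :: q :: k, s⟩ :=
  have hok := Ok.of_run h
  h.trans (Run.one (c := ⟨.seq p q :: k, s⟩) hok hok rfl)

theorem emits_emitLoop_zero {Γ : Ctx} {s : State} (hok : Ok Γ s) (h5 : s.reg 5 = 0) (d b : ℕ)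
    (hb : 1 ≤ b) : Emits Γ d b ⟨[emitLoop], s⟩ [] :=
  .halt (Run.one hok (by simpa [Config.step, emitLoop] using hok) rfl) hb (by
    simp [Config.step, emitLoop, Test.holds, h5])

/-- Induction on the number of outstanding choices. Before the first output there is one `resetProg`
and one `writeProg`; between two outputs there is an `advanceProg` in addition, all of it linear in
the size of the query. -/
theorem emits_emitLoop {Γ : Ctx} {P : Layout} {N : ℕ} {F : ℕ → (ℕ → ℕ) → Prop}
    (hQ : P.toPlan.Good) (hp : Γ.prot = 40) (hS : Static P Γ.mem₀)
    (hD : Dyn.Clean P.toPlan N F (view Γ.mem₀)) (h0 : (view Γ.mem₀).W 1 ≠ 0)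
    (E : List (ℕ → ℕ)) {s : State} (hidx : s.idx = []) (hok : Ok Γ s) (h1 : s.reg 1 = P.hd.length)
    (h2 : s.reg 2 = P.K) (h3 : s.reg 3 ≤ P.K) (h5 : 0 < s.reg 5) (hb : s.buf = [])
    (hsel : Selected P (view Γ.mem₀) (s.reg 3) s.mem)
    (hE : P.todo (view Γ.mem₀) (s.reg 3) s.mem = E) :
    Emits Γ P.enumDelay ((P.K + P.hd.length) * 122 + 40) ⟨[emitLoop], s⟩
      (E.map (P.out (view Γ.mem₀))) := by
  induction hn : E.length using Nat.strong_induction_on generalizing E s with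
  | _ n ih =>
    have r1 := Run.one (Γ := Γ) (c := ⟨[emitLoop], s⟩) hok
      (by simpa [Config.step, emitLoop] using hok) rfl
    simp only [Config.step, emitLoop, Test.holds, Operand.val, h5, decide_true, if_true] at r1
    have r2 := r1.seq
    obtain ⟨t₁, ht₁, s₁, r3, hi₁, hf₁, e3, hsel₁, htodo⟩ :=
      exec_resetProg hQ hp hS hD h0 h2 rfl h3 hsel hidx hok _
    have r4 := r2.trans r3
    have r5 := r4.seq
    obtain ⟨t₂, ht₂, s₂, r6, hi₂, hm₂, hr₂, hb₂⟩ :=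
      exec_writeProg hp hS ((hf₁.2.2 1 (by omega)).trans h1) (hf₁.2.1.trans hb) hi₁ (Ok.of_run r5) _
    have r7 := r5.trans r6
    have r8 := r7.seq
    have hok₂ : Ok Γ (s₂.setBuf []) := (Ok.of_run r8).setBuf (by simp)
    rw [hE, Layout.todo, Nat.sub_self, Plan.ext, List.singleton_append] at htodo
    rw [← htodo, List.map_cons]
    have hB : (P.K + P.hd.length) * 122 = P.K * 122 + P.hd.length * 122 := by ring
    refine .emit r8 (by omega) (congrArg some hb₂) hok₂ ?_
    obtain ⟨t₃, ht₃, s₃, r9, hi₃, hf₃, hc⟩ := exec_advanceProg (s := s₂.setBuf []) hQ hp hS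
      (by rw [State.setBuf_reg, hr₂ 3 (by omega) (by omega), e3]) (by simpa [hm₂] using hsel₁) hi₂ hok₂ [emitLoop]
    have hok₃ := Ok.of_run r9
    rw [State.setBuf_mem, hm₂] at hc
    have e1 : s₃.reg 1 = P.hd.length := by
      rw [hf₃.2.2 1 (by omega), State.setBuf_reg, hr₂ 1 (by omega) (by omega),
        hf₁.2.2 1 (by omega), h1]
    have e2 : s₃.reg 2 = P.K := by
      rw [hf₃.2.2 2 (by omega), State.setBuf_reg, hr₂ 2 (by omega) (by omega),
        hf₁.2.2 2 (by omega), h2]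
    have hT : t₃ + ((P.K + P.hd.length) * 122 + 40) ≤ P.enumDelay := by
      rw [Layout.enumDelay]
      omega
    rcases hc with ⟨c5, hnil⟩ | ⟨c5, c3, hsel₃, hrest⟩
    · rw [hnil]
      exact (emits_emitLoop_zero hok₃ c5 _ _ (by omega)).run r9 hT
    · refine (ih _ ?_ _ hi₃ hok₃ e1 e2 c3 (by omega) hf₃.2.1 hsel₃ hrest rfl).run r9 hT
      rw [← hn, ← htodo]
      simp

theorem emits_enumProg {Γ : Ctx} {P : Layout} {N : ℕ} {F : ℕ → (ℕ → ℕ) → Prop} {s : State}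
    (hQ : P.toPlan.Good) (hp : Γ.prot = 40) (hS : Static P Γ.mem₀)
    (hD : Dyn.Clean P.toPlan N F (view Γ.mem₀)) (hidx : s.idx = []) (hok : Ok Γ s)
    (hb : s.buf = []) :
    ∃ p : ℕ → ℕ, p 0 = 1 ∧ Emits Γ P.enumDelay P.enumDelay ⟨[enumProg], s⟩
      ((if (view Γ.mem₀).W 1 = 0 then [] else P.ext (view Γ.mem₀) P.K 0 p).map
        (P.out (view Γ.mem₀))) := by
  -- Array 40 may contain remains of an earlier call, possibly broken off. Only its entry `0`, the
  -- root, is set at the start; the others are overwritten before they matter.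
  refine ⟨fun v => if v = 0 then 1 else s.mem [40, v], rfl, ?_⟩
  have hm : ∀ (t : ℕ) (l : List ℕ), t < 40 → s.mem (t :: l) = Γ.mem₀ (t :: l) := fun t l ht =>
    hok.2 _ (by rw [hp]; exact ht)
  have r1 := Run.one (Γ := Γ) (c := ⟨[enumProg], s⟩) hok hok rfl
  simp only [Config.step, enumProg] at r1
  obtain ⟨t, ht, s', r2, hi', hs'⟩ := Exec.blk (Γ := Γ) (s := s) 40
    (cs := [.ld 1 12 [.lit 3], .ld 2 12 [.lit 2], .set 3 (.lit 0), .st 40 [.lit 0] (.lit 1),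
      .ld 5 25 [.lit 1]]) (Q := fun s' => s' = runs s [.ld 1 12 [.lit 3], .ld 2 12 [.lit 2],
        .set 3 (.lit 0), .st 40 [.lit 0] (.lit 1), .ld 5 25 [.lit 1]])
    (by rw [hp]) (by decide) (fun _ => ⟨by simp, fun _ => rfl⟩) hidx hok [emitLoop]
  have r3 := r1.trans r2
  have hok' := Ok.of_run r3
  simp [hm] at hs' ht
  have hd : (P.K + P.hd.length) * 122 ≤ (P.K + P.hd.length) * 400 := by omega
  have e5 : s'.reg 5 = (view Γ.mem₀).W 1 := by rw [hs']; simp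
  have e40 : (fun v => s'.mem [40, v]) = fun v => if v = 0 then 1 else s.mem [40, v] := by
    funext v; rw [hs']; simp
  have e3 : s'.reg 3 = 0 := by rw [hs']; simp
  split_ifs with h0
  · exact (emits_emitLoop_zero hok' (e5.trans h0) _ 1 le_rfl).run r3 (by
      rw [Layout.enumDelay]; omega)
  · refine (emits_emitLoop hQ hp hS hD h0 _ hi' hok' ?_ ?_ (by omega) (by omega) ?_ ?_ ?_).run r3 (by
      rw [Layout.enumDelay]; omega)
    · rw [hs']; simp [hS.hd_length]
    · rw [hs']; simp [hS.K_eq]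
    · rw [hs']; simpa using hb
    · rw [e3]
      exact ⟨⟨congrFun e40 0, fun v h1 h2 => by omega⟩, fun v h1 h2 => by omega⟩
    · rw [e3, Layout.todo, e40]
      simp [Plan.rest]

/-- Output the number of results. -/
def countProg : Program := .seq (blk [.ld 1 25 [.lit 1], .write (.reg 1)]) (.instr .emit)

/-- Output whether there is a result. -/
def answerProg : Program :=
  .seq (.seq (blk [.ld 1 25 [.lit 1]]) <|
    .ite (.lt (.lit 0) (.reg 1)) (blk [.write (.lit 1)]) (blk [.write (.lit 0)])) (.instr .emit)

theorem Exec.emits {Γ : Ctx} {p : Program} {s : State} {T d : ℕ} {o : List ℕ}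
    (h : Exec Γ p s T fun s' => s'.buf = o) (hidx : s.idx = []) (hok : Ok Γ s) :
    Emits Γ d (T + 2) ⟨[.seq p (.instr .emit)], s⟩ [o] := by
  have r1 := Run.one (Γ := Γ) (c := ⟨[.seq p (.instr .emit)], s⟩) hok hok rfl
  obtain ⟨t, ht, s', r2, hi', hs'⟩ := h hidx hok [.instr .emit]
  have r3 := r1.trans r2
  have hok' : Ok Γ (s'.setBuf []) := (Ok.of_run r3).setBuf (by simp)
  exact .emit r3 (by omega) (congrArg some hs') hok' (.halt (Run.refl hok') (Nat.zero_le _) rfl)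

theorem emits_countProg {Γ : Ctx} {s : State} {d : ℕ} (hp : Γ.prot = 40) (hidx : s.idx = [])
    (hok : Ok Γ s) (hb : s.buf = []) :
    Emits Γ d 50 ⟨[countProg], s⟩ [[(view Γ.mem₀).W 1]] := by
  have hm : s.mem [25, 1] = Γ.mem₀ [25, 1] := hok.2 _ (by rw [hp]; decide)
  refine (Exec.emits (Exec.blk 40 (by rw [hp]) (by decide) fun _ => ⟨by simp, fun _ => ?_⟩) hidx
    hok).run (Run.refl hok) (by simp)
  simp [hb, hm]

theorem emits_answerProg {Γ : Ctx} {s : State} {d : ℕ} (hp : Γ.prot = 40) (hidx : s.idx = [])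
    (hok : Ok Γ s) (hb : s.buf = []) :
    Emits Γ d 80 ⟨[answerProg], s⟩ [[if (view Γ.mem₀).W 1 = 0 then 0 else 1]] := by
  have hm : s.mem [25, 1] = Γ.mem₀ [25, 1] := hok.2 _ (by rw [hp]; decide)
  refine (Exec.emits (T := 70) (Exec.mono (Exec.blk_seq 40 (by rw [hp]) (by decide) (T := 22)
    fun _ => ⟨by simp, fun _ => ?_⟩) (by simp)) hidx hok).run (Run.refl hok) (by omega)
  refine Exec.ite (T := 21) (fun hc => ?_) fun hc => ?_ <;>
    refine Exec.blk 40 (by rw [hp]) (by decide) fun _ => ⟨by simp, fun _ => ?_⟩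
  · simp [Test.holds, hm] at hc
    simp [hb, hc.ne']
  · simp [Test.holds, hm] at hc
    simp [hb, hc]

/-! ### The query as the machine sees it -/

namespace Query

variable {σ : Schema} (φ : Query σ)

def raw : Raw where
  d := φ.atoms.length
  rel i := if h : i < φ.atoms.length then (φ.atoms[i].rel : ℕ) else 0
  args i := if h : i < φ.atoms.length then List.ofFn φ.atoms[i].args else []
  quant := φ.quantified
  head := φ.head

theorem raw_rel {i : ℕ} (h : i < φ.atoms.length) : φ.raw.rel i = (φ.atoms[i].rel : ℕ) := dif_pos h

theorem raw_args {i : ℕ} (h : i < φ.atoms.length) : φ.raw.args i = List.ofFn φ.atoms[i].args :=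
  dif_pos h

theorem mem_raw_args {i x : ℕ} (h : i < φ.atoms.length) :
    x ∈ φ.raw.args i ↔ x ∈ φ.atoms[i].vars := by
  rw [raw_args φ h, List.mem_ofFn]
  exact Iff.rfl

theorem exists_mem_raw_args {x : ℕ} : (∃ i < φ.raw.d, x ∈ φ.raw.args i) ↔ x ∈ φ.vars := by
  constructor
  · rintro ⟨i, hi, hx⟩
    exact ⟨_, List.getElem_mem hi, (φ.mem_raw_args hi).1 hx⟩
  · rintro ⟨ψ, hψ, hx⟩
    obtain ⟨i, hi, rfl⟩ := List.getElem_of_mem hψ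
    exact ⟨i, hi, (φ.mem_raw_args hi).2 hx⟩

variable {φ}

/-- Suppose that `x` and `y` share an atom and `y` occurs in an atom without `x`. Then condition (i)
leaves `atoms(x) ⊊ atoms(y)`, so `y` occurs in more atoms, and by (ii) `x` is quantified if `y` is.
Both make the rank of `y` smaller than that of `x`. -/
theorem QHierarchical.raw_good (hφ : φ.QHierarchical) : φ.raw.Good where
  d_pos := List.length_pos_of_ne_nil φ.atoms_ne_nil
  args_ne i hi := by
    rw [φ.raw_args hi]
    intro h
    have := congrArg List.length h
    have := σ.ar_pos φ.atoms[i].rel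
    simp at *
    omega
  mem_head x := by
    rw [exists_mem_raw_args]
    exact φ.mem_head x
  hier x y hxy i hi hx hy j hj hyj := by
    have hx' := φ.exists_mem_raw_args.1 ⟨i, hi, hx⟩
    have hy' := φ.exists_mem_raw_args.1 ⟨i, hi, hy⟩
    obtain ⟨h1, h2⟩ := hφ x hx' y hy'
    have hne : ¬ φ.atomsOf x ∩ φ.atomsOf y = ∅ := fun h => by
      have : φ.atoms[i] ∈ φ.atomsOf x ∩ φ.atomsOf y :=
        ⟨⟨List.getElem_mem hi, (φ.mem_raw_args hi).1 hx⟩,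
          ⟨List.getElem_mem hi, (φ.mem_raw_args hi).1 hy⟩⟩
      rw [h] at this
      exact this
    have key : φ.atomsOf y ⊆ φ.atomsOf x → x ∈ φ.raw.args j := fun h =>
      (φ.mem_raw_args hj).2 (h ⟨List.getElem_mem hj, (φ.mem_raw_args hj).1 hyj⟩).2
    rcases h1 with h | h | h
    · by_contra hxj
      have hfree := h2 ⟨h, fun h' => hxj (key h')⟩
      have hle : ∀ i ∈ Finset.range φ.raw.d, φ.raw.inAtom i x ≤ φ.raw.inAtom i y := by
        intro i hi
        rw [Finset.mem_range] at hi
        unfold Raw.inAtom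
        split_ifs with ha hb
        · exact le_rfl
        · exact absurd ((φ.mem_raw_args hi).2 (h ⟨List.getElem_mem hi, (φ.mem_raw_args hi).1 ha⟩).2) hb
        · exact Nat.zero_le _
        · exact le_rfl
      have hlt := Finset.sum_lt_sum hle ⟨j, Finset.mem_range.2 hj, by
        simp [Raw.inAtom, hxj, hyj]⟩
      have hd : ∑ i ∈ Finset.range φ.raw.d, φ.raw.inAtom i y ≤ φ.raw.d := by
        refine (Finset.sum_le_card_nsmul _ _ 1 fun i _ => ?_).trans (by simp)
        unfold Raw.inAtom
        split_ifs <;> omega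
      have hq : φ.raw.isq y ≤ φ.raw.isq x := by
        unfold Raw.isq
        split_ifs with ha hb
        · exact le_rfl
        · exact absurd ha (hfree ⟨hx', hb⟩).2
        · exact Nat.zero_le _
        · exact le_rfl
      have := Nat.mul_le_mul_right (φ.raw.d + 1) hq
      unfold Raw.rk at hxy
      omega
    · exact key h
    · exact absurd h hne

variable (φ)

theorem length_names : φ.raw.names.length = (φ.atoms.map fun ψ => σ.ar ψ.rel).sum := by
  unfold Raw.names
  rw [List.length_flatMap]
  congr 1
  refine List.ext_getElem (by simp [raw]) fun i h1 h2 => ?_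
  rw [List.length_map] at h2
  simp [φ.raw_args h2]

theorem size_bounds : 4 ≤ φ.size ∧ φ.raw.names.length ≤ φ.size ∧ φ.raw.d ≤ φ.size ∧
    φ.raw.head.length ≤ φ.size ∧ φ.raw.quant.length ≤ φ.size := by
  have hd : 0 < φ.atoms.length := List.length_pos_of_ne_nil φ.atoms_ne_nil
  have h1 : (φ.atoms.map fun ψ => σ.ar ψ.rel + 1).sum =
      φ.raw.names.length + φ.atoms.length := by
    rw [length_names, List.sum_map_add]
    simp
  have h2 : φ.atoms.length ≤ φ.raw.names.length := by
    rw [length_names]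
    refine le_trans ?_ (List.length_le_sum_of_one_le _ fun n hn => ?_)
    · simp
    · obtain ⟨ψ, -, rfl⟩ := List.mem_map.1 hn
      exact σ.ar_pos _
  have h3 : φ.head.length ≤ φ.raw.names.length := by
    refine List.Subperm.length_le (List.subperm_of_subset φ.head_nodup fun x hx => ?_)
    rw [Raw.mem_names, exists_mem_raw_args]
    exact ((φ.mem_head x).1 hx).1
  have e1 : φ.raw.d = φ.atoms.length := rfl
  have e2 : φ.raw.head = φ.head := rfl
  have e3 : φ.raw.quant = φ.quantified := rfl
  unfold size
  rw [e1, e2, e3]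
  omega

/-- The data structure for the query. -/
noncomputable def layout : Layout := φ.raw.layout φ.raw.vars φ.size

variable {φ}

theorem QHierarchical.layout_good (hφ : φ.QHierarchical) : φ.layout.Good :=
  hφ.raw_good.layout_good φ.raw.order_vars φ.size_bounds.2.1 φ.size_bounds.2.2.1
    φ.size_bounds.2.2.2.1

end Query

/-! ### From words back to databases and query results -/

/-- The facts of a database, as sequences of words. -/
def Database.codes {σ : Schema} (D : Database σ) : Set (List ℕ) :=
  {g | ∃ f : Fact σ, f.2 ∈ D f.1 ∧ g = f.encode}

theorem Fact.encode_injective {σ : Schema} : Function.Injective (Fact.encode (σ := σ)) := by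
  rintro ⟨R, t⟩ ⟨R', t'⟩ h
  simp only [Fact.encode, List.cons.injEq] at h
  obtain rfl : R = R' := Fin.ext h.1
  have := List.ofFn_injective h.2
  congr 1
  funext j
  exact PNat.coe_injective (congrFun this j)

namespace Query

variable {σ : Schema} {φ : Query σ}

theorem mem_raw_vars {x : ℕ} (hx : x ∈ φ.vars) : x ∈ φ.raw.vars :=
  (φ.raw.order_vars.mem_iff x).2 (φ.exists_mem_raw_args.2 hx)

theorem sat_iff {D : Database σ} {i : ℕ} (hi : i < φ.atoms.length) {ν : ℕ → ℕ} :
    φ.layout.Sat D.codes i ν ↔ ∃ t : Fin (σ.ar φ.atoms[i].rel) → ℕ+,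
      t ∈ D φ.atoms[i].rel ∧ ∀ j, (t j : ℕ) =
      ν (Raw.pos φ.raw.vars (φ.atoms[i].args j)) := by
  have hl : φ.layout.rel i :: (List.range (φ.layout.ar i)).map (fun p => ν (φ.layout.arg i p)) =
      (φ.atoms[i].rel : ℕ) :: List.ofFn fun j => ν (Raw.pos φ.raw.vars (φ.atoms[i].args j)) := by
    congr 1
    · exact φ.raw_rel hi
    · change (List.range (φ.raw.args i).length).map (fun p => ν (Raw.pos φ.raw.vars
        ((φ.raw.args i).getD p 0))) = _
      rw [φ.raw_args hi]
      refine List.ext_getElem (by simp) fun p h1 h2 => ?_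
      simp at h1 h2
      simp [h2]
  unfold Layout.Sat
  rw [hl]
  constructor
  · rintro ⟨⟨R, t⟩, ht, he⟩
    simp only [Fact.encode, List.cons.injEq] at he
    obtain rfl : R = φ.atoms[i].rel := Fin.ext he.1.symm
    exact ⟨t, ht, fun j => (congrFun (List.ofFn_injective he.2) j).symm⟩
  · rintro ⟨t, ht, he⟩
    refine ⟨⟨_, t⟩, ht, ?_⟩
    simp only [Fact.encode]
    congr 2
    exact funext fun j => (he j).symm

/-- Translates between valuations of variables by positive integers and valuations of positions by
words, via `Raw.pos` and `Raw.var`, which are inverse to each other on the variables of the query.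
-/
theorem mem_result_iff {D : Database σ} {a : Fin φ.head.length → ℕ+} :
    a ∈ φ.result D ↔ ∃ ν : ℕ → ℕ, (∀ i < φ.layout.d, φ.layout.Sat D.codes i ν) ∧
      ∀ h, ν (Raw.pos φ.raw.vars (φ.head.get h)) = a h := by
  constructor
  · rintro ⟨ν, h1, h2⟩
    have hν : ∀ x ∈ φ.vars, ν (Raw.var φ.raw.vars (Raw.pos φ.raw.vars x)) = ν x := fun x hx => by
      rw [Raw.var_pos (mem_raw_vars hx)]
    refine ⟨fun u => ν (Raw.var φ.raw.vars u), fun i hi => ?_, fun h => ?_⟩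
    · refine (sat_iff hi).2 ⟨_, h2 _ (List.getElem_mem hi), fun j => ?_⟩
      rw [hν _ ⟨_, List.getElem_mem hi, j, rfl⟩]
    · refine congrArg PNat.val ?_
      rw [hν _ ((φ.mem_head _).1 (List.get_mem _ _)).1, h1]
  · rintro ⟨ν, h1, h2⟩
    -- For variables of the query `toPNat'` loses nothing, as their values are entries of database
    -- tuples and thus positive.
    refine ⟨fun x => (ν (Raw.pos φ.raw.vars x)).toPNat', fun h => ?_, fun ψ hψ => ?_⟩
    · change (ν (Raw.pos φ.raw.vars (φ.head.get h))).toPNat' = _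
      rw [h2]
      exact PNat.coe_toPNat' _
    · obtain ⟨i, hi, rfl⟩ := List.getElem_of_mem hψ
      obtain ⟨t, ht, he⟩ := (sat_iff hi).1 (h1 i hi)
      convert ht using 1
      funext j
      change (ν (Raw.pos φ.raw.vars (φ.atoms[i].args j))).toPNat' = _
      rw [← he]
      exact PNat.coe_toPNat' _

/-- The choices of nodes correspond to the query result. -/
theorem QHierarchical.result_spec (hφ : φ.QHierarchical) {D : Database σ} {N : ℕ} {ds : DS}
    (hD : Dyn.Clean φ.layout.toPlan N (φ.layout.Sat D.codes) ds) {p : ℕ → ℕ} (hp : p 0 = 1) :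
    ∃ E : List (Fin φ.head.length → ℕ+), E.Nodup ∧ (∀ a, a ∈ E ↔ a ∈ φ.result D) ∧
      (if ds.W 1 = 0 then [] else φ.layout.ext ds φ.layout.K 0 p).map (φ.layout.out ds) =
        E.map (fun a => List.ofFn fun i => (a i : ℕ)) ∧ E.length = ds.W 1 := by
  have hP := hφ.layout_good
  have hhd : ∀ h, 1 ≤ Raw.pos φ.raw.vars (φ.head.get h) ∧
      Raw.pos φ.raw.vars (φ.head.get h) ≤ φ.layout.K := fun h =>
    (hP.mem_hd _).1 (List.mem_map.2 ⟨_, List.get_mem _ _, rfl⟩)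
  by_cases h0 : ds.W 1 = 0
  · refine ⟨[], List.nodup_nil, fun a => ⟨fun h => (List.not_mem_nil h).elim, fun h => ?_⟩, by simp [h0],
      by simp [h0]⟩
    obtain ⟨ν, hν, -⟩ := mem_result_iff.1 h
    exact absurd h0 (hD.ext_complete hP.toGood hp hν).1
  let f : (ℕ → ℕ) → Fin φ.head.length → ℕ+ := fun q h =>
    (ds.val (q (Raw.pos φ.raw.vars (φ.head.get h)))).toPNat'
  have hf : ∀ q ∈ φ.layout.ext ds φ.layout.K 0 p, f q ∈ φ.result D ∧
      ∀ h, (f q h : ℕ) = ds.val (q (Raw.pos φ.raw.vars (φ.head.get h))) := by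
    intro q hq
    obtain ⟨ν, hν, hv⟩ := hD.ext_sound hP.toGood h0 hp hq
    have hpos : ∀ h, (f q h : ℕ) = ds.val (q (Raw.pos φ.raw.vars (φ.head.get h))) := fun h => by
      -- A head variable occurs in some atom; the tuple satisfying that atom shows that its value is
      -- positive.
      have hx := ((φ.mem_head _).1 (List.get_mem φ.head h)).1
      obtain ⟨ψ, hψ, j, hj⟩ := hx
      obtain ⟨i, hi, rfl⟩ := List.getElem_of_mem hψ
      obtain ⟨t, -, he⟩ := (sat_iff hi).1 (hν i hi)
      have := he j
      rw [hj, hv _ (hhd h).2] at this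
      simp only [f]
      rw [← this]
      exact congrArg PNat.val (PNat.coe_toPNat' _)
    exact ⟨mem_result_iff.2 ⟨ν, hν, fun h => by rw [hv _ (hhd h).2, hpos]⟩, hpos⟩
  refine ⟨(φ.layout.ext ds φ.layout.K 0 p).map f, ?_, fun a => ?_, ?_, ?_⟩
  · refine List.Nodup.map_on (fun q hq q' hq' he => ?_)
      (hD.nodup_ext hP.toGood _ _ (by have := hP.K_le; omega) _)
    -- Every free position is the position of a head variable, so equal output tuples mean equal
    -- values at all positions up to `K`.
    refine hD.ext_inj hP.toGood hp hq hq' fun v h1 h2 => ?_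
    obtain ⟨x, hx, rfl⟩ := List.mem_map.1 ((hP.mem_hd v).2 ⟨h1, h2⟩)
    obtain ⟨h, rfl⟩ := List.get_of_mem hx
    exact ((hf q hq).2 h).symm.trans ((congrArg (fun g => (g h : ℕ)) he).trans ((hf q' hq').2 h))
  · rw [List.mem_map]
    constructor
    · rintro ⟨q, hq, rfl⟩
      exact (hf q hq).1
    · intro ha
      obtain ⟨ν, hν, hv⟩ := mem_result_iff.1 ha
      obtain ⟨-, q, hq, hval⟩ := hD.ext_complete hP.toGood hp hν
      refine ⟨q, hq, funext fun h => PNat.coe_injective ?_⟩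
      rw [(hf q hq).2 h, hval _ (hhd h).1 (hhd h).2, hv]
  · rw [if_neg h0, List.map_map]
    refine List.map_congr_left fun q hq => ?_
    change (φ.head.map _).map _ = List.ofFn fun i => (f q i : ℕ)
    refine List.ext_getElem (by simp) fun i h1 h2 => ?_
    simp at h1
    simp [(hf q hq).2]
  · rw [List.length_map, hD.length_ext_zero hP.toGood h0 hp]

end Query

/-! ### The dynamic algorithm -/

def algorithm : DynamicAlgorithm := ⟨preProg, updateProg, enumProg, countProg, answerProg⟩

theorem Config.HaltedAt.after_eq {c : Config} {t t' : ℕ} (h : c.HaltedAt t) (hle : t ≤ t') :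
    c.after t' = c.after t := by
  obtain ⟨n, rfl⟩ := Nat.exists_eq_add_of_le hle
  rw [Config.after_add, Config.after_of_halted h]

theorem Config.HaltedAt.mono {c : Config} {t t' : ℕ} (h : c.HaltedAt t) (hle : t ≤ t') :
    c.HaltedAt t' := by
  rw [Config.HaltedAt, h.after_eq hle]
  exact h

theorem Config.DelayLE.mono {c : Config} {d d' : ℕ} (h : c.DelayLE d) (hle : d ≤ d') :
    c.DelayLE d' := by
  intro i
  rcases h i with ⟨j, h1, h2, h3⟩ | h
  · exact Or.inl ⟨j, h1, by omega, h3⟩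
  · exact Or.inr (h.mono (by omega))

theorem Config.HaltedAt.outputs_eq {c : Config} {t t' : ℕ} (h : c.HaltedAt t) (hle : t ≤ t') :
    c.outputs t' = c.outputs t := by
  obtain ⟨n, rfl⟩ := Nat.exists_eq_add_of_le hle
  rw [Config.outputs_add]
  have : (c.after t).outputs n = [] := by
    rw [Config.outputs, List.filterMap_eq_nil_iff]
    intro i _
    rw [Config.after_of_halted h, Config.emitted, show (c.after t).code = [] from h]
  rw [this, List.append_nil]

/-- What `Exec` means for the behaviour of the machine. -/
theorem Exec.spec {Γ : Ctx} {p : Program} {s : State} {T : ℕ} {Q : State → Prop}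
    (h : Exec Γ p s T Q) (hi : s.idx = []) (hok : Ok Γ s) : Config.HaltedAt ⟨[p], s⟩ T ∧
      (∀ t, Ok Γ (Config.after ⟨[p], s⟩ t).state) ∧
      ∀ t, Config.HaltedAt ⟨[p], s⟩ t → Q (Config.after ⟨[p], s⟩ t).state := by
  obtain ⟨t, ht, s', hr, -, hq⟩ := h hi hok []
  have hh : Config.HaltedAt ⟨[p], s⟩ t := by rw [Config.HaltedAt, hr.1]
  refine ⟨hh.mono ht, fun t' => ?_, fun t' ht' => ?_⟩
  · rcases le_total t' t with h | h
    · exact hr.2.1 _ h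
    · rw [hh.after_eq h]
      exact hr.2.1 _ le_rfl
  · have : Config.after ⟨[p], s⟩ t' = ⟨[], s'⟩ := by
      rcases le_total t' t with h | h
      · rw [← ht'.after_eq h, hr.1]
      · rw [hh.after_eq h, hr.1]
    rw [this]
    exact hq

section
variable {σ : Schema}

theorem Lists.codes_eq {L : List (Fact σ)} {D : Database σ} (hL : Lists L D) :
    {g | ∃ f ∈ L.map (fun f => ((f.1 : ℕ), List.ofFn fun j => (f.2 j : ℕ))), g = f.1 :: f.2} =
      D.codes := by
  ext g
  simp only [Set.mem_ofPred_eq, List.mem_map, Database.codes]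
  constructor
  · rintro ⟨_, ⟨f, hf, rfl⟩, rfl⟩
    exact ⟨f, (hL.2 f).1 hf, rfl⟩
  · rintro ⟨f, hf, rfl⟩
    exact ⟨_, ⟨f, (hL.2 f).2 hf, rfl⟩, rfl⟩

theorem Lists.sum_ar_le {L : List (Fact σ)} {D : Database σ} (hL : Lists L D) :
    (L.map fun f => σ.ar f.1).sum ≤ D.size := by
  classical
  have h : (⟨((L : Multiset (Fact σ)) :), hL.1⟩ : Finset (Σ R : Fin σ.card, (Fin (σ.ar R) → ℕ+))) =
      Finset.univ.sigma fun R => D R := by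
    ext ⟨R, t⟩
    rw [Finset.mem_sigma]
    exact (hL.2 ⟨R, t⟩).trans ⟨fun h => ⟨Finset.mem_univ R, h⟩, fun h => h.2⟩
  have h2 : (L.map fun f => σ.ar f.1).sum =
    ∑ f ∈ (⟨((L : Multiset (Fact σ)) :), hL.1⟩ : Finset (Σ R : Fin σ.card, (Fin (σ.ar R) → ℕ+))), σ.ar f.1 := rfl
  rw [h2, h, Finset.sum_sigma]
  refine le_trans (le_of_eq ?_) (Nat.le_add_left _ _)
  exact Finset.sum_congr rfl fun R _ =>
    (Finset.sum_const (s := (D R : Finset (Fin (σ.ar R) → ℕ+))) (σ.ar R)).trans (mul_comm _ _)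

/-- The fact that an update inserts or deletes. -/
def Update.fact : Update σ → Fact σ
  | .insert f => f
  | .delete f => f

def Update.op : Update σ → ℕ
  | .insert _ => 1
  | .delete _ => 0

theorem Update.encode_eq (u : Update σ) : u.encode = u.op :: u.fact.encode := by cases u <;> rfl

theorem Update.op_le (u : Update σ) : u.op ≤ 1 := by cases u <;> simp [Update.op]

theorem Update.mem_apply (u : Update σ) (D : Database σ) (f : Fact σ) :
    f.2 ∈ u.apply D f.1 ↔ (f = u.fact ∧ u.op = 1) ∨ (f ≠ u.fact ∧ f.2 ∈ D f.1) := by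
  obtain ⟨R, t⟩ := f
  cases u with
  | insert g =>
    obtain ⟨R', t'⟩ := g
    simp only [Update.fact, Update.op, and_true]
    by_cases h : R = R'
    · subst h
      have hs : (Update.insert ⟨R, t'⟩).apply D R = Insert.insert t' (D R) := Function.update_self ..
      rw [hs, Finset.mem_insert]
      have : (⟨R, t⟩ : Fact σ) = ⟨R, t'⟩ ↔ t = t' := by simp
      tauto
    · have hs : (Update.insert ⟨R', t'⟩).apply D R = D R := Function.update_of_ne h ..
      rw [hs]
      have : (⟨R, t⟩ : Fact σ) ≠ ⟨R', t'⟩ := fun h' => h (congrArg Sigma.fst h')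
      tauto
  | delete g =>
    obtain ⟨R', t'⟩ := g
    simp only [Update.fact, Update.op, zero_ne_one, and_false, false_or]
    by_cases h : R = R'
    · subst h
      have hs : (Update.delete ⟨R, t'⟩).apply D R = (D R).erase t' := Function.update_self ..
      rw [hs, Finset.mem_erase]
      have : (⟨R, t⟩ : Fact σ) = ⟨R, t'⟩ ↔ t = t' := by simp
      tauto
    · have hs : (Update.delete ⟨R', t'⟩).apply D R = D R := Function.update_of_ne h ..
      rw [hs]
      have : (⟨R, t⟩ : Fact σ) ≠ ⟨R', t'⟩ := fun h' => h (congrArg Sigma.fst h')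
      tauto

theorem Update.mem_codes_apply (u : Update σ) (D : Database σ) (g : List ℕ) :
    g ∈ (u.apply D).codes ↔ (g = u.fact.encode ∧ u.op = 1) ∨ (g ≠ u.fact.encode ∧ g ∈ D.codes) := by
  simp only [Database.codes, Set.mem_ofPred_eq, Update.mem_apply]
  constructor
  · rintro ⟨f, ⟨rfl, h⟩ | ⟨hne, h⟩, rfl⟩
    · exact Or.inl ⟨rfl, h⟩
    · exact Or.inr ⟨fun h' => hne (Fact.encode_injective h'), f, h, rfl⟩
  · rintro (⟨rfl, h⟩ | ⟨hne, f, h, rfl⟩)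
    · exact ⟨_, Or.inl ⟨rfl, h⟩, rfl⟩
    · exact ⟨f, Or.inr ⟨fun h' => hne (congrArg _ h'), h⟩, rfl⟩

theorem encodeInput_eq (φ : Query σ) (L : List (Fact σ)) : encodeInput φ L =
    φ.raw.code (List.ofFn σ.ar) ++
      ((L.map fun f => ((f.1 : ℕ), List.ofFn fun j => (f.2 j : ℕ))).length ::
        (L.map fun f => ((f.1 : ℕ), List.ofFn fun j => (f.2 j : ℕ))).flatMap fun f => f.1 :: f.2) := by
  have h1 : (List.range φ.raw.d).flatMap (fun i => φ.raw.rel i :: φ.raw.args i) =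
      φ.atoms.flatMap Atom.encode := by
    rw [List.flatMap_def, List.flatMap_def]
    congr 1
    refine List.ext_getElem (by simp [Query.raw]) fun i h1 h2 => ?_
    rw [List.length_map] at h2
    simp [φ.raw_args h2, φ.raw_rel h2, Atom.encode]
  unfold encodeInput Raw.code
  rw [h1, List.length_ofFn, List.length_map, List.flatMap_map]
  simp [Schema.encode, Query.encode, Query.raw]
  rfl

end

/-! ### Time and space -/

theorem Layout.factTime_le {P : Layout} (hP : P.Good) (hn : 1 ≤ P.n) :
    P.factTime ≤ 5300 * P.n ^ 3 := by
  have hm := hP.m_le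
  have hd := hP.d_le
  unfold Layout.factTime Layout.atomTime
  generalize P.n = n at *
  obtain ⟨k, rfl⟩ := Nat.exists_eq_add_of_le hn
  calc P.d * (240 * (1 + k) + (P.m + 1) * (300 * (P.d + P.m + 1) + 1500) + 200) + 30
      ≤ (1 + k) * (240 * (1 + k) + (1 + k + 1) * (300 * (1 + k + (1 + k) + 1) + 1500) + 200) + 30 := by
        gcongr
    _ ≤ 5300 * (1 + k) ^ 3 := by
        ring_nf
        nlinarith [Nat.zero_le k]

theorem Layout.updateTime_le {P : Layout} (hP : P.Good) (hn : 1 ≤ P.n) :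
    P.updateTime ≤ 10000 * P.n ^ 4 := by
  have h := Layout.factTime_le hP hn
  have h1 : P.n ≤ P.n ^ 4 := Nat.le_self_pow (by norm_num) _
  have h3 : P.n ^ 3 ≤ P.n ^ 4 := Nat.pow_le_pow_right hn (by norm_num)
  unfold Layout.updateTime
  omega

theorem Layout.enumDelay_le {P : Layout} (hP : P.Good) (hn : 1 ≤ P.n) :
    P.enumDelay ≤ 10000 * P.n ^ 4 := by
  have h1 : P.n ≤ P.n ^ 4 := Nat.le_self_pow (by norm_num) _
  have := hP.K_le
  have := hP.m_le
  have := hP.hd_le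
  unfold Layout.enumDelay
  omega

theorem loadTime_le (c : ℕ) {n : ℕ} (hn : 1 ≤ n) : loadTime c n ≤ 62 * c + 4400 * n ^ 4 := by
  unfold loadTime
  obtain ⟨k, rfl⟩ := Nat.exists_eq_add_of_le hn
  ring_nf
  nlinarith [Nat.zero_le k]

/-- Arities are positive, so the fixed cost of a fact can be charged to its length; `5512 = 5300 +
62 + 150`. -/
theorem Layout.sum_readTime_le {P : Layout} (hP : P.Good) (hn : 1 ≤ P.n) (fs : List (ℕ × List ℕ))
    (hfs : ∀ f ∈ fs, f.2 ≠ []) :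
    (fs.map P.readTime).sum ≤ 5512 * P.n ^ 4 * (fs.map fun f => f.2.length).sum := by
  rw [← List.sum_map_mul_left]
  refine List.sum_le_sum fun f hf => ?_
  have h := Layout.factTime_le hP hn
  have h1 : 1 ≤ P.n ^ 4 := Nat.one_le_pow _ _ hn
  have h3 : P.n ^ 3 ≤ P.n ^ 4 := Nat.pow_le_pow_right hn (by norm_num)
  have h2 := List.length_pos_of_ne_nil (hfs f hf)
  unfold Layout.readTime
  have h4 := Nat.le_mul_of_pos_right (P.n ^ 4) h2
  have h5 := Nat.le_mul_of_pos_left f.2.length h1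
  rw [mul_assoc]
  omega

theorem Plan.M_le (Q : Plan) (N : ℕ) : Q.M N ≤ (N + 2) ^ (2 * Q.m + 2) := by
  have h1 : Q.m + 1 ≤ (N + 2) ^ Q.m :=
    (Nat.lt_two_pow_self (n := Q.m)).trans_le (Nat.pow_le_pow_left (by omega) _)
  have h2 : (N + 1) ^ (Q.m + 1) ≤ (N + 2) ^ (Q.m + 1) := Nat.pow_le_pow_left (by omega) _
  have h3 := Nat.mul_le_mul h1 h2
  have h4 : 2 ≤ (N + 2) ^ (2 * Q.m + 1) :=
    le_trans (by omega) (Nat.le_self_pow (by omega) (N + 2))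
  have h5 := Nat.mul_le_mul_left ((N + 2) ^ (2 * Q.m + 1)) (show 2 ≤ N + 2 by omega)
  rw [← pow_add, show Q.m + (Q.m + 1) = 2 * Q.m + 1 by omega] at h3
  rw [← pow_succ, show 2 * Q.m + 1 + 1 = 2 * Q.m + 2 by omega] at h5
  unfold Plan.M
  exact (Nat.add_le_add h3 h4).trans (by omega)

/-- By `Plan.M_le` the largest weight is below `(N + 2) ^ ((2 * m + 2) * (m + 2))`, with an exponent
at most `12 * n ^ 2`: words of polynomially many times `log (N + 2)` bits. -/
theorem Layout.fits {P : Layout} (hP : P.Good) (N : ℕ) (hn : 1 ≤ P.n) :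
    P.Fits N ((N + 2) ^ (10000 * P.n ^ 4)) where
  pow_le := by
    refine (Nat.pow_le_pow_left (P.toPlan.M_le N) _).trans ?_
    rw [← pow_mul]
    refine Nat.pow_le_pow_right (by omega) ?_
    have hm := hP.m_le
    have h2 : P.n ^ 2 ≤ P.n ^ 4 := Nat.pow_le_pow_right hn (by norm_num)
    calc (2 * P.m + 2) * (P.m + 2) ≤ (2 * P.n + 2 * P.n) * (P.n + 2 * P.n) := by
          gcongr <;> omega
      _ = 12 * P.n ^ 2 := by ring
      _ ≤ _ := by omega
  n_le := by
    have h1 : P.n ≤ P.n ^ 4 := Nat.le_self_pow (by norm_num) _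
    have h2 : P.n < 2 ^ P.n := Nat.lt_two_pow_self
    calc 2 * P.n + 10 ≤ 2 ^ 4 * 2 ^ P.n := by omega
      _ = 2 ^ (4 + P.n) := (pow_add 2 4 P.n).symm
      _ ≤ 2 ^ (10000 * P.n ^ 4) := Nat.pow_le_pow_right (by norm_num) (by omega)
      _ ≤ _ := Nat.pow_le_pow_left (by omega) _

theorem hundred_le_wordBound (N : ℕ) {e : ℕ} (h : 7 ≤ e) : 100 ≤ (N + 2) ^ e :=
  calc 100 ≤ 2 ^ 7 := by norm_num
    _ ≤ 2 ^ e := Nat.pow_le_pow_right (by norm_num) h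
    _ ≤ _ := Nat.pow_le_pow_left (by omega) _

theorem le_wordBound (N : ℕ) {e : ℕ} (h : 7 ≤ e) : N ≤ (N + 2) ^ e :=
  le_trans (by omega) (Nat.le_self_pow (by omega) (N + 2))

/-! ### The invariant -/

section
variable {σ : Schema}

/-- Between two calls, the memory contains the data structure for the current database. -/
structure Query.Inv (φ : Query σ) (N B : ℕ) (s : State) (D : Database σ) : Prop where
  reg_le : ∀ r, s.reg r ≤ B
  mem_le : ∀ a, s.mem a ≤ B
  static : Static φ.layout s.mem
  clean : Dyn.Clean φ.layout.toPlan N (φ.layout.Sat D.codes) (view s.mem)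

variable {φ : Query σ} {N B : ℕ} {s : State} {D : Database σ}

theorem Query.Inv.ok (h : φ.Inv N B s D) (hB : 100 ≤ B) (p : ℕ) {l : List ℕ} (hl : ∀ w ∈ l, w ≤ B) :
    Ok ⟨B, p, s.mem, hB⟩ { s with idx := [], inp := l, buf := [] } :=
  ⟨⟨h.reg_le, h.mem_le, by simp, hl, by simp⟩, fun _ _ => rfl⟩

/-- Everything the invariant says about memory contents concerns arrays below number `40`. As `Ok`
holds at each step of an output routine, the invariant holds wherever the routine is broken off. -/
theorem Query.Inv.of_ok (h : φ.Inv N B s D) {hB : 100 ≤ B} {s' : State}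
    (ho : Ok ⟨B, 40, s.mem, hB⟩ s') : φ.Inv N B s' D where
  reg_le := ho.1.1
  mem_le := ho.1.2.1
  static := h.static.congr fun a ha => ho.2 a (lt_trans ha (by simp))
  clean := by
    rw [view_congr (mem := s.mem) fun a _ ha => ho.2 a (lt_trans ha (by simp))]
    exact h.clean

theorem exec_update (hφ : φ.QHierarchical) (hB : φ.layout.Fits N B) (hB' : 100 ≤ B)
    (hNB : N ≤ B) (h : φ.Inv N B s D) (u : Update σ) (hu : ∀ w ∈ u.encode, w ≤ N) :
    (call updateProg s u.encode).HaltedAt φ.layout.updateTime ∧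
      (call updateProg s u.encode).WordsLE B ∧
      ∀ t, (call updateProg s u.encode).HaltedAt t →
        φ.Inv N B ((call updateProg s u.encode).after t).state (u.apply D) := by
  have hok := h.ok hB' 0 (l := u.encode) fun w hw => (hu w hw).trans hNB
  rw [u.encode_eq] at hu
  have hlen : ∀ i < φ.layout.d, φ.layout.rel i = (u.fact.1 : ℕ) →
      (List.ofFn fun j => (u.fact.2 j : ℕ)).length = φ.layout.ar i := fun i hi hR => by
    have hi' : i < φ.atoms.length := hi
    have hrel : u.fact.1 = φ.atoms[i].rel := Fin.ext (hR.symm.trans (φ.raw_rel hi'))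
    change _ = (φ.raw.args i).length
    rw [φ.raw_args hi', List.length_ofFn, List.length_ofFn, hrel]
  obtain ⟨h1, h2, h3⟩ := (exec_updateProg (X := D.codes) (X' := (u.apply D).codes)
    (Γ := ⟨B, 0, s.mem, hB'⟩) (o := u.op) (R := (u.fact.1 : ℕ))
    (t := List.ofFn fun j => (u.fact.2 j : ℕ)) (N := N)
    (s := { s with idx := [], inp := u.encode, buf := [] }) hφ.layout_good hB le_rfl h.static
    h.clean u.encode_eq u.op_le hlen (fun w hw => hu w (List.mem_cons_of_mem _ (List.mem_cons_of_mem _ hw)))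
    (fun g => u.mem_codes_apply D g)).spec rfl hok
  exact ⟨h1, fun t => (h2 t).1, fun t ht => ⟨(h2 t).1.1, (h2 t).1.2.1, (h3 t ht).1, (h3 t ht).2⟩⟩

theorem exec_preprocess (hφ : φ.QHierarchical) {L : List (Fact σ)} (hL : Lists L D)
    (hB : φ.layout.Fits N B) (hB' : 100 ≤ B) (hNB : N ≤ B) (hw : ∀ w ∈ encodeInput φ L, w ≤ N) :
    (call preProg State.blank (encodeInput φ L)).HaltedAt (10000 * φ.size ^ 4 * D.size) ∧
      (call preProg State.blank (encodeInput φ L)).WordsLE B ∧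
      ∀ t, (call preProg State.blank (encodeInput φ L)).HaltedAt t →
        φ.Inv N B ((call preProg State.blank (encodeInput φ L)).after t).state D := by
  have hok : Ok ⟨B, 0, fun _ => 0, hB'⟩ { State.blank with inp := encodeInput φ L } :=
    ⟨⟨fun _ => Nat.zero_le _, fun _ => Nat.zero_le _, by simp [State.blank],
      fun w h => (hw w h).trans hNB, by simp [State.blank]⟩, fun _ _ => rfl⟩
  have hsz := φ.size_bounds
  have har : ∀ i < φ.raw.d, φ.raw.rel i < (List.ofFn σ.ar).length ∧
      (List.ofFn σ.ar).getD (φ.raw.rel i) 0 = (φ.raw.args i).length := fun i hi => by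
    have hi' : i < φ.atoms.length := hi
    rw [φ.raw_rel hi', φ.raw_args hi', List.length_ofFn]
    simp
  have hfs : ∀ f ∈ L.map (fun f => ((f.1 : ℕ), List.ofFn fun j => (f.2 j : ℕ))),
      f.1 < (List.ofFn σ.ar).length ∧ (List.ofFn σ.ar).getD f.1 0 = f.2.length := fun f hf => by
    obtain ⟨g, -, rfl⟩ := List.mem_map.1 hf
    simp
  have hws : ∀ f ∈ L.map (fun f => ((f.1 : ℕ), List.ofFn fun j => (f.2 j : ℕ))),
      ∀ w ∈ f.2, w ≤ N := fun f hf w hw' => by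
    refine hw w ?_
    rw [encodeInput_eq]
    refine List.mem_append_right _ (List.mem_cons_of_mem _ (List.mem_flatMap.2 ⟨f, hf, ?_⟩))
    exact List.mem_cons_of_mem _ hw'
  obtain ⟨h1, h2, h3⟩ := (exec_preProg (N := N) (n := φ.size)
    (fs := L.map fun f => ((f.1 : ℕ), List.ofFn fun j => (f.2 j : ℕ)))
    (Γ := ⟨B, 0, fun _ => 0, hB'⟩) (s := { State.blank with inp := encodeInput φ L }) le_rfl
    hφ.raw_good hB (fun _ => rfl) (encodeInput_eq φ L) har hfs hsz.2.1
    hsz.2.2.1 hsz.2.2.2.1 hsz.2.2.2.2 hws).spec rfl hok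
  refine ⟨h1.mono ?_, fun t => (h2 t).1, fun t ht => ⟨(h2 t).1.1, (h2 t).1.2.1, (h3 t ht).1, ?_⟩⟩
  · have hP := hφ.layout_good
    have e1 := Layout.sum_readTime_le hP (show 1 ≤ φ.size by omega)
      (L.map fun f => ((f.1 : ℕ), List.ofFn fun j => (f.2 j : ℕ))) (fun f hf => by
        obtain ⟨g, -, rfl⟩ := List.mem_map.1 hf
        have := σ.ar_pos g.1
        intro h
        have := congrArg List.length h
        simp at this
        omega)
    have e2 := loadTime_le σ.card (show 1 ≤ φ.size by omega)
    have e3 := hL.sum_ar_le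
    have e4 : ((L.map fun f => ((f.1 : ℕ), List.ofFn fun j => (f.2 j : ℕ))).map
        fun f => f.2.length) = L.map fun f => σ.ar f.1 := by simp
    have e5 : σ.card ≤ D.size := by unfold Database.size; omega
    have e6 : 1 ≤ σ.card := by
      obtain ⟨ψ, -⟩ := List.exists_mem_of_ne_nil _ φ.atoms_ne_nil
      have := ψ.rel.2
      omega
    have e7 : 1 ≤ φ.size ^ 4 := Nat.one_le_pow _ _ (by omega)
    rw [e4] at e1
    have e8 := Nat.mul_le_mul_left (φ.size ^ 4) e3
    have e9 := Nat.mul_le_mul_left (φ.size ^ 4) (e6.trans e5)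
    have e10 := Nat.mul_le_mul e7 e5
    rw [List.length_ofFn, mul_assoc 10000]
    change _ ≤ 5512 * φ.size ^ 4 * _ at e1
    rw [mul_assoc 5512] at e1
    -- In units of `φ.size ^ 4 * D.size`: `62` for the schema, `4400` for analysing the query and
    -- `5512` for the facts, together less than `10000`.
    change loadTime σ.card φ.size + (List.map φ.layout.readTime _).sum ≤ _
    omega
  · have := (h3 t ht).2
    rw [hL.codes_eq] at this
    exact this

theorem Query.Inv.enumerates (hφ : φ.QHierarchical) (hB : 100 ≤ B) (h : φ.Inv N B s D) :
    (call enumProg s []).Enumerates φ D ∧ (call enumProg s []).DelayLE φ.layout.enumDelay ∧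
      (call enumProg s []).WordsLE B ∧ ∀ t, φ.Inv N B ((call enumProg s []).after t).state D := by
  obtain ⟨p, hp, he⟩ := emits_enumProg (Γ := ⟨B, 40, s.mem, hB⟩) hφ.layout_good.toGood rfl h.static
    h.clean rfl (h.ok hB 40 (l := []) (by simp)) rfl
  obtain ⟨E, hE, hmem, hout, -⟩ := hφ.result_spec h.clean hp
  obtain ⟨⟨T, -, hT, ho⟩, hok, hd⟩ := he.spec
  rw [max_self] at hd
  exact ⟨⟨T, E, hT, hE, hmem, ho.trans hout⟩, hd, fun t => (hok t).1, fun t => h.of_ok (hok t)⟩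

theorem Query.Inv.encard_result (hφ : φ.QHierarchical) (h : φ.Inv N B s D) :
    (φ.result D).encard = ((view s.mem).W 1 : ℕ) := by
  obtain ⟨E, hE, hmem, -, hlen⟩ := hφ.result_spec h.clean (p := fun _ => 1) rfl
  classical
  have : φ.result D = (E.toFinset : Set _) := by
    ext a
    simp [hmem]
  rw [this, Set.encard_coe_eq_coe_finsetCard, List.toFinset_card_of_nodup hE, hlen]

/-- With one output there are two phases, up to the output and from there to the halt, which
explains the factor `2`. -/
theorem Emits.returns {Γ : Ctx} {b C w : ℕ} {c : Config} (h : Emits Γ 0 b c [[w]]) (hC : b * 2 ≤ C) :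
    c.Returns w C := by
  obtain ⟨⟨T, hT, hh, ho⟩, -⟩ := h.spec
  have hle : T ≤ C := hT.trans (by simpa using hC)
  exact ⟨hh.mono hle, (hh.outputs_eq hle).trans ho⟩

theorem Query.Inv.counts (hB : 100 ≤ B) (h : φ.Inv N B s D) :
    (call countProg s []).Returns ((view s.mem).W 1) 10000 ∧ (call countProg s []).WordsLE B ∧
      ∀ t, φ.Inv N B ((call countProg s []).after t).state D := by
  have he := emits_countProg (Γ := ⟨B, 40, s.mem, hB⟩) (d := 0) rfl rfl
    (h.ok hB 40 (l := []) (by simp)) rfl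
  have hok := he.spec.2.1
  exact ⟨he.returns (by norm_num), fun t => (hok t).1, fun t => h.of_ok (hok t)⟩

theorem Query.Inv.answers (hB : 100 ≤ B) (h : φ.Inv N B s D) :
    (call answerProg s []).Returns (if (view s.mem).W 1 = 0 then 0 else 1) 10000 ∧
      (call answerProg s []).WordsLE B ∧
      ∀ t, φ.Inv N B ((call answerProg s []).after t).state D := by
  have he := emits_answerProg (Γ := ⟨B, 40, s.mem, hB⟩) (d := 0) rfl rfl
    (h.ok hB 40 (l := []) (by simp)) rfl
  have hok := he.spec.2.1
  exact ⟨he.returns (by norm_num), fun t => (hok t).1, fun t => h.of_ok (hok t)⟩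

end

end DynCQ

/-! ### The theorem -/

open DynCQ in
theorem theorem3p2 :
    ∃ (A : DynamicAlgorithm) (C e : ℕ),
      ∀ (σ : Schema) (φ : Query σ), φ.QHierarchical →
      ∀ (D₀ : Database σ) (L : List (Fact σ)), Lists L D₀ →
      -- preprocessing time
      (call A.preprocess State.blank (encodeInput φ L)).HaltedAt (C * φ.size ^ e * D₀.size) ∧
      ∀ N : ℕ, D₀.size ≤ N → (∀ w ∈ encodeInput φ L, w ≤ N) →
      -- word size during the preprocessing
      (call A.preprocess State.blank (encodeInput φ L)).WordsLE ((N + 2) ^ (C * φ.size ^ e)) ∧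
      ∀ (s : State) (D : Database σ), A.Reaches φ L D₀ N s D →
        -- update time
        (∀ u : Update σ, (u.apply D).size ≤ N → (∀ w ∈ u.encode, w ≤ N) →
          (call A.update s u.encode).HaltedAt (C * φ.size ^ e) ∧
          (call A.update s u.encode).WordsLE ((N + 2) ^ (C * φ.size ^ e))) ∧
        -- enumeration
        (call A.enumerate s []).Enumerates φ D ∧
        (call A.enumerate s []).DelayLE (C * φ.size ^ e) ∧
        (call A.enumerate s []).WordsLE ((N + 2) ^ (C * φ.size ^ e)) ∧
        -- counting
        (∃ w : ℕ, (φ.result D).encard = w ∧ (call A.count s []).Returns w C) ∧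
        (call A.count s []).WordsLE ((N + 2) ^ (C * φ.size ^ e)) ∧
        -- answering Boolean queries
        (φ.head = [] →
          ((φ.result D).Nonempty → (call A.answer s []).Returns 1 C) ∧
          (¬ (φ.result D).Nonempty → (call A.answer s []).Returns 0 C)) ∧
        (call A.answer s []).WordsLE ((N + 2) ^ (C * φ.size ^ e)) := by
  -- The fourth power covers the analysis of the query, which is the most expensive part; updates
  -- need only a cubic number of steps.
  refine ⟨algorithm, 10000, 4, fun σ φ hφ D₀ L hL => ?_⟩
  have hP := hφ.layout_good
  have hn : 1 ≤ φ.size := le_trans (by norm_num) φ.size_bounds.1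
  have he : 7 ≤ 10000 * φ.size ^ 4 := by
    have : 1 ≤ φ.size ^ 4 := Nat.one_le_pow _ _ hn
    omega
  have pre := fun (N : ℕ) (hw : ∀ w ∈ encodeInput φ L, w ≤ N) =>
    exec_preprocess hφ hL (Layout.fits hP N hn) (hundred_le_wordBound N he) (le_wordBound N he) hw
  -- The time bound does not mention `N`, so any bound on the input words will do; their sum is one.
  refine ⟨(pre _ fun w hw => List.le_sum_of_mem hw).1, fun N _ hw => ⟨(pre N hw).2.1, ?_⟩⟩
  have hB := hundred_le_wordBound N he
  have upd := fun {s : State} {D : Database σ}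
      (h : φ.Inv N ((N + 2) ^ (10000 * φ.size ^ 4)) s D) (u : Update σ) =>
    exec_update hφ (Layout.fits hP N hn) hB (le_wordBound N he) h u
  intro s D hr
  -- Updates are considered at their halt, the output routines at an arbitrary moment `t`.
  have inv : φ.Inv N ((N + 2) ^ (10000 * φ.size ^ 4)) s D := by
    induction hr with
    | preprocess t _ hw ht => exact (pre N hw).2.2 t ht
    | update _ u t _ hw ht ih => exact (upd ih u hw).2.2 t ht
    | enumerate _ t ih => exact (ih.enumerates hφ hB).2.2.2 t
    | count _ t ih => exact (ih.counts hB).2.2 t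
    | answer _ t ih => exact (ih.answers hB).2.2 t
  obtain ⟨e1, e2, e3, -⟩ := inv.enumerates hφ hB
  obtain ⟨c1, c2, -⟩ := inv.counts hB
  obtain ⟨a1, a2, -⟩ := inv.answers hB
  have card := inv.encard_result hφ
  refine ⟨fun u _ hu => ⟨(upd inv u hu).1.mono (Layout.updateTime_le hP hn), (upd inv u hu).2.1⟩, e1,
    e2.mono (Layout.enumDelay_le hP hn), e3, ⟨_, card, c1⟩, c2, fun _ => ⟨fun h => ?_, fun h => ?_⟩, a2⟩
  · rwa [if_neg] at a1
    intro h0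
    rw [h0, Nat.cast_zero, Set.encard_eq_zero] at card
    exact h.ne_empty card
  · rwa [if_pos] at a1
    rw [Set.not_nonempty_iff_eq_empty.1 h, Set.encard_empty] at card
    exact_mod_cast card.symm
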